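/- **Setting.** Let $\mathbb T=\mathbb R/2\pi\mathbb Z$, $A>0$, $\hat Y>0$, $\gamma>2$, $Y(y)=\hat Y y^{\gamma}$, $\varphi(x)=A\sin x$, and let $F$ be a map of the cylinder $\{(x,y)\}$, $x\in\mathbb T$, which for $y>L$ (with some $L\ge 0$) is $$F(x,y)=\bigl(x+Y(y),\; y+2\dot\varphi(x+Y(y))\bigr),$$ and is continued arbitrarily elsewhere. Fix $0<\delta<\pi/4$, $D>0$, $\nu\in\mathbb N$ and $y_*>L$. A *basic pair* $\ell=(\Gamma_\ell,\rho_\ell)$ is a curve $\Gamma_\ell=\{(x,\psi_\ell(x)):x\in I_\ell\}\subset\{y\ge y_*\}$, where $I_\ell\subset\mathbb T$ is an interval and $\psi_\ell$ is smooth, with a smooth strictly positive probability density $\rho_\ell$ on $I_\ell$. Put $\mathbb P_\ell(E)=\int_{I_\ell}1_E(x,\psi_\ell(x))\rho_\ell(x)\,dx$, $\hat y_\ell=\inf_{I_\ell}\psi_\ell$ and $\mathcal L_\ell=1+Y'(\psi_\ell)\dot\psi_\ell$. With $y_{-1}=y-2\dot\varphi(x)$ let $h_1(x,y)=2\ddot\varphi(x)+1/Y'(y_{-1})$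 and $\dot h_1(x,y)=2\dddot\varphi(x)-Y''(y_{-1})/Y'(y_{-1})^3$. A basic pair is a *standard pair* if $\delta/4<|I_\ell|<\delta$ and, for all $x\in I_\ell$, $|\dot\rho_\ell/\rho_\ell|<1$, $|\dot\psi_\ell(x)-h_1(x,\psi_\ell(x))|<D^{-1}Y'(\psi_\ell(x))^{-3/2}$ and $|\ddot\psi_\ell(x)-\dot h_1(x,\psi_\ell(x))|<A/10$. The image under $F$ of the restriction of $\ell$ to an interval $U\subset I_\ell$, if it is a basic pair $\ell'$, has curve $F(\Gamma_\ell|_U)$ and the normalized push-forward density $\rho_{\ell'}(x')=c\,\rho_\ell(x)/|\mathcal L_\ell(x)|$. Fix a *cutting rule*: to every standard pair $\ell$ it assigns a family of disjoint open subintervals (pieces) of $I_\ell$, such that for each piece either its image is a standard pair $\ell'$, or its image is a basic (stand-by) pair whose image is a standard pair $\ell''$. The points of $\ell$ that lie in no piece form the remainder, which is not restricted. The *critical time* $\tau_\ell:\Gamma_\ell\to\mathbb N\cup\{\infty\}$ is defined recursively: $\tau_\ell(p)=\tau_{\ell'}(Fp)+1$ on pieces of the first kind, $\tau_\ell(p)=\tau_{\ell''}(F^2p)+2$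 on pieces of the second kind, and $\tau_\ell(p)=0$ on the remainder. Fix a standard pair $\bar\ell$ (the master pair) and let $R_k=2^k\hat y_{\bar\ell}$, $k\in\mathbb Z$. A standard pair $\ell$ is *compatible* with $R_k$ if $\Gamma_\ell\subset\mathbb T\times[R_{k-1},R_{k+1}]$, and *close* to $R_k$ if $\Gamma_\ell\subset\mathbb T\times[R_k-2A\nu,R_k+2A\nu]$. Let $\tau^{[k]}_\ell\equiv 0$ if $\ell$ is not compatible with $R_k$; otherwise $\tau^{[k]}_\ell$ is given by the same recursion as $\tau_\ell$, with $\tau^{[k]}$ in place of $\tau$. Finally let $\xi^{[k]}_\ell(p)=+1$ if $\tau^{[k]}_\ell(p)<\tau_\ell(p)$ and the standard pair to which $F^{\tau^{[k]}_\ell(p)}(p)$ belongs is close to $R_{k+1}$, and $\xi^{[k]}_\ell(p)=-1$ otherwise. **Proposition.** There are $y_0>L$, $C>0$ and $0<\vartheta<1$, depending only on $A,\hat Y,\gamma,\delta,D,L,\nu$, such that for every $y_*\ge y_0$, every $F$ as above, every cutting rule, every master standard pair $\bar\ell$, every $k\in\mathbb Z$ and every standard pair $\ell$: (a) $\mathbb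 P_\ell(\tau^{[k]}_\ell\ge s)\le C\,\vartheta^{\,s/\hat y_\ell^{2}}$ for all $s\in\mathbb N$; (b) if $\ell$ is close to $R_k$, then $\mathbb P_\ell(\xi^{[k]}_\ell=-1)\ge 0.6$. -/

import Mathlib

open Set

noncomputable section

/-- The phase space: the angle `x ∈ ℝ/2πℤ` and the height `y`. -/
abbrev Phase : Type := Real.Angle × ℝ

/-- The constants that are fixed once and for all: the amplitude `A` of `φ_A = A sin`, the twist
`Y(y) = Yhat * y ^ γ`, the length scale `δ` of standard intervals and the constant `D` that
measures how close standard curves are to reference curves. -/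
structure Params where
  A : ℝ
  Yhat : ℝ
  γ : ℝ
  δ : ℝ
  D : ℝ

namespace Params

variable (P : Params)

/-- The twist function `Y`. -/
def Y (y : ℝ) : ℝ := P.Yhat * y ^ P.γ

/-- First derivative of `φ_A = A sin`, as a function on the circle. -/
def dphi (x : Real.Angle) : ℝ := P.A * x.cos

/-- Second derivative of `φ_A = A sin`. -/
def ddphi (x : Real.Angle) : ℝ := -(P.A * x.sin)

/-- Third derivative of `φ_A = A sin`. -/
def dddphi (x : Real.Angle) : ℝ := -(P.A * x.cos)

/-- `F` is given by `(x, y) ↦ (x + Y(y), y + 2 φ_A'(x + Y(y)))` for `y > L`; it is an arbitrary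
continuation of this formula to the rest of the phase space. -/
def IsTwistMap (L : ℝ) (F : Phase → Phase) : Prop :=
  ∀ (x : Real.Angle) (y : ℝ), L < y →
    F (x, y) = (x + (P.Y y : Real.Angle), y + 2 * P.dphi (x + (P.Y y : Real.Angle)))

/-- The height `y₋₁` of the preimage of `(x₀, y₀)`. -/
def prevHeight (x : Real.Angle) (y : ℝ) : ℝ := y - 2 * P.dphi x

/-- The reference slope field `h₁(x₀, y₀) = 2 φ_A''(x₀) + 1 / Y'(y₋₁)`. -/
def refSlope (x : Real.Angle) (y : ℝ) : ℝ :=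
  2 * P.ddphi x + 1 / deriv P.Y (P.prevHeight x y)

/-- The derivative of the reference slope along reference curves,
`2 φ_A'''(x₀) - Y''(y₋₁) / Y'(y₋₁) ^ 3`. -/
def refDSlope (x : Real.Angle) (y : ℝ) : ℝ :=
  2 * P.dddphi x - deriv (deriv P.Y) (P.prevHeight x y) / deriv P.Y (P.prevHeight x y) ^ 3

end Params

/-- The data of a pair: the arc `I` of the circle that is the projection of the real interval
`(a, b)`, the function `ψ` whose graph over `I` is the curve, and the density `ρ` on `I`.
Only the values of `ψ` and `ρ` on `(a, b)` matter. -/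
structure CurvePair where
  a : ℝ
  b : ℝ
  ψ : ℝ → ℝ
  ρ : ℝ → ℝ

namespace CurvePair

/-- The part of the curve of `ℓ` that lies over `(u, v)`. -/
def arc (ℓ : CurvePair) (u v : ℝ) : Set Phase :=
  (fun x : ℝ => ((x : Real.Angle), ℓ.ψ x)) '' Ioo u v

/-- The curve `Γ_ℓ`. -/
def curve (ℓ : CurvePair) : Set Phase := ℓ.arc ℓ.a ℓ.b

/-- The expectation `𝔼_ℓ(f) = ∫_I f(x, ψ(x)) ρ(x) dx`. -/
def expect (ℓ : CurvePair) (f : Phase → ℝ) : ℝ :=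
  ∫ x in Ioo ℓ.a ℓ.b, f ((x : Real.Angle), ℓ.ψ x) * ℓ.ρ x

/-- The probability `ℙ_ℓ(E) = 𝔼_ℓ(1_E)`. -/
def prob (ℓ : CurvePair) (E : Set Phase) : ℝ := ℓ.expect (E.indicator fun _ => 1)

/-- `ŷ_ℓ`, the infimum of the heights of the points of the curve. -/
def yhat (ℓ : CurvePair) : ℝ := sInf (ℓ.ψ '' Ioo ℓ.a ℓ.b)

/-- The local expansion rate `(ψ' + 1 / Y'(ψ)) Y'(ψ)` of the map along the curve. -/
def expansion (P : Params) (ℓ : CurvePair) (x : ℝ) : ℝ :=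
  (deriv ℓ.ψ x + 1 / deriv P.Y (ℓ.ψ x)) * deriv P.Y (ℓ.ψ x)

/-- Basic pairs: a smooth curve over an arc of the circle, contained in `{y ≥ ystar}`, with a
smooth and strictly positive probability density. -/
structure IsBasic (ystar : ℝ) (ℓ : CurvePair) : Prop where
  lt : ℓ.a < ℓ.b
  length_le : ℓ.b - ℓ.a ≤ 2 * Real.pi
  smooth_curve : ContDiffOn ℝ (⊤ : ℕ∞) ℓ.ψ (Ioo ℓ.a ℓ.b)
  smooth_density : ContDiffOn ℝ (⊤ : ℕ∞) ℓ.ρ (Ioo ℓ.a ℓ.b)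
  height : ∀ x ∈ Ioo ℓ.a ℓ.b, ystar ≤ ℓ.ψ x
  density_pos : ∀ x ∈ Ioo ℓ.a ℓ.b, 0 < ℓ.ρ x
  density_integral : ∫ x in Ioo ℓ.a ℓ.b, ℓ.ρ x = 1

/-- Standard pairs: basic pairs over a standard interval, with a regular density, whose curve is
locally close to a reference curve. -/
structure IsStandard (P : Params) (ystar : ℝ) (ℓ : CurvePair) : Prop
    extends IsBasic ystar ℓ where
  length_gt : P.δ / 4 < ℓ.b - ℓ.a
  length_lt : ℓ.b - ℓ.a < P.δ
  regular : ∀ x ∈ Ioo ℓ.a ℓ.b, |(ℓ.ρ x)⁻¹ * deriv ℓ.ρ x| < 1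
  slope_close : ∀ x ∈ Ioo ℓ.a ℓ.b,
    |deriv ℓ.ψ x - P.refSlope (x : Real.Angle) (ℓ.ψ x)|
      < P.D⁻¹ * deriv P.Y (ℓ.ψ x) ^ (-(3 / 2) : ℝ)
  dslope_close : ∀ x ∈ Ioo ℓ.a ℓ.b,
    |deriv (deriv ℓ.ψ) x - P.refDSlope (x : Real.Angle) (ℓ.ψ x)| < P.A / 10

/-- `ℓ'` is the image under `F` of the restriction of `ℓ` to `(u, v)`: the curve of `ℓ'` is the
image of the arc, and the density is the normalized push-forward `ρ'(x') = c ρ(x) / |𝓛_ℓ(x)|`. -/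
def IsImage (P : Params) (F : Phase → Phase) (ℓ : CurvePair) (u v : ℝ) (ℓ' : CurvePair) : Prop :=
  F '' ℓ.arc u v = ℓ'.curve ∧
    ∃ c : ℝ, 0 < c ∧ ∀ x ∈ Ioo u v, ∀ x' ∈ Ioo ℓ'.a ℓ'.b,
      F ((x : Real.Angle), ℓ.ψ x) = ((x' : Real.Angle), ℓ'.ψ x') →
        ℓ'.ρ x' = c * ℓ.ρ x / |ℓ.expansion P x|

end CurvePair

/-- A piece `(left, right)` of the base of a pair, which is mapped in `steps` iterates of the map
to the pair `target`. -/
structure Piece where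
  left : ℝ
  right : ℝ
  steps : ℕ
  target : CurvePair

/-- `c` is an admissible piece of `ℓ`: either the image of the piece is a standard pair, or
the image of the piece is a basic pair (a stand-by pair) whose image is a standard pair. -/
def IsAdmissiblePiece (P : Params) (ystar : ℝ) (F : Phase → Phase) (ℓ : CurvePair) (c : Piece) :
    Prop :=
  ℓ.a ≤ c.left ∧ c.left < c.right ∧ c.right ≤ ℓ.b ∧ c.target.IsStandard P ystar ∧
    ((c.steps = 1 ∧ ℓ.IsImage P F c.left c.right c.target) ∨
      (c.steps = 2 ∧ ∃ m : CurvePair, m.IsBasic ystar ∧ ℓ.IsImage P F c.left c.right m ∧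
        m.IsImage P F m.a m.b c.target))

/-- A rule that cuts the images of standard pairs: each standard pair is cut into disjoint
admissible pieces and a remainder (the set of points that lie in no piece), on which the
decomposition stops. -/
structure CuttingRule (P : Params) (ystar : ℝ) (F : Phase → Phase) where
  pieces : CurvePair → Set Piece
  admissible : ∀ ℓ : CurvePair, ℓ.IsStandard P ystar →
    ∀ c ∈ pieces ℓ, IsAdmissiblePiece P ystar F ℓ c
  disjoint : ∀ ℓ : CurvePair, ℓ.IsStandard P ystar →
    (pieces ℓ).Pairwise fun c d => Disjoint (Ioo c.left c.right) (Ioo d.left d.right)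

namespace CuttingRule

variable {P : Params} {ystar : ℝ} {F : Phase → Phase}

/-- `Reaches S G ℓ p n ℓ'`: starting from the point `p` of `ℓ` and following the pieces of the
successive pairs, as long as these pairs satisfy `G`, the point `F^n p` is found on the pair `ℓ'`.
The last pair `ℓ'` itself need not satisfy `G`. -/
inductive Reaches (S : CuttingRule P ystar F) (G : CurvePair → Prop) :
    CurvePair → Phase → ℕ → CurvePair → Prop
  | start (ℓ : CurvePair) (p : Phase) : Reaches S G ℓ p 0 ℓ
  | move (ℓ : CurvePair) (p : Phase) (c : Piece) (n : ℕ) (ℓ' : CurvePair) :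
      G ℓ → c ∈ S.pieces ℓ → p ∈ ℓ.arc c.left c.right →
      Reaches S G c.target (F^[c.steps] p) n ℓ' → Reaches S G ℓ p (n + c.steps) ℓ'

/-- The number of iterates during which `p` can be followed through pairs that satisfy `G`. -/
def time (S : CuttingRule P ystar F) (G : CurvePair → Prop) (ℓ : CurvePair) (p : Phase) : ℕ∞ :=
  ⨆ (n : ℕ) (_ : ∃ ℓ', S.Reaches G ℓ p n ℓ'), (n : ℕ∞)

/-- `τ_ℓ`: the critical time, at which `p` enters the remainder. -/
def criticalTime (S : CuttingRule P ystar F) (ℓ : CurvePair) (p : Phase) : ℕ∞ :=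
  S.time (fun _ => True) ℓ p

end CuttingRule

/-- The levels `R_k = 2 ^ k * ŷ` of the master pair, for `k ∈ ℤ`. -/
def level (master : CurvePair) (k : ℤ) : ℝ := (2 : ℝ) ^ k * master.yhat

/-- `ℓ` is close to `R_k`: the curve lies at heights in `[R_k - 2Aν, R_k + 2Aν]`. -/
def IsCloseTo (P : Params) (ν : ℕ) (master : CurvePair) (k : ℤ) (ℓ : CurvePair) : Prop :=
  ∀ q ∈ ℓ.curve, q.2 ∈ Icc (level master k - 2 * P.A * ν) (level master k + 2 * P.A * ν)

/-- `ℓ` is compatible with `R_k`: the curve lies at heights in `[R_{k-1}, R_{k+1}]`. -/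
def IsCompatible (master : CurvePair) (k : ℤ) (ℓ : CurvePair) : Prop :=
  ∀ q ∈ ℓ.curve, q.2 ∈ Icc (level master (k - 1)) (level master (k + 1))

namespace CuttingRule

variable {P : Params} {ystar : ℝ} {F : Phase → Phase}

/-- `τ_ℓ^{[k]}`: the exit time from the window `[R_{k-1}, R_{k+1}]`, or the critical time. -/
def exitTime (S : CuttingRule P ystar F) (master : CurvePair) (k : ℤ) (ℓ : CurvePair)
    (p : Phase) : ℕ∞ :=
  S.time (IsCompatible master k) ℓ p

open Classical in
/-- `ξ_ℓ^{[k]}`: it is `+1` if `τ_ℓ^{[k]} < τ_ℓ` and at time `τ_ℓ^{[k]}` the orbit of the point is on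
a pair close to `R_{k+1}`, and `-1` otherwise. -/
def exitSign (S : CuttingRule P ystar F) (ν : ℕ) (master : CurvePair) (k : ℤ) (ℓ : CurvePair)
    (p : Phase) : ℤ :=
  if S.exitTime master k ℓ p < S.criticalTime ℓ p ∧
      ∃ (n : ℕ) (ℓ' : CurvePair), S.Reaches (IsCompatible master k) ℓ p n ℓ' ∧
        (n : ℕ∞) = S.exitTime master k ℓ p ∧ IsCloseTo P ν master (k + 1) ℓ'
  then 1 else -1

/-- Off the pairs that satisfy `G`, the time is zero. -/
theorem time_of_not (S : CuttingRule P ystar F) {G : CurvePair → Prop} {ℓ : CurvePair}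
    (h : ¬ G ℓ) (p : Phase) : S.time G ℓ p = 0 := by
  refine le_antisymm (iSup₂_le ?_) bot_le
  rintro n ⟨ℓ', hr⟩
  cases hr with
  | start => simp
  | move _ _ _ _ _ hG => exact absurd hG h

/-- On the remainder, the time is zero. -/
theorem time_of_remainder (S : CuttingRule P ystar F) (G : CurvePair → Prop) {ℓ : CurvePair}
    {p : Phase} (h : ∀ c ∈ S.pieces ℓ, p ∉ ℓ.arc c.left c.right) : S.time G ℓ p = 0 := by
  refine le_antisymm (iSup₂_le ?_) bot_le
  rintro n ⟨ℓ', hr⟩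
  cases hr with
  | start => simp
  | move _ _ c _ _ _ hc hp => exact absurd hp (h c hc)

/-- A point of a standard pair lies in at most one piece. -/
theorem piece_unique (S : CuttingRule P ystar F) {ℓ : CurvePair} (hℓ : ℓ.IsStandard P ystar)
    {c d : Piece} (hc : c ∈ S.pieces ℓ) (hd : d ∈ S.pieces ℓ) {p : Phase}
    (hpc : p ∈ ℓ.arc c.left c.right) (hpd : p ∈ ℓ.arc d.left d.right) : c = d := by
  by_contra hne
  obtain ⟨x, hx, rfl⟩ := hpc
  obtain ⟨x', hx', he⟩ := hpd
  obtain ⟨h1, -, h2, -⟩ := S.admissible ℓ hℓ c hc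
  obtain ⟨h3, -, h4, -⟩ := S.admissible ℓ hℓ d hd
  have hl := hℓ.length_le
  have hxx : x = x' := by
    obtain ⟨m, hm⟩ := Real.Angle.angle_eq_iff_two_pi_dvd_sub.1 (congrArg Prod.fst he)
    have hpi := Real.pi_pos
    have hm0 : m = 0 := by
      have hlt : (m : ℝ) < 1 := by
        by_contra hge
        nlinarith [hx.1, hx.2, hx'.1, hx'.2]
      have hgt : (-1 : ℝ) < m := by
        by_contra hge
        nlinarith [hx.1, hx.2, hx'.1, hx'.2]
      have h5 : m < 1 := by exact_mod_cast hlt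
      have h6 : -1 < m := by exact_mod_cast hgt
      omega
    rw [hm0] at hm
    simp at hm
    linarith
  exact Set.disjoint_left.1 (S.disjoint ℓ hℓ hc hd hne) hx (hxx ▸ hx')

/-- The recursion `τ_ℓ(p) = τ_{ℓ'}(F^s p) + s` on a piece that is mapped to `ℓ'` in `s` iterates. -/
theorem time_of_mem (S : CuttingRule P ystar F) {G : CurvePair → Prop} {ℓ : CurvePair}
    (hℓ : ℓ.IsStandard P ystar) (hG : G ℓ) {c : Piece} (hc : c ∈ S.pieces ℓ) {p : Phase}
    (hp : p ∈ ℓ.arc c.left c.right) :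
    S.time G ℓ p = S.time G c.target (F^[c.steps] p) + c.steps := by
  refine le_antisymm (iSup₂_le ?_) ?_
  · rintro n ⟨ℓ', hr⟩
    cases hr with
    | start => simp
    | move _ _ d n _ _ hd hpd hr =>
      obtain rfl := S.piece_unique hℓ hc hd hp hpd
      push_cast
      gcongr
      exact le_iSup₂_of_le (f := fun (n : ℕ) (_ : ∃ ℓ', S.Reaches G c.target (F^[c.steps] p) n ℓ') =>
        (n : ℕ∞)) n ⟨_, hr⟩ le_rfl
  · unfold time
    rw [ENat.iSup_add]
    refine iSup_le fun n => ?_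
    by_cases hn : ∃ ℓ', S.Reaches G c.target (F^[c.steps] p) n ℓ'
    · obtain ⟨ℓ', hr⟩ := hn
      rw [iSup_pos ⟨ℓ', hr⟩]
      refine le_iSup₂_of_le (f := fun (n : ℕ) (_ : ∃ ℓ', S.Reaches G ℓ p n ℓ') => (n : ℕ∞))
        (n + c.steps) ⟨_, .move ℓ p c n ℓ' hG hc hp hr⟩ ?_
      push_cast
      exact le_rfl
    · rw [iSup_neg hn]
      refine le_iSup₂_of_le (f := fun (n : ℕ) (_ : ∃ ℓ', S.Reaches G ℓ p n ℓ') => (n : ℕ∞))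
        (0 + c.steps) ⟨_, .move ℓ p c 0 _ hG hc hp (.start _ _)⟩ ?_
      simp

end CuttingRule

end

/-!
Write `T = Y'(R)`, `X = x + Y(y)` and `y' = y + 2 A cos X`, so that the height performs a walk with
the increments `2 A cos X`. On a standard pair at a height comparable to `R` the phase `X` turns at
the rate `-2 A T sin x`, up to a bounded error, and it is therefore equidistributed except near the
zeros of `sin x`. The claims follow from a supermartingale: a potential `V` of standard pairs,
positive on the pairs that occur, at most `0.4` on the pairs close to `R_k`, at least `1` on the
pairs close to `R_{k+1}`, whose mean over the targets of the pieces of a pair `ℓ` compatible with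
`R_k` is at most `(1 - c / R_k²) V(ℓ)` (`CuttingRule.IsPotential`,
`CuttingRule.exists_isPotential`). Then the time at which the pair is left has an exponential tail
on the scale `R_k²` (`prob_le_time_le`), and the pairs close to `R_{k+1}` are reached with
probability at most `0.4` (`prob_exists_reachSet_le`). The supermartingale need not be a good
approximation of a hitting probability, since the remainder of a cutting rule is arbitrary: to lose
mass only helps.

The potential is the expectation of a test function `g`, minus `κ` times the probability of the
remainder. The main part of `g` is a quadratic polynomial `f` of `z = (y - R) / R`, so that one
step changes it by a drift `β a(y) cos X`, with `β` of order `1 / R` and `|a| ≤ 1`, and a diffusion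
`b cos² X`, with `b` of order `1 / R²`. The difficulty is the drift. Over `|sin x| ≥ M / √T` the
expectation of `a(y) cos X` is `O(1 / (M √T))`, by nonstationary phase
(`RegCurve.abs_integral_phase_le`). On the windows `|sin x| < M / √T` there is no cancellation
along a single pair. There `g` contains the correction `β a(y) cos X`, which counts the increment
one step earlier; what remains is the integral of the second increment over the points whose phase
falls into a window (`IsQuadratic.testFun_next`). This integral is `o(1 / √T)`
(`RegCurve.eventually_abs_integral_window_far_le`): along the image curve the phase of the next
point gains about `2 + 2 A (γ - 1) cos X / y` turns while `X` makes one turn, so that a shift of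
`X` by `N ≈ y / (4 A (γ - 1))` turns leaves the window and the weight nearly unchanged and reverses
the sign of the next cosine. The number `N` is small compared with the number of turns, of order
`T`. Thus the drift is at most `ε / (R √T)` for every `ε > 0`, if `M` and then `R` are large
(`RegCurve.exists_abs_integral_drift_next_le`).

A stand-by piece makes two steps at once, and its middle pair is only basic, so no estimate along
it is available; moreover the cutting rule may choose the stand-by pieces adversely. Therefore the
second increment is included on all pieces alike, and its expectation is estimated on the whole
pair `ℓ`; on the pieces with a standard image this is undone by the estimate on that image
(`CuttingRule.mass_mul_mean_le`).

For `γ ≥ 3` one has `√T ≥ c R`, the drift is at most `ε / R²`, and `V` decreases by diffusion if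
`f` is concave, since the mean of `cos² X` is at least `1 / 4` (`eventually_le_integral_cos_sq`).
For `γ < 3` the drift may exceed `1 / R²`, but it is negligible against `1 / T`, as is the
diffusion; now the remainder has a probability of order `1 / T` in two successive steps
(`CuttingRule.exists_le_stopProb`). Indeed, at the points with `sin X ≈ 1 / (A T)` the image pair
is close to a critical point of its own phase. There its rate of expansion `𝓛` is too small for a
standard image, because the slope of an image differs from the reference slope by `1 / (Y' 𝓛)`
(`CurvePair.lt_abs_rate`). A stand-by piece is impossible as well: the rate of the two iterates is
`a 𝓛 - θ` with `θ ≈ 1`, the regularity of the final density bounds its logarithmic derivative, so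
it stays bounded near the critical point, while a standard second image needs a large second rate;
hence `𝓛` would be small on the whole piece, which would be so short that its second image could
not have the length of a standard pair (`CurvePair.eventually_lt_abs_rate_of_standby`). This
killing is turned into a decrease of `V` by the term with `κ`, which charges the losses of the next
step in advance.
-/

noncomputable section

open Filter Topology MeasureTheory

/-! ### The twist rate and its variation over a window of heights -/

namespace Params

/-- The standing positivity assumptions on the constants of the map. -/
structure Pos (P : Params) : Prop where
  A_pos : 0 < P.A
  Yhat_pos : 0 < P.Yhat
  two_lt : 2 < P.γ

/-- The twist rate `Y'(y)`, as an explicit power. -/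
def twist (P : Params) (y : ℝ) : ℝ := P.Yhat * P.γ * y ^ (P.γ - 1)

/-- A bound for the ratio of the twist rates at two heights of `[R/8, 8R]`. -/
def kap (P : Params) : ℝ := (8 : ℝ) ^ P.γ

variable {P : Params}

theorem Pos.γ_pos (h : P.Pos) : 0 < P.γ := by linarith [h.two_lt]

theorem Pos.one_le_kap (h : P.Pos) : 1 ≤ P.kap :=
  Real.one_le_rpow (by norm_num) h.γ_pos.le

theorem Pos.kap_pos (h : P.Pos) : 0 < P.kap := lt_of_lt_of_le one_pos h.one_le_kap

theorem Pos.twist_pos (h : P.Pos) {y : ℝ} (hy : 0 < y) : 0 < P.twist y :=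
  mul_pos (mul_pos h.Yhat_pos h.γ_pos) (Real.rpow_pos_of_pos hy _)

theorem hasDerivAt_Y {y : ℝ} (hy : 0 < y) : HasDerivAt P.Y (P.twist y) y := by
  have := (Real.hasDerivAt_rpow_const (p := P.γ) (Or.inl hy.ne')).const_mul P.Yhat
  unfold twist
  rw [mul_assoc]
  exact this

theorem deriv_Y {y : ℝ} (hy : 0 < y) : deriv P.Y y = P.twist y := (hasDerivAt_Y hy).deriv

theorem hasDerivAt_twist {y : ℝ} (hy : 0 < y) :
    HasDerivAt P.twist ((P.γ - 1) * P.twist y / y) y := by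
  refine ((Real.hasDerivAt_rpow_const (p := P.γ - 1) (Or.inl hy.ne')).const_mul
    (P.Yhat * P.γ)).congr_deriv ?_
  unfold twist
  rw [Real.rpow_sub_one hy.ne' (P.γ - 1)]
  field_simp

theorem deriv_deriv_Y {y : ℝ} (hy : 0 < y) :
    deriv (deriv P.Y) y = (P.γ - 1) * P.twist y / y := by
  have : deriv P.Y =ᶠ[𝓝 y] P.twist := by
    filter_upwards [lt_mem_nhds hy] with z hz using deriv_Y hz
  rw [this.deriv_eq, (hasDerivAt_twist hy).deriv]

theorem Pos.twist_le_of_le (h : P.Pos) {c R y : ℝ} (hR : 0 < R) (hc8 : c ≤ 8)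
    (hy : 0 < y) (hyR : y ≤ c * R) : P.twist y ≤ P.kap * P.twist R := by
  have hg := h.two_lt
  have h1 : y ^ (P.γ - 1) ≤ (8 * R) ^ (P.γ - 1) :=
    Real.rpow_le_rpow hy.le (by nlinarith) (by linarith)
  rw [Real.mul_rpow (by norm_num) hR.le] at h1
  have h2 : (8 : ℝ) ^ (P.γ - 1) ≤ 8 ^ P.γ :=
    Real.rpow_le_rpow_of_exponent_le (by norm_num) (by linarith)
  have h3 := Real.rpow_pos_of_pos hR (P.γ - 1)
  have h4 : y ^ (P.γ - 1) ≤ P.kap * R ^ (P.γ - 1) := h1.trans (by unfold kap; gcongr)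
  have h5 := mul_pos h.Yhat_pos h.γ_pos
  unfold twist
  nlinarith [mul_le_mul_of_nonneg_left h4 h5.le]

theorem Pos.twist_le (h : P.Pos) {R y : ℝ} (hR : 0 < R) (h1 : R / 8 ≤ y) (h2 : y ≤ 8 * R) :
    P.twist y ≤ P.kap * P.twist R :=
  h.twist_le_of_le hR le_rfl (by linarith) h2

theorem Pos.le_twist (h : P.Pos) {R y : ℝ} (hR : 0 < R) (h1 : R / 8 ≤ y) :
    P.twist R ≤ P.kap * P.twist y :=
  h.twist_le_of_le (c := 8) (by linarith) le_rfl hR (by linarith)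

/-- The derivative of the twist rate is of order `T(R) / R` on `[R/8, 8R]`. -/
theorem Pos.dtwist_le (h : P.Pos) {R y : ℝ} (hR : 0 < R) (h1 : R / 8 ≤ y) (h2 : y ≤ 8 * R) :
    |(P.γ - 1) * P.twist y / y| ≤ 8 * P.γ * P.kap * P.twist R / R := by
  have hy : 0 < y := by linarith
  have hT := h.twist_pos hy
  have hg := h.two_lt
  have hT2 := h.twist_le hR h1 h2
  rw [abs_of_nonneg (div_nonneg (mul_nonneg (by linarith) hT.le) hy.le), div_le_div_iff₀ hy hR]
  have h3 : (P.γ - 1) * P.twist y ≤ P.γ * (P.kap * P.twist R) := by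
    apply mul_le_mul _ hT2 hT.le (by linarith)
    linarith
  have h4 : 0 ≤ P.γ * (P.kap * P.twist R) := by
    have := h.kap_pos
    have := h.twist_pos hR
    have := h.γ_pos
    positivity
  calc (P.γ - 1) * P.twist y * R ≤ P.γ * (P.kap * P.twist R) * (8 * y) := by
        apply mul_le_mul h3 (by linarith) hR.le h4
    _ = 8 * P.γ * P.kap * P.twist R * y := by ring

theorem Pos.twist_sub_le (h : P.Pos) {R y z : ℝ} (hR : 0 < R) (h1 : R / 8 ≤ y) (h2 : y ≤ 8 * R)
    (h3 : R / 8 ≤ z) (h4 : z ≤ 8 * R) :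
    |P.twist y - P.twist z| ≤ 8 * P.γ * P.kap * P.twist R / R * |y - z| := by
  have := (convex_Icc (R / 8) (8 * R)).norm_image_sub_le_of_norm_hasDerivWithin_le
    (f := P.twist) (f' := fun y => (P.γ - 1) * P.twist y / y)
    (C := 8 * P.γ * P.kap * P.twist R / R) (x := z) (y := y)
    (fun x hx => (hasDerivAt_twist (by linarith [hx.1])).hasDerivWithinAt)
    (fun x hx => h.dtwist_le hR hx.1 hx.2) ⟨h3, h4⟩ ⟨h1, h2⟩
  simpa [Real.norm_eq_abs] using this

/-- The logarithmic derivative of the twist rate, compared with a finite difference. -/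
theorem Pos.twist_diff (h : P.Pos) {R u c : ℝ} (hR : 0 < R) (h1 : R / 8 ≤ u) (h2 : u ≤ 8 * R)
    (h3 : R / 8 ≤ u + c) (h4 : u + c ≤ 8 * R) :
    |P.twist (u + c) - P.twist u - c * ((P.γ - 1) * P.twist u / u)|
      ≤ 128 * P.γ ^ 2 * P.kap * P.twist R / R ^ 2 * c ^ 2 := by
  have hg := h.two_lt
  have hk := h.kap_pos
  have hτ := h.twist_pos hR
  -- the derivative of `T' = (γ - 1) T / y`
  have hd : ∀ y : ℝ, 0 < y → HasDerivAt (fun y => (P.γ - 1) * P.twist y / y)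
      ((P.γ - 1) * (P.γ - 2) * P.twist y / y ^ 2) y := by
    intro y hy
    refine (((hasDerivAt_twist hy).const_mul (P.γ - 1)).fun_div (hasDerivAt_id y)
      hy.ne').congr_deriv ?_
    simp only [id]
    field_simp
    ring
  set M := 64 * P.γ ^ 2 * P.kap * P.twist R / R ^ 2 with hM
  have hM0 : 0 ≤ M := by positivity
  have hb : ∀ y ∈ Icc (R / 8) (8 * R), |(P.γ - 1) * (P.γ - 2) * P.twist y / y ^ 2| ≤ M := by
    intro y hy
    have hy0 : 0 < y := by linarith [hy.1]
    have hT := h.twist_pos hy0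
    have hT2 := h.twist_le hR hy.1 hy.2
    have h0 : 0 ≤ (P.γ - 1) * (P.γ - 2) := mul_nonneg (by linarith) (by linarith)
    rw [abs_of_nonneg (by positivity), hM, div_le_div_iff₀ (by positivity) (by positivity)]
    have h5 : (P.γ - 1) * (P.γ - 2) ≤ P.γ ^ 2 := by nlinarith
    have h6 : R ^ 2 ≤ 64 * y ^ 2 := by nlinarith [hy.1]
    calc (P.γ - 1) * (P.γ - 2) * P.twist y * R ^ 2
        ≤ P.γ ^ 2 * (P.kap * P.twist R) * (64 * y ^ 2) := by gcongr
      _ = 64 * P.γ ^ 2 * P.kap * P.twist R * y ^ 2 := by ring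
  have hd1 : ∀ y ∈ Icc (R / 8) (8 * R),
      |(P.γ - 1) * P.twist y / y - (P.γ - 1) * P.twist u / u| ≤ M * |y - u| := by
    intro y hy
    have := (convex_Icc (R / 8) (8 * R)).norm_image_sub_le_of_norm_hasDerivWithin_le
      (f := fun y => (P.γ - 1) * P.twist y / y) (C := M) (x := u) (y := y)
      (fun x hx => (hd x (by linarith [hx.1])).hasDerivWithinAt)
      (fun x hx => hb x hx) ⟨h1, h2⟩ hy
    simpa [Real.norm_eq_abs] using this
  have hsub : uIcc u (u + c) ⊆ Icc (R / 8) (8 * R) := uIcc_subset_Icc ⟨h1, h2⟩ ⟨h3, h4⟩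
  have := (convex_uIcc u (u + c)).norm_image_sub_le_of_norm_hasDerivWithin_le
    (f := fun y => P.twist y - (y - u) * ((P.γ - 1) * P.twist u / u))
    (f' := fun y => (P.γ - 1) * P.twist y / y - (P.γ - 1) * P.twist u / u)
    (C := M * |c|) (x := u) (y := u + c)
    (fun x hx => by
      have hx0 : 0 < x := by linarith [(hsub hx).1]
      have := (hasDerivAt_twist (P := P) hx0).sub
        (((hasDerivAt_id x).sub_const u).mul_const ((P.γ - 1) * P.twist u / u))
      simp only [one_mul] at this
      exact this.hasDerivWithinAt)
    (fun x hx => by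
      refine (hd1 x (hsub hx)).trans ?_
      have : |x - u| ≤ |c| := by simpa using abs_sub_left_of_mem_uIcc hx
      gcongr) left_mem_uIcc right_mem_uIcc
  simp only [Real.norm_eq_abs, add_sub_cancel_left, sub_self, zero_mul, sub_zero] at this
  calc _ = |P.twist (u + c) - c * ((P.γ - 1) * P.twist u / u) - P.twist u| := by ring_nf
    _ ≤ M * |c| * |c| := this
    _ = M * c ^ 2 := by rw [mul_assoc, abs_mul_abs_self, sq]
    _ ≤ 128 * P.γ ^ 2 * P.kap * P.twist R / R ^ 2 * c ^ 2 := by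
        apply mul_le_mul_of_nonneg_right _ (sq_nonneg c)
        rw [hM]
        gcongr
        norm_num

theorem Pos.twist_tendsto (h : P.Pos) : Tendsto P.twist atTop atTop :=
  (tendsto_rpow_atTop (by linarith [h.two_lt])).const_mul_atTop (mul_pos h.Yhat_pos h.γ_pos)

theorem Pos.div_twist_tendsto (h : P.Pos) : Tendsto (fun R => R / P.twist R) atTop (𝓝 0) := by
  have h0 := mul_pos h.Yhat_pos h.γ_pos
  have h1 := (tendsto_rpow_neg_atTop (y := P.γ - 2) (by linarith [h.two_lt])).const_mul
    (P.Yhat * P.γ)⁻¹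
  rw [mul_zero] at h1
  refine h1.congr' ?_
  filter_upwards [eventually_gt_atTop 0] with R hR
  have h2 := Real.rpow_pos_of_pos hR (P.γ - 2)
  have h3 : R ^ (P.γ - 1) = R ^ (P.γ - 2) * R := by
    rw [← Real.rpow_add_one hR.ne']; congr 1; ring
  unfold twist
  rw [h3, Real.rpow_neg hR.le]
  field_simp

/-- Below the exponent `3` killing at the rate `1 / T` dominates diffusion at the rate `1 / R²`. -/
theorem Pos.twist_div_sq_tendsto (h3 : P.γ < 3) :
    Tendsto (fun R => P.twist R / R ^ 2) atTop (𝓝 0) := by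
  have h1 := (tendsto_rpow_neg_atTop (y := 3 - P.γ) (by linarith)).const_mul (P.Yhat * P.γ)
  rw [mul_zero] at h1
  refine h1.congr' ?_
  filter_upwards [eventually_gt_atTop 0] with R hR
  have h3 : R ^ (P.γ - 1) = R ^ (-(3 - P.γ)) * R ^ 2 := by
    rw [← Real.rpow_natCast R 2, ← Real.rpow_add hR]; congr 1; push_cast; ring
  unfold twist
  rw [h3]
  field_simp

/-- From the exponent `3` on, `R ≤ C √T`. -/
theorem Pos.sq_le_twist (h : P.Pos) (h3 : 3 ≤ P.γ) {R : ℝ} (hR : 1 ≤ R) :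
    P.Yhat * P.γ * R ^ 2 ≤ P.twist R := by
  have h0 := mul_pos h.Yhat_pos h.γ_pos
  unfold twist
  have : R ^ 2 ≤ R ^ (P.γ - 1) := by
    rw [← Real.rpow_natCast R 2]
    exact Real.rpow_le_rpow_of_exponent_le hR (by push_cast; linarith)
  gcongr

end Params

/-! ### Neighbourhoods of the zeros of the sine -/

/-- On an interval of length at most `1` the sine is small only on one subinterval. -/
theorem exists_sin_lt_interval {p q t : ℝ} (hpq : p < q) (hl : q - p ≤ 1) (ht : 0 < t)
    (ht2 : t ≤ 1 / 2) :
    ∃ c d, p ≤ c ∧ c ≤ d ∧ d ≤ q ∧ d - c ≤ 4 * t ∧ (∀ x ∈ Ioo p c, t ≤ |Real.sin x|) ∧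
      (∀ x ∈ Ioo d q, t ≤ |Real.sin x|) ∧ ∀ x ∈ Ioo c d, |Real.sin x| < t := by
  have hpi := Real.pi_gt_three
  have hpi4 := Real.pi_le_four
  obtain ⟨n, hn⟩ : ∃ n : ℤ, |(p + q) / 2 - n * Real.pi| ≤ Real.pi / 2 := by
    refine ⟨round ((p + q) / 2 / Real.pi), ?_⟩
    have h := abs_sub_round ((p + q) / 2 / Real.pi)
    have : (p + q) / 2 - round ((p + q) / 2 / Real.pi) * Real.pi
        = ((p + q) / 2 / Real.pi - round ((p + q) / 2 / Real.pi)) * Real.pi := by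
      field_simp
    rw [this, abs_mul, abs_of_pos Real.pi_pos]
    nlinarith
  obtain ⟨θ, hθ0, hθ1, hθ2, hθ3⟩ : ∃ θ, 0 ≤ θ ∧ Real.sin θ = t ∧ θ ≤ 2 * t ∧ θ ≤ Real.pi / 4 := by
    have h1 : Real.sin (Real.arcsin t) = t := Real.sin_arcsin (by linarith) (by linarith)
    have h0 : 0 ≤ Real.arcsin t := Real.arcsin_nonneg.2 ht.le
    have h2 := Real.mul_le_sin h0 (Real.arcsin_le_pi_div_two t)
    rw [h1, div_mul_eq_mul_div, div_le_iff₀ (by linarith)] at h2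
    exact ⟨_, h0, h1, by nlinarith, by nlinarith⟩
  have habs : ∀ x : ℝ, |Real.sin x| = |Real.sin (x - n * Real.pi)| := by
    intro x
    rw [Real.sin_sub_int_mul_pi, abs_mul, abs_zpow, abs_neg, abs_one, one_zpow, one_mul]
  have key : ∀ z : ℝ, θ ≤ |z| → |z| ≤ Real.pi / 2 + 1 / 2 → t ≤ |Real.sin z| := by
    intro z h1 h2
    have h3 : |Real.sin z| = Real.sin |z| := by
      rw [Real.abs_sin_eq_sin_abs_of_abs_le_pi (by linarith)]
    rw [h3, ← hθ1]
    rcases le_total |z| (Real.pi / 2) with h | h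
    · exact Real.sin_le_sin_of_le_of_le_pi_div_two (by linarith) h h1
    · rw [← Real.sin_pi_sub |z|]
      exact Real.sin_le_sin_of_le_of_le_pi_div_two (by linarith) (by linarith) (by linarith)
  have hn' := abs_le.1 hn
  refine ⟨max p (min q (n * Real.pi - θ)), max p (min q (n * Real.pi + θ)), le_max_left _ _,
    max_le_max le_rfl (min_le_min le_rfl (by linarith)), max_le hpq.le (min_le_left _ _),
    ?_, ?_, ?_, ?_⟩
  · rcases max_cases p (min q (n * Real.pi - θ)) with h | h <;>
    rcases min_cases q (n * Real.pi - θ) with h' | h' <;>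
    rcases max_cases p (min q (n * Real.pi + θ)) with h'' | h'' <;>
    rcases min_cases q (n * Real.pi + θ) with h''' | h''' <;> linarith
  · intro x hx
    have h1 : x < n * Real.pi - θ := by
      rcases lt_max_iff.1 hx.2 with h | h
      · linarith [hx.1]
      · exact lt_of_lt_of_le h (min_le_right _ _)
    have hx1 := hx.1
    rw [habs]
    have h2 : |x - n * Real.pi| = n * Real.pi - x := by rw [abs_of_neg] <;> linarith
    apply key <;> rw [h2] <;> linarith
  · intro x hx
    have h0 := (le_max_right _ _).trans hx.1.le
    have h1 : n * Real.pi + θ ≤ x := by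
      rcases min_le_iff.1 h0 with h | h
      · linarith [hx.2]
      · exact h
    have hx1 := hx.2
    rw [habs]
    have h2 : |x - n * Real.pi| = x - n * Real.pi := by rw [abs_of_nonneg]; linarith
    apply key <;> rw [h2] <;> linarith
  · intro x hx
    have h1 : n * Real.pi - θ < x := by
      by_contra hc
      rcases le_total q (n * Real.pi - θ) with h | h
      · have h3 := hx.1
        rw [min_eq_left h, max_eq_right hpq.le] at h3
        have := hx.2.trans_le (max_le hpq.le (min_le_left _ _))
        linarith
      · have h3 := lt_of_le_of_lt (le_max_right _ _) hx.1
        rw [min_eq_right h] at h3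
        linarith
    have h2 : x < n * Real.pi + θ := by
      rcases lt_max_iff.1 hx.2 with h | h
      · have := lt_of_le_of_lt (le_max_left _ _) hx.1
        linarith
      · exact lt_of_lt_of_le h (min_le_right _ _)
    have h3 : |x - n * Real.pi| < θ := abs_lt.2 ⟨by linarith, by linarith⟩
    rw [habs, Real.abs_sin_eq_sin_abs_of_abs_le_pi (by linarith), ← hθ1]
    exact Real.sin_lt_sin_of_lt_of_le_pi_div_two (by linarith [abs_nonneg (x - n * Real.pi)])
      (by linarith) h3

theorem volume_sin_lt_le_of_length_le_one {p q t : ℝ} (hl : q - p ≤ 1) (ht : 0 < t) :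
    volume (Ioo p q ∩ {x | |Real.sin x| < t}) ≤ ENNReal.ofReal (4 * t) := by
  rcases le_or_gt q p with h | hpq
  · simp [Ioo_eq_empty (not_lt.2 h)]
  rcases le_or_gt t (1 / 2) with ht2 | ht2
  · obtain ⟨c, d, h1, h2, h3, h4, h5, h6, -⟩ := exists_sin_lt_interval hpq hl ht ht2
    calc volume (Ioo p q ∩ {x | |Real.sin x| < t}) ≤ volume (Icc c d) := by
          apply measure_mono
          rintro x ⟨hx, hx2⟩
          have hx2' : |Real.sin x| < t := hx2
          refine ⟨?_, ?_⟩
          · by_contra hc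
            exact absurd (h5 x ⟨hx.1, not_le.1 hc⟩) (not_le.2 hx2')
          · by_contra hc
            exact absurd (h6 x ⟨not_le.1 hc, hx.2⟩) (not_le.2 hx2')
      _ ≤ _ := by
          rw [Real.volume_Icc]
          exact ENNReal.ofReal_le_ofReal h4
  · calc volume (Ioo p q ∩ {x | |Real.sin x| < t}) ≤ volume (Ioo p q) :=
          measure_mono inter_subset_left
      _ ≤ _ := by
          rw [Real.volume_Ioo]
          exact ENNReal.ofReal_le_ofReal (by linarith)

theorem volume_sin_lt_le {p q t : ℝ} (ht : 0 < t) (n : ℕ) (hl : q - p ≤ n) :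
    volume (Ioo p q ∩ {x | |Real.sin x| < t}) ≤ ENNReal.ofReal (4 * t * n) := by
  induction n generalizing q with
  | zero =>
    have : q ≤ p := by simpa using hl
    simp [Ioo_eq_empty (not_lt.2 this)]
  | succ n ih =>
    push_cast at hl
    calc volume (Ioo p q ∩ {x | |Real.sin x| < t})
        ≤ volume ((Ioo p (q - 1) ∩ {x | |Real.sin x| < t}) ∪
          (Ioo (q - 1) q ∩ {x | |Real.sin x| < t}) ∪ {q - 1}) := by
          apply measure_mono
          rintro x ⟨hx, hx2⟩
          rcases lt_trichotomy x (q - 1) with h | h | h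
          · exact Or.inl (Or.inl ⟨⟨hx.1, h⟩, hx2⟩)
          · exact Or.inr h
          · exact Or.inl (Or.inr ⟨⟨h, hx.2⟩, hx2⟩)
      _ ≤ ENNReal.ofReal (4 * t * n) + ENNReal.ofReal (4 * t) + 0 := by
          refine (measure_union_le _ _).trans (add_le_add ((measure_union_le _ _).trans
            (add_le_add (ih (by linarith)) (volume_sin_lt_le_of_length_le_one (by linarith) ht)))
            ?_)
          simp
      _ = _ := by
          rw [add_zero, ← ENNReal.ofReal_add (by positivity) (by positivity)]
          congr 1
          push_cast
          ring

/-- An integral over an open interval is controlled by those over compact subintervals. -/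
theorem abs_integral_Ioo_le_of_forall {p q C : ℝ} {h : ℝ → ℝ} (hi : IntegrableOn h (Ioo p q))
    (hC : 0 ≤ C)
    (hb : ∀ p' q', p < p' → p' ≤ q' → q' < q → |∫ x in p'..q', h x| ≤ C) :
    |∫ x in Ioo p q, h x| ≤ C := by
  rcases le_or_gt q p with hqp | hpq
  · simpa [Ioo_eq_empty (not_lt.2 hqp)] using hC
  have h1 : Tendsto (fun e : ℝ => p + e) (𝓝[>] 0) (𝓝 p) := by
    have : Tendsto (fun e : ℝ => p + e) (𝓝 0) (𝓝 (p + 0)) := (continuous_const.add continuous_id).tendsto 0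
    rw [add_zero] at this
    exact this.mono_left nhdsWithin_le_nhds
  have h2 : Tendsto (fun e : ℝ => q - e) (𝓝[>] 0) (𝓝 q) := by
    have : Tendsto (fun e : ℝ => q - e) (𝓝 0) (𝓝 (q - 0)) := (continuous_const.sub continuous_id).tendsto 0
    rw [sub_zero] at this
    exact this.mono_left nhdsWithin_le_nhds
  have h3 := (aecover_Ioo_of_Ioc (μ := volume) h1 h2).integral_tendsto_of_countably_generated hi
  refine le_of_tendsto h3.abs ?_
  have h4 : ∀ᶠ e : ℝ in 𝓝[>] 0, e < (q - p) / 2 :=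
    nhdsWithin_le_nhds (gt_mem_nhds (by linarith))
  filter_upwards [self_mem_nhdsWithin, h4] with e he he2
  have he0 : (0 : ℝ) < e := he
  have h5 := hb (p + e) (q - e) (by linarith) (by linarith) (by linarith)
  rw [intervalIntegral.integral_of_le (by linarith)] at h5
  rw [Measure.restrict_restrict measurableSet_Ioc, inter_eq_left.2]
  · exact h5
  · intro x hx
    exact ⟨by linarith [hx.1], by linarith [hx.2]⟩

/-! ### Weighted curves close to the reference curves, and oscillation along them -/

theorem integrableOn_Ioo_of_abs_le {p q M : ℝ} {f : ℝ → ℝ}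
    (hf : AEStronglyMeasurable f (volume.restrict (Ioo p q))) (h : ∀ x ∈ Ioo p q, |f x| ≤ M) :
    IntegrableOn f (Ioo p q) := by
  refine Integrable.of_bound (C := M) hf ?_
  filter_upwards [ae_restrict_mem measurableSet_Ioo] with x hx using h x hx

namespace Params

/-- The lift `x + Y(y)` of the angle of the image point. -/
def nextX (P : Params) (x y : ℝ) : ℝ := x + P.Y y

/-- The height of the image point. -/
def nextY (P : Params) (x y : ℝ) : ℝ := y + 2 * P.A * Real.cos (P.nextX x y)

end Params

/-- A graph `y = ψ(x)` over `(p, q)` with a nonnegative weight `w`; `ψ'`, `ψ''` and `w'` are the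
functions `ψ₁`, `ψ₂` and `w₁`. The heights are comparable to `R`, the slope is that of the reference
curves up to `K / Y'(R)`, and the logarithmic derivative of the weight is at most `K`. -/
structure RegCurve (P : Params) (R K W p q : ℝ) (ψ ψ₁ ψ₂ w w₁ : ℝ → ℝ) : Prop where
  der : ∀ x ∈ Ioo p q, HasDerivAt ψ (ψ₁ x) x
  der₁ : ∀ x ∈ Ioo p q, HasDerivAt ψ₁ (ψ₂ x) x
  derw : ∀ x ∈ Ioo p q, HasDerivAt w (w₁ x) x
  height : ∀ x ∈ Ioo p q, ψ x ∈ Icc (R / 4) (4 * R)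
  slope : ∀ x ∈ Ioo p q, |ψ₁ x + 2 * P.A * Real.sin x| ≤ K / P.twist R
  dslope : ∀ x ∈ Ioo p q, |ψ₂ x + 2 * P.A * Real.cos x| ≤ P.A / 4
  nonneg : ∀ x ∈ Ioo p q, 0 ≤ w x
  le : ∀ x ∈ Ioo p q, w x ≤ W
  regular : ∀ x ∈ Ioo p q, |w₁ x| ≤ K * w x

/-- The derivative of `x ↦ x + Y(ψ(x))`. -/
def phaseRate (P : Params) (ψ ψ₁ : ℝ → ℝ) (x : ℝ) : ℝ := 1 + P.twist (ψ x) * ψ₁ x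

/-- The second derivative of `x ↦ x + Y(ψ(x))`. -/
def phaseRate' (P : Params) (ψ ψ₁ ψ₂ : ℝ → ℝ) (x : ℝ) : ℝ :=
  (P.γ - 1) * P.twist (ψ x) / ψ x * ψ₁ x * ψ₁ x + P.twist (ψ x) * ψ₂ x

namespace RegCurve

variable {P : Params} {R K W p q : ℝ} {ψ ψ₁ ψ₂ w w₁ : ℝ → ℝ}

theorem mono (h : RegCurve P R K W p q ψ ψ₁ ψ₂ w w₁) {p' q' : ℝ} (hp : p ≤ p') (hq : q' ≤ q) :
    RegCurve P R K W p' q' ψ ψ₁ ψ₂ w w₁ := by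
  have hs : Ioo p' q' ⊆ Ioo p q := Ioo_subset_Ioo hp hq
  exact ⟨fun x hx => h.der x (hs hx), fun x hx => h.der₁ x (hs hx), fun x hx => h.derw x (hs hx),
    fun x hx => h.height x (hs hx), fun x hx => h.slope x (hs hx), fun x hx => h.dslope x (hs hx),
    fun x hx => h.nonneg x (hs hx), fun x hx => h.le x (hs hx), fun x hx => h.regular x (hs hx)⟩

theorem pos (h : RegCurve P R K W p q ψ ψ₁ ψ₂ w w₁) (hR : 0 < R) {x : ℝ} (hx : x ∈ Ioo p q) :
    0 < ψ x := by linarith [(h.height x hx).1]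

theorem hasDerivAt_phase (h : RegCurve P R K W p q ψ ψ₁ ψ₂ w w₁) (hR : 0 < R) {x : ℝ}
    (hx : x ∈ Ioo p q) :
    HasDerivAt (fun x => P.nextX x (ψ x)) (phaseRate P ψ ψ₁ x) x :=
  (hasDerivAt_id x).add ((Params.hasDerivAt_Y (h.pos hR hx)).comp x (h.der x hx))

theorem hasDerivAt_phaseRate (h : RegCurve P R K W p q ψ ψ₁ ψ₂ w w₁) (hR : 0 < R) {x : ℝ}
    (hx : x ∈ Ioo p q) : HasDerivAt (phaseRate P ψ ψ₁) (phaseRate' P ψ ψ₁ ψ₂ x) x :=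
  ((((Params.hasDerivAt_twist (h.pos hR hx)).comp x (h.der x hx)).mul
    (h.der₁ x hx)).const_add 1).congr_deriv (by unfold phaseRate'; simp only [Function.comp])

theorem abs_slope_le (h : RegCurve P R K W p q ψ ψ₁ ψ₂ w w₁) (hP : P.Pos)
    (hτ : 1 ≤ P.twist R) (hK : 0 ≤ K) {x : ℝ} (hx : x ∈ Ioo p q) :
    |ψ₁ x| ≤ 2 * P.A + K := by
  have h1 := abs_le.1 (h.slope x hx)
  have h2 : K / P.twist R ≤ K := div_le_self hK hτ
  have h3 := Real.sin_le_one x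
  have h4 := Real.neg_one_le_sin x
  have hA := hP.A_pos
  rw [abs_le]
  constructor <;> nlinarith

theorem twist_le (h : RegCurve P R K W p q ψ ψ₁ ψ₂ w w₁) (hP : P.Pos) (hR : 0 < R) {x : ℝ}
    (hx : x ∈ Ioo p q) : P.twist (ψ x) ≤ P.kap * P.twist R :=
  hP.twist_le (y := ψ x) hR (by linarith [(h.height x hx).1]) (by linarith [(h.height x hx).2])

theorem le_twist (h : RegCurve P R K W p q ψ ψ₁ ψ₂ w w₁) (hP : P.Pos) (hR : 0 < R) {x : ℝ}
    (hx : x ∈ Ioo p q) : P.twist R ≤ P.kap * P.twist (ψ x) :=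
  hP.le_twist (y := ψ x) hR (by linarith [(h.height x hx).1])

/-- The phase advances at the rate `-2 A Y' sin x`, up to a bounded error. -/
theorem abs_phaseRate_add_le (h : RegCurve P R K W p q ψ ψ₁ ψ₂ w w₁) (hP : P.Pos) (hR : 0 < R)
    {x : ℝ} (hx : x ∈ Ioo p q) :
    |phaseRate P ψ ψ₁ x + 2 * P.A * P.twist (ψ x) * Real.sin x| ≤ 1 + P.kap * K := by
  have hT := hP.twist_pos (h.pos hR hx)
  have hτ := hP.twist_pos hR
  have hle := h.twist_le hP hR hx
  have e : phaseRate P ψ ψ₁ x + 2 * P.A * P.twist (ψ x) * Real.sin x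
      = 1 + P.twist (ψ x) * (ψ₁ x + 2 * P.A * Real.sin x) := by unfold phaseRate; ring
  rw [e]
  refine (abs_add_le _ _).trans ?_
  rw [abs_one, abs_mul, abs_of_pos hT]
  have h1 := h.slope x hx
  have h2 : P.kap * P.twist R * (K / P.twist R) = P.kap * K := by field_simp
  have : P.twist (ψ x) * |ψ₁ x + 2 * P.A * Real.sin x| ≤ P.kap * P.twist R * (K / P.twist R) :=
    mul_le_mul hle h1 (abs_nonneg _) (hT.le.trans hle)
  linarith

/-- Where `|sin x|` is large compared with `1 / Y'(R)` the curve is expanded, by the order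
`Y'(R) |sin x|`. -/
theorem le_abs_phaseRate (h : RegCurve P R K W p q ψ ψ₁ ψ₂ w w₁) (hP : P.Pos) (hR : 0 < R)
    {t x : ℝ} (hx : x ∈ Ioo p q) (ht : t ≤ |Real.sin x|)
    (hbig : P.kap * (1 + P.kap * K) ≤ P.A * P.twist R * t) :
    P.A * P.twist R / P.kap * |Real.sin x| ≤ |phaseRate P ψ ψ₁ x| := by
  have hT := hP.twist_pos (h.pos hR hx)
  have hτ := hP.twist_pos hR
  have hA := hP.A_pos
  have hk := hP.kap_pos
  have hle := h.le_twist hP hR hx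
  have h1 := h.abs_phaseRate_add_le hP hR hx
  have h2 : 2 * P.A * P.twist (ψ x) * |Real.sin x| ≤ |phaseRate P ψ ψ₁ x| + (1 + P.kap * K) := by
    have : |2 * P.A * P.twist (ψ x) * Real.sin x| ≤ |phaseRate P ψ ψ₁ x|
        + |phaseRate P ψ ψ₁ x + 2 * P.A * P.twist (ψ x) * Real.sin x| := by
      rw [add_comm]
      simpa using abs_sub (phaseRate P ψ ψ₁ x + 2 * P.A * P.twist (ψ x) * Real.sin x)
        (phaseRate P ψ ψ₁ x)
    rw [abs_mul, abs_of_pos (by positivity : 0 < 2 * P.A * P.twist (ψ x))] at this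
    linarith
  have h3 : P.A * P.twist R / P.kap ≤ P.A * P.twist (ψ x) := by
    rw [div_le_iff₀ hk]
    nlinarith
  have h4 : 1 + P.kap * K ≤ P.A * P.twist R / P.kap * t := by
    rw [div_mul_eq_mul_div, le_div_iff₀ hk]
    linarith
  have h5 : P.A * P.twist R / P.kap * t ≤ P.A * P.twist R / P.kap * |Real.sin x| := by gcongr
  have h6 := mul_le_mul_of_nonneg_right h3 (abs_nonneg (Real.sin x))
  nlinarith

/-- A bound for the second derivative of the phase, in units of `Y'(R)`. -/
def curvConst (P : Params) (K : ℝ) : ℝ :=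
  8 * P.γ * P.kap * (2 * P.A + K) ^ 2 + 3 * P.A * P.kap

theorem curvConst_nonneg (hP : P.Pos) : 0 ≤ curvConst P K := by
  have := hP.A_pos
  have := hP.kap_pos
  have := hP.γ_pos
  unfold curvConst
  positivity

theorem abs_phaseRate'_le (h : RegCurve P R K W p q ψ ψ₁ ψ₂ w w₁) (hP : P.Pos) (hR : 1 ≤ R)
    (hτ : 1 ≤ P.twist R) (hK : 0 ≤ K) {x : ℝ} (hx : x ∈ Ioo p q) :
    |phaseRate' P ψ ψ₁ ψ₂ x| ≤ curvConst P K * P.twist R := by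
  have hR0 : 0 < R := by linarith
  have hT := hP.twist_pos (h.pos hR0 hx)
  have hA := hP.A_pos
  have hk := hP.kap_pos
  have hg := hP.γ_pos
  have h1 := hP.dtwist_le (y := ψ x) hR0 (by linarith [(h.height x hx).1])
    (by linarith [(h.height x hx).2])
  have h2 : 8 * P.γ * P.kap * P.twist R / R ≤ 8 * P.γ * P.kap * P.twist R :=
    div_le_self (by positivity) hR
  have h3 := h.abs_slope_le hP hτ hK hx
  have h4 : |ψ₂ x| ≤ 3 * P.A := by
    have h5 := abs_le.1 (h.dslope x hx)
    have h6 := Real.cos_le_one x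
    have h7 := Real.neg_one_le_cos x
    rw [abs_le]
    constructor <;> nlinarith
  unfold phaseRate'
  refine (abs_add_le _ _).trans ?_
  rw [abs_mul, abs_mul, abs_mul (P.twist (ψ x)), abs_of_pos hT]
  have h5 := h.twist_le hP hR0 hx
  calc |(P.γ - 1) * P.twist (ψ x) / ψ x| * |ψ₁ x| * |ψ₁ x| + P.twist (ψ x) * |ψ₂ x|
      ≤ (8 * P.γ * P.kap * P.twist R) * (2 * P.A + K) * (2 * P.A + K)
        + P.kap * P.twist R * (3 * P.A) := by
        have := h1.trans h2
        gcongr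
    _ = _ := by unfold curvConst; ring

theorem abs_phaseRate_le (h : RegCurve P R K W p q ψ ψ₁ ψ₂ w w₁) (hP : P.Pos) (hR : 1 ≤ R)
    (hτ : 1 ≤ P.twist R) (hK : 0 ≤ K) {x : ℝ} (hx : x ∈ Ioo p q) :
    |phaseRate P ψ ψ₁ x| ≤ (1 + P.kap * (2 * P.A + K)) * P.twist R := by
  have hR0 : 0 < R := by linarith
  have hT := hP.twist_pos (h.pos hR0 hx)
  have hk := hP.kap_pos
  have h3 := h.abs_slope_le hP hτ hK hx
  have h5 := h.twist_le hP hR0 hx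
  unfold phaseRate
  refine (abs_add_le _ _).trans ?_
  rw [abs_one, abs_mul, abs_of_pos hT]
  have : P.twist (ψ x) * |ψ₁ x| ≤ P.kap * P.twist R * (2 * P.A + K) := by gcongr
  nlinarith

/-- The constant in the oscillation estimate. -/
def oscConst (P : Params) (K : ℝ) : ℝ :=
  2 * (P.kap / P.A) + 2 * (K * P.kap / P.A + curvConst P K * P.kap ^ 2 / P.A ^ 2)

theorem oscConst_nonneg (hP : P.Pos) (hK : 0 ≤ K) : 0 ≤ oscConst P K := by
  have := hP.A_pos
  have := hP.kap_pos
  have := curvConst_nonneg (K := K) hP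
  unfold oscConst
  positivity

/-- Nonstationary phase: away from the zeros of the sine the integral of a derivative `b = B'`,
evaluated at the phase, gains a factor `1 / (Y'(R) t)`. The bound on the derivative of
`α B(Φ) / Φ'` is `1 / sin²`, the derivative of the cotangent, which is at most `1 / t`. -/
theorem abs_integral_phase_le (h : RegCurve P R K W p q ψ ψ₁ ψ₂ w w₁) (hP : P.Pos) (hR : 1 ≤ R)
    (hτ : 1 ≤ P.twist R) (hK : 0 ≤ K) {t : ℝ} (ht : 0 < t)
    (hbig : P.kap * (1 + P.kap * K) ≤ P.A * P.twist R * t)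
    (hs : ∀ x ∈ Ioo p q, t ≤ |Real.sin x|) {α α₁ B b : ℝ → ℝ} {β V : ℝ}
    (hV : 0 ≤ V)
    (hα : ∀ x ∈ Ioo p q, HasDerivAt α (α₁ x) x) (hαb : ∀ x ∈ Ioo p q, |α x| ≤ V)
    (hα₁ : ∀ x ∈ Ioo p q, |α₁ x| ≤ K * V) (hB : ∀ X, HasDerivAt B (b X) X) (hb : Continuous b)
    (hbb : ∃ c, ∀ X, |b X| ≤ c)
    (hBb : ∀ X, |B X| ≤ β) :
    |∫ x in Ioo p q, α x * b (P.nextX x (ψ x))| ≤ oscConst P K * β * V / (P.twist R * t) := by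
  have hR0 : 0 < R := by linarith
  have hτ0 : 0 < P.twist R := by linarith
  have hA := hP.A_pos
  have hk := hP.kap_pos
  have hβ : 0 ≤ β := (abs_nonneg _).trans (hBb 0)
  have hC1 := curvConst_nonneg (K := K) hP
  rcases le_or_gt q p with hqp | hpq
  · simp only [Ioo_eq_empty (not_lt.2 hqp), Measure.restrict_empty, integral_zero_measure, abs_zero]
    have := oscConst_nonneg (K := K) hP hK
    positivity
  set Φ := fun x => P.nextX x (ψ x) with hΦ
  set L := phaseRate P ψ ψ₁ with hL
  have hcont : ContinuousOn (fun x => α x * b (Φ x)) (Ioo p q) := by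
    intro x hx
    exact ((hα x hx).continuousAt.mul
      (hb.continuousAt.comp (h.hasDerivAt_phase hR0 hx).continuousAt)).continuousWithinAt
  obtain ⟨c, hc⟩ := hbb
  have hint : IntegrableOn (fun x => α x * b (Φ x)) (Ioo p q) := by
    refine integrableOn_Ioo_of_abs_le (M := V * c)
      (hcont.aestronglyMeasurable measurableSet_Ioo) fun x hx => ?_
    rw [abs_mul]
    exact mul_le_mul (hαb x hx) (hc _) (abs_nonneg _) hV
  refine abs_integral_Ioo_le_of_forall hint
    (by have := oscConst_nonneg (K := K) hP hK; positivity) ?_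
  intro p' q' hp' hpq' hq'
  have hsub : Icc p' q' ⊆ Ioo p q := fun x hx => ⟨by linarith [hx.1], by linarith [hx.2]⟩
  have hLlow : ∀ x ∈ Ioo p q, P.A * P.twist R / P.kap * |Real.sin x| ≤ |L x| :=
    fun x hx => h.le_abs_phaseRate hP hR0 hx (hs x hx) hbig
  have hsin0 : ∀ x ∈ Ioo p q, Real.sin x ≠ 0 := by
    intro x hx h0
    have := hs x hx
    rw [h0, abs_zero] at this
    linarith
  have hL0 : ∀ x ∈ Ioo p q, L x ≠ 0 := by
    intro x hx h0
    have h1 := hLlow x hx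
    rw [h0, abs_zero] at h1
    have := abs_pos.2 (hsin0 x hx)
    have : 0 < P.A * P.twist R / P.kap * |Real.sin x| := by positivity
    linarith
  set C3 := β * V * (K * P.kap / P.A + curvConst P K * P.kap ^ 2 / P.A ^ 2) / P.twist R with hC3
  have hC30 : 0 ≤ C3 := by positivity
  -- integration by parts along the phase: `Z` is what is left after the boundary term
  -- `α B(Φ) / Φ'` has been taken out
  set Z := fun x => (∫ z in p'..x, α z * b (Φ z)) - α x * B (Φ x) / L x with hZ
  set Z' := fun x => - ((α₁ x * L x - α x * phaseRate' P ψ ψ₁ ψ₂ x) / L x ^ 2 * B (Φ x)) with hZ'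
  have hZd : ∀ x ∈ Icc p' q', HasDerivAt Z (Z' x) x := by
    intro x hx
    have hx' := hsub hx
    have h1 : HasDerivAt (fun x => ∫ z in p'..x, α z * b (Φ z)) (α x * b (Φ x)) x := by
      apply intervalIntegral.integral_hasDerivAt_right
      · refine (hcont.mono ?_).intervalIntegrable
        rw [uIcc_of_le hx.1]
        exact fun z hz => hsub ⟨hz.1, hz.2.trans hx.2⟩
      · exact hcont.stronglyMeasurableAtFilter isOpen_Ioo x hx'
      · exact hcont.continuousAt (isOpen_Ioo.mem_nhds hx')
    have h2 := ((hα x hx').mul ((hB (Φ x)).comp x (h.hasDerivAt_phase hR0 hx'))).div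
      (h.hasDerivAt_phaseRate hR0 hx') (hL0 x hx')
    refine (h1.sub h2).congr_deriv ?_
    have := hL0 x hx'
    simp only [hZ', Function.comp, Pi.mul_apply]
    simp only [← hL, hΦ] at this ⊢
    field_simp
    ring
  -- the comparison function for `Z`: a multiple of the cotangent
  set G := fun x => - C3 * (Real.cos x / Real.sin x) with hG
  have hGd : ∀ x ∈ Icc p' q', HasDerivAt G (C3 / Real.sin x ^ 2) x := by
    intro x hx
    have h0 := hsin0 x (hsub hx)
    refine (((Real.hasDerivAt_cos x).div (Real.hasDerivAt_sin x) h0).const_mul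
      (-C3)).congr_deriv ?_
    field_simp
    nlinarith [Real.sin_sq_add_cos_sq x]
  have hZb : ∀ x ∈ Icc p' q', ‖Z' x‖ ≤ C3 / Real.sin x ^ 2 := by
    intro x hx
    have hx' := hsub hx
    have hs0 := abs_pos.2 (hsin0 x hx')
    have hl := hLlow x hx'
    have hl0 : 0 < P.A * P.twist R / P.kap * |Real.sin x| := by positivity
    have hLp := hl0.trans_le hl
    have hs1 := Real.abs_sin_le_one x
    have e1 : |Z' x| ≤ (|α₁ x| / |L x| + |α x| * |phaseRate' P ψ ψ₁ ψ₂ x| / |L x| ^ 2) * β := by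
      simp only [hZ', abs_neg, abs_mul, abs_div, abs_pow]
      refine mul_le_mul ?_ (hBb _) (abs_nonneg _) (by positivity)
      calc _ ≤ (|α₁ x| * |L x| + |α x| * |phaseRate' P ψ ψ₁ ψ₂ x|) / |L x| ^ 2 := by
            gcongr
            refine (abs_sub _ _).trans ?_
            rw [abs_mul, abs_mul]
        _ = _ := by field_simp
    rw [Real.norm_eq_abs]
    refine e1.trans ?_
    have e2 : |α₁ x| / |L x| ≤ K * V / (P.A * P.twist R / P.kap * |Real.sin x|) := by
      have := hα₁ x hx'
      gcongr
    have e3 : |α x| * |phaseRate' P ψ ψ₁ ψ₂ x| / |L x| ^ 2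
        ≤ V * (curvConst P K * P.twist R) / (P.A * P.twist R / P.kap * |Real.sin x|) ^ 2 := by
      have := hαb x hx'
      have := h.abs_phaseRate'_le hP hR hτ hK hx'
      gcongr
    have e4 : K * V / (P.A * P.twist R / P.kap * |Real.sin x|)
        ≤ K * V / (P.A * P.twist R / P.kap * |Real.sin x| ^ 2) := by
      apply div_le_div_of_nonneg_left (by positivity) (by positivity)
      have : |Real.sin x| ^ 2 ≤ |Real.sin x| := by nlinarith
      gcongr
    rw [← sq_abs (Real.sin x)]
    calc _ ≤ (K * V / (P.A * P.twist R / P.kap * |Real.sin x| ^ 2)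
          + V * (curvConst P K * P.twist R) / (P.A * P.twist R / P.kap * |Real.sin x|) ^ 2) * β := by
          exact mul_le_mul_of_nonneg_right (add_le_add (e2.trans e4) e3) hβ
      _ = C3 / |Real.sin x| ^ 2 := by
          rw [hC3]
          field_simp
  have key := image_norm_le_of_norm_deriv_right_le_deriv_boundary'
    (f := fun x => Z x - Z p') (f' := Z') (a := p') (b := q') (B := fun x => G x - G p')
    (B' := fun x => C3 / Real.sin x ^ 2)
    (fun x hx => ((hZd x hx).sub_const _).continuousAt.continuousWithinAt)
    (fun x hx => ((hZd x (Ico_subset_Icc_self hx)).sub_const _).hasDerivWithinAt)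
    (by simp)
    (fun x hx => ((hGd x hx).sub_const _).continuousAt.continuousWithinAt)
    (fun x hx => ((hGd x (Ico_subset_Icc_self hx)).sub_const _).hasDerivWithinAt)
    (fun x hx => hZb x (Ico_subset_Icc_self hx)) (right_mem_Icc.2 hpq')
  have hpm : p' ∈ Ioo p q := hsub (left_mem_Icc.2 hpq')
  have hqm : q' ∈ Ioo p q := hsub (right_mem_Icc.2 hpq')
  have hGb : ∀ x ∈ Ioo p q, |G x| ≤ C3 / t := by
    intro x hx
    have := hs x hx
    have hs0 := abs_pos.2 (hsin0 x hx)
    simp only [hG]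
    rw [abs_mul, abs_neg, abs_of_nonneg hC30, abs_div, div_eq_mul_one_div C3 t]
    have := Real.abs_cos_le_one x
    gcongr
  have hEb : ∀ x ∈ Ioo p q, |α x * B (Φ x) / L x| ≤ V * β / (P.A * P.twist R / P.kap * t) := by
    intro x hx
    rw [abs_div, abs_mul]
    have h1 := hαb x hx
    have h2 := hBb (Φ x)
    have h3 : P.A * P.twist R / P.kap * t ≤ |L x| := by
      refine le_trans ?_ (hLlow x hx)
      have := hs x hx
      gcongr
    gcongr
  have hfin : (∫ z in p'..q', α z * b (Φ z)) = (Z q' - Z p') + α q' * B (Φ q') / L q'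
      - α p' * B (Φ p') / L p' := by
    simp only [hZ, intervalIntegral.integral_same]
    ring
  rw [hfin]
  have k1 := abs_le.1 (show |Z q' - Z p'| ≤ G q' - G p' from key)
  have k2 := abs_le.1 (hGb _ hpm)
  have k3 := abs_le.1 (hGb _ hqm)
  have k4 := abs_le.1 (hEb _ hpm)
  have k5 := abs_le.1 (hEb _ hqm)
  have k6 : oscConst P K * β * V / (P.twist R * t)
      = 2 * (C3 / t) + 2 * (V * β / (P.A * P.twist R / P.kap * t)) := by
    rw [hC3]
    unfold oscConst
    field_simp
    ring
  rw [k6, abs_le]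
  constructor <;> linarith

end RegCurve

/-! ### Equidistribution of the phase in small windows -/

/-- A continuous cutoff between the windows `|sin X| < s` and `|sin X| < 2s`. -/
def sinCut (s X : ℝ) : ℝ := min 1 (max 0 (2 - |Real.sin X| / s))

/-- A continuous bump supported on `|sin X - σ| < η`. -/
def sinBump (σ η X : ℝ) : ℝ := max 0 (1 - |Real.sin X - σ| / η)

/-- The mean of a `2π`-periodic function. -/
def circMean (χ : ℝ → ℝ) : ℝ := (∫ X in (0 : ℝ)..(2 * Real.pi), χ X) / (2 * Real.pi)

theorem continuous_sinCut (s : ℝ) : Continuous (sinCut s) := by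
  unfold sinCut
  fun_prop

theorem continuous_sinBump (σ η : ℝ) : Continuous (sinBump σ η) := by
  unfold sinBump
  fun_prop

theorem sinCut_mem (s X : ℝ) : sinCut s X ∈ Icc (0 : ℝ) 1 :=
  ⟨le_min zero_le_one (le_max_left _ _), min_le_left _ _⟩

theorem sinBump_mem {σ η : ℝ} (hη : 0 < η) (X : ℝ) : sinBump σ η X ∈ Icc (0 : ℝ) 1 :=
  ⟨le_max_left _ _, max_le zero_le_one (by
    have : 0 ≤ |Real.sin X - σ| / η := by positivity
    linarith)⟩

theorem sinCut_eq_one {s X : ℝ} (hs : 0 < s) (h : |Real.sin X| < s) : sinCut s X = 1 := by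
  have : |Real.sin X| / s ≤ 1 := (div_le_one hs).2 h.le
  exact min_eq_left (le_max_of_le_right (by linarith))

/-- If a continuous function with values in `[0, 1]` vanishes off the window `|sin X| < s`, its
mean is at most a multiple of `s`. -/
theorem circMean_le {χ : ℝ → ℝ} (hc : Continuous χ) (h01 : ∀ X, χ X ∈ Icc (0 : ℝ) 1) {s : ℝ}
    (hs : 0 < s) (h0 : ∀ X, s ≤ |Real.sin X| → χ X = 0) : circMean χ ≤ 5 * s := by
  have hpi := Real.pi_gt_three
  have hpi2 : Real.pi < 3.15 := Real.pi_lt_d2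
  unfold circMean
  rw [div_le_iff₀ (by linarith), intervalIntegral.integral_of_le (by linarith),
    integral_Ioc_eq_integral_Ioo]
  have hm : MeasurableSet {x : ℝ | |Real.sin x| < s} :=
    measurableSet_lt (by fun_prop) measurable_const
  have hv := volume_sin_lt_le (p := 0) (q := 2 * Real.pi) hs 7 (by push_cast; linarith)
  calc ∫ X in Ioo 0 (2 * Real.pi), χ X
      ≤ ∫ X in Ioo 0 (2 * Real.pi), {x : ℝ | |Real.sin x| < s}.indicator (fun _ => (1 : ℝ)) X := by
        apply integral_mono
        · exact (hc.integrableOn_Icc (a := 0) (b := 2 * Real.pi)).mono_set Ioo_subset_Icc_self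
        · exact (integrable_const (1 : ℝ)).indicator hm
        · intro X
          by_cases h : |Real.sin X| < s
          · have : X ∈ {x : ℝ | |Real.sin x| < s} := h
            simp only [indicator_of_mem this]
            exact (h01 X).2
          · have : X ∉ {x : ℝ | |Real.sin x| < s} := h
            simp only [indicator_of_notMem this, h0 X (not_lt.1 h)]
            exact le_rfl
    _ = (volume (Ioo 0 (2 * Real.pi) ∩ {x : ℝ | |Real.sin x| < s})).toReal := by
        rw [integral_indicator hm, Measure.restrict_restrict hm, setIntegral_const, inter_comm]
        simp [Measure.real]
    _ ≤ 4 * s * 7 := by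
        refine ENNReal.toReal_le_of_le_ofReal (by positivity) ?_
        exact_mod_cast hv
    _ ≤ 5 * s * (2 * Real.pi) := by nlinarith

theorem circMean_nonneg {χ : ℝ → ℝ} (h01 : ∀ X, χ X ∈ Icc (0 : ℝ) 1) : 0 ≤ circMean χ :=
  div_nonneg (intervalIntegral.integral_nonneg (by positivity) fun X _ => (h01 X).1)
    (by positivity)

theorem circMean_sinCut_le {s : ℝ} (hs : 0 < s) : circMean (sinCut s) ≤ 10 * s := by
  have := circMean_le (continuous_sinCut s) (sinCut_mem s) (s := 2 * s) (by linarith) (by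
    intro X hX
    have : 2 ≤ |Real.sin X| / s := by rwa [le_div_iff₀ hs]
    unfold sinCut
    rw [max_eq_left (by linarith), min_eq_right zero_le_one])
  linarith

/-- The mean of a bump at a small value `σ` of the sine is at least of the order of its width: for
`σ ≤ X ≤ σ + η / 2` the sine differs from `X` by less than `X³ / 4`, hence from `σ` by at most
`3 η / 4`. -/
theorem le_circMean_sinBump {σ η : ℝ} (hη : 0 < η) (hσ : 0 < σ) (h1 : σ + η ≤ 1)
    (h3 : (σ + η) ^ 3 ≤ η) : η / 64 ≤ circMean (sinBump σ η) := by
  have hpi := Real.pi_gt_three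
  have hpi2 : Real.pi < 3.15 := Real.pi_lt_d2
  unfold circMean
  rw [le_div_iff₀ (by linarith)]
  have hb : ∀ X ∈ Icc σ (σ + η / 2), (1 / 4 : ℝ) ≤ sinBump σ η X := by
    intro X hX
    have hX0 : 0 < X := by linarith [hX.1]
    have h4 := Real.sin_gt_sub_cube hX0
    have h5 := Real.sin_lt hX0
    have h6 : X ^ 3 ≤ η := (pow_le_pow_left₀ hX0.le (by linarith [hX.2]) 3).trans h3
    have h7 : |Real.sin X - σ| / η ≤ 3 / 4 := by
      rw [div_le_iff₀ hη, abs_le]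
      constructor <;> linarith [hX.1, hX.2]
    exact le_max_of_le_right (by linarith)
  have hi : ∀ a b, IntervalIntegrable (sinBump σ η) volume a b :=
    fun a b => (continuous_sinBump σ η).intervalIntegrable a b
  have h4 : ∫ X in σ..(σ + η / 2), (1 / 4 : ℝ) ≤ ∫ X in σ..(σ + η / 2), sinBump σ η X :=
    intervalIntegral.integral_mono_on (by linarith) (by simp) (hi _ _) hb
  have h5 : ∫ X in σ..(σ + η / 2), sinBump σ η X ≤ ∫ X in (0 : ℝ)..(2 * Real.pi), sinBump σ η X :=
    intervalIntegral.integral_mono_interval hσ.le (by linarith) (by linarith)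
      (Eventually.of_forall fun X => (sinBump_mem hη X).1) (hi _ _)
  rw [intervalIntegral.integral_const] at h4
  simp only [smul_eq_mul] at h4
  nlinarith

/-- The oscillating part of a periodic function has a primitive bounded by its mean. -/
theorem exists_primitive_circMean {χ : ℝ → ℝ} (hc : Continuous χ)
    (h01 : ∀ X, χ X ∈ Icc (0 : ℝ) 1) (hp : Function.Periodic χ (2 * Real.pi)) :
    ∃ B : ℝ → ℝ, (∀ X, HasDerivAt B (χ X - circMean χ) X) ∧
      ∀ X, |B X| ≤ 2 * Real.pi * circMean χ := by
  have hpi := Real.pi_pos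
  set m := circMean χ with hm
  have hm0 : 0 ≤ m := circMean_nonneg h01
  have hmi : ∫ X in (0 : ℝ)..(2 * Real.pi), χ X = 2 * Real.pi * m := by
    rw [hm, circMean]
    field_simp
  set B := fun X => ∫ z in (0 : ℝ)..X, (χ z - m) with hB
  have hcm : Continuous fun z => χ z - m := hc.sub continuous_const
  have hBd : ∀ X, HasDerivAt B (χ X - m) X := fun X => hcm.integral_hasStrictDerivAt 0 X |>.hasDerivAt
  have hi : ∀ a b, IntervalIntegrable χ volume a b := fun a b => hc.intervalIntegrable a b
  have hB2 : ∀ X, B X = (∫ z in (0 : ℝ)..X, χ z) - X * m := by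
    intro X
    simp only [hB]
    rw [intervalIntegral.integral_sub (hi _ _) (by simp)]
    simp
  have hper : Function.Periodic B (2 * Real.pi) := by
    intro X
    rw [hB2, hB2, ← intervalIntegral.integral_add_adjacent_intervals (hi 0 X) (hi X _),
      hp.intervalIntegral_add_eq X 0, zero_add, hmi]
    ring
  refine ⟨B, hBd, fun X => ?_⟩
  obtain ⟨Y, hY, hXY⟩ := hper.exists_mem_Ico₀ (by linarith) X
  rw [hXY, hB2]
  have h1 : 0 ≤ ∫ z in (0 : ℝ)..Y, χ z :=
    intervalIntegral.integral_nonneg hY.1 fun X _ => (h01 X).1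
  have h2 : ∫ z in (0 : ℝ)..Y, χ z ≤ ∫ z in (0 : ℝ)..(2 * Real.pi), χ z :=
    intervalIntegral.integral_mono_interval le_rfl hY.1 hY.2.le
      (Eventually.of_forall fun X => (h01 X).1) (hi _ _)
  rw [hmi] at h2
  have h3 : Y * m ≤ 2 * Real.pi * m := by
    have := hY.2
    gcongr
  have h4 : 0 ≤ Y * m := mul_nonneg hY.1 hm0
  rw [abs_le]
  constructor <;> linarith

theorem periodic_sinCut (s : ℝ) : Function.Periodic (sinCut s) (2 * Real.pi) := fun X => by
  simp [sinCut]

theorem periodic_sinBump (σ η : ℝ) : Function.Periodic (sinBump σ η) (2 * Real.pi) := fun X => by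
  simp [sinBump]

namespace RegCurve

variable {P : Params} {R K W p q : ℝ} {ψ ψ₁ ψ₂ w w₁ : ℝ → ℝ}

/-- Away from the zeros of the sine the phase is equidistributed, with a relative error that does
not depend on the window. -/
theorem abs_integral_window_sub_le (h : RegCurve P R K W p q ψ ψ₁ ψ₂ w w₁) (hP : P.Pos)
    (hR : 1 ≤ R) (hτ : 1 ≤ P.twist R) (hK : 0 ≤ K) (hW : 0 ≤ W) {t : ℝ} (ht : 0 < t)
    (hbig : P.kap * (1 + P.kap * K) ≤ P.A * P.twist R * t)
    (hs : ∀ x ∈ Ioo p q, t ≤ |Real.sin x|) {χ : ℝ → ℝ} (hc : Continuous χ)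
    (h01 : ∀ X, χ X ∈ Icc (0 : ℝ) 1) (hp : Function.Periodic χ (2 * Real.pi)) :
    |(∫ x in Ioo p q, w x * χ (P.nextX x (ψ x))) - circMean χ * ∫ x in Ioo p q, w x|
      ≤ oscConst P K * (2 * Real.pi * circMean χ) * W / (P.twist R * t) := by
  obtain ⟨B, hB, hBb⟩ := exists_primitive_circMean hc h01 hp
  have hR0 : 0 < R := by linarith
  have key := h.abs_integral_phase_le hP hR hτ hK ht hbig hs hW (α := w) (α₁ := w₁) h.derw
    (fun x hx => by rw [abs_of_nonneg (h.nonneg x hx)]; exact h.le x hx)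
    (fun x hx => (h.regular x hx).trans (by have := h.le x hx; gcongr))
    hB (by fun_prop)
    ⟨1 + |circMean χ|, fun X => (abs_sub _ _).trans (by
      have := h01 X
      rw [abs_of_nonneg this.1]
      linarith [this.2])⟩ hBb
  have hwc : ContinuousOn w (Ioo p q) := fun x hx => (h.derw x hx).continuousAt.continuousWithinAt
  have hi1 : IntegrableOn w (Ioo p q) :=
    integrableOn_Ioo_of_abs_le (hwc.aestronglyMeasurable measurableSet_Ioo)
      (M := W) fun x hx => by rw [abs_of_nonneg (h.nonneg x hx)]; exact h.le x hx
  have hi2 : IntegrableOn (fun x => w x * χ (P.nextX x (ψ x))) (Ioo p q) := by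
    refine integrableOn_Ioo_of_abs_le (ContinuousOn.aestronglyMeasurable (fun x hx =>
      ((h.derw x hx).continuousAt.mul (hc.continuousAt.comp
        (h.hasDerivAt_phase hR0 hx).continuousAt)).continuousWithinAt) measurableSet_Ioo)
      (M := W) fun x hx => ?_
    have h1 := h01 (P.nextX x (ψ x))
    rw [abs_mul, abs_of_nonneg (h.nonneg x hx), abs_of_nonneg h1.1]
    nlinarith [h.le x hx, h.nonneg x hx, h1.2, h1.1]
  rw [← integral_const_mul, ← integral_sub hi2 (hi1.const_mul _)]
  refine le_of_eq_of_le ?_ key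
  congr 2
  ext x
  ring

end RegCurve

/-! ### The image of a curve, parametrized by the lifted angle -/

/-- The case of a positive derivative of `exists_inverse_of_ne_zero`. -/
theorem exists_inverse_of_pos {p q C : ℝ} {Φ L : ℝ → ℝ} (hpq : p < q)
    (hd : ∀ x ∈ Ioo p q, HasDerivAt Φ (L x) x) (h0 : ∀ x ∈ Ioo p q, 0 < L x)
    (hb : ∀ x ∈ Ioo p q, |L x| ≤ C) :
    ∃ (α β : ℝ) (G : ℝ → ℝ), α < β ∧ Φ '' Ioo p q = Ioo α β ∧ InjOn Φ (Ioo p q) ∧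
      (∀ X ∈ Ioo α β, G X ∈ Ioo p q ∧ Φ (G X) = X ∧ HasDerivAt G (L (G X))⁻¹ X) ∧
      ∀ x ∈ Ioo p q, G (Φ x) = x := by
  have hcont : ContinuousOn Φ (Ioo p q) := fun x hx => (hd x hx).continuousAt.continuousWithinAt
  have hmono : StrictMonoOn Φ (Ioo p q) := by
    apply strictMonoOn_of_deriv_pos (convex_Ioo p q) hcont
    intro x hx
    rw [interior_Ioo] at hx
    rw [(hd x hx).deriv]
    exact h0 x hx
  set m := (p + q) / 2 with hm
  have hmI : m ∈ Ioo p q := ⟨by linarith, by linarith⟩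
  have hbd : ∀ x ∈ Ioo p q, |Φ x - Φ m| ≤ C * (q - p) := by
    intro x hx
    have := (convex_Ioo p q).norm_image_sub_le_of_norm_hasDerivWithin_le
      (fun x hx => (hd x hx).hasDerivWithinAt) (C := C) hb hmI hx
    refine this.trans ?_
    have hC : 0 ≤ C := (abs_nonneg _).trans (hb m hmI)
    have : ‖x - m‖ ≤ q - p := by
      rw [Real.norm_eq_abs, abs_le]
      constructor <;> linarith [hx.1, hx.2]
    gcongr
  set S := Φ '' Ioo p q with hS
  have hne : S.Nonempty := ⟨Φ m, m, hmI, rfl⟩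
  have hbb : BddBelow S := ⟨Φ m - C * (q - p), by
    rintro _ ⟨x, hx, rfl⟩
    linarith [(abs_le.1 (hbd x hx)).1]⟩
  have hba : BddAbove S := ⟨Φ m + C * (q - p), by
    rintro _ ⟨x, hx, rfl⟩
    linarith [(abs_le.1 (hbd x hx)).2]⟩
  have hpre : IsPreconnected S := isPreconnected_Ioo.image _ hcont
  have hSeq : S = Ioo (sInf S) (sSup S) := by
    apply Subset.antisymm
    · rintro _ ⟨x, hx, rfl⟩
      have ha : (p + x) / 2 ∈ Ioo p q := ⟨by linarith [hx.1], by linarith [hx.1, hx.2]⟩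
      have hb : (x + q) / 2 ∈ Ioo p q := ⟨by linarith [hx.1, hx.2], by linarith [hx.2]⟩
      exact ⟨(csInf_le hbb ⟨_, ha, rfl⟩).trans_lt (hmono ha hx (by linarith [hx.1])),
        (hmono hx hb (by linarith [hx.2])).trans_le (le_csSup hba ⟨_, hb, rfl⟩)⟩
    · exact IsConnected.Ioo_csInf_csSup_subset ⟨hne, hpre⟩ hbb hba
  refine ⟨sInf S, sSup S, Function.invFunOn Φ (Ioo p q), ?_, hSeq, hmono.injOn, ?_, ?_⟩
  · have : Φ m ∈ Ioo (sInf S) (sSup S) := hSeq ▸ ⟨m, hmI, rfl⟩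
    exact this.1.trans this.2
  · intro X hX
    have hX' : X ∈ Φ '' Ioo p q := by rw [← hS, hSeq]; exact hX
    have e1 := Function.invFunOn_mem hX'
    have e2 := Function.invFunOn_eq hX'
    refine ⟨e1, e2, ?_⟩
    have hev : ∀ᶠ Y in 𝓝 X, Φ (Function.invFunOn Φ (Ioo p q) Y) = Y := by
      filter_upwards [isOpen_Ioo.mem_nhds hX] with Y hY
      exact Function.invFunOn_eq (show Y ∈ Φ '' Ioo p q by rw [← hS, hSeq]; exact hY)
    refine HasDerivAt.of_local_left_inverse ?_ (hd _ e1) (h0 _ e1).ne' hev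
    have hm2 : StrictMonoOn (Function.invFunOn Φ (Ioo p q)) (Ioo (sInf S) (sSup S)) := by
      intro Y hY Z hZ hYZ
      rw [← hSeq] at hY hZ
      rw [← hmono.lt_iff_lt (Function.invFunOn_mem hY) (Function.invFunOn_mem hZ),
        Function.invFunOn_eq hY, Function.invFunOn_eq hZ]
      exact hYZ
    refine hm2.continuousAt_of_image_mem_nhds (isOpen_Ioo.mem_nhds hX) ?_
    refine mem_of_superset (isOpen_Ioo.mem_nhds e1) ?_
    intro x hx
    refine ⟨Φ x, hSeq ▸ ⟨x, hx, rfl⟩, ?_⟩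
    exact hmono.injOn.leftInvOn_invFunOn hx
  · intro x hx
    exact hmono.injOn.leftInvOn_invFunOn hx

/-- A function with nonvanishing bounded derivative on an interval has a differentiable inverse, and
its derivative has a constant sign `σ`. -/
theorem exists_inverse_of_ne_zero {p q C : ℝ} {Φ L : ℝ → ℝ} (hpq : p < q)
    (hd : ∀ x ∈ Ioo p q, HasDerivAt Φ (L x) x) (h0 : ∀ x ∈ Ioo p q, L x ≠ 0)
    (hb : ∀ x ∈ Ioo p q, |L x| ≤ C) :
    ∃ (α β σ : ℝ) (G : ℝ → ℝ), α < β ∧ |σ| = 1 ∧ (∀ x ∈ Ioo p q, |L x| = σ * L x) ∧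
      Φ '' Ioo p q = Ioo α β ∧ InjOn Φ (Ioo p q) ∧
      (∀ X ∈ Ioo α β, G X ∈ Ioo p q ∧ Φ (G X) = X ∧ HasDerivAt G (L (G X))⁻¹ X) ∧
      ∀ x ∈ Ioo p q, G (Φ x) = x := by
  rcases hasDerivWithinAt_forall_lt_or_forall_gt_of_forall_ne (convex_Ioo p q)
    (fun x hx => (hd x hx).hasDerivWithinAt) h0 with h | h
  · obtain ⟨α, β, G, h1, h2, h3, h4, h5⟩ := exists_inverse_of_pos (Φ := fun x => - Φ x)
      (L := fun x => - L x) (C := C) hpq (fun x hx => (hd x hx).neg)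
      (fun x hx => neg_pos.2 (h x hx)) (fun x hx => by rw [abs_neg]; exact hb x hx)
    refine ⟨-β, -α, -1, fun X => G (-X), by linarith, by simp, fun x hx => ?_, ?_, ?_, ?_, ?_⟩
    · rw [abs_of_neg (h x hx)]
      ring
    · have : Φ '' Ioo p q = Neg.neg '' ((fun x => - Φ x) '' Ioo p q) := by
        rw [image_image]
        simp
      rw [this, h2]
      simp
    · intro x hx y hy hxy
      exact h3 hx hy (by simpa using hxy)
    · intro X hX
      have hX' : -X ∈ Ioo α β := ⟨by linarith [hX.2], by linarith [hX.1]⟩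
      obtain ⟨e1, e2, e3⟩ := h4 _ hX'
      refine ⟨e1, by linarith, ?_⟩
      refine (e3.comp X (hasDerivAt_neg X)).congr_deriv ?_
      rw [inv_neg]
      ring
    · intro x hx
      exact h5 x hx
  · obtain ⟨α, β, G, h1, h2, h3, h4, h5⟩ := exists_inverse_of_pos hpq hd h hb
    exact ⟨α, β, 1, G, h1, by simp, fun x hx => by rw [abs_of_pos (h x hx), one_mul], h2, h3, h4, h5⟩

theorem sign_mul_div {σ L v : ℝ} (hσ : |σ| = 1) (h : |L| = σ * L) : σ * (v / L) = v / |L| := by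
  rw [h]
  rcases eq_or_eq_neg_of_abs_eq hσ with rfl | rfl
  · simp
  · rw [neg_one_mul, neg_one_mul, div_neg]

namespace RegCurve

variable {P : Params} {R K W p q : ℝ} {ψ ψ₁ ψ₂ w w₁ : ℝ → ℝ}

/-- Away from the zeros of the sine, the image of a weighted curve is again a graph with a slope
close to the reference slope, over the range of the phase. -/
theorem exists_image (h : RegCurve P R K W p q ψ ψ₁ ψ₂ w w₁) (hP : P.Pos) (hR : 1 ≤ R)
    (hτ : 1 ≤ P.twist R) (hK : 0 ≤ K) (hpq : p < q) (hlen : q - p ≤ 1) {t l K' : ℝ}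
    (hbig : P.kap * (1 + P.kap * K) ≤ P.A * P.twist R * t)
    (hs : ∀ x ∈ Ioo p q, t ≤ |Real.sin x|)
    (hl : l = P.A * P.twist R / P.kap * t) (hl1 : 1 ≤ l)
    (hl2 : 2 * P.kap * curvConst P K / l ^ 2 ≤ P.A / 4)
    (hK' : 2 * P.kap ≤ K') (hK'2 : K / l + curvConst P K * P.twist R / l ^ 2 ≤ K')
    (hh : ∀ x ∈ Ioo p q, P.nextY x (ψ x) ∈ Icc (R / 4) (4 * R)) :
    ∃ (α β : ℝ) (φ φ₁ φ₂ v v₁ : ℝ → ℝ), α < β ∧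
      RegCurve P R K' (W / l) α β φ φ₁ φ₂ v v₁ ∧
      (∀ X ∈ Ioo α β, ∃ x ∈ Ioo p q, φ X - 2 * P.A * Real.cos X = ψ x) ∧
      (∀ X ∈ Ioo α β, |P.twist (φ X - 2 * P.A * Real.cos X) * (φ₁ X + 2 * P.A * Real.sin X) - 1|
        ≤ 1 / l) ∧
      (∀ X ∈ Ioo α β, ∀ X' ∈ Ioo α β, |(φ X - 2 * P.A * Real.cos X)
        - (φ X' - 2 * P.A * Real.cos X')| ≤ 2 * P.A + K) ∧
      (∀ X ∈ Ioo α β, |v₁ X| ≤ (K / l + curvConst P K * P.twist R / l ^ 2) * v X) ∧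
      β - α ≤ (1 + P.kap * (2 * P.A + K)) * P.twist R ∧
      ∀ f : ℝ → ℝ → ℝ, ∫ x in Ioo p q, f (P.nextX x (ψ x)) (P.nextY x (ψ x)) * w x
        = ∫ X in Ioo α β, f X (φ X) * v X := by
  have hR0 : 0 < R := by linarith
  have hτ0 : 0 < P.twist R := by linarith
  have hA := hP.A_pos
  have hk := hP.kap_pos
  have hC1 := curvConst_nonneg (K := K) hP
  set L := phaseRate P ψ ψ₁ with hL
  have hLl : ∀ x ∈ Ioo p q, l ≤ |L x| := by
    intro x hx
    refine le_trans ?_ (h.le_abs_phaseRate hP hR0 hx (hs x hx) hbig)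
    rw [hl]
    have := hs x hx
    gcongr
  have hL0 : ∀ x ∈ Ioo p q, L x ≠ 0 := fun x hx h0 => by
    have := hLl x hx
    rw [h0, abs_zero] at this
    linarith
  obtain ⟨α, β, σ, G, hαβ, hσ, hσL, him, hinj, hG, hGl⟩ := exists_inverse_of_ne_zero hpq
    (fun x hx => h.hasDerivAt_phase hR0 hx) hL0 (fun x hx => h.abs_phaseRate_le hP hR hτ hK hx)
  set T := P.twist R with hT
  have hreg : ∀ X ∈ Ioo α β, |σ * ((w₁ (G X) * L (G X) - w (G X) * phaseRate' P ψ ψ₁ ψ₂ (G X))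
      / L (G X) ^ 3)| ≤ (K / l + curvConst P K * T / l ^ 2) * (σ * (w (G X) / L (G X))) := by
    intro X hX
    obtain ⟨e1, -, -⟩ := hG X hX
    have h0 := hL0 _ e1
    have hLp := abs_pos.2 h0
    have hw := h.nonneg _ e1
    have e4 : σ * (w (G X) / L (G X)) = w (G X) / |L (G X)| := sign_mul_div hσ (hσL _ e1)
    simp only [e4]
    rw [abs_mul, hσ, one_mul, abs_div, abs_pow]
    have hl' := hLl _ e1
    have b1 := h.abs_phaseRate'_le hP hR hτ hK e1
    calc _ ≤ (K * w (G X) * |L (G X)| + w (G X) * (curvConst P K * T)) / |L (G X)| ^ 3 := by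
          gcongr
          refine (abs_sub _ _).trans ?_
          rw [abs_mul, abs_mul, abs_of_nonneg hw]
          have := h.regular _ e1
          gcongr
      _ = (K / |L (G X)| + curvConst P K * T / |L (G X)| ^ 2) * (w (G X) / |L (G X)|) := by
          field_simp
      _ ≤ (K / l + curvConst P K * T / l ^ 2) * (w (G X) / |L (G X)|) := by gcongr
  refine ⟨α, β, fun X => ψ (G X) + 2 * P.A * Real.cos X,
    fun X => ψ₁ (G X) / L (G X) - 2 * P.A * Real.sin X,
    fun X => ψ₂ (G X) / L (G X) ^ 2 - ψ₁ (G X) * phaseRate' P ψ ψ₁ ψ₂ (G X) / L (G X) ^ 3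
      - 2 * P.A * Real.cos X,
    fun X => σ * (w (G X) / L (G X)),
    fun X => σ * ((w₁ (G X) * L (G X) - w (G X) * phaseRate' P ψ ψ₁ ψ₂ (G X)) / L (G X) ^ 3),
    hαβ, ?_, ?_, ?_, ?_, ?_, ?_, ?_⟩
  · constructor
    · intro X hX
      obtain ⟨e1, e2, e3⟩ := hG X hX
      have := ((h.der _ e1).comp X e3).add ((Real.hasDerivAt_cos X).const_mul (2 * P.A))
      refine this.congr_deriv ?_
      rw [div_eq_mul_inv]
      ring
    · intro X hX
      obtain ⟨e1, e2, e3⟩ := hG X hX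
      have h0 := hL0 _ e1
      have := (((h.der₁ _ e1).comp X e3).div ((h.hasDerivAt_phaseRate hR0 e1).comp X e3) h0).sub
        ((Real.hasDerivAt_sin X).const_mul (2 * P.A))
      refine this.congr_deriv ?_
      simp only [Function.comp, ← hL]
      field_simp
    · intro X hX
      obtain ⟨e1, e2, e3⟩ := hG X hX
      have h0 := hL0 _ e1
      have := (((h.derw _ e1).comp X e3).div ((h.hasDerivAt_phaseRate hR0 e1).comp X e3)
        h0).const_mul σ
      refine this.congr_deriv ?_
      simp only [Function.comp, ← hL]
      field_simp
    · intro X hX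
      obtain ⟨e1, e2, e3⟩ := hG X hX
      have := hh _ e1
      unfold Params.nextY at this
      rwa [e2] at this
    · intro X hX
      obtain ⟨e1, e2, e3⟩ := hG X hX
      have h0 := hL0 _ e1
      have hTp := hP.twist_pos (h.pos hR0 e1)
      -- the slope of the image is `(1 - 1 / L) / Y'(ψ)` plus the reference term
      have e4 : ψ₁ (G X) / L (G X) - 2 * P.A * Real.sin X + 2 * P.A * Real.sin X
          = (1 - (L (G X))⁻¹) / P.twist (ψ (G X)) := by
        have : ψ₁ (G X) = (L (G X) - 1) / P.twist (ψ (G X)) := by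
          simp only [hL, phaseRate]
          field_simp
          ring
        rw [this]
        field_simp
        ring
      rw [e4, abs_div, abs_of_pos hTp, div_le_div_iff₀ hTp hτ0]
      have e5 : |1 - (L (G X))⁻¹| ≤ 2 := by
        refine (abs_sub _ _).trans ?_
        rw [abs_one, abs_inv]
        have := inv_le_one_of_one_le₀ (hl1.trans (hLl _ e1))
        linarith
      have e6 := h.le_twist hP hR0 e1
      calc |1 - (L (G X))⁻¹| * T ≤ 2 * (P.kap * P.twist (ψ (G X))) := by gcongr
        _ = 2 * P.kap * P.twist (ψ (G X)) := by ring
        _ ≤ K' * P.twist (ψ (G X)) := by gcongr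
    · intro X hX
      obtain ⟨e1, e2, e3⟩ := hG X hX
      have h0 := hL0 _ e1
      have hLp := abs_pos.2 h0
      have hl' := hLl _ e1
      have hTp := hP.twist_pos (h.pos hR0 e1)
      have e4 : ψ₂ (G X) / L (G X) ^ 2 - ψ₁ (G X) * phaseRate' P ψ ψ₁ ψ₂ (G X) / L (G X) ^ 3
          - 2 * P.A * Real.cos X + 2 * P.A * Real.cos X
          = (phaseRate' P ψ ψ₁ ψ₂ (G X) / L (G X)
            - (P.γ - 1) * P.twist (ψ (G X)) / ψ (G X) * ψ₁ (G X) * ψ₁ (G X))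
              / (P.twist (ψ (G X)) * L (G X) ^ 2) := by
        have h5 : P.twist (ψ (G X)) * ψ₁ (G X) = L (G X) - 1 := by
          simp only [hL, phaseRate]
          ring
        have h6 : phaseRate' P ψ ψ₁ ψ₂ (G X)
            - (P.γ - 1) * P.twist (ψ (G X)) / ψ (G X) * ψ₁ (G X) * ψ₁ (G X)
            = P.twist (ψ (G X)) * ψ₂ (G X) := by
          unfold phaseRate'
          ring
        set D := (P.γ - 1) * P.twist (ψ (G X)) / ψ (G X) * ψ₁ (G X) * ψ₁ (G X)
        have h7 : D = phaseRate' P ψ ψ₁ ψ₂ (G X) - P.twist (ψ (G X)) * ψ₂ (G X) := by linarith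
        rw [h7]
        have h8 : ψ₁ (G X) = (L (G X) - 1) / P.twist (ψ (G X)) := by
          rw [← h5]
          field_simp
        rw [h8]
        field_simp
        ring
      rw [e4, abs_div, abs_mul, abs_of_pos hTp, abs_pow]
      have b1 : |phaseRate' P ψ ψ₁ ψ₂ (G X) / L (G X)| ≤ curvConst P K * T := by
        rw [abs_div]
        exact (div_le_self (abs_nonneg _) (hl1.trans hl')).trans
          (h.abs_phaseRate'_le hP hR hτ hK e1)
      have b2 : |(P.γ - 1) * P.twist (ψ (G X)) / ψ (G X) * ψ₁ (G X) * ψ₁ (G X)|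
          ≤ curvConst P K * T := by
        have c1 := hP.dtwist_le (y := ψ (G X)) hR0 (by linarith [(h.height _ e1).1])
          (by linarith [(h.height _ e1).2])
        have hg := hP.γ_pos
        have c2 : 8 * P.γ * P.kap * T / R ≤ 8 * P.γ * P.kap * T :=
          div_le_self (by positivity) hR
        have c3 := h.abs_slope_le hP hτ hK e1
        rw [abs_mul, abs_mul]
        have c4 := c1.trans c2
        calc _ ≤ (8 * P.γ * P.kap * T) * (2 * P.A + K) * (2 * P.A + K) := by gcongr
          _ ≤ curvConst P K * T := by
            unfold curvConst
            nlinarith [mul_pos (mul_pos hA hk) hτ0]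
      have b3 := h.le_twist hP hR0 e1
      calc _ ≤ (curvConst P K * T + curvConst P K * T) / (P.twist (ψ (G X)) * l ^ 2) := by
            gcongr
            exact (abs_sub _ _).trans (add_le_add b1 b2)
        _ ≤ 2 * P.kap * curvConst P K / l ^ 2 := by
            rw [div_le_div_iff₀ (by positivity) (by positivity)]
            have : curvConst P K * T ≤ curvConst P K * (P.kap * P.twist (ψ (G X))) := by gcongr
            have hl0 : 0 ≤ l ^ 2 := by positivity
            nlinarith
        _ ≤ _ := hl2
    · intro X hX
      obtain ⟨e1, -, -⟩ := hG X hX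
      have h0 := hL0 _ e1
      have : σ * (w (G X) / L (G X)) = w (G X) / |L (G X)| := sign_mul_div hσ (hσL _ e1)
      simp only [this]
      exact div_nonneg (h.nonneg _ e1) (abs_nonneg _)
    · intro X hX
      obtain ⟨e1, -, -⟩ := hG X hX
      refine (le_abs_self _).trans ?_
      rw [abs_mul, hσ, one_mul, abs_div, abs_of_nonneg (h.nonneg _ e1)]
      have := hLl _ e1
      have := h.le _ e1
      have := h.nonneg _ e1
      have : 0 ≤ W := by linarith
      gcongr
    · intro X hX
      refine (hreg X hX).trans (mul_le_mul_of_nonneg_right hK'2 ?_)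
      obtain ⟨e1, -, -⟩ := hG X hX
      rw [sign_mul_div hσ (hσL _ e1)]
      exact div_nonneg (h.nonneg _ e1) (abs_nonneg _)
  · intro X hX
    obtain ⟨e1, -, -⟩ := hG X hX
    exact ⟨_, e1, by simp⟩
  · intro X hX
    obtain ⟨e1, -, -⟩ := hG X hX
    have h0 := hL0 _ e1
    simp only [add_sub_cancel_right, sub_add_cancel]
    have e2 : P.twist (ψ (G X)) * (ψ₁ (G X) / L (G X)) - 1 = - (L (G X))⁻¹ := by
      have : P.twist (ψ (G X)) * ψ₁ (G X) = L (G X) - 1 := by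
        simp only [hL, phaseRate]
        ring
      rw [mul_div_assoc', this]
      field_simp
      ring
    rw [e2, abs_neg, abs_inv, one_div]
    exact inv_anti₀ (by linarith) (hLl _ e1)
  · intro X hX X' hX'
    obtain ⟨e1, -, -⟩ := hG X hX
    obtain ⟨e1', -, -⟩ := hG X' hX'
    simp only [add_sub_cancel_right]
    have := (convex_Ioo p q).norm_image_sub_le_of_norm_hasDerivWithin_le
      (fun x hx => (h.der x hx).hasDerivWithinAt)
      (fun x hx => h.abs_slope_le hP hτ hK hx) e1' e1
    refine this.trans (mul_le_of_le_one_right (by linarith) ?_)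
    rw [Real.norm_eq_abs, abs_le]
    constructor <;> linarith [e1.1, e1.2, e1'.1, e1'.2]
  · exact hreg
  · by_contra hc
    rw [not_le] at hc
    set C := (1 + P.kap * (2 * P.A + K)) * T with hC
    have hC0 : 0 ≤ C := by positivity
    set d := (β - α - C) / 4 with hd
    have m1 : α + d ∈ Ioo α β := ⟨by linarith, by linarith⟩
    have m2 : β - d ∈ Ioo α β := ⟨by linarith, by linarith⟩
    obtain ⟨e1, e2, -⟩ := hG _ m1
    obtain ⟨e1', e2', -⟩ := hG _ m2
    have := (convex_Ioo p q).norm_image_sub_le_of_norm_hasDerivWithin_le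
      (fun x hx => (h.hasDerivAt_phase hR0 hx).hasDerivWithinAt)
      (fun x hx => h.abs_phaseRate_le hP hR hτ hK hx) e1 e1'
    simp only [e2, e2'] at this
    have h1 : ‖G (β - d) - G (α + d)‖ ≤ 1 := by
      rw [Real.norm_eq_abs, abs_le]
      constructor <;> linarith [e1.1, e1.2, e1'.1, e1'.2]
    have h2 := this.trans (mul_le_of_le_one_right hC0 h1)
    have h3 := (le_abs_self _).trans h2
    linarith
  · intro f
    rw [← him, integral_image_eq_integral_abs_deriv_smul measurableSet_Ioo
      (fun x hx => (h.hasDerivAt_phase hR0 hx).hasDerivWithinAt) hinj]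
    apply setIntegral_congr_fun measurableSet_Ioo
    intro x hx
    have h0 := hL0 x hx
    have hLp := abs_pos.2 h0
    have hx2 := hGl x hx
    simp only [smul_eq_mul]
    rw [hx2]
    have : σ * (w x / L x) * |L x| = w x := by
      rw [sign_mul_div hσ (hσL x hx)]
      exact div_mul_cancel₀ _ hLp.ne'
    unfold Params.nextY
    simp only [← hL]
    linear_combination -(f (P.nextX x (ψ x)) (ψ x + 2 * P.A * Real.cos (P.nextX x (ψ x)))) * this

end RegCurve

/-! ### The half-turn shift -/

/-- The windows `|sin X| < s` have measure at most `4 s` in each interval of length `1`. -/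
theorem abs_integral_le_of_window {α β s V : ℝ} (hαβ : α < β) (hs : 0 < s) (hV : 0 ≤ V)
    {f : ℝ → ℝ} (h : ∀ X ∈ Ioo α β, |f X| ≤ if |Real.sin X| < s then V else 0) :
    |∫ X in Ioo α β, f X| ≤ V * (4 * s * (β - α + 1)) := by
  have hm : MeasurableSet {x : ℝ | |Real.sin x| < s} :=
    measurableSet_lt (by fun_prop) measurable_const
  have hn : β - α ≤ (⌈β - α⌉₊ : ℝ) := Nat.le_ceil _
  have hn2 : (⌈β - α⌉₊ : ℝ) < β - α + 1 := Nat.ceil_lt_add_one (by linarith)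
  have hv := volume_sin_lt_le (p := α) (q := β) hs _ hn
  have hi : IntegrableOn ({x : ℝ | |Real.sin x| < s}.indicator fun _ => V) (Ioo α β) :=
    (integrable_const V).indicator hm
  have h1 := norm_integral_le_of_norm_le (μ := volume.restrict (Ioo α β)) (f := f) hi (by
    filter_upwards [ae_restrict_mem measurableSet_Ioo] with X hX
    have := h X hX
    by_cases hX2 : |Real.sin X| < s
    · have e : X ∈ {x : ℝ | |Real.sin x| < s} := hX2
      rw [indicator_of_mem e]
      rwa [if_pos hX2] at this
    · have e : X ∉ {x : ℝ | |Real.sin x| < s} := hX2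
      rw [indicator_of_notMem e]
      rwa [if_neg hX2] at this)
  refine (show |∫ X in Ioo α β, f X| ≤ _ from h1).trans ?_
  rw [integral_indicator hm, Measure.restrict_restrict hm, setIntegral_const, inter_comm,
    smul_eq_mul, mul_comm]
  apply mul_le_mul_of_nonneg_left _ hV
  refine ENNReal.toReal_le_of_le_ofReal (by nlinarith) (hv.trans ?_)
  apply ENNReal.ofReal_le_ofReal
  nlinarith

/-- The error per unit length in the phase advance, for curves whose slope has the relative error
`e` and whose heights vary by at most `H`. -/
def shiftErr (P : Params) (R e H : ℝ) : ℝ :=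
  e * (1 + 8 * P.A * P.γ) + (32 * P.A * P.γ * H + 1024 * P.A ^ 2 * P.γ ^ 2 * P.kap ^ 2) / R ^ 2

/-- Along an image curve `y = u(X) + c`, with `Y'(u) u' ≈ 1`, the next phase `X + Y(u + c)` advances
by `2 + c (γ - 1) / u` per unit length. -/
theorem abs_phase_advance_le {P : Params} (hP : P.Pos) {R e H α β y₀ c h X : ℝ} (hR : 1 ≤ R)
    (hcR : 8 * (2 * P.A) ≤ R) {u u₁ : ℝ → ℝ} (he1 : e ≤ 1) (hh : 0 ≤ h)
    (hu : ∀ Z ∈ Ioo α β, HasDerivAt u (u₁ Z) Z)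
    (hur : ∀ Z ∈ Ioo α β, u Z ∈ Icc (R / 4) (4 * R))
    (hu₁ : ∀ Z ∈ Ioo α β, |P.twist (u Z) * u₁ Z - 1| ≤ e)
    (hy₀ : R / 4 ≤ y₀) (hH : ∀ Z ∈ Ioo α β, |u Z - y₀| ≤ H) (hc : |c| ≤ 2 * P.A)
    (hX : X ∈ Ioo α β) (hXh : X + h ∈ Ioo α β) :
    |(X + h + P.Y (u (X + h) + c)) - (X + P.Y (u X + c)) - h * (2 + c * (P.γ - 1) / y₀)|
      ≤ h * shiftErr P R e H := by
  have hR0 : 0 < R := by linarith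
  have hA := hP.A_pos
  have hk := hP.kap_pos
  have hg := hP.two_lt
  have hτ := hP.twist_pos hR0
  have hc' := abs_le.1 hc
  have hsub : Icc X (X + h) ⊆ Ioo α β := fun z hz =>
    ⟨hX.1.trans_le hz.1, hz.2.trans_lt hXh.2⟩
  have hd : ∀ Z ∈ Icc X (X + h), HasDerivWithinAt
      (fun Z => Z + P.Y (u Z + c) - Z * (2 + c * (P.γ - 1) / y₀))
      (1 + P.twist (u Z + c) * u₁ Z - (2 + c * (P.γ - 1) / y₀)) (Icc X (X + h)) Z := by
    intro Z hZ
    have hZ' := hsub hZ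
    have hp : 0 < u Z + c := by linarith [(hur Z hZ').1]
    have h1 := (Params.hasDerivAt_Y (P := P) hp).comp Z ((hu Z hZ').add_const c)
    have := (((hasDerivAt_id Z).add h1).sub
      ((hasDerivAt_id Z).mul_const (2 + c * (P.γ - 1) / y₀)))
    refine HasDerivAt.hasDerivWithinAt (this.congr_deriv ?_)
    simp
  have hb : ∀ Z ∈ Icc X (X + h),
      ‖1 + P.twist (u Z + c) * u₁ Z - (2 + c * (P.γ - 1) / y₀)‖ ≤ shiftErr P R e H := by
    intro Z hZ
    have hZ' := hsub hZ
    have hr := hur Z hZ'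
    have hu0 : 0 < u Z := by linarith [hr.1]
    have hy0 : 0 < y₀ := by linarith
    have hT := hP.twist_pos hu0
    have hTle := hP.le_twist (y := u Z) hR0 (by linarith [hr.1])
    set θ := P.twist (u Z) * u₁ Z - 1 with hθ
    have hθe := hu₁ Z hZ'
    have hu1 : u₁ Z = (1 + θ) / P.twist (u Z) := by
      rw [hθ]
      field_simp
      ring
    have he0 : 0 ≤ e := (abs_nonneg _).trans hθe
    have hu1b : |u₁ Z| ≤ 2 * P.kap / P.twist R := by
      rw [hu1, abs_div, abs_of_pos hT, div_le_div_iff₀ hT hτ]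
      have : |1 + θ| ≤ 2 := (abs_add_le _ _).trans (by rw [abs_one]; linarith)
      calc |1 + θ| * P.twist R ≤ 2 * (P.kap * P.twist (u Z)) := by gcongr
        _ = _ := by ring
    have htd := hP.twist_diff (u := u Z) (c := c) hR0 (by linarith [hr.1]) (by linarith [hr.2])
      (by linarith [hr.1]) (by linarith [hr.2])
    set r := P.twist (u Z + c) - P.twist (u Z) - c * ((P.γ - 1) * P.twist (u Z) / u Z) with hrr
    have hdec : 1 + P.twist (u Z + c) * u₁ Z - (2 + c * (P.γ - 1) / y₀)
        = θ * (1 + c * (P.γ - 1) / u Z) + c * (P.γ - 1) * (1 / u Z - 1 / y₀) + r * u₁ Z := by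
      have : P.twist (u Z + c) = P.twist (u Z) + c * ((P.γ - 1) * P.twist (u Z) / u Z) + r := by
        rw [hrr]; ring
      rw [this, hu1]
      field_simp
      ring
    have hc2 : c ^ 2 ≤ 4 * P.A ^ 2 := by nlinarith
    have hcg : |c * (P.γ - 1)| ≤ 2 * P.A * P.γ := by
      rw [abs_mul]
      apply mul_le_mul hc _ (abs_nonneg _) (by linarith)
      rw [abs_of_pos (by linarith)]
      linarith
    have b1 : |θ * (1 + c * (P.γ - 1) / u Z)| ≤ e * (1 + 8 * P.A * P.γ) := by
      rw [abs_mul]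
      apply mul_le_mul hθe _ (abs_nonneg _) he0
      refine (abs_add_le _ _).trans ?_
      rw [abs_one, abs_div, abs_of_pos hu0]
      have : |c * (P.γ - 1)| / u Z ≤ 2 * P.A * P.γ / (1 / 4) := by
        have : (1 : ℝ) / 4 ≤ u Z := by linarith [hr.1]
        gcongr
      linarith
    have b2 : |c * (P.γ - 1) * (1 / u Z - 1 / y₀)| ≤ 32 * P.A * P.γ * H / R ^ 2 := by
      rw [abs_mul]
      have h1 : |1 / u Z - 1 / y₀| ≤ H / (R / 4 * (R / 4)) := by
        have : 1 / u Z - 1 / y₀ = (y₀ - u Z) / (u Z * y₀) := by field_simp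
        rw [this, abs_div, abs_of_pos (mul_pos hu0 hy0), abs_sub_comm]
        have h2 := hH Z hZ'
        have h3 := (abs_nonneg _).trans h2
        have := hr.1
        gcongr
      calc _ ≤ 2 * P.A * P.γ * (H / (R / 4 * (R / 4))) := by gcongr
        _ = _ := by field_simp; ring
    have b3 : |r * u₁ Z| ≤ 1024 * P.A ^ 2 * P.γ ^ 2 * P.kap ^ 2 / R ^ 2 := by
      rw [abs_mul]
      calc _ ≤ (128 * P.γ ^ 2 * P.kap * P.twist R / R ^ 2 * (4 * P.A ^ 2))
            * (2 * P.kap / P.twist R) := by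
            gcongr
            exact htd.trans (by gcongr)
        _ = _ := by field_simp; ring
    rw [Real.norm_eq_abs, hdec]
    refine (abs_add_three _ _ _).trans ?_
    unfold shiftErr
    rw [add_div]
    linarith
  have := (convex_Icc X (X + h)).norm_image_sub_le_of_norm_hasDerivWithin_le hd hb
    (left_mem_Icc.2 (by linarith)) (right_mem_Icc.2 (by linarith))
  rw [Real.norm_eq_abs, Real.norm_eq_abs, add_sub_cancel_left, abs_of_nonneg hh] at this
  calc _ = |X + h + P.Y (u (X + h) + c) - (X + h) * (2 + c * (P.γ - 1) / y₀) -
        (X + P.Y (u X + c) - X * (2 + c * (P.γ - 1) / y₀))| := by ring_nf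
    _ ≤ _ := this
    _ = _ := mul_comm _ _

/-- A phase that advances by about `4πN ± π` changes the sign of its cosine. -/
theorem abs_cos_add_cos_le {X₂ X₂' s X δ : ℝ} {N : ℕ} (hs : |Real.sin X| < s)
    (hδ : |X₂' - X₂ - 2 * (2 * Real.pi * N) - Real.pi * Real.cos X| ≤ δ) :
    |Real.cos X₂' + Real.cos X₂| ≤ 4 * s ^ 2 + δ := by
  have hpi := Real.pi_pos
  have hpi4 := Real.pi_le_four
  have hs0 : 0 < s := (abs_nonneg _).trans_lt hs
  have hsq : Real.sin X ^ 2 ≤ s ^ 2 := by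
    rw [← sq_abs]
    exact pow_le_pow_left₀ (abs_nonneg _) hs.le 2
  have hcs := Real.sin_sq_add_cos_sq X
  have h1 := Real.cos_le_one X
  have h2 := Real.neg_one_le_cos X
  have fin : ∀ d : ℝ, Real.cos X₂' = - Real.cos (X₂ + d) → |d| ≤ 4 * s ^ 2 + δ →
      |Real.cos X₂' + Real.cos X₂| ≤ 4 * s ^ 2 + δ := by
    intro d hd hd2
    rw [hd]
    have := Real.abs_cos_sub_cos_le X₂ (X₂ + d)
    calc _ = |Real.cos X₂ - Real.cos (X₂ + d)| := by congr 1; ring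
      _ ≤ |X₂ - (X₂ + d)| := this
      _ = |d| := by rw [sub_add_cancel_left, abs_neg]
      _ ≤ _ := hd2
  rcases le_total 0 (Real.cos X) with hc | hc
  · have h3 : 1 - Real.cos X ≤ s ^ 2 := by nlinarith
    refine fin (X₂' - X₂ - 2 * (2 * Real.pi * N) - Real.pi) ?_ ?_
    · have : X₂ + (X₂' - X₂ - 2 * (2 * Real.pi * N) - Real.pi)
          = X₂' - Real.pi - (2 * N : ℕ) * (2 * Real.pi) := by push_cast; ring
      rw [this, Real.cos_sub_nat_mul_two_pi, Real.cos_sub_pi, neg_neg]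
    · have : X₂' - X₂ - 2 * (2 * Real.pi * N) - Real.pi = (X₂' - X₂ - 2 * (2 * Real.pi * N)
          - Real.pi * Real.cos X) + - (Real.pi * (1 - Real.cos X)) := by ring
      rw [this]
      refine (abs_add_le _ _).trans ?_
      rw [abs_neg, abs_of_nonneg (mul_nonneg hpi.le (by linarith))]
      nlinarith
  · have h3 : 1 + Real.cos X ≤ s ^ 2 := by nlinarith
    refine fin (X₂' - X₂ - 2 * (2 * Real.pi * N) + Real.pi) ?_ ?_
    · have : X₂ + (X₂' - X₂ - 2 * (2 * Real.pi * N) + Real.pi)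
          = X₂' + Real.pi - (2 * N : ℕ) * (2 * Real.pi) := by push_cast; ring
      rw [this, Real.cos_sub_nat_mul_two_pi, Real.cos_add_pi, neg_neg]
    · have : X₂' - X₂ - 2 * (2 * Real.pi * N) + Real.pi = (X₂' - X₂ - 2 * (2 * Real.pi * N)
          - Real.pi * Real.cos X) + (Real.pi * (1 + Real.cos X)) := by ring
      rw [this]
      refine (abs_add_le _ _).trans ?_
      rw [abs_of_nonneg (mul_nonneg hpi.le (by linarith))]
      nlinarith

/-- If a function supported on the windows `|sin X| < s` nearly changes sign under a shift by `h`,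
its integral is small: only two end intervals of length `h` are not compensated. -/
theorem abs_integral_le_of_shift {α β s V h η : ℝ} (hαβ : α < β) (hs : 0 < s) (hV : 0 ≤ V)
    (hh : 0 < h) (hη : 0 ≤ η) {k : ℝ → ℝ} (hk : AEStronglyMeasurable k (volume.restrict (Ioo α β)))
    (hkb : ∀ X ∈ Ioo α β, |k X| ≤ if |Real.sin X| < s then V else 0)
    (hkh : ∀ X ∈ Ioo α β, X + h ∈ Ioo α β →
      |k (X + h) + k X| ≤ if |Real.sin X| < s then V * η else 0) :
    |∫ X in Ioo α β, k X| ≤ V * (4 * s * (h + 1)) + V * η * (4 * s * (β - α + 1)) := by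
  have hn : 0 ≤ V * η * (4 * s * (β - α + 1)) := by
    have : 0 ≤ β - α + 1 := by linarith
    positivity
  rcases le_or_gt (β - α) h with hle | hlt
  · have := abs_integral_le_of_window hαβ hs hV hkb
    have h2 : V * (4 * s * (β - α + 1)) ≤ V * (4 * s * (h + 1)) := by gcongr
    linarith
  · have hi : IntegrableOn k (Ioo α β) := by
      refine integrableOn_Ioo_of_abs_le (M := V) hk fun x hx => (hkb x hx).trans ?_
      split_ifs <;> linarith
    have hi' : ∀ a b, α ≤ a → a ≤ b → b ≤ β → IntervalIntegrable k volume a b := by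
      intro a b ha hab hb
      rw [intervalIntegrable_iff_integrableOn_Ioo_of_le hab]
      exact hi.mono_set (Ioo_subset_Ioo ha hb)
    have e0 : ∀ a b (f : ℝ → ℝ), a ≤ b → ∫ X in Ioo a b, f X = ∫ X in a..b, f X := by
      intro a b f hab
      rw [intervalIntegral.integral_of_le hab, integral_Ioc_eq_integral_Ioo]
    have e1 : (∫ X in α..β, k X) = (∫ X in α..(α + h), k X) + ∫ X in (α + h)..β, k X :=
      (intervalIntegral.integral_add_adjacent_intervals (hi' _ _ le_rfl (by linarith) (by linarith))
        (hi' _ _ (by linarith) (by linarith) le_rfl)).symm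
    have e2 : (∫ X in α..β, k X) = (∫ X in α..(β - h), k X) + ∫ X in (β - h)..β, k X :=
      (intervalIntegral.integral_add_adjacent_intervals (hi' _ _ le_rfl (by linarith) (by linarith))
        (hi' _ _ (by linarith) (by linarith) le_rfl)).symm
    have e3 : ∫ X in (α + h)..β, k X = ∫ X in α..(β - h), k (X + h) := by
      rw [intervalIntegral.integral_comp_add_right]
      simp
    have hi2 : IntervalIntegrable (fun X => k (X + h)) volume α (β - h) := by
      have := (hi' (α + h) β (by linarith) (by linarith) le_rfl).comp_add_right h
      simpa using this
    have e4 : (∫ X in α..(β - h), k (X + h)) + ∫ X in α..(β - h), k X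
        = ∫ X in α..(β - h), (k (X + h) + k X) :=
      (intervalIntegral.integral_add hi2 (hi' _ _ le_rfl (by linarith) (by linarith))).symm
    have b1 : |∫ X in α..(α + h), k X| ≤ V * (4 * s * (h + 1)) := by
      rw [← e0 _ _ _ (by linarith)]
      have := abs_integral_le_of_window (α := α) (β := α + h) (by linarith) hs hV (f := k)
        fun X hX => hkb X ⟨hX.1, by linarith [hX.2]⟩
      simpa using this
    have b2 : |∫ X in (β - h)..β, k X| ≤ V * (4 * s * (h + 1)) := by
      rw [← e0 _ _ _ (by linarith)]
      have := abs_integral_le_of_window (α := β - h) (β := β) (by linarith) hs hV (f := k)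
        fun X hX => hkb X ⟨by linarith [hX.1], hX.2⟩
      simpa using this
    have b3 : |∫ X in α..(β - h), (k (X + h) + k X)| ≤ V * η * (4 * s * (β - α + 1)) := by
      rw [← e0 _ _ _ (by linarith)]
      have := abs_integral_le_of_window (α := α) (β := β - h) (by linarith) hs (by positivity)
        (f := fun X => k (X + h) + k X)
        fun X hX => hkh X ⟨hX.1, by linarith [hX.2]⟩ ⟨by linarith [hX.1], by linarith [hX.2]⟩
      refine this.trans ?_
      have : β - h - α + 1 ≤ β - α + 1 := by linarith
      gcongr
    rw [e0 _ _ _ hαβ.le]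
    have b1' := abs_le.1 b1
    have b2' := abs_le.1 b2
    have b3' := abs_le.1 b3
    rw [abs_le]
    constructor <;> linarith

/-! ### The drift along weighted curves -/

/-- An affine function of the height, of size at most `1` at heights comparable to `R`. -/
structure IsWeight (R : ℝ) (a : ℝ → ℝ) (a' : ℝ) : Prop where
  der : ∀ y, HasDerivAt a a' y
  abs_der_le : |a'| ≤ 1
  abs_le : ∀ y ∈ Icc (R / 8) (8 * R), |a y| ≤ 1

/-- The weighted increment `a(y) cos(x + Y(y))`, on the windows `|sin x| < s` only. -/
def windowTerm (P : Params) (a : ℝ → ℝ) (s x y : ℝ) : ℝ :=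
  if |Real.sin x| < s then a y * Real.cos (P.nextX x y) else 0

theorem IsWeight.abs_sub_le {R a' : ℝ} {a : ℝ → ℝ} (h : IsWeight R a a') (y z : ℝ) :
    |a y - a z| ≤ |y - z| := by
  have := convex_univ.norm_image_sub_le_of_norm_hasDerivWithin_le (f := a) (f' := fun _ => a')
    (C := 1) (fun x _ => (h.der x).hasDerivWithinAt) (fun x _ => h.abs_der_le)
    (mem_univ z) (mem_univ y)
  simpa [Real.norm_eq_abs] using this

theorem IsWeight.continuous {R a' : ℝ} {a : ℝ → ℝ} (h : IsWeight R a a') : Continuous a :=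
  continuous_iff_continuousAt.2 fun y => (h.der y).continuousAt

theorem abs_windowTerm_le {P : Params} {R a' s x y : ℝ} {a : ℝ → ℝ} (h : IsWeight R a a')
    (hy : y ∈ Icc (R / 8) (8 * R)) : |windowTerm P a s x y| ≤ if |Real.sin x| < s then 1 else 0 := by
  unfold windowTerm
  split_ifs
  · rw [abs_mul]
    exact mul_le_one₀ (h.abs_le y hy) (abs_nonneg _) (Real.abs_cos_le_one _)
  · simp

theorem measurable_nextX (P : Params) : Measurable fun z : ℝ × ℝ => P.nextX z.1 z.2 := by
  unfold Params.nextX Params.Y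
  fun_prop

theorem measurable_nextY (P : Params) : Measurable fun z : ℝ × ℝ => P.nextY z.1 z.2 := by
  unfold Params.nextY
  have := measurable_nextX P
  fun_prop

theorem measurable_windowTerm {P : Params} {R a' s : ℝ} {a : ℝ → ℝ} (h : IsWeight R a a') :
    Measurable fun z : ℝ × ℝ => windowTerm P a s z.1 z.2 := by
  unfold windowTerm
  have h1 := measurable_nextX P
  have h2 := h.continuous.measurable
  refine Measurable.ite (measurableSet_lt (by fun_prop) measurable_const) ?_ measurable_const
  exact (h2.comp measurable_snd).mul (Real.measurable_cos.comp h1)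

namespace RegCurve

variable {P : Params}

theorem aestronglyMeasurable_comp {R K W p q : ℝ} {ψ ψ₁ ψ₂ w w₁ : ℝ → ℝ}
    (h : RegCurve P R K W p q ψ ψ₁ ψ₂ w w₁) {f : ℝ → ℝ → ℝ}
    (hf : Measurable fun z : ℝ × ℝ => f z.1 z.2) :
    AEStronglyMeasurable (fun x => f x (ψ x) * w x) (volume.restrict (Ioo p q)) := by
  have h1 : AEMeasurable ψ (volume.restrict (Ioo p q)) :=
    (ContinuousOn.aemeasurable (fun x hx => (h.der x hx).continuousAt.continuousWithinAt)
      measurableSet_Ioo)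
  have h2 : AEMeasurable w (volume.restrict (Ioo p q)) :=
    (ContinuousOn.aemeasurable (fun x hx => (h.derw x hx).continuousAt.continuousWithinAt)
      measurableSet_Ioo)
  exact ((hf.comp_aemeasurable (aemeasurable_id.prodMk h1)).mul h2).aestronglyMeasurable

/-- The compensation under a shift by `N` turns. -/
theorem abs_windowTerm_add_shift_le (hP : P.Pos) {R e H κ V α β s m X a' : ℝ} {N : ℕ}
    {φ φ₁ φ₂ v v₁ a : ℝ → ℝ} (hreg : RegCurve P R (2 * P.kap) V α β φ φ₁ φ₂ v v₁) (hR : 1 ≤ R)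
    (hcR : 8 * (2 * P.A) ≤ R) (he1 : e ≤ 1) (hκ : 0 ≤ κ) (hV : 0 ≤ V) (ha : IsWeight R a a')
    (hur : ∀ X ∈ Ioo α β, φ X - 2 * P.A * Real.cos X ∈ Icc (R / 4) (4 * R))
    (hu₁ : ∀ X ∈ Ioo α β,
      |P.twist (φ X - 2 * P.A * Real.cos X) * (φ₁ X + 2 * P.A * Real.sin X) - 1| ≤ e)
    (hosc : ∀ X ∈ Ioo α β, ∀ X' ∈ Ioo α β, |(φ X - 2 * P.A * Real.cos X)
        - (φ X' - 2 * P.A * Real.cos X')| ≤ H)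
    (hv₁ : ∀ X ∈ Ioo α β, |v₁ X| ≤ κ * v X) (hm : m ∈ Ioo α β)
    (hN1 : N * (4 * P.A * (P.γ - 1)) ≤ φ m - 2 * P.A * Real.cos m)
    (hN2 : φ m - 2 * P.A * Real.cos m < (N + 1) * (4 * P.A * (P.γ - 1)))
    (hX : X ∈ Ioo α β) (hXh : X + 2 * Real.pi * N ∈ Ioo α β) :
    |windowTerm P a s (X + 2 * Real.pi * N) (φ (X + 2 * Real.pi * N)) * v (X + 2 * Real.pi * N)
      + windowTerm P a s X (φ X) * v X| ≤ if |Real.sin X| < s then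
        V * (2 * P.kap / P.twist R * (2 * Real.pi * N) + κ * (2 * Real.pi * N)
          + (4 * s ^ 2 + (2 * Real.pi * N * shiftErr P R e H + 64 * P.A * P.γ / R))) else 0 := by
  have hA := hP.A_pos
  have hk := hP.kap_pos
  have hg := hP.two_lt
  have hR0 : 0 < R := by linarith
  have hT0 := hP.twist_pos hR0
  have hpi := Real.pi_pos
  obtain ⟨y₀, hy₀⟩ : ∃ y, y = φ m - 2 * P.A * Real.cos m := ⟨_, rfl⟩
  have hy₀r := hur m hm
  rw [← hy₀] at hN1 hN2 hy₀r
  have hy₀p : 0 < y₀ := by linarith [hy₀r.1]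
  obtain ⟨h', hh'⟩ : ∃ h, h = 2 * Real.pi * (N : ℝ) := ⟨_, rfl⟩
  rw [← hh'] at hXh ⊢
  have hh'0 : 0 ≤ h' := by rw [hh']; positivity
  have hsin : Real.sin (X + h') = Real.sin X := by
    rw [hh', show 2 * Real.pi * (N : ℝ) = N * (2 * Real.pi) by ring, Real.sin_add_nat_mul_two_pi]
  have hcosh : Real.cos (X + h') = Real.cos X := by
    rw [hh', show 2 * Real.pi * (N : ℝ) = N * (2 * Real.pi) by ring, Real.cos_add_nat_mul_two_pi]
  simp only [windowTerm, hsin]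
  split_ifs with hc
  swap
  · simp
  obtain ⟨c, hcdef⟩ : ∃ c, c = 2 * P.A * Real.cos X := ⟨_, rfl⟩
  have hcb : |c| ≤ 2 * P.A := by
    rw [hcdef, abs_mul, abs_of_pos (by linarith : 0 < 2 * P.A)]
    exact mul_le_of_le_one_right (by linarith) (Real.abs_cos_le_one X)
  have hud : ∀ Z ∈ Ioo α β, HasDerivAt (fun X => φ X - 2 * P.A * Real.cos X)
      (φ₁ Z + 2 * P.A * Real.sin Z) Z := by
    intro Z hZ
    refine ((hreg.der Z hZ).sub ((Real.hasDerivAt_cos Z).const_mul (2 * P.A))).congr_deriv ?_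
    ring
  have hadv := abs_phase_advance_le hP (e := e) (H := H) (y₀ := y₀) (c := c) (h := h')
    hR hcR he1 hh'0 hud hur hu₁ hy₀r.1 (fun Z hZ => hy₀ ▸ hosc Z hZ m hm) hcb hX hXh
  have eX : X + P.Y (φ X - 2 * P.A * Real.cos X + c) = P.nextX X (φ X) := by
    simp only [Params.nextX, hcdef, sub_add_cancel]
  have eX' : X + h' + P.Y (φ (X + h') - 2 * P.A * Real.cos (X + h') + c)
      = P.nextX (X + h') (φ (X + h')) := by
    simp only [Params.nextX, hcdef, hcosh, sub_add_cancel]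
  rw [eX, eX'] at hadv
  obtain ⟨X₂, hX₂⟩ : ∃ z, z = P.nextX X (φ X) := ⟨_, rfl⟩
  obtain ⟨X₂', hX₂'⟩ : ∃ z, z = P.nextX (X + h') (φ (X + h')) := ⟨_, rfl⟩
  rw [← hX₂, ← hX₂'] at hadv ⊢
  have hδ : |X₂' - X₂ - 2 * (2 * Real.pi * N) - Real.pi * Real.cos X|
      ≤ h' * shiftErr P R e H + 64 * P.A * P.γ / R := by
    have e : X₂' - X₂ - 2 * (2 * Real.pi * N) - Real.pi * Real.cos X
        = (X₂' - X₂ - h' * (2 + c * (P.γ - 1) / y₀))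
          - Real.pi * Real.cos X * ((y₀ - N * (4 * P.A * (P.γ - 1))) / y₀) := by
      rw [hh', hcdef]
      field_simp
      ring
    rw [e]
    refine (abs_sub _ _).trans (add_le_add hadv ?_)
    rw [abs_mul, abs_mul, abs_of_pos hpi, abs_div, abs_of_pos hy₀p,
      abs_of_nonneg (by linarith : 0 ≤ y₀ - N * (4 * P.A * (P.γ - 1)))]
    have h1 : y₀ - N * (4 * P.A * (P.γ - 1)) ≤ 4 * P.A * P.γ := by
      have : (N + 1) * (4 * P.A * (P.γ - 1))
        = N * (4 * P.A * (P.γ - 1)) + 4 * P.A * (P.γ - 1) := by ring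
      linarith
    have h2 : (y₀ - N * (4 * P.A * (P.γ - 1))) / y₀ ≤ 4 * P.A * P.γ / (R / 4) := by
      have := hP.γ_pos
      exact div_le_div₀ (by positivity) h1 (by positivity) hy₀r.1
    have h3 := Real.abs_cos_le_one X
    have h4 := Real.pi_le_four
    have h5 : 0 ≤ (y₀ - N * (4 * P.A * (P.γ - 1))) / y₀ := div_nonneg (by linarith) hy₀p.le
    calc Real.pi * |Real.cos X| * ((y₀ - N * (4 * P.A * (P.γ - 1))) / y₀)
        ≤ 4 * 1 * (4 * P.A * P.γ / (R / 4)) := by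
          apply mul_le_mul (mul_le_mul h4 h3 (abs_nonneg _) (by norm_num)) h2 h5 (by norm_num)
      _ = 64 * P.A * P.γ / R := by field_simp; ring
  have hcos := abs_cos_add_cos_le hc hδ
  have hφr := hreg.height X hX
  have ha1 := ha.abs_le (φ X) ⟨by linarith [hφr.1], by linarith [hφr.2]⟩
  have hv0 := hreg.nonneg X hX
  have hvV := hreg.le X hX
  have hv0' := hreg.nonneg _ hXh
  have hvV' := hreg.le _ hXh
  have hsub : Icc X (X + h') ⊆ Ioo α β := fun z hz =>
    ⟨hX.1.trans_le hz.1, hz.2.trans_lt hXh.2⟩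
  have hXX : X ∈ Icc X (X + h') := left_mem_Icc.2 (by linarith)
  have hXX' : X + h' ∈ Icc X (X + h') := right_mem_Icc.2 (by linarith)
  have hda : |a (φ (X + h')) - a (φ X)| ≤ 2 * P.kap / P.twist R * h' := by
    refine (ha.abs_sub_le _ _).trans ?_
    have e : φ (X + h') - φ X = (φ (X + h') - 2 * P.A * Real.cos (X + h'))
        - (φ X - 2 * P.A * Real.cos X) := by rw [hcosh]; ring
    rw [e]
    have := (convex_Icc X (X + h')).norm_image_sub_le_of_norm_hasDerivWithin_le
      (fun z hz => (hud z (hsub hz)).hasDerivWithinAt) (fun z hz => hreg.slope z (hsub hz)) hXX hXX'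
    rwa [Real.norm_eq_abs, Real.norm_eq_abs, add_sub_cancel_left, abs_of_nonneg hh'0] at this
  have hdv : |v (X + h') - v X| ≤ κ * V * h' := by
    have := (convex_Icc X (X + h')).norm_image_sub_le_of_norm_hasDerivWithin_le
      (fun z hz => (hreg.derw z (hsub hz)).hasDerivWithinAt) (C := κ * V) (fun z hz =>
        (hv₁ z (hsub hz)).trans (mul_le_mul_of_nonneg_left (hreg.le z (hsub hz)) hκ)) hXX hXX'
    rwa [Real.norm_eq_abs, Real.norm_eq_abs, add_sub_cancel_left, abs_of_nonneg hh'0] at this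
  have hdec : a (φ (X + h')) * Real.cos X₂' * v (X + h') + a (φ X) * Real.cos X₂ * v X
      = (a (φ (X + h')) - a (φ X)) * Real.cos X₂' * v (X + h')
        + a (φ X) * Real.cos X₂' * (v (X + h') - v X)
        + a (φ X) * v X * (Real.cos X₂' + Real.cos X₂) := by ring
  rw [hdec]
  refine (abs_add_three _ _ _).trans ?_
  have hcX := Real.abs_cos_le_one X₂'
  have b1 : |(a (φ (X + h')) - a (φ X)) * Real.cos X₂' * v (X + h')|
      ≤ 2 * P.kap / P.twist R * h' * 1 * V := by
    rw [abs_mul, abs_mul, abs_of_nonneg hv0']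
    gcongr
  have b2 : |a (φ X) * Real.cos X₂' * (v (X + h') - v X)| ≤ 1 * 1 * (κ * V * h') := by
    rw [abs_mul, abs_mul]
    gcongr
  have b3 : |a (φ X) * v X * (Real.cos X₂' + Real.cos X₂)| ≤ 1 * V * (4 * s ^ 2
      + (h' * shiftErr P R e H + 64 * P.A * P.γ / R)) := by
    rw [abs_mul, abs_mul, abs_of_nonneg hv0]
    gcongr
  refine (add_le_add (add_le_add b1 b2) b3).trans (le_of_eq ?_)
  ring

set_option maxHeartbeats 1000000 in
/-- Over `|sin x| ≥ r`, the second increments cancel: consecutive passages of the phase through a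
window differ by a rotation of the next phase by an angle of order `1 / R`, so that a shift by
`N ≈ R / A` turns changes the sign of the next increment. -/
theorem eventually_abs_integral_window_far_le (hP : P.Pos) {K M r ε : ℝ} (hK : 0 ≤ K) (hM : 0 < M)
    (hr : 0 < r) (hε : 0 < ε) :
    ∀ᶠ R in atTop, ∀ (p q W a' : ℝ) (ψ ψ₁ ψ₂ w w₁ a : ℝ → ℝ),
      RegCurve P R K W p q ψ ψ₁ ψ₂ w w₁ → p < q → q - p ≤ 1 → 0 ≤ W → IsWeight R a a' →
      (∀ x ∈ Ioo p q, r ≤ |Real.sin x|) →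
      (∀ x ∈ Ioo p q, P.nextY x (ψ x) ∈ Icc (R / 4) (4 * R)) →
      |∫ x in Ioo p q, windowTerm P a (M / √(P.twist R)) (P.nextX x (ψ x)) (P.nextY x (ψ x)) * w x|
        ≤ ε * W / √(P.twist R) := by
  have hA := hP.A_pos
  have hk := hP.kap_pos
  have hg := hP.two_lt
  have hg0 := hP.γ_pos
  set l₀ := P.A * r / P.kap with hl₀
  have hl₀p : 0 < l₀ := by positivity
  set C₁ := curvConst P K with hC₁
  have hC₁0 : 0 ≤ C₁ := curvConst_nonneg hP
  set C₄ := 1 + P.kap * (2 * P.A + K) with hC₄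
  have hC₄0 : 0 ≤ C₄ := by positivity
  set H := 2 * P.A + K with hH
  set C₅ := 32 * P.A * P.γ * H + 1024 * P.A ^ 2 * P.γ ^ 2 * P.kap ^ 2 with hC₅
  -- the error terms, in the small quantities `R / T`, `1 / T`, `1 / R`
  set η : ℝ → ℝ := fun R => 7 / P.A * (2 * P.kap + (K / l₀ + C₁ / l₀ ^ 2)
    + 1 / l₀ * (1 + 8 * P.A * P.γ)) * (R / P.twist R) + 4 * M ^ 2 * (P.twist R)⁻¹
    + (7 / P.A * C₅ + 64 * P.A * P.γ) * R⁻¹ with hη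
  set E : ℝ → ℝ := fun R => 4 * M / l₀ * (7 / P.A * (R / P.twist R) + (P.twist R)⁻¹
    + η R * (C₄ + (P.twist R)⁻¹)) with hE
  have hT1 : Tendsto (fun R => (P.twist R)⁻¹) atTop (𝓝 0) := hP.twist_tendsto.inv_tendsto_atTop
  have hT2 : Tendsto (fun R : ℝ => R⁻¹) atTop (𝓝 0) := tendsto_inv_atTop_zero
  have hηt : Tendsto η atTop (𝓝 0) := by
    have := ((hP.div_twist_tendsto.const_mul (7 / P.A * (2 * P.kap + (K / l₀ + C₁ / l₀ ^ 2)
      + 1 / l₀ * (1 + 8 * P.A * P.γ)))).add (hT1.const_mul (4 * M ^ 2))).add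
      (hT2.const_mul (7 / P.A * C₅ + 64 * P.A * P.γ))
    simp only [mul_zero, add_zero] at this
    exact this
  have hEt : Tendsto E atTop (𝓝 0) := by
    have := (((hP.div_twist_tendsto.const_mul (7 / P.A)).add hT1).add
      (hηt.mul (hT1.const_add C₄))).const_mul (4 * M / l₀)
    simp only [mul_zero, add_zero, zero_mul] at this
    exact this
  have hbigt : Tendsto (fun R => P.A * P.twist R * r) atTop atTop :=
    (hP.twist_tendsto.const_mul_atTop hA).atTop_mul_const hr
  have hlt : Tendsto (fun R => l₀ * P.twist R) atTop atTop := hP.twist_tendsto.const_mul_atTop hl₀p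
  have hlt2 : Tendsto (fun R => 2 * P.kap * C₁ / (l₀ * P.twist R) ^ 2) atTop (𝓝 0) := by
    have : Tendsto (fun R => (l₀ * P.twist R) ^ 2) atTop atTop :=
      (tendsto_pow_atTop two_ne_zero).comp hlt
    exact this.const_div_atTop _
  have hKt : Tendsto (fun R => K / (l₀ * P.twist R) + C₁ / l₀ ^ 2 * (P.twist R)⁻¹)
      atTop (𝓝 0) := by
    have := (hlt.const_div_atTop K).add (hT1.const_mul (C₁ / l₀ ^ 2))
    simpa using this
  filter_upwards [eventually_ge_atTop 1, hP.twist_tendsto.eventually_ge_atTop 1,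
    hbigt.eventually_ge_atTop (P.kap * (1 + P.kap * K)), hlt.eventually_ge_atTop 1,
    hlt2.eventually_le_const (show (0 : ℝ) < P.A / 4 by positivity),
    hKt.eventually_le_const (show (0 : ℝ) < 2 * P.kap by positivity),
    eventually_ge_atTop (8 * (2 * P.A)), eventually_ge_atTop (16 * P.A * (P.γ - 1)),
    hEt.eventually_le_const hε]
    with R hR hτ hbig hl1 hl2 hK2 hcR hcR2 hEε
  intro p q W a' ψ ψ₁ ψ₂ w w₁ a h hpq hlen hW ha hs hh
  have hR0 : 0 < R := by linarith
  set T := P.twist R with hT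
  have hτ0 : 0 < T := by linarith
  set s := M / √T with hsdef
  have hs0 : 0 < s := by positivity
  have hs2 : s ^ 2 = M ^ 2 * T⁻¹ := by rw [hsdef, div_pow, Real.sq_sqrt hτ0.le]; rfl
  obtain ⟨α, β, φ, φ₁, φ₂, v, v₁, hαβ, hreg, hur', hu₁, hosc, hv₁, hβα, hint⟩ :=
    h.exists_image hP hR hτ hK hpq hlen (t := r) (l := l₀ * T) (K' := 2 * P.kap) hbig hs
      (by rw [hl₀, ← hT]; field_simp) hl1 hl2 le_rfl
      (by
        refine le_trans (le_of_eq ?_) hK2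
        rw [← hT, ← hC₁]
        field_simp) hh
  have hur : ∀ X ∈ Ioo α β, φ X - 2 * P.A * Real.cos X ∈ Icc (R / 4) (4 * R) := by
    intro X hX
    obtain ⟨x, hx, hx2⟩ := hur' X hX
    exact hx2 ▸ h.height x hx
  rw [hint (fun X y => windowTerm P a s X y)]
  set V := W / (l₀ * T) with hV
  have hV0 : 0 ≤ V := by positivity
  set m := (α + β) / 2 with hm
  have hmI : m ∈ Ioo α β := ⟨by linarith, by linarith⟩
  obtain ⟨y₀, hy₀⟩ : ∃ y, y = φ m - 2 * P.A * Real.cos m := ⟨_, rfl⟩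
  have hy₀r := hur m hmI
  rw [← hy₀] at hy₀r
  have hy₀p : 0 < y₀ := by linarith [hy₀r.1]
  obtain ⟨N, hN⟩ : ∃ n, n = ⌊y₀ / (4 * P.A * (P.γ - 1))⌋₊ := ⟨_, rfl⟩
  have hden : 0 < 4 * P.A * (P.γ - 1) := by
    have : 0 < P.γ - 1 := by linarith
    positivity
  -- in one turn the phase of the next point gains `2 ± 2 A (γ - 1) / y₀` turns, by the sign of the
  -- cosine; `N` is chosen so that the second part amounts to half a turn
  have hN1 : (N : ℝ) ≤ y₀ / (4 * P.A * (P.γ - 1)) := hN ▸ Nat.floor_le (by positivity)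
  have hN2 : y₀ / (4 * P.A * (P.γ - 1)) < N + 1 := hN ▸ Nat.lt_floor_add_one _
  have hN1' : N * (4 * P.A * (P.γ - 1)) ≤ y₀ := by rwa [le_div_iff₀ hden] at hN1
  have hN2' : y₀ < (N + 1) * (4 * P.A * (P.γ - 1)) := by rwa [div_lt_iff₀ hden] at hN2
  have hNpos : 0 < (N : ℝ) := by
    by_contra hc
    have : (N : ℝ) ≤ 0 := not_lt.1 hc
    have : (N + 1) * (4 * P.A * (P.γ - 1)) ≤ 1 * (4 * P.A * (P.γ - 1)) := by gcongr; linarith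
    linarith [hy₀r.1]
  obtain ⟨h', hh'⟩ : ∃ h, h = 2 * Real.pi * (N : ℝ) := ⟨_, rfl⟩
  have hpi := Real.pi_pos
  have hh'0 : 0 < h' := by rw [hh']; positivity
  have hh'le : h' ≤ 7 / P.A * R := by
    have : N * (4 * P.A) ≤ N * (4 * P.A * (P.γ - 1)) := by
      apply mul_le_mul_of_nonneg_left _ hNpos.le
      exact le_mul_of_one_le_right (by positivity) (by linarith)
    have h1 : N * P.A ≤ R := by linarith [hy₀r.2]
    rw [div_mul_eq_mul_div, le_div_iff₀ hA]
    have : Real.pi ≤ 3.5 := by linarith [Real.pi_lt_d2]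
    calc h' * P.A = 2 * Real.pi * (N * P.A) := by rw [hh']; ring
      _ ≤ 2 * 3.5 * R := by gcongr
      _ = 7 * R := by ring
  -- the sizes of the three errors in the compensation
  have hshift : h' * shiftErr P R (1 / (l₀ * T)) H + 64 * P.A * P.γ / R ≤
      7 / P.A * (1 / l₀ * (1 + 8 * P.A * P.γ)) * (R / T) + (7 / P.A * C₅ + 64 * P.A * P.γ) * R⁻¹ := by
    have h0 : 0 ≤ shiftErr P R (1 / (l₀ * T)) H := by unfold shiftErr; positivity
    have h1 := mul_le_mul_of_nonneg_right hh'le h0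
    have h2 : 7 / P.A * R * shiftErr P R (1 / (l₀ * T)) H =
      7 / P.A * (1 / l₀ * (1 + 8 * P.A * P.γ)) * (R / T) + 7 / P.A * C₅ * R⁻¹ := by
      unfold shiftErr
      rw [← hC₅]
      field_simp
    have h3 : 64 * P.A * P.γ / R = 64 * P.A * P.γ * R⁻¹ := div_eq_mul_inv _ _
    rw [h3]
    linarith
  have key := abs_integral_le_of_shift (k := fun X => windowTerm P a s X (φ X) * v X) (h := h')
    (η := η R) (V := V) hαβ hs0 hV0 hh'0 (by
      simp only [hη]
      have : 0 ≤ K / l₀ + C₁ / l₀ ^ 2 := by positivity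
      positivity) (hreg.aestronglyMeasurable_comp (measurable_windowTerm ha)) ?_ ?_
  · refine key.trans ?_
    have e1 : V * (4 * s * (h' + 1)) + V * η R * (4 * s * (β - α + 1))
        ≤ V * (4 * s * (7 / P.A * R + 1)) + V * η R * (4 * s * (C₄ * T + 1)) := by
      have : 0 ≤ η R := by
        simp only [hη]
        have : 0 ≤ K / l₀ + C₁ / l₀ ^ 2 := by positivity
        positivity
      gcongr
    have e2 : V * (4 * s * (7 / P.A * R + 1)) + V * η R * (4 * s * (C₄ * T + 1))
        = E R * (W / √T) := by
      simp only [hE, hV, hsdef, ← hT]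
      field_simp
    rw [e2] at e1
    refine e1.trans ?_
    rw [mul_div_assoc]
    gcongr
  · intro X hX
    rw [abs_mul, abs_of_nonneg (hreg.nonneg X hX)]
    have h1 := abs_windowTerm_le (P := P) (s := s) (x := X) (y := φ X) ha
      ⟨by linarith [(hreg.height X hX).1], by linarith [(hreg.height X hX).2]⟩
    have h3 := hreg.nonneg X hX
    split_ifs with hc
    · rw [if_pos hc] at h1
      exact (mul_le_of_le_one_left h3 h1).trans (hreg.le X hX)
    · rw [if_neg hc] at h1
      exact mul_nonpos_of_nonpos_of_nonneg h1 h3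
  · intro X hX hXh
    rw [hh'] at hXh ⊢
    refine (abs_windowTerm_add_shift_le hP hreg hR hcR (e := 1 / (l₀ * T)) (H := H)
      (κ := K / (l₀ * T) + C₁ * T / (l₀ * T) ^ 2) (by rw [div_le_one (by linarith)]; exact hl1)
      (by positivity) hV0 ha hur hu₁ hosc hv₁ hmI (hy₀ ▸ hN1') (hy₀ ▸ hN2') hX hXh).trans ?_
    rw [← hh', ← hT]
    split_ifs
    swap
    · exact le_rfl
    apply mul_le_mul_of_nonneg_left _ hV0
    have c1 : 2 * P.kap / T * h' ≤ 2 * P.kap / T * (7 / P.A * R) :=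
      mul_le_mul_of_nonneg_left hh'le (by positivity)
    have c2 : (K / (l₀ * T) + C₁ * T / (l₀ * T) ^ 2) * h'
        ≤ (K / (l₀ * T) + C₁ * T / (l₀ * T) ^ 2) * (7 / P.A * R) :=
      mul_le_mul_of_nonneg_left hh'le (by positivity)
    have c3 : η R = 2 * P.kap / T * (7 / P.A * R)
        + (K / (l₀ * T) + C₁ * T / (l₀ * T) ^ 2) * (7 / P.A * R) + (4 * s ^ 2
        + (7 / P.A * (1 / l₀ * (1 + 8 * P.A * P.γ)) * (R / T)
          + (7 / P.A * C₅ + 64 * P.A * P.γ) * R⁻¹)) := by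
      rw [hs2]
      simp only [hη, ← hT]
      field_simp
      ring
    rw [c3]
    linarith

end RegCurve

theorem setIntegral_Ioo_add_Ioo {p c q : ℝ} (hpc : p ≤ c) (hcq : c ≤ q) {f : ℝ → ℝ}
    (hf : IntegrableOn f (Ioo p q)) :
    ∫ x in Ioo p q, f x = (∫ x in Ioo p c, f x) + ∫ x in Ioo c q, f x := by
  have e0 : ∀ a b : ℝ, a ≤ b → ∫ X in Ioo a b, f X = ∫ X in a..b, f X := by
    intro a b hab
    rw [intervalIntegral.integral_of_le hab, integral_Ioc_eq_integral_Ioo]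
  have hi : ∀ a b, p ≤ a → a ≤ b → b ≤ q → IntervalIntegrable f volume a b := by
    intro a b ha hab hb
    rw [intervalIntegrable_iff_integrableOn_Ioo_of_le hab]
    exact hf.mono_set (Ioo_subset_Ioo ha hb)
  rw [e0 _ _ (hpc.trans hcq), e0 _ _ hpc, e0 _ _ hcq,
    intervalIntegral.integral_add_adjacent_intervals (hi _ _ le_rfl hpc hcq) (hi _ _ hpc hcq le_rfl)]

/-- An interval of length at most `1` contains at most one component of `|sin x| < t`. -/
theorem abs_integral_le_of_sin_split {p q t B C : ℝ} {f : ℝ → ℝ} (hpq : p < q) (hl : q - p ≤ 1)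
    (ht : 0 < t) (ht2 : t ≤ 1 / 2) (hf : IntegrableOn f (Ioo p q)) (hB : 0 ≤ B) (hC : 0 ≤ C)
    (h1 : ∀ p' q', p ≤ p' → p' < q' → q' ≤ q → (∀ x ∈ Ioo p' q', t ≤ |Real.sin x|) →
      |∫ x in Ioo p' q', f x| ≤ B)
    (h2 : ∀ p' q', p ≤ p' → p' < q' → q' ≤ q → q' - p' ≤ 4 * t →
      (∀ x ∈ Ioo p' q', |Real.sin x| < t) → |∫ x in Ioo p' q', f x| ≤ C) :
    |∫ x in Ioo p q, f x| ≤ 2 * B + C := by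
  obtain ⟨c, d, hc, hcd, hd, hdc, hs1, hs2, hs3⟩ := exists_sin_lt_interval hpq hl ht ht2
  rw [setIntegral_Ioo_add_Ioo hc (hcd.trans hd) hf,
    setIntegral_Ioo_add_Ioo hcd hd (hf.mono_set (Ioo_subset_Ioo_left hc))]
  have b1 : |∫ x in Ioo p c, f x| ≤ B := by
    rcases hc.eq_or_lt with h | h
    · simpa [h] using hB
    · exact h1 _ _ le_rfl h (hcd.trans hd) hs1
  have b2 : |∫ x in Ioo d q, f x| ≤ B := by
    rcases hd.eq_or_lt with h | h
    · simpa [h] using hB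
    · exact h1 _ _ (hc.trans hcd) h le_rfl hs2
  have b3 : |∫ x in Ioo c d, f x| ≤ C := by
    rcases hcd.eq_or_lt with h | h
    · simpa [h] using hC
    · exact h2 _ _ hc h hd hdc hs3
  have := abs_add_three (∫ x in Ioo p c, f x) (∫ x in Ioo c d, f x) (∫ x in Ioo d q, f x)
  rw [← add_assoc]
  linarith

theorem abs_integral_Ioo_le_mul {p q V : ℝ} {f : ℝ → ℝ} (hpq : p ≤ q)
    (h : ∀ x ∈ Ioo p q, |f x| ≤ V) : |∫ x in Ioo p q, f x| ≤ V * (q - p) := by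
  have := norm_setIntegral_le_of_norm_le_const (μ := volume) (s := Ioo p q) (f := f) (C := V)
    (by simp) h
  simpa [Measure.real, Real.volume_Ioo, ENNReal.toReal_ofReal (sub_nonneg.2 hpq)] using this

/-- The weighted increment `a(y) cos(x + Y(y))`, off the windows `|sin x| < s`. -/
def outerTerm (P : Params) (a : ℝ → ℝ) (s x y : ℝ) : ℝ :=
  if s ≤ |Real.sin x| then a y * Real.cos (P.nextX x y) else 0

theorem abs_outerTerm_le {P : Params} {R a' s x y : ℝ} {a : ℝ → ℝ} (h : IsWeight R a a')
    (hy : y ∈ Icc (R / 8) (8 * R)) : |outerTerm P a s x y| ≤ 1 := by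
  unfold outerTerm
  split_ifs
  · rw [abs_mul]
    exact mul_le_one₀ (h.abs_le y hy) (abs_nonneg _) (Real.abs_cos_le_one _)
  · simp

theorem measurable_outerTerm {P : Params} {R a' s : ℝ} {a : ℝ → ℝ} (h : IsWeight R a a') :
    Measurable fun z : ℝ × ℝ => outerTerm P a s z.1 z.2 := by
  unfold outerTerm
  have h1 := measurable_nextX P
  have h2 := h.continuous.measurable
  exact Measurable.ite (measurableSet_le measurable_const (by fun_prop))
    ((h2.comp measurable_snd).mul (Real.measurable_cos.comp h1)) measurable_const

/-- The drift, up to a coboundary: the increment `a(y) cos(x + Y(y))`, where the increments that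
start in the windows `|sin x| < s` are counted one step earlier. -/
def driftTerm (P : Params) (a : ℝ → ℝ) (s x y : ℝ) : ℝ :=
  outerTerm P a s x y + windowTerm P a s (P.nextX x y) (P.nextY x y)

theorem measurable_windowTerm_next {P : Params} {R a' s : ℝ} {a : ℝ → ℝ} (h : IsWeight R a a') :
    Measurable fun z : ℝ × ℝ => windowTerm P a s (P.nextX z.1 z.2) (P.nextY z.1 z.2) := by
  have h1 := (measurable_windowTerm (P := P) (s := s) h).comp
    ((measurable_nextX P).prodMk (measurable_nextY P))
  simpa only [Function.comp_def] using h1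

theorem measurable_driftTerm {P : Params} {R a' s : ℝ} {a : ℝ → ℝ} (h : IsWeight R a a') :
    Measurable fun z : ℝ × ℝ => driftTerm P a s z.1 z.2 :=
  (measurable_outerTerm h).add (measurable_windowTerm_next h)

theorem abs_nextY_sub_le {P : Params} (hA : 0 < P.A) (x y : ℝ) :
    |P.nextY x y - y| ≤ 2 * P.A := by
  unfold Params.nextY
  rw [add_sub_cancel_left, abs_mul, abs_of_pos (by linarith : 0 < 2 * P.A)]
  exact mul_le_of_le_one_right (by linarith) (Real.abs_cos_le_one _)

theorem abs_driftTerm_le {P : Params} {R a' s x y : ℝ} {a : ℝ → ℝ} (h : IsWeight R a a')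
    (hy : y ∈ Icc (R / 8) (8 * R)) (hy' : P.nextY x y ∈ Icc (R / 8) (8 * R)) :
    |driftTerm P a s x y| ≤ 2 := by
  unfold driftTerm
  have h1 := abs_windowTerm_le (P := P) (s := s) (x := P.nextX x y) h hy'
  have h2 := abs_outerTerm_le (P := P) (s := s) (x := x) h hy
  have h3 : (if |Real.sin (P.nextX x y)| < s then (1 : ℝ) else 0) ≤ 1 := by
    split_ifs <;> norm_num
  have := abs_add_le (outerTerm P a s x y) (windowTerm P a s (P.nextX x y) (P.nextY x y))
  linarith

namespace RegCurve

variable {P : Params}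

theorem mono_const {R K K' W p q : ℝ} {ψ ψ₁ ψ₂ w w₁ : ℝ → ℝ}
    (h : RegCurve P R K W p q ψ ψ₁ ψ₂ w w₁) (hP : P.Pos) (hR : 0 < R) (hKK : K ≤ K') :
    RegCurve P R K' W p q ψ ψ₁ ψ₂ w w₁ := by
  have hT := hP.twist_pos hR
  refine ⟨h.der, h.der₁, h.derw, h.height, fun x hx => (h.slope x hx).trans ?_, h.dslope, h.nonneg,
    h.le, fun x hx => (h.regular x hx).trans ?_⟩
  · gcongr
  · exact mul_le_mul_of_nonneg_right hKK (h.nonneg x hx)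

theorem mono_weight {R K W W' p q : ℝ} {ψ ψ₁ ψ₂ w w₁ : ℝ → ℝ}
    (h : RegCurve P R K W p q ψ ψ₁ ψ₂ w w₁) (hW : ∀ x ∈ Ioo p q, w x ≤ W') :
    RegCurve P R K W' p q ψ ψ₁ ψ₂ w w₁ :=
  ⟨h.der, h.der₁, h.derw, h.height, h.slope, h.dslope, h.nonneg, hW, h.regular⟩

/-- The increments from the points outside the windows oscillate. -/
theorem abs_integral_increment_le (hP : P.Pos) {R K W p q s a' : ℝ}
    {ψ ψ₁ ψ₂ w w₁ a : ℝ → ℝ} (h : RegCurve P R K W p q ψ ψ₁ ψ₂ w w₁) (hR : 1 ≤ R)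
    (hτ : 1 ≤ P.twist R) (hK : 0 ≤ K) (hW : 0 ≤ W) (hpq : p < q) (hl : q - p ≤ 1)
    (ha : IsWeight R a a') (hs : 0 < s) (hs2 : s ≤ 1 / 2)
    (hbig : P.kap * (1 + P.kap * (2 * P.A + 2 * K)) ≤ P.A * P.twist R * s) :
    |∫ x in Ioo p q, outerTerm P a s x (ψ x) * w x|
      ≤ 2 * (oscConst P (2 * P.A + 2 * K) * W / (P.twist R * s)) := by
  have hA := hP.A_pos
  have hR0 : 0 < R := by linarith
  have hτ0 : 0 < P.twist R := by linarith
  have hK' : 0 ≤ 2 * P.A + 2 * K := by positivity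
  have ho := oscConst_nonneg hP hK'
  have hα : ∀ x ∈ Ioo p q, |a (ψ x)| ≤ 1 := fun x hx =>
    ha.abs_le _ ⟨by linarith [(h.height x hx).1], by linarith [(h.height x hx).2]⟩
  have hint := integrableOn_Ioo_of_abs_le (M := W)
    (h.aestronglyMeasurable_comp (measurable_outerTerm (P := P) (s := s) ha)) (by
    intro x hx
    rw [abs_mul, abs_of_nonneg (h.nonneg x hx)]
    exact (mul_le_of_le_one_left (h.nonneg x hx) (abs_outerTerm_le ha
      ⟨by linarith [(h.height x hx).1], by linarith [(h.height x hx).2]⟩)).trans (h.le x hx))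
  have key := abs_integral_le_of_sin_split (B := oscConst P (2 * P.A + 2 * K) * W
    / (P.twist R * s)) (C := 0) hpq hl hs hs2 hint (by positivity) le_rfl ?_ ?_
  · simpa using key
  · intro p' q' hp' hpq' hq' hs'
    have hsub : Ioo p' q' ⊆ Ioo p q := Ioo_subset_Ioo hp' hq'
    have hreg := (h.mono hp' hq').mono_const hP hR0 (K' := 2 * P.A + 2 * K) (by linarith)
    have := hreg.abs_integral_phase_le hP hR hτ hK' hs hbig hs' hW
      (α := fun x => a (ψ x) * w x) (α₁ := fun x => a' * ψ₁ x * w x + a (ψ x) * w₁ x)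
      (B := Real.sin) (b := Real.cos) (β := 1)
      (fun x hx => ((ha.der (ψ x)).comp x (h.der x (hsub hx))).mul (h.derw x (hsub hx)))
      (fun x hx => by
        rw [abs_mul, abs_of_nonneg (h.nonneg x (hsub hx))]
        exact (mul_le_of_le_one_left (h.nonneg x (hsub hx)) (hα x (hsub hx))).trans
          (h.le x (hsub hx)))
      (fun x hx => by
        have h1 := h.abs_slope_le hP hτ hK (hsub hx)
        have h2 := h.regular x (hsub hx)
        have h3 := h.le x (hsub hx)
        have h4 := h.nonneg x (hsub hx)
        have h5 := ha.abs_der_le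
        have h6 := hα x (hsub hx)
        refine (abs_add_le _ _).trans ?_
        rw [abs_mul, abs_mul, abs_mul, abs_of_nonneg h4]
        have e1 : |a'| * |ψ₁ x| * w x ≤ 1 * (2 * P.A + K) * W := by gcongr
        have e2 : |a (ψ x)| * |w₁ x| ≤ 1 * (K * W) := by
          apply mul_le_mul h6 (h2.trans (by gcongr)) (abs_nonneg _) zero_le_one
        linarith)
      Real.hasDerivAt_sin Real.continuous_cos ⟨1, Real.abs_cos_le_one⟩ Real.abs_sin_le_one
    rw [mul_one] at this
    refine le_trans (le_of_eq ?_) this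
    congr 1
    refine setIntegral_congr_fun measurableSet_Ioo fun x hx => ?_
    simp only [outerTerm, if_pos (hs' x hx)]
    ring
  · intro p' q' hp' hpq' hq' hl' hs'
    rw [setIntegral_congr_fun (g := fun _ => 0) measurableSet_Ioo fun x hx => by
      simp only [outerTerm, if_neg (not_le.2 (hs' x hx)), zero_mul]]
    simp

/-- Windows that start at `t ≤ |sin x|`, on a short interval: the time spent in the next window is
controlled by equidistribution of the phase. -/
theorem abs_integral_window_near_le (hP : P.Pos) {R K W p q s t a' : ℝ}
    {ψ ψ₁ ψ₂ w w₁ a : ℝ → ℝ} (h : RegCurve P R K W p q ψ ψ₁ ψ₂ w w₁) (hR : 1 ≤ R)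
    (hτ : 1 ≤ P.twist R) (hK : 0 ≤ K) (hW : 0 ≤ W) (hpq : p < q)
    (ha : IsWeight R a a') (hs : 0 < s) (ht : 0 < t)
    (hbig : P.kap * (1 + P.kap * K) ≤ P.A * P.twist R * t)
    (hst : ∀ x ∈ Ioo p q, t ≤ |Real.sin x|)
    (hh : ∀ x ∈ Ioo p q, P.nextY x (ψ x) ∈ Icc (R / 4) (4 * R)) :
    |∫ x in Ioo p q, windowTerm P a s (P.nextX x (ψ x)) (P.nextY x (ψ x)) * w x|
      ≤ 10 * s * (W * (q - p) + oscConst P K * (2 * Real.pi) * W / (P.twist R * t)) := by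
  have hpi := Real.pi_pos
  have hτ0 : 0 < P.twist R := by linarith
  have ho := oscConst_nonneg hP hK
  have hcs : Measurable fun z : ℝ × ℝ => sinCut s (P.nextX z.1 z.2) :=
    (continuous_sinCut s).measurable.comp (measurable_nextX P)
  have hcw := h.aestronglyMeasurable_comp (f := fun x y => sinCut s (P.nextX x y)) hcs
  simp only [mul_comm (sinCut s _)] at hcw
  have hi1 : IntegrableOn (fun x => w x * sinCut s (P.nextX x (ψ x))) (Ioo p q) :=
    integrableOn_Ioo_of_abs_le (M := W) hcw (by
      intro x hx
      have := sinCut_mem s (P.nextX x (ψ x))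
      rw [abs_mul, abs_of_nonneg (h.nonneg x hx), abs_of_nonneg this.1]
      exact (mul_le_of_le_one_right (h.nonneg x hx) this.2).trans (h.le x hx))
  have hle : |∫ x in Ioo p q, windowTerm P a s (P.nextX x (ψ x)) (P.nextY x (ψ x)) * w x|
      ≤ ∫ x in Ioo p q, w x * sinCut s (P.nextX x (ψ x)) := by
    rw [← Real.norm_eq_abs]
    refine norm_integral_le_of_norm_le hi1 ?_
    filter_upwards [ae_restrict_mem measurableSet_Ioo] with x hx
    rw [Real.norm_eq_abs, abs_mul, abs_of_nonneg (h.nonneg x hx), mul_comm]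
    have hx2 := hh x hx
    have h1 := abs_windowTerm_le (P := P) (s := s) (x := P.nextX x (ψ x)) ha
      (y := P.nextY x (ψ x)) ⟨by linarith [hx2.1], by linarith [hx2.2]⟩
    refine mul_le_mul_of_nonneg_left (h1.trans ?_) (h.nonneg x hx)
    split_ifs with hc
    · rw [sinCut_eq_one hs hc]
    · exact (sinCut_mem s _).1
  have hwin := h.abs_integral_window_sub_le hP hR hτ hK hW ht hbig hst (continuous_sinCut s)
    (sinCut_mem s) (periodic_sinCut s)
  have hm := circMean_sinCut_le hs
  have hm0 := circMean_nonneg (sinCut_mem s)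
  have hw : |∫ x in Ioo p q, w x| ≤ W * (q - p) := abs_integral_Ioo_le_mul hpq.le fun x hx => by
    rw [abs_of_nonneg (h.nonneg x hx)]
    exact h.le x hx
  have hw2 : circMean (sinCut s) * ∫ x in Ioo p q, w x ≤ 10 * s * (W * (q - p)) := by
    have : 0 ≤ W * (q - p) := mul_nonneg hW (by linarith)
    exact (mul_le_mul_of_nonneg_left ((le_abs_self _).trans hw) hm0).trans
      (mul_le_mul_of_nonneg_right hm this)
  have hw3 : oscConst P K * (2 * Real.pi * circMean (sinCut s)) * W / (P.twist R * t)
      ≤ 10 * s * (oscConst P K * (2 * Real.pi) * W / (P.twist R * t)) := by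
    rw [show 10 * s * (oscConst P K * (2 * Real.pi) * W / (P.twist R * t))
      = oscConst P K * (2 * Real.pi * (10 * s)) * W / (P.twist R * t) by ring]
    gcongr
  have := (abs_le.1 hwin).2
  linarith

set_option maxHeartbeats 1000000 in
/-- The drift is negligible on the scale `1 / √Y'`. -/
theorem exists_abs_integral_drift_le (hP : P.Pos) {K ε : ℝ} (hK : 0 ≤ K) (hε : 0 < ε) :
    ∃ M : ℝ, 0 < M ∧ ∀ᶠ R in atTop, ∀ (p q W a' : ℝ) (ψ ψ₁ ψ₂ w w₁ a : ℝ → ℝ),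
      RegCurve P R K W p q ψ ψ₁ ψ₂ w w₁ → p < q → q - p ≤ 1 → 0 ≤ W → IsWeight R a a' →
      (∀ x ∈ Ioo p q, ψ x ∈ Icc (R / 3) (3 * R)) →
      |∫ x in Ioo p q, driftTerm P a (M / √(P.twist R)) x (ψ x) * w x|
        ≤ ε * W / √(P.twist R) := by
  have hA := hP.A_pos
  have hk := hP.kap_pos
  have hpi := Real.pi_pos
  have ho1 := oscConst_nonneg hP (K := 2 * P.A + 2 * K) (by positivity)
  have ho2 := oscConst_nonneg hP hK
  -- the windows are so wide that the increments from outside contribute at most `ε / 4`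
  obtain ⟨M, hM⟩ : ∃ M, M = 8 * (oscConst P (2 * P.A + 2 * K) + 1) / ε := ⟨_, rfl⟩
  have hM0 : 0 < M := by rw [hM]; positivity
  have hMb : 2 * oscConst P (2 * P.A + 2 * K) / M ≤ ε / 4 := by
    rw [hM, div_le_iff₀ (by positivity)]
    have : ε / 4 * (8 * (oscConst P (2 * P.A + 2 * K) + 1) / ε)
      = 2 * (oscConst P (2 * P.A + 2 * K) + 1) := by field_simp; ring
    rw [this]
    linarith
  -- next to the zeros of the sine, for `|sin x| < r`, the next windows have measure `O(M r / √Y')`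
  obtain ⟨r, hr⟩ : ∃ r, r = min (1 / 2) (ε / (640 * M)) := ⟨_, rfl⟩
  have hr0 : 0 < r := by rw [hr]; positivity
  have hr1 : r ≤ 1 / 2 := by rw [hr]; exact min_le_left _ _
  have hr2 : 40 * M * r ≤ ε / 16 := by
    have : r ≤ ε / (640 * M) := by rw [hr]; exact min_le_right _ _
    rw [le_div_iff₀ (by positivity)] at this
    linarith
  -- the points with `|sin x| < e / √Y'`, where the phase may be stationary, are neglected
  obtain ⟨e, he⟩ : ∃ e, e = ε / 16 := ⟨_, rfl⟩
  have he0 : 0 < e := by rw [he]; positivity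
  refine ⟨M, hM0, ?_⟩
  have hsq : Tendsto (fun R => √(P.twist R)) atTop atTop :=
    Real.tendsto_sqrt_atTop.comp hP.twist_tendsto
  filter_upwards [eventually_abs_integral_window_far_le hP hK hM0 hr0 (ε := ε / 16) (by positivity),
    eventually_ge_atTop 1, hP.twist_tendsto.eventually_ge_atTop 1,
    hsq.eventually_ge_atTop (2 * M), hsq.eventually_ge_atTop (2 * e),
    (hsq.const_mul_atTop (mul_pos hA hM0)).eventually_ge_atTop
      (P.kap * (1 + P.kap * (2 * P.A + 2 * K))),
    (hsq.const_mul_atTop (mul_pos hA he0)).eventually_ge_atTop (P.kap * (1 + P.kap * K)),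
    (hsq.const_div_atTop (10 * M * (oscConst P K * (2 * Real.pi)) / e)).eventually_le_const
      (show (0 : ℝ) < ε / 16 by positivity),
    eventually_ge_atTop (24 * P.A)]
    with R hfar hR hτ hs1 he1 hb1 hb2 hosc hRA
  intro p q W a' ψ ψ₁ ψ₂ w w₁ a h hpq hl hW ha hh3
  have hR0 : 0 < R := by linarith
  have hτ0 : 0 < P.twist R := by linarith
  obtain ⟨Q, hQ⟩ : ∃ Q, Q = √(P.twist R) := ⟨_, rfl⟩
  rw [← hQ] at hs1 he1 hb1 hb2 hosc hfar ⊢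
  have hQ0 : 0 < Q := by rw [hQ]; positivity
  have hQQ : P.twist R = Q * Q := by rw [hQ, Real.mul_self_sqrt hτ0.le]
  have hh : ∀ x ∈ Ioo p q, P.nextY x (ψ x) ∈ Icc (R / 4) (4 * R) := fun x hx => by
    have h1 := abs_le.1 (abs_nextY_sub_le hA x (ψ x))
    have h2 := hh3 x hx
    exact ⟨by linarith [h2.1, h1.1], by linarith [h2.2, h1.2]⟩
  have hs0 : 0 < M / Q := by positivity
  have hs2 : M / Q ≤ 1 / 2 := by rw [div_le_iff₀ hQ0]; linarith
  have ht0 : 0 < e / Q := by positivity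
  have ht2 : e / Q ≤ 1 / 2 := by rw [div_le_iff₀ hQ0]; linarith
  have hwb : ∀ x ∈ Ioo p q,
      |windowTerm P a (M / Q) (P.nextX x (ψ x)) (P.nextY x (ψ x)) * w x| ≤ W := by
    intro x hx
    have hx2 := hh x hx
    have h1 := abs_windowTerm_le (P := P) (s := M / Q) (x := P.nextX x (ψ x)) ha
      (y := P.nextY x (ψ x)) ⟨by linarith [hx2.1], by linarith [hx2.2]⟩
    rw [abs_mul, abs_of_nonneg (h.nonneg x hx)]
    refine (mul_le_of_le_one_left (h.nonneg x hx) (h1.trans ?_)).trans (h.le x hx)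
    split_ifs <;> norm_num
  have hwi := integrableOn_Ioo_of_abs_le
    (h.aestronglyMeasurable_comp
      (f := fun x y => windowTerm P a (M / Q) (P.nextX x y) (P.nextY x y))
      (measurable_windowTerm_next ha)) hwb
  have hinc := abs_integral_increment_le hP h hR hτ hK hW hpq hl ha hs0 hs2
    (by rw [hQQ]; refine hb1.trans (le_of_eq ?_); field_simp)
  have hinc' : |∫ x in Ioo p q, outerTerm P a (M / Q) x (ψ x) * w x| ≤ ε / 4 * (W / Q) := by
    refine hinc.trans ?_
    have : 2 * (oscConst P (2 * P.A + 2 * K) * W / (P.twist R * (M / Q)))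
        = 2 * oscConst P (2 * P.A + 2 * K) / M * (W / Q) := by rw [hQQ]; field_simp
    rw [this]
    gcongr
  have hbig2 : P.kap * (1 + P.kap * K) ≤ P.A * P.twist R * (e / Q) := by
    rw [hQQ]
    refine hb2.trans (le_of_eq ?_)
    field_simp
  have hwin : |∫ x in Ioo p q, windowTerm P a (M / Q) (P.nextX x (ψ x)) (P.nextY x (ψ x)) * w x|
      ≤ 2 * (2 * (ε / 16 * (W / Q)) + ε / 8 * (W / Q)) + ε / 4 * (W / Q) := by
    refine abs_integral_le_of_sin_split hpq hl ht0 ht2 hwi (by positivity) (by positivity) ?_ ?_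
    · intro p' q' hp' hpq' hq' hs'
      have hsub : Ioo p' q' ⊆ Ioo p q := Ioo_subset_Ioo hp' hq'
      refine abs_integral_le_of_sin_split hpq' (by linarith) hr0 hr1 (hwi.mono_set hsub)
        (by positivity) (by positivity) ?_ ?_
      · intro p'' q'' hp'' hpq'' hq'' hs''
        have := hfar p'' q'' W a' ψ ψ₁ ψ₂ w w₁ a (h.mono (hp'.trans hp'') (hq''.trans hq')) hpq''
          (by linarith) hW ha hs''
          (fun x hx => hh x (hsub (Ioo_subset_Ioo hp'' hq'' hx)))
        rwa [mul_div_assoc] at this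
      · intro p'' q'' hp'' hpq'' hq'' hl'' _
        have hsub' := Ioo_subset_Ioo hp'' hq''
        have := abs_integral_window_near_le hP (h.mono (hp'.trans hp'') (hq''.trans hq')) hR hτ hK
          hW hpq'' ha hs0 ht0 hbig2 (fun x hx => hs' x (hsub' hx))
          (fun x hx => hh x (hsub (hsub' hx)))
        refine this.trans ?_
        have e1 : 10 * (M / Q) * (W * (q'' - p'')) ≤ 10 * (M / Q) * (W * (4 * r)) := by gcongr
        have e2 : 10 * (M / Q) * (W * (4 * r)) = 40 * M * r * (W / Q) := by ring
        have e3 : 10 * (M / Q) * (oscConst P K * (2 * Real.pi) * W / (P.twist R * (e / Q)))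
            = 10 * M * (oscConst P K * (2 * Real.pi)) / e / Q * (W / Q) := by
          rw [hQQ]
          field_simp
        have e4 : 40 * M * r * (W / Q) ≤ ε / 16 * (W / Q) := by gcongr
        have e5 : 10 * M * (oscConst P K * (2 * Real.pi)) / e / Q * (W / Q)
          ≤ ε / 16 * (W / Q) := by gcongr
        rw [mul_add, e3]
        linarith
    · intro p' q' hp' hpq' hq' hl' _
      have := abs_integral_Ioo_le_mul hpq'.le fun x hx => hwb x (Ioo_subset_Ioo hp' hq' hx)
      refine this.trans ?_
      calc W * (q' - p') ≤ W * (4 * (e / Q)) := by gcongr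
        _ = ε / 4 * (W / Q) := by rw [he]; ring
  have hsplit : ∫ x in Ioo p q, driftTerm P a (M / Q) x (ψ x) * w x
      = (∫ x in Ioo p q, outerTerm P a (M / Q) x (ψ x) * w x)
        + ∫ x in Ioo p q, windowTerm P a (M / Q) (P.nextX x (ψ x)) (P.nextY x (ψ x)) * w x := by
    rw [← integral_add _ hwi]
    · simp only [driftTerm, add_mul]
    · refine integrableOn_Ioo_of_abs_le (M := W)
        (h.aestronglyMeasurable_comp (measurable_outerTerm ha)) ?_
      intro x hx
      rw [abs_mul, abs_of_nonneg (h.nonneg x hx)]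
      exact (mul_le_of_le_one_left (h.nonneg x hx) (abs_outerTerm_le ha
        ⟨by linarith [(h.height x hx).1], by linarith [(h.height x hx).2]⟩)).trans (h.le x hx)
  rw [hsplit, mul_div_assoc]
  refine (abs_add_le _ _).trans ?_
  linarith

end RegCurve

/-- A bound on the logarithmic derivative of a weight that may vanish. -/
theorem le_exp_mul_of_abs_deriv_le {α β K : ℝ} {v v₁ : ℝ → ℝ}
    (hd : ∀ x ∈ Ioo α β, HasDerivAt v (v₁ x) x) (hr : ∀ x ∈ Ioo α β, |v₁ x| ≤ K * v x) {x y : ℝ}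
    (hx : x ∈ Ioo α β) (hy : y ∈ Ioo α β) : v x ≤ Real.exp (K * |x - y|) * v y := by
  have hE : ∀ c z : ℝ, HasDerivAt (fun z => Real.exp (c * z)) (Real.exp (c * z) * c) z := by
    intro c z
    simpa using ((hasDerivAt_id z).const_mul c).exp
  have hmul : ∀ c, ∀ z ∈ Ioo α β, HasDerivAt (fun z => v z * Real.exp (c * z))
      (Real.exp (c * z) * (v₁ z + c * v z)) z := by
    intro c z hz
    refine ((hd z hz).mul (hE c z)).congr_deriv ?_
    ring
  have hcont : ∀ c, ContinuousOn (fun z => v z * Real.exp (c * z)) (Ioo α β) := fun c z hz =>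
    (hmul c z hz).continuousAt.continuousWithinAt
  rcases le_total x y with hxy | hxy
  · have hm : MonotoneOn (fun z => v z * Real.exp (K * z)) (Ioo α β) := by
      refine monotoneOn_of_deriv_nonneg (convex_Ioo _ _) (hcont K) ?_ ?_
      · intro z hz
        rw [interior_Ioo] at hz
        exact (hmul K z hz).differentiableAt.differentiableWithinAt
      · intro z hz
        rw [interior_Ioo] at hz
        rw [(hmul K z hz).deriv]
        have := (abs_le.1 (hr z hz)).1
        exact mul_nonneg (Real.exp_pos _).le (by linarith)
    have h1 := hm hx hy hxy
    simp only at h1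
    have e : Real.exp (K * |x - y|) * Real.exp (K * x) = Real.exp (K * y) := by
      rw [← Real.exp_add, abs_of_nonpos (by linarith)]
      congr 1
      ring
    rw [← e, mul_comm (Real.exp _) (Real.exp _), mul_comm (v y), mul_assoc, mul_comm (v x)] at h1
    exact le_of_mul_le_mul_left h1 (Real.exp_pos _)
  · have hm : AntitoneOn (fun z => v z * Real.exp (-K * z)) (Ioo α β) := by
      refine antitoneOn_of_deriv_nonpos (convex_Ioo _ _) (hcont _) ?_ ?_
      · intro z hz
        rw [interior_Ioo] at hz
        exact (hmul _ z hz).differentiableAt.differentiableWithinAt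
      · intro z hz
        rw [interior_Ioo] at hz
        rw [(hmul _ z hz).deriv]
        have := (abs_le.1 (hr z hz)).2
        exact mul_nonpos_of_nonneg_of_nonpos (Real.exp_pos _).le (by linarith)
    have h1 := hm hy hx hxy
    simp only at h1
    have e : Real.exp (K * |x - y|) * Real.exp (-K * x) = Real.exp (-K * y) := by
      rw [← Real.exp_add, abs_of_nonneg (by linarith)]
      congr 1
      ring
    rw [← e, mul_comm (Real.exp _) (Real.exp _), mul_comm (v y), mul_assoc, mul_comm (v x)] at h1
    exact le_of_mul_le_mul_left h1 (Real.exp_pos _)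

/-- Cutting a long interval into cells of unit length, on which the weight is nearly constant. -/
theorem abs_integral_le_of_cells {α β K V e : ℝ} {v v₁ k : ℝ → ℝ} (hαβ : α < β) (he : 0 ≤ e)
    (hK : 0 ≤ K) (hV : 0 ≤ V) (hd : ∀ x ∈ Ioo α β, HasDerivAt v (v₁ x) x)
    (h0 : ∀ x ∈ Ioo α β, 0 ≤ v x) (hvV : ∀ x ∈ Ioo α β, v x ≤ V)
    (hr : ∀ x ∈ Ioo α β, |v₁ x| ≤ K * v x) (hk : IntegrableOn k (Ioo α β))
    (hcell : ∀ p q W, α ≤ p → p < q → q ≤ β → q - p ≤ 1 → 0 ≤ W → (∀ x ∈ Ioo p q, v x ≤ W) →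
      |∫ x in Ioo p q, k x| ≤ e * W) :
    |∫ x in Ioo α β, k x| ≤ e * (V + Real.exp K * ∫ x in Ioo α β, v x) := by
  have hvi : IntegrableOn v (Ioo α β) := by
    refine integrableOn_Ioo_of_abs_le (M := V) ?_ fun x hx => by
      rw [abs_of_nonneg (h0 x hx)]
      exact hvV x hx
    exact ContinuousOn.aestronglyMeasurable
      (fun x hx => (hd x hx).continuousAt.continuousWithinAt) measurableSet_Ioo
  have main : ∀ n : ℕ, ∀ p, α ≤ p → p < β → β - p ≤ n →
      |∫ x in Ioo p β, k x| ≤ e * (V + Real.exp K * ∫ x in Ioo p β, v x) := by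
    intro n
    induction n with
    | zero =>
      intro p _ hp hn
      simp only [Nat.cast_zero] at hn
      linarith
    | succ n ih =>
      intro p hαp hp hn
      rw [Nat.cast_add, Nat.cast_one] at hn
      have hint0 : ∀ a b, α ≤ a → b ≤ β → 0 ≤ ∫ x in Ioo a b, v x := fun a b ha hb =>
        setIntegral_nonneg measurableSet_Ioo fun x hx => h0 x (Ioo_subset_Ioo ha hb hx)
      rcases le_or_gt (β - p) 1 with h1 | h1
      · refine (hcell p β V hαp hp le_rfl h1 hV fun x hx =>
          hvV x (Ioo_subset_Ioo_left hαp hx)).trans ?_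
        apply mul_le_mul_of_nonneg_left _ he
        have := mul_nonneg (Real.exp_pos K).le (hint0 p β hαp le_rfl)
        linarith
      · have hsub : Ioo p (p + 1) ⊆ Ioo α β := Ioo_subset_Ioo hαp (by linarith)
        have hvsub := hvi.mono_set hsub
        have hcl := hcell p (p + 1) (Real.exp K * ∫ x in Ioo p (p + 1), v x) hαp (by linarith)
          (by linarith) (by linarith)
          (mul_nonneg (Real.exp_pos K).le (hint0 _ _ hαp (by linarith))) (by
          intro x hx
          have h2 : ∫ _y in Ioo p (p + 1), v x = v x := by
            rw [setIntegral_const]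
            simp [Measure.real, Real.volume_Ioo]
          rw [← h2, ← integral_const_mul]
          refine setIntegral_mono_on (integrableOn_const (by simp)) (hvsub.const_mul _)
            measurableSet_Ioo fun y hy => ?_
          refine (le_exp_mul_of_abs_deriv_le hd hr (hsub hx) (hsub hy)).trans ?_
          apply mul_le_mul_of_nonneg_right _ (h0 y (hsub hy))
          apply Real.exp_le_exp.2
          refine mul_le_of_le_one_right hK ?_
          rw [abs_le]
          exact ⟨by linarith [hx.1, hy.2], by linarith [hx.2, hy.1]⟩)
        have hrec := ih (p + 1) (by linarith) (by linarith) (by linarith)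
        rw [setIntegral_Ioo_add_Ioo (c := p + 1) (by linarith) (by linarith)
          (hk.mono_set (Ioo_subset_Ioo_left hαp)),
          setIntegral_Ioo_add_Ioo (c := p + 1) (by linarith) (by linarith)
          (hvi.mono_set (Ioo_subset_Ioo_left hαp))]
        refine (abs_add_le _ _).trans ?_
        linarith
  obtain ⟨n, hn⟩ := exists_nat_ge (β - α)
  exact main n α le_rfl hαβ hn

namespace RegCurve

variable {P : Params}

set_option maxHeartbeats 1000000 in
/-- The drift along a curve and along its image are both negligible on the scale `1 / √Y'`. -/
theorem exists_abs_integral_drift_next_le (hP : P.Pos) {K ε : ℝ} (hK : 0 ≤ K) (hε : 0 < ε) :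
    ∃ M : ℝ, 0 < M ∧ ∀ᶠ R in atTop, ∀ (p q W a' : ℝ) (ψ ψ₁ ψ₂ w w₁ a : ℝ → ℝ),
      RegCurve P R K W p q ψ ψ₁ ψ₂ w w₁ → p < q → q - p ≤ 1 → 0 ≤ W → IsWeight R a a' →
      (∀ x ∈ Ioo p q, ψ x ∈ Icc (2 * R / 5) (5 * R / 2)) →
      |∫ x in Ioo p q, driftTerm P a (M / √(P.twist R)) x (ψ x) * w x|
        ≤ ε * W / √(P.twist R) ∧
      |∫ x in Ioo p q,
          driftTerm P a (M / √(P.twist R)) (P.nextX x (ψ x)) (P.nextY x (ψ x)) * w x|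
        ≤ ε * W / √(P.twist R) := by
  have hA := hP.A_pos
  have hk := hP.kap_pos
  have hC := curvConst_nonneg (K := K) hP
  obtain ⟨e, he⟩ : ∃ e, e = ε / 32 := ⟨_, rfl⟩
  have he0 : 0 < e := by rw [he]; positivity
  obtain ⟨K', hK'⟩ : ∃ K', K' = 2 * P.kap + K + curvConst P K * P.kap ^ 2 / (P.A * e) ^ 2 := ⟨_, rfl⟩
  have hK'0 : 0 ≤ K' := by rw [hK']; positivity
  have hKK' : K ≤ K' := by
    have : 0 ≤ curvConst P K * P.kap ^ 2 / (P.A * e) ^ 2 := by positivity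
    rw [hK']
    linarith
  obtain ⟨ε', hε'⟩ : ∃ ε', ε' = ε / (8 * (1 + Real.exp K')) := ⟨_, rfl⟩
  have hexp := Real.exp_pos K'
  have hε'0 : 0 < ε' := by rw [hε']; positivity
  have hε'1 : ε' * (1 + Real.exp K') = ε / 8 := by rw [hε']; field_simp
  obtain ⟨M, hM0, hM⟩ := exists_abs_integral_drift_le hP hK'0 hε'0
  refine ⟨M, hM0, ?_⟩
  have hsq : Tendsto (fun R => √(P.twist R)) atTop atTop :=
    Real.tendsto_sqrt_atTop.comp hP.twist_tendsto
  have hlt : Tendsto (fun R => P.A * e / P.kap * √(P.twist R)) atTop atTop :=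
    hsq.const_mul_atTop (by positivity)
  filter_upwards [hM, eventually_ge_atTop 1, hP.twist_tendsto.eventually_ge_atTop 1,
    hsq.eventually_ge_atTop (2 * e),
    (hsq.const_mul_atTop (mul_pos hA he0)).eventually_ge_atTop (P.kap * (1 + P.kap * K)),
    hlt.eventually_ge_atTop 1, (((tendsto_pow_atTop two_ne_zero).comp hlt).const_div_atTop
      (2 * P.kap * curvConst P K)).eventually_le_const (show (0 : ℝ) < P.A / 4 by positivity),
    eventually_ge_atTop (60 * P.A)]
    with R hdr hR hτ he1 hb1 hl1 hl2 hRA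
  intro p q W a' ψ ψ₁ ψ₂ w w₁ a h hpq hlen hW ha hh
  have hR0 : 0 < R := by linarith
  have hτ0 : 0 < P.twist R := by linarith
  simp only [Function.comp] at hl2
  obtain ⟨Q, hQ⟩ : ∃ Q, Q = √(P.twist R) := ⟨_, rfl⟩
  rw [← hQ] at he1 hb1 hl1 hl2 hdr ⊢
  have hQ0 : 0 < Q := by rw [hQ]; positivity
  have hQQ : P.twist R = Q * Q := by rw [hQ, Real.mul_self_sqrt hτ0.le]
  have hε'ε : ε' ≤ ε / 8 := by
    rw [← hε'1]
    exact le_mul_of_one_le_right hε'0.le (by linarith)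
  have hnext : ∀ x y, y ∈ Icc (2 * R / 5) (5 * R / 2) → P.nextY x y ∈ Icc (R / 3) (3 * R) := by
    intro x y hy
    have h1 := abs_le.1 (abs_nextY_sub_le hA x y)
    exact ⟨by linarith [hy.1, h1.1], by linarith [hy.2, h1.2]⟩
  have hnext2 : ∀ x y, y ∈ Icc (R / 3) (3 * R) → P.nextY x y ∈ Icc (R / 8) (8 * R) := by
    intro x y hy
    have h1 := abs_le.1 (abs_nextY_sub_le hA x y)
    exact ⟨by linarith [hy.1, h1.1], by linarith [hy.2, h1.2]⟩
  constructor
  · refine (hdr p q W a' ψ ψ₁ ψ₂ w w₁ a (h.mono_const hP hR0 hKK') hpq hlen hW ha fun x hx =>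
      ⟨by linarith [(hh x hx).1], by linarith [(hh x hx).2]⟩).trans ?_
    gcongr
    linarith
  have hb : ∀ x ∈ Ioo p q,
      |driftTerm P a (M / Q) (P.nextX x (ψ x)) (P.nextY x (ψ x)) * w x| ≤ 2 * W := by
    intro x hx
    have h1 := hnext x _ (hh x hx)
    rw [abs_mul, abs_of_nonneg (h.nonneg x hx)]
    have h2 := abs_driftTerm_le (P := P) (s := M / Q) (x := P.nextX x (ψ x))
      (y := P.nextY x (ψ x)) ha ⟨by linarith [h1.1], by linarith [h1.2]⟩ (hnext2 _ _ h1)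
    exact mul_le_mul h2 (h.le x hx) (h.nonneg x hx) (by norm_num)
  have hmeas : Measurable fun z : ℝ × ℝ =>
      driftTerm P a (M / Q) (P.nextX z.1 z.2) (P.nextY z.1 z.2) := by
    have h1 := (measurable_driftTerm (P := P) (s := M / Q) ha).comp
      ((measurable_nextX P).prodMk (measurable_nextY P))
    simpa only [Function.comp_def] using h1
  have hi := integrableOn_Ioo_of_abs_le (h.aestronglyMeasurable_comp
    (f := fun x y => driftTerm P a (M / Q) (P.nextX x y) (P.nextY x y)) hmeas) hb
  have ht0 : 0 < e / Q := by positivity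
  have key : |∫ x in Ioo p q, driftTerm P a (M / Q) (P.nextX x (ψ x)) (P.nextY x (ψ x)) * w x|
      ≤ 2 * (ε / 4 * (W / Q)) + ε / 4 * (W / Q) := by
    refine abs_integral_le_of_sin_split hpq hlen ht0 (by rw [div_le_iff₀ hQ0]; linarith) hi
      (by positivity) (by positivity) ?_ ?_
    swap
    · intro p' q' hp' hpq' hq' hl' _
      have := abs_integral_Ioo_le_mul hpq'.le fun x hx => hb x (Ioo_subset_Ioo hp' hq' hx)
      refine this.trans ?_
      calc 2 * W * (q' - p') ≤ 2 * W * (4 * (e / Q)) := by gcongr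
        _ = ε / 4 * (W / Q) := by rw [he]; ring
    intro p' q' hp' hpq' hq' hs'
    have hsub : Ioo p' q' ⊆ Ioo p q := Ioo_subset_Ioo hp' hq'
    have hreg' := h.mono hp' hq'
    have hhn : ∀ x ∈ Ioo p' q', P.nextY x (ψ x) ∈ Icc (R / 4) (4 * R) := fun x hx => by
      have h1 := hnext x _ (hh x (hsub hx))
      exact ⟨by linarith [h1.1], by linarith [h1.2]⟩
    obtain ⟨l, hl⟩ : ∃ l, l = P.A * P.twist R / P.kap * (e / Q) := ⟨_, rfl⟩
    have hl' : l = P.A * e / P.kap * Q := by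
      rw [hl, hQQ]
      field_simp
    rw [← hl'] at hl1 hl2
    have hl0 : 0 < l := by linarith
    obtain ⟨α, β, φ, φ₁, φ₂, v, v₁, hαβ, hreg, hur, -, -, -, -, hint⟩ :=
      hreg'.exists_image hP hR hτ hK hpq' (by linarith) (t := e / Q) (l := l) (K' := K')
        (by rw [hQQ]; refine hb1.trans (le_of_eq ?_); field_simp) hs' hl hl1 hl2
        (by
          have : 0 ≤ curvConst P K * P.kap ^ 2 / (P.A * e) ^ 2 := by positivity
          rw [hK']
          linarith)
        (by
          have e1 : K / l ≤ K := div_le_self hK hl1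
          have e2 : curvConst P K * P.twist R / l ^ 2
              = curvConst P K * P.kap ^ 2 / (P.A * e) ^ 2 := by
            rw [hl', hQQ]
            field_simp
          rw [e2, hK']
          linarith) hhn
    rw [hint (fun X y => driftTerm P a (M / Q) X y)]
    have hφ : ∀ X ∈ Ioo α β, φ X ∈ Icc (R / 3) (3 * R) := by
      intro X hX
      obtain ⟨x, hx, hx2⟩ := hur X hX
      have h1 := hh x (hsub hx)
      have h2 := Real.neg_one_le_cos X
      have h3 := Real.cos_le_one X
      have h4 : φ X = ψ x + 2 * P.A * Real.cos X := by linarith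
      rw [h4]
      constructor <;> nlinarith [h1.1, h1.2]
    have hV0 : 0 ≤ W / l := by positivity
    have hki : IntegrableOn (fun X => driftTerm P a (M / Q) X (φ X) * v X) (Ioo α β) :=
      integrableOn_Ioo_of_abs_le (M := 2 * (W / l))
        (hreg.aestronglyMeasurable_comp (measurable_driftTerm ha)) (by
        intro X hX
        have h1 := hφ X hX
        rw [abs_mul, abs_of_nonneg (hreg.nonneg X hX)]
        exact mul_le_mul (abs_driftTerm_le ha ⟨by linarith [h1.1], by linarith [h1.2]⟩
          (hnext2 _ _ h1)) (hreg.le X hX) (hreg.nonneg X hX) (by norm_num))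
    refine (abs_integral_le_of_cells (e := ε' / Q) hαβ (by positivity) hK'0 hV0 hreg.derw
      hreg.nonneg hreg.le hreg.regular hki ?_).trans ?_
    · intro p₁ q₁ W₁ hp₁ hpq₁ hq₁ hl₁ hW₁ hv
      refine (hdr p₁ q₁ W₁ a' φ φ₁ φ₂ v v₁ a ((hreg.mono hp₁ hq₁).mono_weight hv) hpq₁ hl₁ hW₁ ha
        fun X hX => hφ X (Ioo_subset_Ioo hp₁ hq₁ hX)).trans (le_of_eq ?_)
      ring
    · have h1 : ∫ X in Ioo α β, v X ≤ W := by
        have h2 := hint fun _ _ => 1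
        simp only [one_mul] at h2
        rw [← h2]
        refine (le_abs_self _).trans ((abs_integral_Ioo_le_mul (V := W) hpq'.le fun x hx => ?_).trans
          (mul_le_of_le_one_right hW (by linarith)))
        rw [abs_of_nonneg (hreg'.nonneg x hx)]
        exact hreg'.le x hx
      have h2 : W / l ≤ W := div_le_self hW hl1
      calc ε' / Q * (W / l + Real.exp K' * ∫ X in Ioo α β, v X)
          ≤ ε' / Q * (W + Real.exp K' * W) := by gcongr
        _ = ε' * (1 + Real.exp K') * (W / Q) := by ring
        _ = ε / 8 * (W / Q) := by rw [hε'1]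
        _ ≤ ε / 4 * (W / Q) := by gcongr; norm_num
  rw [mul_div_assoc]
  linarith [show 0 ≤ ε * (W / Q) by positivity]

end RegCurve

/-! ### Images of pairs -/

/-- A connected set of reals whose projection to the circle lies in the arc of an interval `(a, b)`
of length at most `2π` lies in one translate of this interval. -/
theorem exists_translate_of_isPreconnected {s : Set ℝ} (hs : IsPreconnected s) (hne : s.Nonempty)
    {a b : ℝ} (hab : b - a ≤ 2 * Real.pi)
    (h : ∀ x ∈ s, ∃ k : ℤ, x - 2 * Real.pi * k ∈ Ioo a b) :
    ∃ k : ℤ, ∀ x ∈ s, x - 2 * Real.pi * k ∈ Ioo a b := by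
  have hpi := Real.pi_pos
  obtain ⟨x₀, hx₀⟩ := hne
  obtain ⟨k, hk⟩ := h x₀ hx₀
  refine ⟨k, fun x hx => ?_⟩
  by_contra hc
  -- the end points of the translates are not attained
  have hend : ∀ z ∈ s, z ≠ a + 2 * Real.pi * k ∧ z ≠ b + 2 * Real.pi * k := by
    intro z hz
    obtain ⟨j, hj⟩ := h z hz
    constructor
    · rintro rfl
      have h1 : (0 : ℝ) < (k - j : ℤ) := by
        push_cast
        by_contra h0
        nlinarith [hj.1]
      have h2 : ((k - j : ℤ) : ℝ) < 1 := by
        push_cast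
        by_contra h0
        nlinarith [hj.2]
      have h3 : 0 < k - j := by exact_mod_cast h1
      have h4 : k - j < 1 := by exact_mod_cast h2
      omega
    · rintro rfl
      have h1 : (-1 : ℝ) < (k - j : ℤ) := by
        push_cast
        by_contra h0
        nlinarith [hj.1]
      have h2 : ((k - j : ℤ) : ℝ) < 0 := by
        push_cast
        by_contra h0
        nlinarith [hj.2]
      have h3 : -1 < k - j := by exact_mod_cast h1
      have h4 : k - j < 0 := by exact_mod_cast h2
      omega
  have hoc := hs.ordConnected
  rw [mem_Ioo, not_and_or, not_lt, not_lt] at hc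
  rcases hc with hc | hc
  · exact (hend _ (hoc.out hx hx₀ ⟨by linarith, by linarith [hk.1]⟩)).1 rfl
  · exact (hend _ (hoc.out hx₀ hx ⟨by linarith [hk.2], by linarith⟩)).2 rfl

namespace CurvePair

variable {P : Params} {L ystar : ℝ} {F : Phase → Phase} {ℓ ℓ' m : CurvePair} {u v : ℝ}

/-- The rate of expansion along the curve of `ℓ`, written without division. -/
def rate (P : Params) (ℓ : CurvePair) : ℝ → ℝ := phaseRate P ℓ.ψ (deriv ℓ.ψ)

theorem expansion_eq_rate (hP : P.Pos) {x : ℝ} (hx : 0 < ℓ.ψ x) :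
    ℓ.expansion P x = ℓ.rate P x := by
  unfold expansion rate phaseRate
  have := (hP.twist_pos hx).ne'
  rw [Params.deriv_Y hx]
  field_simp
  ring

/-- `g` is a lift of the map `x ↦ x + Y(ψ(x))` on `(u, v)`, which takes the part of the curve of `ℓ`
over `(u, v)` to the curve of `ℓ'`; `c` is the constant that normalizes the density. -/
structure IsLift (P : Params) (ℓ : CurvePair) (u v : ℝ) (ℓ' : CurvePair) (g : ℝ → ℝ) (c : ℝ) :
    Prop where
  lift : ∃ k : ℤ, ∀ x, g x = P.nextX x (ℓ.ψ x) - 2 * Real.pi * k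
  image : g '' Ioo u v = Ioo ℓ'.a ℓ'.b
  inj : InjOn g (Ioo u v)
  der : ∀ x ∈ Ioo u v, HasDerivAt g (ℓ.rate P x) x
  rate_ne : ∀ x ∈ Ioo u v, ℓ.rate P x ≠ 0
  curve : ∀ x ∈ Ioo u v, ℓ'.ψ (g x) = P.nextY x (ℓ.ψ x)
  const_pos : 0 < c
  density : ∀ x ∈ Ioo u v, ℓ'.ρ (g x) = c * ℓ.ρ x / |ℓ.rate P x|

theorem IsBasic.hasDerivAt (h : ℓ.IsBasic ystar) {x : ℝ} (hx : x ∈ Ioo ℓ.a ℓ.b) :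
    HasDerivAt ℓ.ψ (deriv ℓ.ψ x) x :=
  ((h.smooth_curve.contDiffAt (isOpen_Ioo.mem_nhds hx)).differentiableAt (by simp)).hasDerivAt

theorem IsBasic.hasDerivAt_deriv (h : ℓ.IsBasic ystar) {x : ℝ} (hx : x ∈ Ioo ℓ.a ℓ.b) :
    HasDerivAt (deriv ℓ.ψ) (deriv (deriv ℓ.ψ) x) x := by
  have h1 := (contDiffOn_infty_iff_deriv_of_isOpen isOpen_Ioo).1 h.smooth_curve
  exact ((h1.2.contDiffAt (isOpen_Ioo.mem_nhds hx)).differentiableAt (by simp)).hasDerivAt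

theorem IsBasic.hasDerivAt_density (h : ℓ.IsBasic ystar) {x : ℝ} (hx : x ∈ Ioo ℓ.a ℓ.b) :
    HasDerivAt ℓ.ρ (deriv ℓ.ρ x) x :=
  ((h.smooth_density.contDiffAt (isOpen_Ioo.mem_nhds hx)).differentiableAt (by simp)).hasDerivAt

theorem IsBasic.hasDerivAt_nextX (h : ℓ.IsBasic ystar) (hy : 0 < ystar) {x : ℝ}
    (hx : x ∈ Ioo ℓ.a ℓ.b) : HasDerivAt (fun x => P.nextX x (ℓ.ψ x)) (ℓ.rate P x) x :=
  (hasDerivAt_id x).add ((Params.hasDerivAt_Y (hy.trans_le (h.height x hx))).comp x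
    (h.hasDerivAt hx))

theorem apply_coe (hF : P.IsTwistMap L F) {x y : ℝ} (hy : L < y) :
    F ((x : Real.Angle), y) = (((P.nextX x y : ℝ) : Real.Angle), P.nextY x y) := by
  rw [hF _ _ hy]
  simp only [Params.dphi, Params.nextY, Params.nextX, ← Real.Angle.coe_add, Real.Angle.cos_coe,
    mul_assoc]

theorem eq_of_coe_eq_of_mem {a b x y : ℝ} (hab : b - a ≤ 2 * Real.pi) (hx : x ∈ Ioo a b)
    (hy : y ∈ Ioo a b) (h : (x : Real.Angle) = y) : x = y := by
  obtain ⟨m, hm⟩ := Real.Angle.angle_eq_iff_two_pi_dvd_sub.1 h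
  have hpi := Real.pi_pos
  have hlt : (m : ℝ) < 1 := by
    by_contra hge
    nlinarith [hx.1, hx.2, hy.1, hy.2]
  have hgt : (-1 : ℝ) < m := by
    by_contra hge
    nlinarith [hx.1, hx.2, hy.1, hy.2]
  have h5 : m < 1 := by exact_mod_cast hlt
  have h6 : -1 < m := by exact_mod_cast hgt
  have hm0 : m = 0 := by omega
  rw [hm0] at hm
  simp at hm
  linarith

/-- The image of a pair is described by a lift. The density of the image is positive, hence the
rate of expansion does not vanish, and the lift is injective. -/
theorem IsImage.exists_isLift (hP : P.Pos) (hF : P.IsTwistMap L F) (hL : 0 ≤ L) (hy : L < ystar)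
    (h : ℓ.IsBasic ystar) (h' : ℓ'.IsBasic ystar) (hu : ℓ.a ≤ u) (huv : u < v) (hv : v ≤ ℓ.b)
    (hi : ℓ.IsImage P F u v ℓ') : ∃ g c, IsLift P ℓ u v ℓ' g c := by
  obtain ⟨him, c, hc, hden⟩ := hi
  have hy0 : 0 < ystar := by linarith
  have hsub : Ioo u v ⊆ Ioo ℓ.a ℓ.b := Ioo_subset_Ioo hu hv
  have hFx : ∀ x ∈ Ioo u v, F ((x : Real.Angle), ℓ.ψ x)
      = (((P.nextX x (ℓ.ψ x) : ℝ) : Real.Angle), P.nextY x (ℓ.ψ x)) := fun x hx =>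
    apply_coe hF (hy.trans_le (h.height x (hsub hx)))
  have hG : ∀ x ∈ Ioo u v, HasDerivAt (fun x => P.nextX x (ℓ.ψ x)) (ℓ.rate P x) x := fun x hx =>
    h.hasDerivAt_nextX hy0 (hsub hx)
  have hcoe : ∀ (X : ℝ) (k : ℤ), ((X - 2 * Real.pi * k : ℝ) : Real.Angle) = X := fun X k => by
    rw [Real.Angle.angle_eq_iff_two_pi_dvd_sub]
    exact ⟨-k, by push_cast; ring⟩
  obtain ⟨k, hk⟩ := exists_translate_of_isPreconnected
    (s := (fun x => P.nextX x (ℓ.ψ x)) '' Ioo u v)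
    (isPreconnected_Ioo.image _ fun x hx => (hG x hx).continuousAt.continuousWithinAt)
    ((nonempty_Ioo.2 huv).image _) h'.length_le (by
      rintro _ ⟨x, hx, rfl⟩
      have : F ((x : Real.Angle), ℓ.ψ x) ∈ ℓ'.curve := him ▸ mem_image_of_mem F ⟨x, hx, rfl⟩
      obtain ⟨x', hx', he⟩ := this
      rw [hFx x hx] at he
      obtain ⟨m, hm⟩ := Real.Angle.angle_eq_iff_two_pi_dvd_sub.1 (congrArg Prod.fst he)
      refine ⟨-m, ?_⟩
      have : P.nextX x (ℓ.ψ x) - 2 * Real.pi * (-m : ℤ) = x' := by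
        push_cast
        linarith
      rwa [this])
  obtain ⟨g, hg⟩ : ∃ g : ℝ → ℝ, g = fun x => P.nextX x (ℓ.ψ x) - 2 * Real.pi * k := ⟨_, rfl⟩
  have hgm : ∀ x ∈ Ioo u v, g x ∈ Ioo ℓ'.a ℓ'.b := fun x hx => hg ▸ hk _ ⟨x, hx, rfl⟩
  have hgc : ∀ x, ((g x : ℝ) : Real.Angle) = P.nextX x (ℓ.ψ x) := fun x => by rw [hg, hcoe]
  have hgψ : ∀ x ∈ Ioo u v, ℓ'.ψ (g x) = P.nextY x (ℓ.ψ x) := by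
    intro x hx
    have : F ((x : Real.Angle), ℓ.ψ x) ∈ ℓ'.curve := him ▸ mem_image_of_mem F ⟨x, hx, rfl⟩
    obtain ⟨x', hx', he⟩ := this
    rw [hFx x hx] at he
    have h1 := congrArg Prod.fst he
    have h2 := congrArg Prod.snd he
    simp only at h1 h2
    rw [← hgc] at h1
    rw [← eq_of_coe_eq_of_mem h'.length_le hx' (hgm x hx) h1, h2]
  have hgρ : ∀ x ∈ Ioo u v, ℓ'.ρ (g x) = c * ℓ.ρ x / |ℓ.rate P x| := by
    intro x hx
    rw [← expansion_eq_rate hP (hy0.trans_le (h.height x (hsub hx)))]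
    apply hden x hx (g x) (hgm x hx)
    rw [hFx x hx, hgc, hgψ x hx]
  -- where the rate vanishes, no positive density satisfies the formula for the image
  have hne : ∀ x ∈ Ioo u v, ℓ.rate P x ≠ 0 := by
    intro x hx h0
    have h1 := h'.density_pos _ (hgm x hx)
    rw [hgρ x hx, h0] at h1
    simp at h1
  have hder : ∀ x ∈ Ioo u v, HasDerivAt g (ℓ.rate P x) x := fun x hx => by
    rw [hg]
    exact (hG x hx).sub_const _
  have hgcont : ContinuousOn g (Ioo u v) := fun x hx => (hder x hx).continuousAt.continuousWithinAt
  have hinj : InjOn g (Ioo u v) := by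
    rcases hasDerivWithinAt_forall_lt_or_forall_gt_of_forall_ne (convex_Ioo u v)
      (fun x hx => (hder x hx).hasDerivWithinAt) hne with h1 | h1
    · refine (strictAntiOn_of_deriv_neg (convex_Ioo u v) hgcont fun x hx => ?_).injOn
      rw [interior_Ioo] at hx
      rw [(hder x hx).deriv]
      exact h1 x hx
    · refine (strictMonoOn_of_deriv_pos (convex_Ioo u v) hgcont fun x hx => ?_).injOn
      rw [interior_Ioo] at hx
      rw [(hder x hx).deriv]
      exact h1 x hx
  refine ⟨g, c, ⟨k, fun x => by rw [hg]⟩, ?_, hinj, hder, hne, hgψ, hc, hgρ⟩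
  refine Subset.antisymm (image_subset_iff.2 hgm) fun x' hx' => ?_
  have : ((x' : Real.Angle), ℓ'.ψ x') ∈ F '' ℓ.arc u v := him ▸ ⟨x', hx', rfl⟩
  obtain ⟨_, ⟨x, hx, rfl⟩, he⟩ := this
  simp only [hFx x hx] at he
  have h1 := congrArg Prod.fst he
  simp only at h1
  rw [← hgc] at h1
  exact ⟨x, hx, eq_of_coe_eq_of_mem h'.length_le (hgm x hx) hx' h1⟩

namespace IsLift

variable {g : ℝ → ℝ} {c : ℝ}

theorem mem (h : IsLift P ℓ u v ℓ' g c) {x : ℝ} (hx : x ∈ Ioo u v) : g x ∈ Ioo ℓ'.a ℓ'.b :=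
  h.image ▸ mem_image_of_mem g hx

theorem continuousOn (h : IsLift P ℓ u v ℓ' g c) : ContinuousOn g (Ioo u v) := fun x hx =>
  (h.der x hx).continuousAt.continuousWithinAt

theorem coe_eq (h : IsLift P ℓ u v ℓ' g c) (x : ℝ) :
    ((g x : ℝ) : Real.Angle) = P.nextX x (ℓ.ψ x) := by
  obtain ⟨k, hk⟩ := h.lift
  rw [hk, Real.Angle.angle_eq_iff_two_pi_dvd_sub]
  exact ⟨-k, by push_cast; ring⟩

theorem integral_eq (h : IsLift P ℓ u v ℓ' g c) (f : ℝ → ℝ) :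
    ∫ x in Ioo ℓ'.a ℓ'.b, f x * ℓ'.ρ x = c * ∫ x in Ioo u v, f (g x) * ℓ.ρ x := by
  rw [← h.image, integral_image_eq_integral_abs_deriv_smul measurableSet_Ioo
    (fun x hx => (h.der x hx).hasDerivWithinAt) h.inj, ← integral_const_mul]
  refine setIntegral_congr_fun measurableSet_Ioo fun x hx => ?_
  simp only [smul_eq_mul]
  rw [h.density x hx]
  have := abs_pos.2 (h.rate_ne x hx)
  field_simp

/-- The normalizing constant is the inverse of the probability of the piece. -/
theorem integral_piece (h : IsLift P ℓ u v ℓ' g c) (h' : ℓ'.IsBasic ystar) (f : ℝ → ℝ) :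
    ∫ x in Ioo u v, f (g x) * ℓ.ρ x
      = (∫ x in Ioo u v, ℓ.ρ x) * ∫ x in Ioo ℓ'.a ℓ'.b, f x * ℓ'.ρ x := by
  have h1 := h.integral_eq fun _ => 1
  simp only [one_mul] at h1
  rw [h'.density_integral] at h1
  rw [h.integral_eq, ← mul_assoc, mul_comm _ c, ← h1, one_mul]

end IsLift

end CurvePair

/-! ### The recursion over the pieces of a cutting rule -/

namespace CurvePair

variable {P : Params} {L ystar : ℝ} {F : Phase → Phase} {ℓ : CurvePair}

/-- The part of the base of `ℓ` over which the curve lies in `E`. -/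
def trace (ℓ : CurvePair) (E : Set Phase) : Set ℝ :=
  {x | x ∈ Ioo ℓ.a ℓ.b ∧ ((x : Real.Angle), ℓ.ψ x) ∈ E}

theorem IsBasic.integrable_density (h : ℓ.IsBasic ystar) : IntegrableOn ℓ.ρ (Ioo ℓ.a ℓ.b) := by
  by_contra hc
  have := integral_undef hc
  rw [h.density_integral] at this
  exact one_ne_zero this

theorem prob_eq_setIntegral {E : Set Phase} (hE : MeasurableSet (ℓ.trace E)) :
    ℓ.prob E = ∫ x in ℓ.trace E, ℓ.ρ x := by
  have hsub : ℓ.trace E ⊆ Ioo ℓ.a ℓ.b := fun x hx => hx.1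
  unfold prob expect
  rw [← inter_eq_left.2 hsub, ← Measure.restrict_restrict hE, ← integral_indicator hE]
  refine setIntegral_congr_fun measurableSet_Ioo fun x hx => ?_
  by_cases hxE : ((x : Real.Angle), ℓ.ψ x) ∈ E
  · have h1 : x ∈ ℓ.trace E := ⟨hx, hxE⟩
    simp [indicator_of_mem h1, indicator_of_mem hxE]
  · have h1 : x ∉ ℓ.trace E := fun h => hxE h.2
    simp [indicator_of_notMem h1, indicator_of_notMem hxE]

theorem IsBasic.prob_le_one (h : ℓ.IsBasic ystar) {E : Set Phase}
    (hE : MeasurableSet (ℓ.trace E)) : ℓ.prob E ≤ 1 := by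
  rw [prob_eq_setIntegral hE, ← h.density_integral]
  refine setIntegral_mono_set h.integrable_density ?_ (LE.le.eventuallyLE fun x hx => hx.1)
  filter_upwards [ae_restrict_mem measurableSet_Ioo] with x hx using (h.density_pos x hx).le

theorem IsBasic.prob_compl (h : ℓ.IsBasic ystar) {E : Set Phase}
    (hE : MeasurableSet (ℓ.trace E)) : ℓ.prob Eᶜ = 1 - ℓ.prob E := by
  have e : ℓ.trace Eᶜ = Ioo ℓ.a ℓ.b \ ℓ.trace E := by
    ext x
    simp only [trace, mem_ofPred_eq, mem_compl_iff, Set.mem_sdiff]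
    tauto
  rw [prob_eq_setIntegral hE, prob_eq_setIntegral (e ▸ measurableSet_Ioo.diff hE), e,
    ← h.density_integral, setIntegral_sdiff hE h.integrable_density fun x hx => hx.1]

/-- The probability of a piece. -/
def mass (ℓ : CurvePair) (c : Piece) : ℝ := ∫ x in Ioo c.left c.right, ℓ.ρ x

end CurvePair

/-- A piece is described by one lift, or by two successive lifts. -/
theorem IsAdmissiblePiece.exists_isLift {P : Params} {L ystar : ℝ} {F : Phase → Phase}
    {ℓ : CurvePair} {c : Piece} (h : IsAdmissiblePiece P ystar F ℓ c) (hP : P.Pos)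
    (hF : P.IsTwistMap L F) (hL : 0 ≤ L) (hy : L < ystar) (hℓ : ℓ.IsBasic ystar) :
    (c.steps = 1 ∧ ∃ g k, CurvePair.IsLift P ℓ c.left c.right c.target g k) ∨
    (c.steps = 2 ∧ ∃ m g k g' k', m.IsBasic ystar ∧ CurvePair.IsLift P ℓ c.left c.right m g k ∧
      CurvePair.IsLift P m m.a m.b c.target g' k') := by
  obtain ⟨h1, h2, h3, h4, h5⟩ := h
  rcases h5 with ⟨hs, hi⟩ | ⟨hs, m, hm, hi, hi'⟩
  · obtain ⟨g, k, hg⟩ := hi.exists_isLift hP hF hL hy hℓ h4.toIsBasic h1 h2 h3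
    exact Or.inl ⟨hs, g, k, hg⟩
  · obtain ⟨g, k, hg⟩ := hi.exists_isLift hP hF hL hy hℓ hm h1 h2 h3
    obtain ⟨g', k', hg'⟩ := hi'.exists_isLift hP hF hL hy hm h4.toIsBasic le_rfl hm.lt le_rfl
    exact Or.inr ⟨hs, m, g, k, g', k', hm, hg, hg'⟩

/-- Each piece is carried to its target by a continuous map of the bases, and the conditional
distribution on the piece is carried to the distribution on the target. -/
theorem IsAdmissiblePiece.exists_map {P : Params} {L ystar : ℝ} {F : Phase → Phase}
    {ℓ : CurvePair} {c : Piece} (h : IsAdmissiblePiece P ystar F ℓ c) (hP : P.Pos)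
    (hF : P.IsTwistMap L F) (hL : 0 ≤ L) (hy : L < ystar) (hℓ : ℓ.IsBasic ystar) :
    ∃ g : ℝ → ℝ, ContinuousOn g (Ioo c.left c.right) ∧
      (∀ x ∈ Ioo c.left c.right, g x ∈ Ioo c.target.a c.target.b) ∧
      (∀ x ∈ Ioo c.left c.right,
        F^[c.steps] ((x : Real.Angle), ℓ.ψ x) = ((g x : Real.Angle), c.target.ψ (g x))) ∧
      ∀ f : ℝ → ℝ, ∫ x in Ioo c.left c.right, f (g x) * ℓ.ρ x
        = ℓ.mass c * ∫ x in Ioo c.target.a c.target.b, f x * c.target.ρ x := by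
  have h4 := h.2.2.2.1
  have hFx : ∀ (m : CurvePair), m.IsBasic ystar → ∀ x ∈ Ioo m.a m.b, F ((x : Real.Angle), m.ψ x)
      = (((P.nextX x (m.ψ x) : ℝ) : Real.Angle), P.nextY x (m.ψ x)) := fun m hm x hx =>
    CurvePair.apply_coe hF (hy.trans_le (hm.height x hx))
  have hsub : Ioo c.left c.right ⊆ Ioo ℓ.a ℓ.b := Ioo_subset_Ioo h.1 h.2.2.1
  rcases h.exists_isLift hP hF hL hy hℓ with ⟨hs, g, k, hg⟩ | ⟨hs, m, g, k, g', k', hm, hg, hg'⟩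
  · refine ⟨g, hg.continuousOn, fun x hx => hg.mem hx, fun x hx => ?_,
      fun f => hg.integral_piece h4.toIsBasic f⟩
    rw [hs, Function.iterate_one, hFx ℓ hℓ x (hsub hx), hg.coe_eq, hg.curve x hx]
  · refine ⟨g' ∘ g, hg'.continuousOn.comp hg.continuousOn fun x hx => hg.mem hx,
      fun x hx => hg'.mem (hg.mem hx), fun x hx => ?_, fun f => ?_⟩
    · rw [hs, Function.iterate_succ, Function.iterate_one, Function.comp, hFx ℓ hℓ x (hsub hx)]
      rw [← hg.coe_eq, ← hg.curve x hx, hFx m hm _ (hg.mem hx), Function.comp, hg'.coe_eq,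
        hg'.curve _ (hg.mem hx)]
    · have e1 := hg.integral_piece hm fun x => f (g' x)
      have e2 := hg'.integral_piece h4.toIsBasic f
      rw [hm.density_integral, one_mul] at e2
      simp only [Function.comp]
      rw [e1, e2]
      rfl

theorem IsAdmissiblePiece.one_le_steps {P : Params} {ystar : ℝ} {F : Phase → Phase}
    {ℓ : CurvePair} {c : Piece} (h : IsAdmissiblePiece P ystar F ℓ c) : 1 ≤ c.steps := by
  rcases h.2.2.2.2 with ⟨hs, -⟩ | ⟨hs, -⟩ <;> omega

namespace CuttingRule

variable {P : Params} {L ystar : ℝ} {F : Phase → Phase} (S : CuttingRule P ystar F)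
  {ℓ : CurvePair} {G Q : CurvePair → Prop}

theorem piece_subset (hℓ : ℓ.IsStandard P ystar) {c : Piece} (hc : c ∈ S.pieces ℓ) :
    Ioo c.left c.right ⊆ Ioo ℓ.a ℓ.b :=
  Ioo_subset_Ioo (S.admissible ℓ hℓ c hc).1 (S.admissible ℓ hℓ c hc).2.2.1

theorem countable_pieces (hℓ : ℓ.IsStandard P ystar) : (S.pieces ℓ).Countable :=
  PairwiseDisjoint.countable_of_isOpen (s := fun c : Piece => Ioo c.left c.right)
    (S.disjoint ℓ hℓ) (fun _ _ => isOpen_Ioo)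
    fun c hc => nonempty_Ioo.2 (S.admissible ℓ hℓ c hc).2.1

theorem hasSum_pieces (hℓ : ℓ.IsStandard P ystar) {f : ℝ → ℝ} {A : Piece → Set ℝ}
    (hA : ∀ c ∈ S.pieces ℓ, MeasurableSet (A c)) (hAc : ∀ c, A c ⊆ Ioo c.left c.right)
    (hf : IntegrableOn f (Ioo ℓ.a ℓ.b)) :
    HasSum (fun c : S.pieces ℓ => ∫ x in A c, f x) (∫ x in ⋃ c : S.pieces ℓ, A c, f x) := by
  have := (S.countable_pieces hℓ).to_subtype
  refine hasSum_integral_iUnion (fun c => hA c c.2) (fun c d hcd => ?_) (hf.mono_set ?_)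
  · exact (S.disjoint ℓ hℓ c.2 d.2 (Subtype.coe_ne_coe.2 hcd)).mono (hAc c) (hAc d)
  · exact iUnion_subset fun c => (hAc c).trans (S.piece_subset hℓ c.2)

theorem mem_arc_iff (hℓ : ℓ.IsStandard P ystar) {c : Piece} (hc : c ∈ S.pieces ℓ) {x : ℝ}
    (hx : x ∈ Ioo ℓ.a ℓ.b) :
    ((x : Real.Angle), ℓ.ψ x) ∈ ℓ.arc c.left c.right ↔ x ∈ Ioo c.left c.right := by
  refine ⟨?_, fun h => ⟨x, h, rfl⟩⟩
  rintro ⟨x', hx', he⟩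
  rwa [← CurvePair.eq_of_coe_eq_of_mem hℓ.length_le (S.piece_subset hℓ hc hx') hx
    (congrArg Prod.fst he)]

theorem reaches_iff {p : Phase} {n : ℕ} {ℓ' : CurvePair} :
    S.Reaches G ℓ p n ℓ' ↔ (n = 0 ∧ ℓ' = ℓ) ∨ (G ℓ ∧ ∃ c ∈ S.pieces ℓ,
      p ∈ ℓ.arc c.left c.right ∧
        ∃ j, n = j + c.steps ∧ S.Reaches G c.target (F^[c.steps] p) j ℓ') := by
  constructor
  · intro h
    cases h with
    | start => exact Or.inl ⟨rfl, rfl⟩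
    | move _ _ c j _ hG hc hp hr => exact Or.inr ⟨hG, c, hc, hp, j, rfl, hr⟩
  · rintro (⟨rfl, rfl⟩ | ⟨hG, c, hc, hp, j, rfl, hr⟩)
    · exact .start _ _
    · exact .move _ _ c j _ hG hc hp hr

/-- The points from which a pair with the property `Q` is reached in exactly `n` iterates. -/
def reachSet (G Q : CurvePair → Prop) (ℓ : CurvePair) (n : ℕ) : Set Phase :=
  {p | ∃ ℓ', S.Reaches G ℓ p n ℓ' ∧ Q ℓ'}

theorem isOpen_trace_reachSet (hP : P.Pos) (hF : P.IsTwistMap L F) (hL : 0 ≤ L) (hy : L < ystar)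
    (n : ℕ) (ℓ : CurvePair) (hℓ : ℓ.IsStandard P ystar) :
    IsOpen (ℓ.trace (S.reachSet G Q ℓ n)) := by
  induction n using Nat.strong_induction_on generalizing ℓ with
  | _ n ih =>
    by_cases h0 : n = 0 ∧ Q ℓ
    · have : ℓ.trace (S.reachSet G Q ℓ n) = Ioo ℓ.a ℓ.b := by
        ext x
        simp only [CurvePair.trace, mem_ofPred_eq, and_iff_left_iff_imp]
        intro _
        exact ⟨ℓ, h0.1 ▸ .start _ _, h0.2⟩
      rw [this]
      exact isOpen_Ioo
    by_cases hG : G ℓ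
    swap
    · have : ℓ.trace (S.reachSet G Q ℓ n) = ∅ := by
        rw [eq_empty_iff_forall_notMem]
        rintro x ⟨-, ℓ', hr, hQ⟩
        rcases S.reaches_iff.1 hr with ⟨h1, rfl⟩ | ⟨hG', -⟩
        · exact h0 ⟨h1, hQ⟩
        · exact hG hG'
      rw [this]
      exact isOpen_empty
    choose! g hgc hgm hgF hgi using fun (c : Piece) (hc : c ∈ S.pieces ℓ) =>
      (S.admissible ℓ hℓ c hc).exists_map hP hF hL hy hℓ.toIsBasic
    have : ℓ.trace (S.reachSet G Q ℓ n) = ⋃ c ∈ S.pieces ℓ, ⋃ (_ : c.steps ≤ n),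
        (Ioo c.left c.right ∩ g c ⁻¹' c.target.trace (S.reachSet G Q c.target (n - c.steps))) := by
      ext x
      simp only [mem_iUnion, exists_prop, mem_inter_iff, mem_preimage]
      constructor
      · rintro ⟨hx, ℓ', hr, hQ⟩
        rcases S.reaches_iff.1 hr with ⟨h1, rfl⟩ | ⟨-, c, hc, hp, j, rfl, hr'⟩
        · exact absurd ⟨h1, hQ⟩ h0
        · rw [S.mem_arc_iff hℓ hc hx] at hp
          refine ⟨c, hc, Nat.le_add_left _ _, hp, hgm c hc x hp, ℓ', ?_, hQ⟩
          rw [Nat.add_sub_cancel, ← hgF c hc x hp]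
          exact hr'
      · rintro ⟨c, hc, hcn, hx, -, ℓ', hr, hQ⟩
        refine ⟨S.piece_subset hℓ hc hx, ℓ', S.reaches_iff.2 (Or.inr ⟨hG, c, hc, ⟨x, hx, rfl⟩, _,
          (Nat.sub_add_cancel hcn).symm, ?_⟩), hQ⟩
        rw [hgF c hc x hx]
        exact hr
    rw [this]
    refine isOpen_biUnion fun c hc => isOpen_iUnion fun hcn => ?_
    have h1 := (S.admissible ℓ hℓ c hc).one_le_steps
    exact (hgc c hc).isOpen_inter_preimage isOpen_Ioo
      (ih _ (by omega) _ (S.admissible ℓ hℓ c hc).2.2.2.1)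

theorem le_time_iff {p : Phase} {s : ℕ} :
    (s : ℕ∞) ≤ S.time G ℓ p ↔ ∃ n, s ≤ n ∧ ∃ ℓ', S.Reaches G ℓ p n ℓ' := by
  constructor
  · intro h
    rcases Nat.eq_zero_or_pos s with rfl | hs
    · exact ⟨0, le_rfl, ℓ, .start _ _⟩
    by_contra! hc
    have : S.time G ℓ p ≤ ((s - 1 : ℕ) : ℕ∞) := by
      refine iSup₂_le fun n hn => ?_
      obtain ⟨ℓ', hr⟩ := hn
      have hlt : n < s := not_le.1 fun h => hc n h ℓ' hr
      exact_mod_cast (by omega : n ≤ s - 1)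
    have h2 : s ≤ s - 1 := by exact_mod_cast h.trans this
    omega
  · rintro ⟨n, hn, ℓ', hr⟩
    refine le_trans (by exact_mod_cast hn) (le_iSup₂_of_le
      (f := fun (n : ℕ) (_ : ∃ ℓ', S.Reaches G ℓ p n ℓ') => (n : ℕ∞)) n ⟨ℓ', hr⟩ le_rfl)

theorem isOpen_trace_le_time (hP : P.Pos) (hF : P.IsTwistMap L F) (hL : 0 ≤ L)
    (hy : L < ystar) (hℓ : ℓ.IsStandard P ystar) (s : ℕ) :
    IsOpen (ℓ.trace {p | (s : ℕ∞) ≤ S.time G ℓ p}) := by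
  have : ℓ.trace {p | (s : ℕ∞) ≤ S.time G ℓ p}
      = ⋃ (n : ℕ) (_ : s ≤ n), ℓ.trace (S.reachSet G (fun _ => True) ℓ n) := by
    ext x
    simp only [CurvePair.trace, mem_ofPred_eq, S.le_time_iff, mem_iUnion, reachSet, exists_prop,
      and_true]
    exact ⟨fun ⟨hx, n, hn, hr⟩ => ⟨n, hn, hx, hr⟩, fun ⟨n, hn, hx, hr⟩ => ⟨hx, n, hn, hr⟩⟩
  rw [this]
  exact isOpen_iUnion fun n => isOpen_iUnion fun _ => S.isOpen_trace_reachSet hP hF hL hy n ℓ hℓ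

/-- If the probabilities of events on the targets are at most `B V`, and every point of `E` is
carried to one of these events, then the probability of `E` is at most `B` times the mean of `V`.
-/
theorem prob_le_of_pieces (hP : P.Pos) (hF : P.IsTwistMap L F) (hL : 0 ≤ L) (hy : L < ystar)
    (hℓ : ℓ.IsStandard P ystar) {E : Set Phase} {E' : Piece → Set Phase}
    (hEm : MeasurableSet (ℓ.trace E))
    (hE : ∀ x ∈ ℓ.trace E, ∃ c ∈ S.pieces ℓ, x ∈ Ioo c.left c.right ∧
      F^[c.steps] ((x : Real.Angle), ℓ.ψ x) ∈ E' c)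
    (hE'o : ∀ c ∈ S.pieces ℓ, IsOpen (c.target.trace (E' c))) {V : CurvePair → ℝ} {B σ : ℝ}
    (hV : HasSum (fun c : S.pieces ℓ => ℓ.mass c * V (c : Piece).target) σ)
    (hB : ∀ c ∈ S.pieces ℓ, c.target.prob (E' c) ≤ B * V c.target) :
    ℓ.prob E ≤ B * σ := by
  choose! g hgc hgm hgF hgi using fun (c : Piece) (hc : c ∈ S.pieces ℓ) =>
    (S.admissible ℓ hℓ c hc).exists_map hP hF hL hy hℓ.toIsBasic
  obtain ⟨A, hA⟩ : ∃ A : Piece → Set ℝ,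
    A = fun c => Ioo c.left c.right ∩ g c ⁻¹' c.target.trace (E' c) := ⟨_, rfl⟩
  have hAc : ∀ c, A c ⊆ Ioo c.left c.right := fun c => hA ▸ inter_subset_left
  have hAm : ∀ c ∈ S.pieces ℓ, MeasurableSet (A c) := by
    intro c hc
    rw [hA]
    exact ((hgc c hc).isOpen_inter_preimage isOpen_Ioo (hE'o c hc)).measurableSet
  have hE' : ∀ c ∈ S.pieces ℓ, MeasurableSet (c.target.trace (E' c)) := fun c hc =>
    (hE'o c hc).measurableSet
  have hint : ∀ c ∈ S.pieces ℓ, ∫ x in A c, ℓ.ρ x = ℓ.mass c * c.target.prob (E' c) := by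
    intro c hc
    rw [CurvePair.prob_eq_setIntegral (hE' c hc)]
    have h1 := hgi c hc ((c.target.trace (E' c)).indicator fun _ => 1)
    have e1 : ∫ x in Ioo c.target.a c.target.b,
        (c.target.trace (E' c)).indicator (fun _ => (1 : ℝ)) x * c.target.ρ x
        = ∫ x in c.target.trace (E' c), c.target.ρ x := by
      have hsub : c.target.trace (E' c) ⊆ Ioo c.target.a c.target.b := fun x hx => hx.1
      rw [← inter_eq_left.2 hsub, ← Measure.restrict_restrict (hE' c hc),
        ← integral_indicator (hE' c hc)]
      congr 1
      ext x
      by_cases hx : x ∈ c.target.trace (E' c) <;> simp [hx, inter_eq_left.2 hsub]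
    rw [e1] at h1
    rw [← h1, ← inter_eq_left.2 (hAc c), ← Measure.restrict_restrict (hAm c hc),
      ← integral_indicator (hAm c hc)]
    refine setIntegral_congr_fun measurableSet_Ioo fun x hx => ?_
    by_cases hx2 : g c x ∈ c.target.trace (E' c)
    · have h3 : x ∈ A c := hA ▸ ⟨hx, hx2⟩
      simp [h3, hx2]
    · have h3 : x ∉ A c := fun h => hx2 ((hA ▸ h : x ∈ Ioo c.left c.right ∩ _).2)
      simp [h3, hx2]
  have hsum := S.hasSum_pieces hℓ hAm hAc hℓ.integrable_density
  have h1 : ℓ.prob E ≤ ∫ x in ⋃ c : S.pieces ℓ, A c, ℓ.ρ x := by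
    rw [CurvePair.prob_eq_setIntegral hEm]
    have hUs : (⋃ c : S.pieces ℓ, A c) ⊆ Ioo ℓ.a ℓ.b :=
      iUnion_subset fun c => (hAc c).trans (S.piece_subset hℓ c.2)
    refine setIntegral_mono_set (hℓ.integrable_density.mono_set hUs) ?_
      (LE.le.eventuallyLE fun x hx => ?_)
    · have := (S.countable_pieces hℓ).to_subtype
      filter_upwards [ae_restrict_mem (MeasurableSet.iUnion fun c : S.pieces ℓ => hAm c c.2)]
        with x hx using (hℓ.density_pos x (hUs hx)).le
    · obtain ⟨c, hc, hxc, hxF⟩ := hE x hx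
      refine mem_iUnion.2 ⟨⟨c, hc⟩, ?_⟩
      rw [hA]
      exact ⟨hxc, hgm c hc x hxc, hgF c hc x hxc ▸ hxF⟩
  refine h1.trans (hasSum_le (fun c => ?_) hsum (hV.mul_left B))
  have hm : 0 ≤ ℓ.mass c := setIntegral_nonneg measurableSet_Ioo fun x hx =>
    (hℓ.density_pos x (S.piece_subset hℓ c.2 hx)).le
  rw [hint c c.2]
  calc ℓ.mass c * (c : Piece).target.prob (E' c) ≤ ℓ.mass c * (B * V (c : Piece).target) :=
        mul_le_mul_of_nonneg_left (hB c c.2) hm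
    _ = _ := by ring

end CuttingRule

/-! ### Potentials -/
theorem IsAdmissiblePiece.steps_le_two {P : Params} {ystar : ℝ} {F : Phase → Phase}
    {ℓ : CurvePair} {c : Piece} (h : IsAdmissiblePiece P ystar F ℓ c) : c.steps ≤ 2 := by
  rcases h.2.2.2.2 with ⟨hs, -⟩ | ⟨hs, -⟩ <;> omega

namespace CuttingRule

variable {P : Params} {L ystar : ℝ} {F : Phase → Phase}

/-- `V` is a potential for the pieces that are followed through pairs with the property `G`: on the
average it decreases by a factor `lam` in each step, it is bounded from below on the pairs with the
property `N`, among which the orbits stay, and it is at least `1` on the pairs with the property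
`Q`. -/
structure IsPotential (S : CuttingRule P ystar F) (G Q N : CurvePair → Prop) (V : CurvePair → ℝ)
    (v₀ lam : ℝ) : Prop where
  pos : 0 < v₀
  lam_pos : 0 < lam
  lam_le : lam ≤ 1
  le : ∀ ℓ : CurvePair, ℓ.IsStandard P ystar → N ℓ → v₀ ≤ V ℓ
  one_le : ∀ ℓ : CurvePair, ℓ.IsStandard P ystar → N ℓ → Q ℓ → 1 ≤ V ℓ
  child : ∀ ℓ : CurvePair, ℓ.IsStandard P ystar → G ℓ → ∀ c ∈ S.pieces ℓ, N c.target
  drift : ∀ ℓ : CurvePair, ℓ.IsStandard P ystar → G ℓ → ∃ σ,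
    HasSum (fun c : S.pieces ℓ => ℓ.mass c * V (c : Piece).target) σ ∧ σ ≤ lam * V ℓ

namespace IsPotential

variable {S : CuttingRule P ystar F} {G Q N : CurvePair → Prop} {V : CurvePair → ℝ} {v₀ lam : ℝ}

/-- The exponent is `s / 2` because a step takes at most two iterates, and a potential bounded below
by `v₀` bounds the probability that a pair with the property `G` is still being followed. -/
theorem prob_le_time_le (h : S.IsPotential G Q N V v₀ lam) (hP : P.Pos) (hF : P.IsTwistMap L F)
    (hL : 0 ≤ L) (hy : L < ystar) (s : ℕ) (ℓ : CurvePair) (hℓ : ℓ.IsStandard P ystar) (hN : N ℓ) :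
    ℓ.prob {p | (s : ℕ∞) ≤ S.time G ℓ p} ≤ V ℓ / v₀ * lam ^ ((s : ℝ) / 2) := by
  have hv := h.pos
  have hl := h.lam_pos
  induction s using Nat.strong_induction_on generalizing ℓ with
  | _ s ih =>
    have hV := h.le ℓ hℓ hN
    have ho := fun (m : CurvePair) (hm : m.IsStandard P ystar) (j : ℕ) =>
      S.isOpen_trace_le_time (G := G) hP hF hL hy hm j
    rcases Nat.eq_zero_or_pos s with rfl | hs
    · refine (hℓ.prob_le_one (ho ℓ hℓ 0).measurableSet).trans ?_
      simp only [Nat.cast_zero, zero_div, Real.rpow_zero, mul_one]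
      rwa [le_div_iff₀ hv, one_mul]
    by_cases hG : G ℓ
    swap
    · have : ℓ.trace {p | (s : ℕ∞) ≤ S.time G ℓ p} = ∅ := by
        rw [eq_empty_iff_forall_notMem]
        rintro x ⟨-, hx⟩
        rw [mem_ofPred_eq, S.time_of_not hG] at hx
        have : s ≤ 0 := by exact_mod_cast hx
        omega
      rw [CurvePair.prob_eq_setIntegral (ho ℓ hℓ s).measurableSet, this]
      simp only [Measure.restrict_empty, integral_zero_measure]
      have : 0 < V ℓ := by linarith
      positivity
    obtain ⟨σ, hσ, hσV⟩ := h.drift ℓ hℓ hG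
    have key := S.prob_le_of_pieces hP hF hL hy hℓ (E := {p | (s : ℕ∞) ≤ S.time G ℓ p})
      (E' := fun c => {p | ((s - c.steps : ℕ) : ℕ∞) ≤ S.time G c.target p})
      (B := v₀⁻¹ * lam ^ ((s : ℝ) / 2 - 1)) (ho ℓ hℓ s).measurableSet ?_ ?_ hσ ?_
    · refine key.trans ?_
      calc v₀⁻¹ * lam ^ ((s : ℝ) / 2 - 1) * σ ≤ v₀⁻¹ * lam ^ ((s : ℝ) / 2 - 1) * (lam * V ℓ) := by
            gcongr
        _ = V ℓ / v₀ * lam ^ ((s : ℝ) / 2) := by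
            rw [Real.rpow_sub_one hl.ne']
            field_simp
    · rintro x ⟨hx, hxs⟩
      obtain ⟨n, hn, ℓ', hr⟩ := S.le_time_iff.1 hxs
      rcases S.reaches_iff.1 hr with ⟨h0, -⟩ | ⟨-, c, hc, hp, j, hj, hr'⟩
      · omega
      · exact ⟨c, hc, (S.mem_arc_iff hℓ hc hx).1 hp, S.le_time_iff.2 ⟨j, by omega, ℓ', hr'⟩⟩
    · exact fun c hc => ho _ (S.admissible ℓ hℓ c hc).2.2.2.1 _
    · intro c hc
      have ha := S.admissible ℓ hℓ c hc
      have h1 := ha.one_le_steps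
      have h2 := ha.steps_le_two
      have hNc := h.child ℓ hℓ hG c hc
      have hVc := h.le _ ha.2.2.2.1 hNc
      refine (ih (s - c.steps) (by omega) c.target ha.2.2.2.1 hNc).trans ?_
      have h3 : (s : ℝ) / 2 - 1 ≤ ((s - c.steps : ℕ) : ℝ) / 2 := by
        have : (s : ℝ) ≤ ((s - c.steps : ℕ) : ℝ) + 2 := by
          exact_mod_cast (by omega : s ≤ s - c.steps + 2)
        linarith
      have h4 := Real.rpow_le_rpow_of_exponent_ge hl h.lam_le h3
      have h5 : 0 ≤ V c.target / v₀ := div_nonneg (by linarith) hv.le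
      refine (mul_le_mul_of_nonneg_left h4 h5).trans (le_of_eq ?_)
      ring

/-- The maximal inequality for the supermartingale `V`, within `n` iterates. -/
theorem prob_reachSet_le (h : S.IsPotential G Q N V v₀ lam) (hP : P.Pos) (hF : P.IsTwistMap L F)
    (hL : 0 ≤ L) (hy : L < ystar) (n : ℕ) (ℓ : CurvePair) (hℓ : ℓ.IsStandard P ystar) (hN : N ℓ) :
    ℓ.prob {p | ∃ j ≤ n, p ∈ S.reachSet G Q ℓ j} ≤ V ℓ := by
  have hv := h.pos
  induction n using Nat.strong_induction_on generalizing ℓ with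
  | _ n ih =>
    have hV := h.le ℓ hℓ hN
    have ho : ∀ (m : CurvePair), m.IsStandard P ystar → ∀ n : ℕ,
        IsOpen (m.trace {p | ∃ j ≤ n, p ∈ S.reachSet G Q m j}) := by
      intro m hm n
      have : m.trace {p | ∃ j ≤ n, p ∈ S.reachSet G Q m j}
          = ⋃ (j : ℕ) (_ : j ≤ n), m.trace (S.reachSet G Q m j) := by
        ext x
        simp only [CurvePair.trace, mem_ofPred_eq, mem_iUnion, exists_prop]
        exact ⟨fun ⟨hx, j, hn, hr⟩ => ⟨j, hn, hx, hr⟩, fun ⟨j, hn, hx, hr⟩ => ⟨hx, j, hn, hr⟩⟩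
      rw [this]
      exact isOpen_iUnion fun j => isOpen_iUnion fun _ =>
        S.isOpen_trace_reachSet hP hF hL hy j m hm
    by_cases hQ : Q ℓ
    · exact (hℓ.prob_le_one (ho ℓ hℓ n).measurableSet).trans (h.one_le ℓ hℓ hN hQ)
    have hempty : ℓ.trace {p | ∃ j ≤ n, p ∈ S.reachSet G Q ℓ j} = ∅ →
        ℓ.prob {p | ∃ j ≤ n, p ∈ S.reachSet G Q ℓ j} ≤ V ℓ := by
      intro he
      rw [CurvePair.prob_eq_setIntegral (ho ℓ hℓ n).measurableSet, he]
      simp only [Measure.restrict_empty, integral_zero_measure]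
      linarith
    by_cases hG : G ℓ
    swap
    · apply hempty
      rw [eq_empty_iff_forall_notMem]
      rintro x ⟨-, j, -, ℓ', hr, hQ'⟩
      rcases S.reaches_iff.1 hr with ⟨-, rfl⟩ | ⟨hG', -⟩
      · exact hQ hQ'
      · exact hG hG'
    rcases Nat.eq_zero_or_pos n with rfl | hn
    · apply hempty
      rw [eq_empty_iff_forall_notMem]
      rintro x ⟨-, j, hj, ℓ', hr, hQ'⟩
      rcases S.reaches_iff.1 hr with ⟨-, rfl⟩ | ⟨-, c, hc, -, i, hi, -⟩
      · exact hQ hQ'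
      · have := (S.admissible ℓ hℓ c hc).one_le_steps
        omega
    obtain ⟨σ, hσ, hσV⟩ := h.drift ℓ hℓ hG
    have key := S.prob_le_of_pieces hP hF hL hy hℓ
      (E := {p | ∃ j ≤ n, p ∈ S.reachSet G Q ℓ j})
      (E' := fun c => {p | ∃ j ≤ n - c.steps, p ∈ S.reachSet G Q c.target j})
      (B := 1) (ho ℓ hℓ n).measurableSet ?_ ?_ hσ ?_
    · rw [one_mul] at key
      refine key.trans (hσV.trans (mul_le_of_le_one_left (by linarith) h.lam_le))
    · rintro x ⟨hx, j, hj, ℓ', hr, hQ'⟩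
      rcases S.reaches_iff.1 hr with ⟨-, rfl⟩ | ⟨-, c, hc, hp, i, hi, hr'⟩
      · exact absurd hQ' hQ
      · exact ⟨c, hc, (S.mem_arc_iff hℓ hc hx).1 hp, i, by omega, ℓ', hr', hQ'⟩
    · exact fun c hc => ho _ (S.admissible ℓ hℓ c hc).2.2.2.1 _
    · intro c hc
      have ha := S.admissible ℓ hℓ c hc
      have h1 := ha.one_le_steps
      rw [one_mul]
      exact ih (n - c.steps) (by omega) c.target ha.2.2.2.1 (h.child ℓ hℓ hG c hc)

/-- The maximal inequality for the supermartingale `V`: pairs with the property `Q`, on which `V` is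
at least `1`, are reached with probability at most `V ℓ`. -/
theorem prob_exists_reachSet_le (h : S.IsPotential G Q N V v₀ lam) (hP : P.Pos)
    (hF : P.IsTwistMap L F) (hL : 0 ≤ L) (hy : L < ystar) {ℓ : CurvePair}
    (hℓ : ℓ.IsStandard P ystar) (hN : N ℓ) :
    ℓ.prob {p | ∃ j, p ∈ S.reachSet G Q ℓ j} ≤ V ℓ := by
  have ho := fun j => (S.isOpen_trace_reachSet (G := G) (Q := Q) hP hF hL hy j ℓ hℓ)
  have e : ℓ.trace {p | ∃ j, p ∈ S.reachSet G Q ℓ j}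
      = ⋃ n : ℕ, ℓ.trace {p | ∃ j ≤ n, p ∈ S.reachSet G Q ℓ j} := by
    ext x
    simp only [CurvePair.trace, mem_ofPred_eq, mem_iUnion]
    exact ⟨fun ⟨hx, j, hr⟩ => ⟨j, hx, j, le_rfl, hr⟩, fun ⟨_, hx, j, _, hr⟩ => ⟨hx, j, hr⟩⟩
  have hm : ∀ n, MeasurableSet (ℓ.trace {p | ∃ j ≤ n, p ∈ S.reachSet G Q ℓ j}) := by
    intro n
    have : ℓ.trace {p | ∃ j ≤ n, p ∈ S.reachSet G Q ℓ j}
        = ⋃ (j : ℕ) (_ : j ≤ n), ℓ.trace (S.reachSet G Q ℓ j) := by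
      ext x
      simp only [CurvePair.trace, mem_ofPred_eq, mem_iUnion, exists_prop]
      exact ⟨fun ⟨hx, j, hn, hr⟩ => ⟨j, hn, hx, hr⟩, fun ⟨j, hn, hx, hr⟩ => ⟨hx, j, hn, hr⟩⟩
    rw [this]
    exact MeasurableSet.iUnion fun j => MeasurableSet.iUnion fun _ => (ho j).measurableSet
  have hm' : MeasurableSet (ℓ.trace {p | ∃ j, p ∈ S.reachSet G Q ℓ j}) := by
    rw [e]
    exact MeasurableSet.iUnion hm
  rw [CurvePair.prob_eq_setIntegral hm', e]
  refine le_of_tendsto (tendsto_setIntegral_of_monotone hm ?_ (hℓ.integrable_density.mono_set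
    (iUnion_subset fun n x hx => hx.1))) (Eventually.of_forall fun n => ?_)
  · intro n n' hnn x hx
    obtain ⟨hx, j, hj, hr⟩ := hx
    exact ⟨hx, j, hj.trans hnn, hr⟩
  · rw [← CurvePair.prob_eq_setIntegral (hm n)]
    exact h.prob_reachSet_le hP hF hL hy n ℓ hℓ hN

end IsPotential

/-- The orbits that leave the window near the upper level have an exit pair that is reached. -/
theorem one_sub_le_prob_exitSign (S : CuttingRule P ystar F) (hP : P.Pos)
    (hF : P.IsTwistMap L F) (hL : 0 ≤ L) (hy : L < ystar) {ν : ℕ} {master ℓ : CurvePair} {k : ℤ}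
    (hℓ : ℓ.IsStandard P ystar) {v : ℝ}
    (hv : ℓ.prob {p | ∃ j, p ∈ S.reachSet (IsCompatible master k) (IsCloseTo P ν master (k + 1)) ℓ j}
      ≤ v) : 1 - v ≤ ℓ.prob {p | S.exitSign ν master k ℓ p = -1} := by
  obtain ⟨E, hE⟩ : ∃ E, E = {p | S.exitTime master k ℓ p < S.criticalTime ℓ p ∧
      ∃ (n : ℕ) (ℓ' : CurvePair), S.Reaches (IsCompatible master k) ℓ p n ℓ' ∧
        (n : ℕ∞) = S.exitTime master k ℓ p ∧ IsCloseTo P ν master (k + 1) ℓ'} := ⟨_, rfl⟩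
  have e : {p | S.exitSign ν master k ℓ p = -1} = Eᶜ := by
    ext p
    rw [hE]
    simp only [mem_ofPred_eq, mem_compl_iff, exitSign]
    split_ifs with hc
    · simp [hc]
    · simp only [hc, not_false_eq_true]
  have ho := fun (G : CurvePair → Prop) (n : ℕ) =>
    (S.isOpen_trace_le_time (G := G) hP hF hL hy hℓ n).measurableSet
  have hr := fun n => (S.isOpen_trace_reachSet (G := IsCompatible master k)
    (Q := IsCloseTo P ν master (k + 1)) hP hF hL hy n ℓ hℓ).measurableSet
  have hm : MeasurableSet (ℓ.trace E) := by
    have : ℓ.trace E = ⋃ n : ℕ,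
        (ℓ.trace {p | (n : ℕ∞) ≤ S.time (IsCompatible master k) ℓ p}
          \ ℓ.trace {p | ((n + 1 : ℕ) : ℕ∞) ≤ S.time (IsCompatible master k) ℓ p})
        ∩ (ℓ.trace {p | ((n + 1 : ℕ) : ℕ∞) ≤ S.time (fun _ => True) ℓ p})
        ∩ ℓ.trace (S.reachSet (IsCompatible master k) (IsCloseTo P ν master (k + 1)) ℓ n) := by
      have hlt : ∀ (n : ℕ) (t : ℕ∞), ((n + 1 : ℕ) : ℕ∞) ≤ t ↔ (n : ℕ∞) < t := by
        intro n t
        push_cast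
        exact ENat.add_one_le_iff (ENat.natCast_ne_top n)
      ext x
      rw [hE]
      simp only [CurvePair.trace, mem_iUnion, mem_inter_iff, Set.mem_sdiff, mem_ofPred_eq, hlt,
        exitTime, criticalTime, reachSet]
      constructor
      · rintro ⟨hx, h1, n, ℓ', h2, h3, h4⟩
        rw [← h3] at h1 ⊢
        exact ⟨n, ⟨⟨⟨hx, le_rfl⟩, fun h => lt_irrefl _ h.2⟩, hx, h1⟩, hx, ℓ', h2, h4⟩
      · rintro ⟨n, ⟨⟨⟨hx, h1⟩, h2⟩, -, h3⟩, -, ℓ', h4, h5⟩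
        have h6 : (n : ℕ∞) = S.time (IsCompatible master k) ℓ (↑x, ℓ.ψ x) :=
          le_antisymm h1 (not_lt.1 fun h => h2 ⟨hx, h⟩)
        rw [← h6]
        exact ⟨hx, h3, n, ℓ', h4, rfl, h5⟩
    rw [this]
    exact MeasurableSet.iUnion fun n => (((ho _ _).diff (ho _ _)).inter (ho _ _)).inter (hr n)
  rw [e, hℓ.prob_compl hm]
  have hm' : MeasurableSet (ℓ.trace {p | ∃ j, p ∈ S.reachSet (IsCompatible master k)
      (IsCloseTo P ν master (k + 1)) ℓ j}) := by
    have : ℓ.trace {p | ∃ j, p ∈ S.reachSet (IsCompatible master k)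
        (IsCloseTo P ν master (k + 1)) ℓ j} = ⋃ n, ℓ.trace (S.reachSet (IsCompatible master k)
        (IsCloseTo P ν master (k + 1)) ℓ n) := by
      ext x
      simp only [CurvePair.trace, mem_ofPred_eq, mem_iUnion]
      exact ⟨fun ⟨hx, j, hr⟩ => ⟨j, hx, hr⟩, fun ⟨j, hx, hr⟩ => ⟨hx, j, hr⟩⟩
    rw [this]
    exact MeasurableSet.iUnion hr
  have : ℓ.prob E ≤ v := by
    refine le_trans ?_ hv
    rw [CurvePair.prob_eq_setIntegral hm, CurvePair.prob_eq_setIntegral hm']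
    refine setIntegral_mono_set (hℓ.integrable_density.mono_set fun x hx => hx.1) ?_
      (LE.le.eventuallyLE fun x hx => ?_)
    · filter_upwards [ae_restrict_mem hm'] with x hx using (hℓ.density_pos x hx.1).le
    · obtain ⟨hx, hxE⟩ := hx
      rw [hE] at hxE
      obtain ⟨-, n, ℓ', h1, -, h2⟩ := hxE
      exact ⟨hx, n, ℓ', h1, h2⟩
  linarith

end CuttingRule

/-! ### Standard pairs as weighted curves -/

/-- The slope and the density of a standard pair satisfy the bounds of `RegCurve` with this
constant. -/
def Params.stdConst (P : Params) : ℝ := P.kap * (1 + P.D⁻¹)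

theorem Params.Pos.one_le_stdConst {P : Params} (hP : P.Pos) (hD : 0 < P.D) : 1 ≤ P.stdConst := by
  have := hP.one_le_kap
  have : 0 < P.D⁻¹ := by positivity
  unfold Params.stdConst
  nlinarith

namespace CurvePair

variable {P : Params} {ystar : ℝ} {ℓ : CurvePair}

theorem refSlope_coe (x y : ℝ) :
    P.refSlope (x : Real.Angle) y
      = -(2 * P.A * Real.sin x) + 1 / deriv P.Y (y - 2 * P.A * Real.cos x) := by
  simp only [Params.refSlope, Params.ddphi, Params.prevHeight, Params.dphi, Real.Angle.sin_coe,
    Real.Angle.cos_coe, ← mul_assoc]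
  ring

theorem refDSlope_coe (x y : ℝ) :
    P.refDSlope (x : Real.Angle) y = -(2 * P.A * Real.cos x)
      - deriv (deriv P.Y) (y - 2 * P.A * Real.cos x)
        / deriv P.Y (y - 2 * P.A * Real.cos x) ^ 3 := by
  simp only [Params.refDSlope, Params.dddphi, Params.prevHeight, Params.dphi, Real.Angle.cos_coe,
    ← mul_assoc]
  ring

theorem IsStandard.abs_deriv_density_le (h : ℓ.IsStandard P ystar) {x : ℝ}
    (hx : x ∈ Ioo ℓ.a ℓ.b) : |deriv ℓ.ρ x| ≤ ℓ.ρ x := by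
  have h0 := h.density_pos x hx
  have h1 := (h.regular x hx).le
  rwa [abs_mul, abs_inv, abs_of_pos h0, inv_mul_le_iff₀ h0, mul_one] at h1

theorem IsStandard.length_le_one (h : ℓ.IsStandard P ystar) (hδ' : P.δ < Real.pi / 4) :
    ℓ.b - ℓ.a ≤ 1 := by
  have := h.length_lt
  have := Real.pi_le_four
  linarith

/-- The density of a standard pair is nearly constant on a base of length at least `δ / 4`. -/
theorem IsStandard.density_le (h : ℓ.IsStandard P ystar) (hδ : 0 < P.δ)
    (hδ' : P.δ < Real.pi / 4) {x : ℝ} (hx : x ∈ Ioo ℓ.a ℓ.b) : ℓ.ρ x ≤ 12 / P.δ := by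
  have hl := h.length_gt
  have hl1 := h.length_le_one hδ'
  have h1 : ∀ y ∈ Ioo ℓ.a ℓ.b, ℓ.ρ x ≤ 3 * ℓ.ρ y := by
    intro y hy
    have h2 := le_exp_mul_of_abs_deriv_le (K := 1) (fun z hz => h.hasDerivAt_density hz)
      (fun z hz => by rw [one_mul]; exact h.abs_deriv_density_le hz) hx hy
    refine h2.trans (mul_le_mul_of_nonneg_right ?_ (h.density_pos y hy).le)
    have h3 : |x - y| ≤ 1 := by
      rw [abs_le]
      constructor <;> linarith [hx.1, hx.2, hy.1, hy.2]
    rw [one_mul]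
    exact (Real.exp_le_exp.2 h3).trans (by linarith [Real.exp_one_lt_d9])
  have h2 : ∫ _y in Ioo ℓ.a ℓ.b, ℓ.ρ x = (ℓ.b - ℓ.a) * ℓ.ρ x := by
    rw [setIntegral_const]
    simp [Measure.real, Real.volume_Ioo, ENNReal.toReal_ofReal (sub_nonneg.2 h.lt.le)]
  have h3 : ∫ y in Ioo ℓ.a ℓ.b, 3 * ℓ.ρ y = 3 := by
    rw [integral_const_mul, h.density_integral, mul_one]
  have h4 := setIntegral_mono_on (integrableOn_const (by simp)) (h.integrable_density.const_mul 3)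
    measurableSet_Ioo h1
  rw [h2, h3] at h4
  have h0 := h.density_pos x hx
  rw [le_div_iff₀ hδ]
  nlinarith

/-- Standard pairs at heights comparable to `R` are weighted curves. -/
theorem eventually_regCurve (hP : P.Pos) (hδ : 0 < P.δ) (hδ' : P.δ < Real.pi / 4) (hD : 0 < P.D) :
    ∀ᶠ R in atTop, ∀ (ystar : ℝ) (ℓ : CurvePair), ℓ.IsStandard P ystar →
      (∀ x ∈ Ioo ℓ.a ℓ.b, ℓ.ψ x ∈ Icc (R / 3) (3 * R)) →
      RegCurve P R P.stdConst (12 / P.δ) ℓ.a ℓ.b ℓ.ψ (deriv ℓ.ψ) (deriv (deriv ℓ.ψ)) ℓ.ρ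
        (deriv ℓ.ρ) := by
  have hA := hP.A_pos
  have hk := hP.kap_pos
  have hg := hP.two_lt
  have hT2 : Tendsto (fun R => 8 * P.γ * P.kap ^ 2 * (P.twist R)⁻¹) atTop (𝓝 0) := by
    simpa using hP.twist_tendsto.inv_tendsto_atTop.const_mul (8 * P.γ * P.kap ^ 2)
  filter_upwards [eventually_ge_atTop 1, hP.twist_tendsto.eventually_ge_atTop P.kap,
    eventually_ge_atTop (24 * P.A),
    hT2.eventually_le_const (show (0 : ℝ) < P.A / 10 by positivity)] with R hR hτ hRA hT
  intro ystar ℓ h hh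
  have hR0 : 0 < R := by linarith
  have hτ0 := hP.twist_pos hR0
  have hprev : ∀ x ∈ Ioo ℓ.a ℓ.b, ℓ.ψ x - 2 * P.A * Real.cos x ∈ Icc (R / 8) (8 * R) := by
    intro x hx
    have h1 := hh x hx
    have h2 := Real.neg_one_le_cos x
    have h3 := Real.cos_le_one x
    constructor <;> nlinarith [h1.1, h1.2]
  have hinv : ∀ y, R / 8 ≤ y → 1 / P.twist y ≤ P.kap / P.twist R := by
    intro y hy
    have := hP.twist_pos (show 0 < y by linarith)
    rw [div_le_div_iff₀ this hτ0, one_mul]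
    exact hP.le_twist hR0 hy
  refine ⟨fun x hx => h.hasDerivAt hx, fun x hx => h.hasDerivAt_deriv hx,
    fun x hx => h.hasDerivAt_density hx, fun x hx => ⟨by linarith [(hh x hx).1],
      by linarith [(hh x hx).2]⟩, ?_, ?_, fun x hx => (h.density_pos x hx).le,
    fun x hx => h.density_le hδ hδ' hx, ?_⟩
  · intro x hx
    have h1 := (h.slope_close x hx).le
    have hp := hprev x hx
    have hψ := hh x hx
    rw [refSlope_coe, Params.deriv_Y (by linarith [hp.1]), Params.deriv_Y (by linarith [hψ.1])]
      at h1
    have hTp := hP.twist_pos (show 0 < ℓ.ψ x by linarith [hψ.1])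
    have hTp' := hP.twist_pos (show 0 < ℓ.ψ x - 2 * P.A * Real.cos x by linarith [hp.1])
    have h2 := hinv _ hp.1
    have h3 := hinv (ℓ.ψ x) (by linarith [hψ.1])
    have h4 : 1 ≤ P.twist (ℓ.ψ x) := by
      have := hP.le_twist hR0 (y := ℓ.ψ x) (by linarith [hψ.1])
      by_contra hc
      nlinarith
    have h5 : P.twist (ℓ.ψ x) ^ (-(3 / 2) : ℝ) ≤ 1 / P.twist (ℓ.ψ x) := by
      rw [one_div, ← Real.rpow_neg_one]
      exact Real.rpow_le_rpow_of_exponent_le h4 (by norm_num)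
    have h6 : P.D⁻¹ * P.twist (ℓ.ψ x) ^ (-(3 / 2) : ℝ) ≤ P.D⁻¹ * (P.kap / P.twist R) := by
      gcongr
      exact h5.trans h3
    have e : deriv ℓ.ψ x + 2 * P.A * Real.sin x
        = (deriv ℓ.ψ x - (-(2 * P.A * Real.sin x)
          + 1 / P.twist (ℓ.ψ x - 2 * P.A * Real.cos x)))
          + 1 / P.twist (ℓ.ψ x - 2 * P.A * Real.cos x) := by ring
    rw [e]
    refine (abs_add_le _ _).trans ?_
    rw [abs_of_pos (one_div_pos.2 hTp')]
    have e2 : P.stdConst / P.twist R = P.D⁻¹ * (P.kap / P.twist R) + P.kap / P.twist R := by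
      unfold Params.stdConst
      ring
    rw [e2]
    exact add_le_add (h1.trans h6) h2
  · intro x hx
    have h1 := (h.dslope_close x hx).le
    have hp := hprev x hx
    have hp0 : 0 < ℓ.ψ x - 2 * P.A * Real.cos x := by linarith [hp.1]
    rw [refDSlope_coe, Params.deriv_Y hp0, Params.deriv_deriv_Y hp0] at h1
    obtain ⟨z, hz⟩ : ∃ z, z = ℓ.ψ x - 2 * P.A * Real.cos x := ⟨_, rfl⟩
    rw [← hz] at h1 hp hp0
    have hTz := hP.twist_pos hp0
    have h2 := hinv z hp.1
    have h3 : |(P.γ - 1) * P.twist z / z / P.twist z ^ 3| ≤ P.A / 10 := by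
      rw [abs_of_nonneg (div_nonneg (div_nonneg (mul_nonneg (by linarith) hTz.le) hp0.le)
        (by positivity))]
      have e : (P.γ - 1) * P.twist z / z / P.twist z ^ 3
          = (P.γ - 1) * z⁻¹ * (1 / P.twist z) * (1 / P.twist z) := by
        field_simp
      rw [e]
      have h4 : z⁻¹ ≤ 8 := by
        rw [inv_le_comm₀ hp0 (by norm_num)]
        linarith [hp.1]
      have h5 : 1 / P.twist z ≤ P.kap := h2.trans (div_le_self hk.le (by linarith [hP.one_le_kap]))
      have h6 : 0 ≤ 1 / P.twist z := by positivity
      calc (P.γ - 1) * z⁻¹ * (1 / P.twist z) * (1 / P.twist z)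
          ≤ P.γ * 8 * P.kap * (P.kap / P.twist R) := by
            gcongr
            linarith
        _ = 8 * P.γ * P.kap ^ 2 * (P.twist R)⁻¹ := by ring
        _ ≤ _ := hT
    have e : deriv (deriv ℓ.ψ) x + 2 * P.A * Real.cos x
        = (deriv (deriv ℓ.ψ) x - (-(2 * P.A * Real.cos x)
          - (P.γ - 1) * P.twist z / z / P.twist z ^ 3))
          - (P.γ - 1) * P.twist z / z / P.twist z ^ 3 := by ring
    rw [e]
    refine (abs_sub _ _).trans ?_
    linarith
  · intro x hx
    refine (h.abs_deriv_density_le hx).trans ?_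
    exact le_mul_of_one_le_left (h.density_pos x hx).le (hP.one_le_stdConst hD)

namespace IsLift

variable {m ℓ' : CurvePair} {u v c : ℝ} {g : ℝ → ℝ}

theorem sin_eq (h : IsLift P ℓ u v ℓ' g c) (x : ℝ) :
    Real.sin (g x) = Real.sin (P.nextX x (ℓ.ψ x)) := by
  obtain ⟨k, hk⟩ := h.lift
  rw [hk, show P.nextX x (ℓ.ψ x) - 2 * Real.pi * k = P.nextX x (ℓ.ψ x) - k * (2 * Real.pi) by ring,
    Real.sin_sub_int_mul_two_pi]

theorem cos_eq (h : IsLift P ℓ u v ℓ' g c) (x : ℝ) :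
    Real.cos (g x) = Real.cos (P.nextX x (ℓ.ψ x)) := by
  obtain ⟨k, hk⟩ := h.lift
  rw [hk, show P.nextX x (ℓ.ψ x) - 2 * Real.pi * k = P.nextX x (ℓ.ψ x) - k * (2 * Real.pi) by ring,
    Real.cos_sub_int_mul_two_pi]

/-- The slope of the image curve, multiplied by the rate of expansion. -/
theorem deriv_curve_mul (h : IsLift P ℓ u v ℓ' g c) (hℓ : ℓ.IsBasic ystar) (hℓ' : ℓ'.IsBasic ystar)
    (hy : 0 < ystar) (hu : ℓ.a ≤ u) (hv : v ≤ ℓ.b) {x : ℝ} (hx : x ∈ Ioo u v) :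
    deriv ℓ'.ψ (g x) * ℓ.rate P x
      = deriv ℓ.ψ x - 2 * P.A * Real.sin (P.nextX x (ℓ.ψ x)) * ℓ.rate P x := by
  have hx' : x ∈ Ioo ℓ.a ℓ.b := Ioo_subset_Ioo hu hv hx
  have h1 := (hℓ'.hasDerivAt (h.mem hx)).comp x (h.der x hx)
  have h2 : HasDerivAt (fun x => P.nextY x (ℓ.ψ x))
      (deriv ℓ.ψ x + 2 * P.A * (-Real.sin (P.nextX x (ℓ.ψ x)) * ℓ.rate P x)) x :=
    (hℓ.hasDerivAt hx').add ((hℓ.hasDerivAt_nextX hy hx').cos.const_mul (2 * P.A))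
  have h3 : (ℓ'.ψ ∘ g) =ᶠ[𝓝 x] fun x => P.nextY x (ℓ.ψ x) := by
    filter_upwards [isOpen_Ioo.mem_nhds hx] with z hz using h.curve z hz
  rw [h1.unique (h2.congr_of_eventuallyEq h3)]
  ring

theorem twist_mul_deriv {x : ℝ} :
    P.twist (ℓ.ψ x) * deriv ℓ.ψ x = ℓ.rate P x - 1 := by
  unfold rate phaseRate
  ring

/-- The slope of a standard image differs from the reference slope by `1 / (Y'(ψ) 𝓛)`, where `𝓛` is
the rate of expansion; hence the rate of expansion is large. -/
theorem lt_abs_rate (h : IsLift P ℓ u v ℓ' g c) (hP : P.Pos) (hD : 0 < P.D) (hℓ : ℓ.IsBasic ystar)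
    (hℓ' : ℓ'.IsStandard P ystar) (hy : 0 < ystar) (hu : ℓ.a ≤ u) (hv : v ≤ ℓ.b) {x : ℝ}
    (hx : x ∈ Ioo u v) :
    P.D * P.twist (P.nextY x (ℓ.ψ x)) ^ (3 / 2 : ℝ) < P.twist (ℓ.ψ x) * |ℓ.rate P x| := by
  have hx' : x ∈ Ioo ℓ.a ℓ.b := Ioo_subset_Ioo hu hv hx
  have h0 := h.rate_ne x hx
  have hL := abs_pos.2 h0
  have hψ : 0 < ℓ.ψ x := hy.trans_le (hℓ.height x hx')
  have hT := hP.twist_pos hψ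
  have hn := hy.trans_le (hℓ'.height _ (h.mem hx))
  rw [h.curve x hx] at hn
  have hT' := hP.twist_pos hn
  have h1 := hℓ'.slope_close _ (h.mem hx)
  have h2 := h.deriv_curve_mul hℓ hℓ'.toIsBasic hy hu hv hx
  have e1 : P.nextY x (ℓ.ψ x) - 2 * P.A * Real.cos (P.nextX x (ℓ.ψ x)) = ℓ.ψ x := by
    unfold Params.nextY
    ring
  rw [refSlope_coe, h.sin_eq, h.cos_eq, h.curve x hx, e1, Params.deriv_Y hψ, Params.deriv_Y hn] at h1
  have h3 : deriv ℓ'.ψ (g x) = deriv ℓ.ψ x / ℓ.rate P x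
      - 2 * P.A * Real.sin (P.nextX x (ℓ.ψ x)) := by
    field_simp
    linarith
  have h4 : deriv ℓ.ψ x = (ℓ.rate P x - 1) / P.twist (ℓ.ψ x) := by
    rw [← twist_mul_deriv]
    field_simp
  have e2 : deriv ℓ'.ψ (g x) - (-(2 * P.A * Real.sin (P.nextX x (ℓ.ψ x))) + 1 / P.twist (ℓ.ψ x))
      = -(1 / (P.twist (ℓ.ψ x) * ℓ.rate P x)) := by
    rw [h3, h4]
    field_simp
    ring
  rw [e2, abs_neg, abs_div, abs_one, abs_mul, abs_of_pos hT, Real.rpow_neg hT'.le,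
    ← mul_inv, ← one_div, one_div_lt_one_div (by positivity) (by positivity)] at h1
  exact h1

end IsLift

end CurvePair

/-! ### Points that are forced into the remainder -/

namespace CurvePair

variable {P : Params} {ystar : ℝ} {ℓ m n : CurvePair} {u v c c' : ℝ} {g g' : ℝ → ℝ}

/-- Along a stand-by piece, the regularity of the final density bounds the logarithmic derivative of
the rate of expansion `q` of the second iterate. -/
theorem IsLift.abs_deriv_rate_le (h : IsLift P ℓ u v m g c) (h' : IsLift P m m.a m.b n g' c')
    (hℓ : ℓ.IsStandard P ystar) (hn : n.IsStandard P ystar) (hu : ℓ.a ≤ u) (hv : v ≤ ℓ.b)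
    {q : ℝ → ℝ} {q₁ x : ℝ} (hx : x ∈ Ioo u v)
    (hq : ∀ z ∈ Ioo u v, q z = ℓ.rate P z * m.rate P (g z)) (hd : HasDerivAt q q₁ x) :
    |q₁| ≤ |q x| + q x ^ 2 := by
  have hx' : x ∈ Ioo ℓ.a ℓ.b := Ioo_subset_Ioo hu hv hx
  have hgx := h.mem hx
  have hGx := h'.mem hgx
  have hid : ∀ z ∈ Ioo u v, n.ρ (g' (g z)) ^ 2 * q z ^ 2 = (c' * c) ^ 2 * ℓ.ρ z ^ 2 := by
    intro z hz
    have h1 := abs_pos.2 (h.rate_ne z hz)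
    have h2 := abs_pos.2 (h'.rate_ne _ (h.mem hz))
    rw [h'.density _ (h.mem hz), h.density z hz, hq z hz, mul_pow, ← sq_abs (ℓ.rate P z),
      ← sq_abs (m.rate P (g z))]
    field_simp
  have hr : HasDerivAt (fun z => n.ρ (g' (g z))) (deriv n.ρ (g' (g x)) * q x) x := by
    refine ((hn.hasDerivAt_density hGx).comp x ((h'.der _ hgx).comp x (h.der x hx))).congr_deriv ?_
    rw [hq x hx]
    ring
  have e1 : HasDerivAt (fun z => n.ρ (g' (g z)) ^ 2 * q z ^ 2)
      (2 * n.ρ (g' (g x)) * (deriv n.ρ (g' (g x)) * q x) * q x ^ 2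
        + n.ρ (g' (g x)) ^ 2 * (2 * q x * q₁)) x := by
    refine ((hr.pow 2).mul (hd.pow 2)).congr_deriv ?_
    simp
  have e2 : HasDerivAt (fun z => (c' * c) ^ 2 * ℓ.ρ z ^ 2)
      ((c' * c) ^ 2 * (2 * ℓ.ρ x * deriv ℓ.ρ x)) x := by
    refine (((hℓ.hasDerivAt_density hx').pow 2).const_mul _).congr_deriv ?_
    simp
  have e3 : (fun z => n.ρ (g' (g z)) ^ 2 * q z ^ 2) =ᶠ[𝓝 x]
      fun z => (c' * c) ^ 2 * ℓ.ρ z ^ 2 := by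
    filter_upwards [isOpen_Ioo.mem_nhds hx] with z hz using hid z hz
  have e4 := e1.unique (e2.congr_of_eventuallyEq e3)
  have hidx := hid x hx
  have hq0 : q x ≠ 0 := by
    rw [hq x hx]
    exact mul_ne_zero (h.rate_ne x hx) (h'.rate_ne _ hgx)
  obtain ⟨r, hr0⟩ : ∃ r, r = n.ρ (g' (g x)) := ⟨_, rfl⟩
  obtain ⟨r₁, hr₁⟩ : ∃ r, r = deriv n.ρ (g' (g x)) := ⟨_, rfl⟩
  have hrp : 0 < r := hr0 ▸ hn.density_pos _ hGx
  have hrb : |r₁| ≤ r := by rw [hr0, hr₁]; exact hn.abs_deriv_density_le hGx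
  have hρ := hℓ.density_pos x hx'
  have hρ1 := hℓ.abs_deriv_density_le hx'
  rw [← hr0, ← hr₁] at e4
  rw [← hr0] at hidx
  have hqp := abs_pos.2 hq0
  have e5 : r ^ 2 * (q x * q₁) = (c' * c) ^ 2 * ℓ.ρ x * deriv ℓ.ρ x - r * r₁ * q x ^ 3 := by
    linarith
  have e6 : r ^ 2 * (|q x| * |q₁|) ≤ r ^ 2 * (|q x| * (|q x| + q x ^ 2)) := by
    calc r ^ 2 * (|q x| * |q₁|) = |r ^ 2 * (q x * q₁)| := by
          rw [abs_mul, abs_mul, abs_of_pos (by positivity : 0 < r ^ 2)]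
      _ ≤ |(c' * c) ^ 2 * ℓ.ρ x * deriv ℓ.ρ x| + |r * r₁ * q x ^ 3| := by
          rw [e5]
          exact abs_sub _ _
      _ ≤ (c' * c) ^ 2 * ℓ.ρ x * ℓ.ρ x + r * r * |q x| ^ 3 := by
          rw [abs_mul, abs_mul, abs_mul, abs_mul, abs_of_pos hρ, abs_of_pos hrp, abs_pow,
            sq_abs, abs_pow (q x) 3]
          gcongr
      _ = r ^ 2 * (|q x| * (|q x| + q x ^ 2)) := by
          rw [← sq_abs (q x)] at hidx ⊢
          linear_combination -hidx
  exact le_of_mul_le_mul_left (le_of_mul_le_mul_left e6 (by positivity)) hqp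

/-- A bound for the power in the definition of a standard pair, in terms of square roots. -/
theorem le_rpow_three_halves {T t : ℝ} (ht : 0 ≤ t) (h : t ≤ T) : t * √t ≤ T ^ (3 / 2 : ℝ) := by
  have e : t * √t = t ^ (3 / 2 : ℝ) := by
    rw [show (3 / 2 : ℝ) = 1 + 1 / 2 by norm_num, Real.rpow_add_of_nonneg ht zero_le_one
      (by norm_num), Real.rpow_one, ← Real.sqrt_eq_rpow]
  rw [e]
  exact Real.rpow_le_rpow ht h (by norm_num)

/-- The bounds on the rate of expansion and its derivative where the rate is small. -/
theorem eventually_le_abs_deriv_rate (hP : P.Pos) (K : ℝ) :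
    ∀ᶠ R in atTop, ∀ (p q W x : ℝ) (ψ ψ₁ ψ₂ w w₁ : ℝ → ℝ),
      RegCurve P R K W p q ψ ψ₁ ψ₂ w w₁ → x ∈ Ioo p q → |phaseRate P ψ ψ₁ x| ≤ 1 / 2 →
      |ψ₁ x| ≤ 1 ∧ P.A / (2 * P.kap) * P.twist R ≤ |phaseRate' P ψ ψ₁ ψ₂ x| := by
  have hA := hP.A_pos
  have hk := hP.kap_pos
  have hg := hP.γ_pos
  filter_upwards [eventually_ge_atTop 1, hP.twist_tendsto.eventually_ge_atTop (2 * P.kap),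
    hP.twist_tendsto.eventually_ge_atTop ((K + 2 * P.kap) / P.A),
    eventually_ge_atTop (32 * P.γ * P.kap ^ 2 / P.A)] with R hR hτ1 hτ2 hR2
  intro p q W x ψ ψ₁ ψ₂ w w₁ h hx hL
  have hR0 : 0 < R := by linarith
  have hτ0 := hP.twist_pos hR0
  have hT := hP.twist_pos (h.pos hR0 hx)
  have hTl := h.le_twist hP hR0 hx
  have e1 : P.twist (ψ x) * ψ₁ x = phaseRate P ψ ψ₁ x - 1 := by unfold phaseRate; ring
  have hL' := abs_le.1 hL
  have h1 : P.twist (ψ x) * |ψ₁ x| ≤ 2 := by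
    rw [← abs_of_pos hT, ← abs_mul, e1, abs_le]
    constructor <;> linarith
  have h2 : P.twist R * |ψ₁ x| ≤ 2 * P.kap := by
    calc P.twist R * |ψ₁ x| ≤ P.kap * P.twist (ψ x) * |ψ₁ x| := by gcongr
      _ = P.kap * (P.twist (ψ x) * |ψ₁ x|) := by ring
      _ ≤ P.kap * 2 := by gcongr
      _ = 2 * P.kap := by ring
  have h3 : |ψ₁ x| ≤ 1 := by
    by_contra hc
    nlinarith [abs_nonneg (ψ₁ x)]
  refine ⟨h3, ?_⟩
  have h4 : |Real.sin x| ≤ 1 / 2 := by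
    have h5 := h.slope x hx
    have h6 : 2 * P.A * |Real.sin x| ≤ K / P.twist R + |ψ₁ x| := by
      have e : 2 * P.A * Real.sin x = (ψ₁ x + 2 * P.A * Real.sin x) - ψ₁ x := by ring
      have e' : 2 * P.A * |Real.sin x| = |2 * P.A * Real.sin x| := by
        rw [abs_mul, abs_of_pos (by linarith : 0 < 2 * P.A)]
      rw [e', e]
      exact (abs_sub _ _).trans (by linarith)
    have h7 : K / P.twist R + |ψ₁ x| ≤ P.A := by
      have : |ψ₁ x| ≤ 2 * P.kap / P.twist R := by
        rw [le_div_iff₀ hτ0]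
        linarith
      have h8 : K / P.twist R + 2 * P.kap / P.twist R ≤ P.A := by
        rw [← add_div, div_le_iff₀ hτ0]
        rw [div_le_iff₀ hA] at hτ2
        linarith
      linarith
    by_contra hc
    nlinarith
  have h5 : 1 / 2 ≤ |Real.cos x| := by
    have h6 := Real.sin_sq_add_cos_sq x
    rw [← sq_abs (Real.sin x), ← sq_abs (Real.cos x)] at h6
    nlinarith [abs_nonneg (Real.sin x), abs_nonneg (Real.cos x)]
  have h6 : 3 * P.A / 4 ≤ |ψ₂ x| := by
    have h7 := h.dslope x hx
    have e : 2 * P.A * Real.cos x = (ψ₂ x + 2 * P.A * Real.cos x) - ψ₂ x := by ring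
    have h8 : 2 * P.A * |Real.cos x| ≤ P.A / 4 + |ψ₂ x| := by
      have e' : 2 * P.A * |Real.cos x| = |2 * P.A * Real.cos x| := by
        rw [abs_mul, abs_of_pos (by linarith : 0 < 2 * P.A)]
      rw [e', e]
      exact (abs_sub _ _).trans (by linarith)
    nlinarith
  have hht := h.height x hx
  have h7 : |(P.γ - 1) * P.twist (ψ x) / ψ x * ψ₁ x * ψ₁ x| ≤ P.A / (4 * P.kap) * P.twist R := by
    rw [abs_mul, abs_mul]
    have h8 := hP.dtwist_le hR0 (y := ψ x) (by linarith [hht.1]) (by linarith [hht.2])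
    calc _ ≤ 8 * P.γ * P.kap * P.twist R / R * 1 * 1 := by gcongr
      _ = 8 * P.γ * P.kap / R * P.twist R := by ring
      _ ≤ P.A / (4 * P.kap) * P.twist R := by
        rw [div_le_iff₀ hA] at hR2
        refine mul_le_mul_of_nonneg_right ?_ hτ0.le
        rw [div_le_div_iff₀ hR0 (by positivity)]
        linarith
  have h8 : 3 * P.A / (4 * P.kap) * P.twist R ≤ |P.twist (ψ x) * ψ₂ x| := by
    rw [abs_mul, abs_of_pos hT]
    calc 3 * P.A / (4 * P.kap) * P.twist R
        ≤ 3 * P.A / (4 * P.kap) * (P.kap * P.twist (ψ x)) := by gcongr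
      _ = P.twist (ψ x) * (3 * P.A / 4) := by field_simp
      _ ≤ _ := by gcongr
  have h9 : |P.twist (ψ x) * ψ₂ x| ≤ |phaseRate' P ψ ψ₁ ψ₂ x|
      + |(P.γ - 1) * P.twist (ψ x) / ψ x * ψ₁ x * ψ₁ x| := by
    have e : P.twist (ψ x) * ψ₂ x = phaseRate' P ψ ψ₁ ψ₂ x
      - (P.γ - 1) * P.twist (ψ x) / ψ x * ψ₁ x * ψ₁ x := by unfold phaseRate'; ring
    rw [e]
    exact abs_sub _ _
  have e : 3 * P.A / (4 * P.kap) * P.twist R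
      = P.A / (2 * P.kap) * P.twist R + P.A / (4 * P.kap) * P.twist R := by
    field_simp
    ring
  linarith

end CurvePair

namespace CurvePair

variable {P : Params} {ystar : ℝ} {ℓ m n : CurvePair} {u v c c' : ℝ} {g g' : ℝ → ℝ}

/-- The constants in the bounds for the factor `a` in `𝓛 𝓛' = a 𝓛 - θ`. -/
def standbyConst (P : Params) : ℝ := 1 + P.kap ^ 2 + 2 * P.A * P.kap
    + 16 * P.A * P.γ * P.kap * (1 + 2 * P.A)

/-- The rate of expansion of two iterates: `𝓛 𝓛' = a 𝓛 - θ`, where `θ` is the ratio of the twist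
rates at the two heights and `a` depends on the sine of the phase. At the critical points of the
phase, where `𝓛 = 0`, the product is `-θ`: two steps do not expand. -/
theorem rate_mul_rate (h : IsLift P ℓ u v m g c) (hℓ : ℓ.IsBasic ystar) (hm : m.IsBasic ystar)
    (hP : P.Pos) (hy : 0 < ystar) (hu : ℓ.a ≤ u) (hv : v ≤ ℓ.b) {x : ℝ} (hx : x ∈ Ioo u v) :
    ℓ.rate P x * m.rate P (g x)
      = (1 + P.twist (P.nextY x (ℓ.ψ x)) / P.twist (ℓ.ψ x)
        - 2 * P.A * P.twist (P.nextY x (ℓ.ψ x)) * Real.sin (P.nextX x (ℓ.ψ x))) * ℓ.rate P x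
        - P.twist (P.nextY x (ℓ.ψ x)) / P.twist (ℓ.ψ x) := by
  have h1 := h.deriv_curve_mul hℓ hm hy hu hv hx
  have hT := hP.twist_pos (hy.trans_le (hℓ.height x (Ioo_subset_Ioo hu hv hx)))
  have e : m.rate P (g x) = 1 + P.twist (P.nextY x (ℓ.ψ x)) * deriv m.ψ (g x) := by
    unfold rate phaseRate
    rw [h.curve x hx]
  have h4 : deriv ℓ.ψ x = (ℓ.rate P x - 1) / P.twist (ℓ.ψ x) := by
    rw [← IsLift.twist_mul_deriv]
    field_simp
  rw [h4] at h1
  rw [e, mul_add, mul_one, mul_left_comm, mul_comm (ℓ.rate P x) (deriv m.ψ (g x)), h1]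
  field_simp
  ring

set_option maxHeartbeats 1000000 in
/-- The bounds on the factor `a` and the ratio `θ` of the twist rates, and on their derivatives,
where the rate of expansion is small. -/
theorem eventually_exists_hasDerivAt_factor (hP : P.Pos) :
    ∀ᶠ R in atTop, ∀ (p q K W x : ℝ) (ψ ψ₁ ψ₂ w w₁ : ℝ → ℝ),
      RegCurve P R K W p q ψ ψ₁ ψ₂ w w₁ → x ∈ Ioo p q → P.nextY x (ψ x) ∈ Icc (R / 4) (4 * R) →
      |phaseRate P ψ ψ₁ x| ≤ 1 → |ψ₁ x| ≤ 1 →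
      ∃ a₁ θ₁ : ℝ,
        HasDerivAt (fun x => 1 + P.twist (P.nextY x (ψ x)) / P.twist (ψ x)
          - 2 * P.A * P.twist (P.nextY x (ψ x)) * Real.sin (P.nextX x (ψ x))) a₁ x ∧
        HasDerivAt (fun x => P.twist (P.nextY x (ψ x)) / P.twist (ψ x)) θ₁ x ∧
        |a₁| ≤ standbyConst P * P.twist R ∧ |θ₁| ≤ 1 ∧
        |1 + P.twist (P.nextY x (ψ x)) / P.twist (ψ x)
          - 2 * P.A * P.twist (P.nextY x (ψ x)) * Real.sin (P.nextX x (ψ x))|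
          ≤ standbyConst P * P.twist R ∧
        |P.twist (P.nextY x (ψ x)) / P.twist (ψ x)| ≤ P.kap ^ 2 := by
  have hA := hP.A_pos
  have hk := hP.kap_pos
  have hg := hP.γ_pos
  filter_upwards [eventually_ge_atTop 1, hP.twist_tendsto.eventually_ge_atTop 1,
    eventually_ge_atTop (8 * P.γ * P.kap ^ 4 * (2 + 2 * P.A))] with R hR hτ hR2
  intro p q K W x ψ ψ₁ ψ₂ w w₁ h hx hn hL hψ₁
  have hR0 : 0 < R := by linarith
  have hτ0 := hP.twist_pos hR0
  have hψ0 := h.pos hR0 hx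
  have hht := h.height x hx
  have hn0 : 0 < P.nextY x (ψ x) := by linarith [hn.1]
  have hT := hP.twist_pos hψ0
  have hT' := hP.twist_pos hn0
  have hTl := h.le_twist hP hR0 hx
  have hTu := h.twist_le hP hR0 hx
  have hTu' := hP.twist_le hR0 (y := P.nextY x (ψ x)) (by linarith [hn.1]) (by linarith [hn.2])
  have hdt := hP.dtwist_le hR0 (y := ψ x) (by linarith [hht.1]) (by linarith [hht.2])
  have hdt' := hP.dtwist_le hR0 (y := P.nextY x (ψ x)) (by linarith [hn.1]) (by linarith [hn.2])
  have hX := h.hasDerivAt_phase hR0 hx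
  have hY : HasDerivAt (fun x => P.nextY x (ψ x))
      (ψ₁ x + 2 * P.A * (-Real.sin (P.nextX x (ψ x)) * phaseRate P ψ ψ₁ x)) x :=
    (h.der x hx).add (hX.cos.const_mul (2 * P.A))
  obtain ⟨y₁, hy₁⟩ : ∃ y, y = ψ₁ x + 2 * P.A * (-Real.sin (P.nextX x (ψ x))
    * phaseRate P ψ ψ₁ x) := ⟨_, rfl⟩
  rw [← hy₁] at hY
  have hs := Real.abs_sin_le_one (P.nextX x (ψ x))
  have hc := Real.abs_cos_le_one (P.nextX x (ψ x))
  have hy₁b : |y₁| ≤ 1 + 2 * P.A := by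
    rw [hy₁]
    refine (abs_add_le _ _).trans (add_le_add hψ₁ ?_)
    rw [abs_mul, abs_of_pos (by linarith : 0 < 2 * P.A), abs_mul, abs_neg]
    exact mul_le_of_le_one_right (by linarith) (mul_le_one₀ hs (abs_nonneg _) hL)
  have hTY := (Params.hasDerivAt_twist (P := P) hn0).comp x hY
  have hTψ := (Params.hasDerivAt_twist (P := P) hψ0).comp x (h.der x hx)
  have hθ := hTY.div hTψ hT.ne'
  obtain ⟨d', hd'⟩ : ∃ d, d = (P.γ - 1) * P.twist (P.nextY x (ψ x)) / P.nextY x (ψ x) := ⟨_, rfl⟩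
  obtain ⟨d, hd⟩ : ∃ d, d = (P.γ - 1) * P.twist (ψ x) / ψ x := ⟨_, rfl⟩
  simp only [Function.comp, ← hd, ← hd'] at hθ hTY
  rw [← hd] at hdt
  rw [← hd'] at hdt'
  have ha := (hθ.const_add 1).sub ((hTY.const_mul (2 * P.A)).mul hX.sin)
  obtain ⟨T, hTT⟩ : ∃ T, T = P.twist (ψ x) := ⟨_, rfl⟩
  obtain ⟨T', hTT'⟩ : ∃ T, T = P.twist (P.nextY x (ψ x)) := ⟨_, rfl⟩
  obtain ⟨τ, hττ⟩ : ∃ T, T = P.twist R := ⟨_, rfl⟩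
  rw [← hTT, ← hTT'] at hθ ha ⊢
  rw [← hTT] at hT hTl hTu
  rw [← hTT'] at hT' hTu'
  rw [← hττ] at hτ hτ0 hTl hTu hTu' hdt hdt' ⊢
  have hθb : |(d' * y₁ * T - T' * (d * ψ₁ x)) / T ^ 2| ≤ 1 := by
    rw [abs_div, abs_of_pos (by positivity : 0 < T ^ 2), div_le_one (by positivity)]
    have e1 : |d' * y₁ * T| ≤ 8 * P.γ * P.kap * τ / R * (1 + 2 * P.A) * (P.kap * τ) := by
      rw [abs_mul, abs_mul, abs_of_pos hT]
      gcongr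
    have e2 : |T' * (d * ψ₁ x)| ≤ P.kap * τ * (8 * P.γ * P.kap * τ / R * 1) := by
      rw [abs_mul, abs_mul, abs_of_pos hT']
      gcongr
    have e3 : 8 * P.γ * P.kap * τ / R * (1 + 2 * P.A) * (P.kap * τ)
        + P.kap * τ * (8 * P.γ * P.kap * τ / R * 1)
        = 8 * P.γ * P.kap ^ 4 * (2 + 2 * P.A) / R * (τ / P.kap) ^ 2 := by
      field_simp
      ring
    have e4 : 8 * P.γ * P.kap ^ 4 * (2 + 2 * P.A) / R ≤ 1 := by rwa [div_le_one hR0]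
    have e5 : τ / P.kap ≤ T := by rwa [div_le_iff₀' hk]
    calc _ ≤ 8 * P.γ * P.kap ^ 4 * (2 + 2 * P.A) / R * (τ / P.kap) ^ 2 := by
          rw [← e3]
          exact (abs_sub _ _).trans (add_le_add e1 e2)
      _ ≤ 1 * T ^ 2 := by gcongr
      _ = T ^ 2 := one_mul _
  have hθ2 : |T' / T| ≤ P.kap ^ 2 := by
    rw [abs_of_pos (by positivity), div_le_iff₀ hT]
    calc T' ≤ P.kap * τ := hTu'
      _ ≤ P.kap * (P.kap * T) := by gcongr
      _ = P.kap ^ 2 * T := by ring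
  refine ⟨_, _, ha, hθ, ?_, hθb, ?_, hθ2⟩
  · have e1 : |2 * P.A * (d' * y₁) * Real.sin (P.nextX x (ψ x))|
        ≤ 2 * P.A * (8 * P.γ * P.kap * τ * (1 + 2 * P.A)) := by
      rw [abs_mul, abs_mul, abs_of_pos (by linarith : 0 < 2 * P.A), abs_mul]
      have : 8 * P.γ * P.kap * τ / R ≤ 8 * P.γ * P.kap * τ := div_le_self (by positivity) hR
      have h2 := hdt'.trans this
      calc _ ≤ 2 * P.A * (8 * P.γ * P.kap * τ * (1 + 2 * P.A)) * 1 := by gcongr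
        _ = _ := mul_one _
    have e2 : |2 * P.A * T' * (Real.cos (P.nextX x (ψ x)) * phaseRate P ψ ψ₁ x)|
        ≤ 2 * P.A * (P.kap * τ) := by
      rw [abs_mul, abs_mul (2 * P.A), abs_of_pos (by linarith : 0 < 2 * P.A), abs_of_pos hT', abs_mul]
      calc _ ≤ 2 * P.A * (P.kap * τ) * (1 * 1) := by gcongr
        _ = _ := by ring
    have e3 : (1 : ℝ) ≤ τ := hτ
    have e4 : standbyConst P * τ = τ + P.kap ^ 2 * τ + 2 * P.A * (P.kap * τ)
        + 2 * P.A * (8 * P.γ * P.kap * τ * (1 + 2 * P.A)) := by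
      unfold standbyConst
      ring
    have e5 : 0 ≤ P.kap ^ 2 * τ := by positivity
    rw [e4]
    simp only [Function.comp, ← hTT']
    refine (abs_sub _ _).trans ?_
    have := abs_add_le (2 * P.A * (d' * y₁) * Real.sin (P.nextX x (ψ x)))
      (2 * P.A * T' * (Real.cos (P.nextX x (ψ x)) * phaseRate P ψ ψ₁ x))
    linarith
  · have e1 : |2 * P.A * T' * Real.sin (P.nextX x (ψ x))| ≤ 2 * P.A * (P.kap * τ) := by
      rw [abs_mul, abs_mul, abs_of_pos (by linarith : 0 < 2 * P.A), abs_of_pos hT']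
      calc _ ≤ 2 * P.A * (P.kap * τ) * 1 := by gcongr
        _ = _ := by ring
    have e2 : standbyConst P * τ = τ + P.kap ^ 2 * τ + 2 * P.A * (P.kap * τ)
        + 2 * P.A * (8 * P.γ * P.kap * τ * (1 + 2 * P.A)) := by
      unfold standbyConst
      ring
    have e3 : P.kap ^ 2 * 1 ≤ P.kap ^ 2 * τ := by gcongr
    have e4 : 0 ≤ 2 * P.A * (8 * P.γ * P.kap * τ * (1 + 2 * P.A)) := by positivity
    rw [e2]
    refine (abs_sub _ _).trans ?_
    have := abs_add_le 1 (T' / T)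
    rw [abs_one] at this
    linarith

end CurvePair

namespace CurvePair

variable {P : Params} {ystar : ℝ} {ℓ m n : CurvePair} {u v c c' : ℝ} {g g' : ℝ → ℝ}

/-- A bound on the rate of expansion below which a point of a standard pair lies in no stand-by
piece. -/
def standbyRate (P : Params) : ℝ :=
  min (1 / 2) (P.A / (8 * P.kap) / (1 + 4 * standbyConst P))

theorem standbyConst_pos (hP : P.Pos) : 0 < standbyConst P := by
  have := hP.A_pos
  have := hP.kap_pos
  have := hP.γ_pos
  unfold standbyConst
  positivity

theorem standbyRate_pos (hP : P.Pos) : 0 < standbyRate P := by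
  have := hP.A_pos
  have := hP.kap_pos
  have := standbyConst_pos hP
  exact lt_min (by norm_num) (by positivity)

/-- The regularity of the density of the second image excludes `|a| ≥ 1 / 2` where the rate of
expansion is small: the derivative of `a 𝓛 - θ` would be too large. -/
theorem abs_factor_lt_half {a L L₁ q q₁ a₁ θ θ₁ e c₅ C Θ τ : ℝ} (he : 0 < e) (he1 : e ≤ 1)
    (hC : 0 < C) (hΘ : 0 ≤ Θ) (hτ : 1 ≤ τ) (hc₅ : 0 < c₅) (hec : e * (1 + 4 * C) ≤ c₅ / 4)
    (hbig : 2 * (Θ + 2 * Θ ^ 2 + 1) ≤ c₅ * τ / 4) (hL : |L| ≤ e) (hL₁ : c₅ * τ ≤ |L₁|)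
    (hq : q = a * L - θ) (hq₁ : q₁ = a₁ * L + a * L₁ - θ₁) (hqb : |q₁| ≤ |q| + q ^ 2)
    (ha : |a| ≤ C * τ) (ha₁ : |a₁| ≤ C * τ) (hθ : |θ| ≤ Θ) (hθ₁ : |θ₁| ≤ 1) : |a| < 1 / 2 := by
  by_contra! hc
  have h1 : |q| ≤ |a| * e + Θ := by
    rw [hq]
    refine (abs_sub _ _).trans (add_le_add ?_ hθ)
    rw [abs_mul]
    gcongr
  have h2 : |a| * (c₅ * τ) ≤ |q₁| + C * τ * e + 1 := by
    have e1 : a * L₁ = q₁ - a₁ * L + θ₁ := by rw [hq₁]; ring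
    calc |a| * (c₅ * τ) ≤ |a| * |L₁| := by gcongr
      _ = |q₁ - a₁ * L + θ₁| := by rw [← abs_mul, e1]
      _ ≤ |q₁| + |a₁ * L| + |θ₁| := (abs_add_le _ _).trans (add_le_add (abs_sub _ _) le_rfl)
      _ ≤ |q₁| + C * τ * e + 1 := by
        rw [abs_mul]
        gcongr
  have h3 : q ^ 2 ≤ 2 * (|a| * (C * τ) * e) + 2 * Θ ^ 2 := by
    have h4 : q ^ 2 ≤ (|a| * e + Θ) ^ 2 := by
      rw [← sq_abs]
      gcongr
    have h5 : (|a| * e) ^ 2 ≤ |a| * (C * τ) * e := by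
      calc (|a| * e) ^ 2 = |a| * |a| * (e * e) := by ring
        _ ≤ |a| * (C * τ) * (e * 1) := by gcongr
        _ = _ := by ring
    nlinarith [sq_nonneg (|a| * e - Θ)]
  have h6 : C * τ * e ≤ 2 * |a| * (C * τ * e) := by
    have : 0 ≤ C * τ * e := by positivity
    nlinarith
  have h7 : |a| * e ≤ |a| * e * τ := le_mul_of_one_le_right (by positivity) hτ
  have h8 : |a| * τ * (e * (1 + 4 * C)) ≤ |a| * τ * (c₅ / 4) := by gcongr
  have h9 : Θ + 2 * Θ ^ 2 + 1 ≤ |a| * (c₅ * τ / 4) := by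
    have : 0 ≤ Θ + 2 * Θ ^ 2 + 1 := by positivity
    nlinarith
  have h10 : 0 < |a| * (c₅ * τ) := by positivity
  nlinarith

set_option maxHeartbeats 1000000 in
/-- On the points of a standard pair that lie in a stand-by piece the rate of expansion is bounded
from below. Otherwise it would be small on the whole piece, by continuity, and the piece would be
too short to be mapped to a standard pair. -/
theorem eventually_lt_abs_rate_of_standby (hP : P.Pos) (hδ : 0 < P.δ) (hδ' : P.δ < Real.pi / 4)
    (hD : 0 < P.D) :
    ∀ᶠ R in atTop, ∀ (ystar u v c c' : ℝ) (g g' : ℝ → ℝ) (ℓ m n : CurvePair), 0 < ystar →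
      ℓ.IsStandard P ystar → (∀ x ∈ Ioo ℓ.a ℓ.b, ℓ.ψ x ∈ Icc (R / 3) (3 * R)) →
      m.IsBasic ystar → n.IsStandard P ystar → IsLift P ℓ u v m g c →
      IsLift P m m.a m.b n g' c' → ℓ.a ≤ u → v ≤ ℓ.b →
      ∀ x ∈ Ioo u v, standbyRate P < |ℓ.rate P x| := by
  have hA := hP.A_pos
  have hk := hP.kap_pos
  obtain ⟨e, hee⟩ : ∃ e, e = standbyRate P := ⟨_, rfl⟩
  have he : 0 < e := hee ▸ standbyRate_pos hP
  have he2 : e ≤ 1 / 2 := hee ▸ min_le_left _ _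
  obtain ⟨C, hCC⟩ : ∃ C, C = standbyConst P := ⟨_, rfl⟩
  have hC : 0 < C := hCC ▸ standbyConst_pos hP
  obtain ⟨c₅, hc₅⟩ : ∃ c₅, c₅ = P.A / (2 * P.kap) := ⟨_, rfl⟩
  have hc₅0 : 0 < c₅ := by rw [hc₅]; positivity
  have hec : e * (1 + 4 * C) ≤ c₅ / 4 := by
    rw [← le_div_iff₀ (by positivity), hee, hc₅, hCC]
    refine (min_le_right _ _).trans (le_of_eq ?_)
    congr 1
    field_simp
    norm_num
  obtain ⟨Θ, hΘ⟩ : ∃ Θ, Θ = P.kap ^ 2 := ⟨_, rfl⟩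
  have hΘ0 : 0 ≤ Θ := by rw [hΘ]; positivity
  filter_upwards [eventually_ge_atTop 1, hP.twist_tendsto.eventually_ge_atTop 1,
    eventually_ge_atTop (48 * P.A), eventually_regCurve hP hδ hδ' hD,
    eventually_le_abs_deriv_rate hP P.stdConst, eventually_exists_hasDerivAt_factor hP,
    hP.twist_tendsto.eventually_ge_atTop (8 * (Θ + 2 * Θ ^ 2 + 1) / c₅),
    hP.twist_tendsto.eventually_ge_atTop (8 * (Θ + 1) / (c₅ * P.δ)),
    hP.twist_tendsto.eventually_ge_atTop (P.kap * (2 * (Θ + 1) / e * P.kap ^ 2 / P.D) ^ 2)]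
    with R hR hτ hRA hreg hder hfac hbig1 hbig2 hbig3
  intro ystar u v c c' g g' ℓ m n hy hℓ hh hm hn h h' hu hv
  have hR0 : 0 < R := by linarith
  have hτ0 := hP.twist_pos hR0
  have hsub : Ioo u v ⊆ Ioo ℓ.a ℓ.b := Ioo_subset_Ioo hu hv
  have hreg' := hreg ystar ℓ hℓ hh
  have hY : ∀ x ∈ Ioo u v, P.nextY x (ℓ.ψ x) ∈ Icc (R / 4) (4 * R) := by
    intro x hx
    have h1 := hh x (hsub hx)
    have h2 := abs_le.1 (abs_nextY_sub_le hA x (ℓ.ψ x))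
    constructor <;> linarith [h1.1, h1.2, h2.1, h2.2]
  obtain ⟨q, hqq⟩ : ∃ q : ℝ → ℝ, q = fun z => ℓ.rate P z * m.rate P (g z) := ⟨_, rfl⟩
  have key : ∀ x ∈ Ioo u v, |ℓ.rate P x| ≤ e →
      c₅ * P.twist R ≤ |phaseRate' P ℓ.ψ (deriv ℓ.ψ) (deriv (deriv ℓ.ψ)) x| ∧ |q x| ≤ Θ + 1 ∧
      |ℓ.rate P x| ≤ e / 2 := by
    intro x hx hL
    obtain ⟨hψ₁, hL₁⟩ := hder _ _ _ x _ _ _ _ _ hreg' (hsub hx) (hL.trans he2)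
    obtain ⟨a₁, θ₁, ha, hθ, ha₁b, hθ₁b, hab, hθb⟩ := hfac _ _ _ _ x _ _ _ _ _ hreg' (hsub hx)
      (hY x hx) (hL.trans (by linarith)) hψ₁
    rw [← hc₅] at hL₁
    rw [← hCC] at ha₁b hab
    rw [← hΘ] at hθb
    have hrate := hreg'.hasDerivAt_phaseRate hR0 (hsub hx)
    have hqeq : ∀ z ∈ Ioo u v, q z
        = (1 + P.twist (P.nextY z (ℓ.ψ z)) / P.twist (ℓ.ψ z)
          - 2 * P.A * P.twist (P.nextY z (ℓ.ψ z)) * Real.sin (P.nextX z (ℓ.ψ z))) * ℓ.rate P z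
          - P.twist (P.nextY z (ℓ.ψ z)) / P.twist (ℓ.ψ z) := fun z hz => by
      rw [hqq]
      exact rate_mul_rate h hℓ.toIsBasic hm hP hy hu hv hz
    have hqd := ((ha.mul hrate).sub hθ).congr_of_eventuallyEq
      (eventually_of_mem (isOpen_Ioo.mem_nhds hx) hqeq)
    have hq1 := h.abs_deriv_rate_le h' hℓ hn hu hv hx (fun z _ => by rw [hqq]) hqd
    have ha2 := abs_factor_lt_half he (by linarith) hC hΘ0 hτ hc₅0 hec
      (by rw [div_le_iff₀ hc₅0] at hbig1; linarith) hL hL₁ (hqeq x hx) rfl hq1 hab ha₁b hθb hθ₁b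
    have hqb : |q x| ≤ Θ + 1 := by
      rw [hqeq x hx]
      refine (abs_sub _ _).trans ?_
      rw [abs_mul, add_comm]
      refine add_le_add hθb ?_
      exact mul_le_one₀ (by linarith) (abs_nonneg _) (by linarith)
    refine ⟨hL₁, hqb, ?_⟩
    have hgx := h.mem hx
    have h1 := h'.lt_abs_rate hP hD hm hn hy le_rfl le_rfl hgx
    have h2 := hY x hx
    have h3 := abs_le.1 (abs_nextY_sub_le hA (g x) (m.ψ (g x)))
    have e1 := h.curve x hx
    rw [← e1] at h2
    have h4 := hP.le_twist hR0 (y := P.nextY (g x) (m.ψ (g x))) (by linarith [h2.1, h3.1])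
    have h5 := hP.twist_le hR0 (y := m.ψ (g x)) (by linarith [h2.1]) (by linarith [h2.2])
    have h6 : P.twist R / P.kap ≤ P.twist (P.nextY (g x) (m.ψ (g x))) := by
      rwa [div_le_iff₀' hk]
    have h7 := le_rpow_three_halves (by positivity) h6
    have h8 : 2 * (Θ + 1) / e * P.kap ^ 2 / P.D ≤ √(P.twist R / P.kap) := by
      refine Real.le_sqrt_of_sq_le ?_
      rwa [le_div_iff₀' hk]
    have h9 : P.D * (P.twist R / P.kap * √(P.twist R / P.kap))
        < P.kap * P.twist R * |m.rate P (g x)| := by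
      calc _ ≤ P.D * P.twist (P.nextY (g x) (m.ψ (g x))) ^ (3 / 2 : ℝ) := by gcongr
        _ < _ := h1
        _ ≤ _ := by gcongr
    -- the second rate is large, because the final image is a standard pair, and the product of
    -- the rates is bounded: so the first rate is at most `e / 2`
    have h10 : 2 * (Θ + 1) / e ≤ |m.rate P (g x)| := by
      rw [div_le_iff₀ hD] at h8
      have h11 : P.D * (P.twist R / P.kap * √(P.twist R / P.kap))
        = P.twist R / P.kap * (√(P.twist R / P.kap) * P.D) := by ring
      rw [h11] at h9
      have h12 : P.twist R / P.kap * (2 * (Θ + 1) / e * P.kap ^ 2)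
          < P.kap * P.twist R * |m.rate P (g x)| := lt_of_le_of_lt (by gcongr) h9
      have h13 : P.twist R / P.kap * (2 * (Θ + 1) / e * P.kap ^ 2)
          = P.kap * P.twist R * (2 * (Θ + 1) / e) := by
        field_simp
      rw [h13] at h12
      exact (lt_of_mul_lt_mul_left h12 (by positivity)).le
    have h11 : |q x| = |ℓ.rate P x| * |m.rate P (g x)| := by rw [hqq, ← abs_mul]
    have h12 : |ℓ.rate P x| * (2 * (Θ + 1) / e) ≤ Θ + 1 :=
      (mul_le_mul_of_nonneg_left h10 (abs_nonneg _)).trans (h11 ▸ hqb)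
    rw [mul_div_assoc', div_le_iff₀ he] at h12
    have : 0 < Θ + 1 := by linarith
    rw [le_div_iff₀ two_pos]
    refine le_of_mul_le_mul_left ?_ this
    linarith
  intro x hx
  by_contra! hc
  rw [← hee] at hc
  have hcont : ContinuousOn (fun z => |ℓ.rate P z|) (Ioo u v) := fun z hz =>
    (hreg'.hasDerivAt_phaseRate hR0 (hsub hz)).continuousAt.abs.continuousWithinAt
  -- there is a gap between `e / 2` and `e` in the values of the rate on the piece
  have hall : ∀ z ∈ Ioo u v, |ℓ.rate P z| ≤ e := by
    intro z hz
    by_contra! hcz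
    have h1 := (key x hx hc).2.2
    obtain ⟨w, hw, hwe⟩ := isPreconnected_Ioo.intermediate_value hx hz hcont
      (show 3 * e / 4 ∈ Icc |ℓ.rate P x| |ℓ.rate P z| from ⟨by linarith, by linarith⟩)
    have hwe' : |ℓ.rate P w| = 3 * e / 4 := hwe
    have h2 := (key w hw (by linarith)).2.2
    linarith
  -- the rate has a derivative of order `Y'(R)`, so that it is small on a short interval only
  have hlen : ∀ y ∈ Ioo u v, ∀ z ∈ Ioo u v, y < z → z - y ≤ 1 / (c₅ * P.twist R) := by
    intro y hy' z hz hyz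
    have hs : Icc y z ⊆ Ioo u v := Icc_subset_Ioo hy'.1 hz.2
    obtain ⟨w, hw, hwe⟩ := exists_hasDerivAt_eq_slope (ℓ.rate P) _ hyz
      (fun t ht => (hreg'.hasDerivAt_phaseRate hR0 (hsub (hs ht))).continuousAt.continuousWithinAt)
      (fun t ht => hreg'.hasDerivAt_phaseRate hR0 (hsub (hs (Ioo_subset_Icc_self ht))))
    have hwm := hs (Ioo_subset_Icc_self hw)
    have h1 := (key w hwm (hall w hwm)).1
    have hzy : 0 < z - y := by linarith
    rw [hwe, abs_div, abs_of_pos hzy, le_div_iff₀ hzy] at h1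
    have h2 : |ℓ.rate P z - ℓ.rate P y| ≤ 1 :=
      (abs_sub _ _).trans (by linarith [hall z hz, hall y hy'])
    rw [le_div_iff₀ (by positivity), mul_comm]
    linarith
  have hder2 : ∀ z ∈ Ioo u v, HasDerivAt (fun z => g' (g z)) (q z) z := fun z hz => by
    refine ((h'.der _ (h.mem hz)).comp z (h.der z hz)).congr_deriv ?_
    rw [hqq, mul_comm]
  have hdist : ∀ y ∈ Ioo u v, ∀ z ∈ Ioo u v, y < z → |g' (g z) - g' (g y)| ≤ P.δ / 8 := by
    intro y hy' z hz hyz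
    have hs : Icc y z ⊆ Ioo u v := Icc_subset_Ioo hy'.1 hz.2
    have h1 := (convex_Icc y z).norm_image_sub_le_of_norm_hasDerivWithin_le
      (f := fun z => g' (g z)) (f' := q) (C := Θ + 1)
      (fun t ht => (hder2 t (hs ht)).hasDerivWithinAt)
      (fun t ht => (key t (hs ht) (hall t (hs ht))).2.1) (left_mem_Icc.2 hyz.le)
      (right_mem_Icc.2 hyz.le)
    rw [Real.norm_eq_abs, Real.norm_eq_abs, abs_of_pos (by linarith : 0 < z - y)] at h1
    refine h1.trans ?_
    calc (Θ + 1) * (z - y) ≤ (Θ + 1) * (1 / (c₅ * P.twist R)) := by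
          gcongr
          exact hlen y hy' z hz hyz
      _ ≤ P.δ / 8 := by
          rw [div_le_iff₀ (by positivity)] at hbig2
          rw [mul_one_div, div_le_div_iff₀ (by positivity) (by norm_num)]
          linarith
  -- the second image of the piece is shorter than a standard pair
  have hnl := hn.length_gt
  have hsurj : ∀ y ∈ Ioo n.a n.b, ∃ z ∈ Ioo u v, g' (g z) = y := by
    intro y hy'
    rw [← h'.image] at hy'
    obtain ⟨w, hw, rfl⟩ := hy'
    rw [← h.image] at hw
    obtain ⟨z, hz, rfl⟩ := hw
    exact ⟨z, hz, rfl⟩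
  obtain ⟨y, hy1, hy2⟩ := hsurj (n.a + (n.b - n.a) / 8) ⟨by linarith, by linarith⟩
  obtain ⟨z, hz1, hz2⟩ := hsurj (n.b - (n.b - n.a) / 8) ⟨by linarith, by linarith⟩
  rcases lt_trichotomy y z with hyz | hyz | hyz
  · have h1 := abs_le.1 (hdist y hy1 z hz1 hyz)
    linarith [h1.1, h1.2]
  · subst hyz
    linarith
  · have h1 := abs_le.1 (hdist z hz1 y hy1 hyz)
    linarith [h1.1, h1.2]

end CurvePair

namespace CurvePair

/-- On a piece with a standard image the rate of expansion is at least `1`. -/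
theorem eventually_one_lt_abs_rate {P : Params} (hP : P.Pos) (hD : 0 < P.D) :
    ∀ᶠ R in atTop, ∀ (ystar u v c x : ℝ) (g : ℝ → ℝ) (m n : CurvePair), 0 < ystar →
      m.IsBasic ystar → n.IsStandard P ystar → IsLift P m u v n g c → m.a ≤ u → v ≤ m.b →
      x ∈ Ioo u v → m.ψ x ∈ Icc (R / 3) (3 * R) → 1 < |m.rate P x| := by
  have hA := hP.A_pos
  have hk := hP.kap_pos
  filter_upwards [eventually_ge_atTop 1, eventually_ge_atTop (48 * P.A),
    hP.twist_tendsto.eventually_ge_atTop (P.kap * (P.kap ^ 2 / P.D) ^ 2)] with R hR hRA hbig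
  intro ystar u v c x g m n hy hm hn h hu hv hx hh
  have hR0 : 0 < R := by linarith
  have hτ0 := hP.twist_pos hR0
  have h1 := h.lt_abs_rate hP hD hm hn hy hu hv hx
  have h3 := abs_le.1 (abs_nextY_sub_le hA x (m.ψ x))
  have h4 := hP.le_twist hR0 (y := P.nextY x (m.ψ x)) (by linarith [hh.1, h3.1])
  have h5 := hP.twist_le hR0 (y := m.ψ x) (by linarith [hh.1]) (by linarith [hh.2])
  have h6 : P.twist R / P.kap ≤ P.twist (P.nextY x (m.ψ x)) := by rwa [div_le_iff₀' hk]
  have h7 := le_rpow_three_halves (by positivity) h6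
  have h8 : P.kap ^ 2 / P.D ≤ √(P.twist R / P.kap) := by
    refine Real.le_sqrt_of_sq_le ?_
    rwa [le_div_iff₀' hk]
  rw [div_le_iff₀ hD] at h8
  have h9 : P.twist R / P.kap * P.kap ^ 2 < P.kap * P.twist R * |m.rate P x| := by
    calc _ ≤ P.twist R / P.kap * (√(P.twist R / P.kap) * P.D) := by gcongr
      _ = P.D * (P.twist R / P.kap * √(P.twist R / P.kap)) := by ring
      _ ≤ P.D * P.twist (P.nextY x (m.ψ x)) ^ (3 / 2 : ℝ) := by gcongr
      _ < _ := h1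
      _ ≤ _ := by gcongr
  have h10 : P.twist R / P.kap * P.kap ^ 2 = P.kap * P.twist R * 1 := by
    field_simp
  rw [h10] at h9
  exact lt_of_mul_lt_mul_left h9 (by positivity)

/-- The width of the windows of phases that are mapped close to the critical points of the phase, in
units of `1 / Y'(R)`. -/
def killWidth (P : Params) : ℝ := standbyRate P / (8 * P.A * P.kap)

/-- The rate of expansion at the image of a point is small if the sine of the phase is close to
`1 / (A Y')`. -/
theorem eventually_abs_rate_next_le {P : Params} (hP : P.Pos) (hδ : 0 < P.δ)
    (hδ' : P.δ < Real.pi / 4) (hD : 0 < P.D) {t : ℝ} (ht : 0 < t) :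
    ∀ᶠ R in atTop, ∀ (ystar u v c x z : ℝ) (g : ℝ → ℝ) (ℓ m : CurvePair), 0 < ystar →
      ℓ.IsStandard P ystar → (∀ x ∈ Ioo ℓ.a ℓ.b, ℓ.ψ x ∈ Icc (2 * R / 5) (5 * R / 2)) →
      m.IsBasic ystar → IsLift P ℓ u v m g c → ℓ.a ≤ u → v ≤ ℓ.b → x ∈ Ioo u v →
      z ∈ Ioo ℓ.a ℓ.b → t ≤ |Real.sin x| →
      |Real.sin (P.nextX x (ℓ.ψ x)) - 1 / (P.A * P.twist (ℓ.ψ z))| ≤ killWidth P / P.twist R →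
      |m.rate P (g x)| ≤ standbyRate P := by
  have hA := hP.A_pos
  have hk := hP.kap_pos
  have hg := hP.γ_pos
  have hK := (hP.one_le_stdConst hD)
  obtain ⟨e, hee⟩ : ∃ e, e = standbyRate P := ⟨_, rfl⟩
  have he : 0 < e := hee ▸ standbyRate_pos hP
  obtain ⟨B, hB⟩ : ∃ B, B = 8 * P.γ * P.kap ^ 2 * (4 * P.A + P.stdConst) := ⟨_, rfl⟩
  have hB0 : 0 < B := by rw [hB]; positivity
  filter_upwards [eventually_ge_atTop 1, hP.twist_tendsto.eventually_ge_atTop 1,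
    eventually_ge_atTop (48 * P.A), eventually_regCurve hP hδ hδ' hD,
    eventually_ge_atTop (12 * B / e),
    hP.twist_tendsto.eventually_ge_atTop (P.kap * (1 + P.kap * P.stdConst) / (P.A * t)),
    hP.twist_tendsto.eventually_ge_atTop (4 * P.kap ^ 3 / (e * (P.A * t)))]
    with R hR hτ hRA hreg hRB hbig1 hbig2
  intro ystar u v c x z g ℓ m hy hℓ hh hm h hu hv hx hz hsx hsX
  have hR0 : 0 < R := by linarith
  have hτ0 := hP.twist_pos hR0
  have hx' : x ∈ Ioo ℓ.a ℓ.b := Ioo_subset_Ioo hu hv hx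
  have hreg' := hreg ystar ℓ hℓ fun x hx => ⟨by linarith [(hh x hx).1], by linarith [(hh x hx).2]⟩
  have hhx := hh x hx'
  have hhz := hh z hz
  have h3 := abs_nextY_sub_le hA x (ℓ.ψ x)
  have h3' := abs_le.1 h3
  have hzx : |ℓ.ψ x - ℓ.ψ z| ≤ 2 * P.A + P.stdConst := by
    have h1 := (convex_Ioo ℓ.a ℓ.b).norm_image_sub_le_of_norm_hasDerivWithin_le
      (f := ℓ.ψ) (f' := deriv ℓ.ψ) (C := 2 * P.A + P.stdConst)
      (fun t ht => (hreg'.der t ht).hasDerivWithinAt)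
      (fun t ht => hreg'.abs_slope_le hP hτ (by linarith) ht) hz hx'
    refine h1.trans (mul_le_of_le_one_right (by positivity) ?_)
    have := hℓ.length_le_one hδ'
    rw [Real.norm_eq_abs, abs_le]
    constructor <;> linarith [hz.1, hz.2, hx'.1, hx'.2]
  have hrm := rate_mul_rate h hℓ.toIsBasic hm hP hy hu hv hx
  have hLne := h.rate_ne x hx
  have hLbig := hreg'.le_abs_phaseRate hP hR0 hx' hsx
    (by rw [div_le_iff₀ (by positivity)] at hbig1; linarith)
  have hT := hreg'.twist_le hP hR0 hx'
  have hTl := hreg'.le_twist hP hR0 hx'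
  have hTp := hP.twist_pos (hreg'.pos hR0 hx')
  have hTz := hreg'.twist_le hP hR0 hz
  have hTzl := hreg'.le_twist hP hR0 hz
  have hTzp := hP.twist_pos (hreg'.pos hR0 hz)
  have hY8 : R / 8 ≤ P.nextY x (ℓ.ψ x) := by linarith [hhx.1, h3'.1]
  have hY8' : P.nextY x (ℓ.ψ x) ≤ 8 * R := by linarith [hhx.2, h3'.2]
  have hT1 := hP.twist_le hR0 hY8 hY8'
  have hT1p := hP.twist_pos (y := P.nextY x (ℓ.ψ x)) (by linarith)
  have hd : ∀ y, R / 8 ≤ y → y ≤ 8 * R → |P.nextY x (ℓ.ψ x) - y| ≤ 4 * P.A + P.stdConst →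
      |P.twist (P.nextY x (ℓ.ψ x)) / P.twist y - 1| ≤ e / 12 := by
    intro y hy1 hy2 hyd
    have hyp := hP.twist_pos (y := y) (by linarith)
    have h1 := hP.twist_sub_le hR0 hY8 hY8' hy1 hy2
    have h2 := hP.le_twist hR0 hy1
    rw [div_sub_one hyp.ne', abs_div, abs_of_pos hyp, div_le_iff₀ hyp]
    refine h1.trans ?_
    calc 8 * P.γ * P.kap * P.twist R / R * |P.nextY x (ℓ.ψ x) - y|
        ≤ 8 * P.γ * P.kap * (P.kap * P.twist y) / R * (4 * P.A + P.stdConst) := by gcongr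
      _ = B / R * P.twist y := by rw [hB]; ring
      _ ≤ e / 12 * P.twist y := by
        refine mul_le_mul_of_nonneg_right ?_ hyp.le
        rw [div_le_iff₀ he] at hRB
        rw [div_le_div_iff₀ hR0 (by norm_num)]
        linarith
  have hd1 := hd (ℓ.ψ x) (by linarith [hhx.1]) (by linarith [hhx.2]) (by linarith)
  have hd2 := hd (ℓ.ψ z) (by linarith [hhz.1]) (by linarith [hhz.2]) (by
    have e : P.nextY x (ℓ.ψ x) - ℓ.ψ z = (P.nextY x (ℓ.ψ x) - ℓ.ψ x) + (ℓ.ψ x - ℓ.ψ z) := by ring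
    rw [e]
    exact (abs_add_le _ _).trans (by linarith))
  obtain ⟨s, hs⟩ : ∃ s, s = Real.sin (P.nextX x (ℓ.ψ x)) := ⟨_, rfl⟩
  obtain ⟨T, hTT⟩ : ∃ T, T = P.twist (ℓ.ψ x) := ⟨_, rfl⟩
  obtain ⟨T', hTT'⟩ : ∃ T, T = P.twist (P.nextY x (ℓ.ψ x)) := ⟨_, rfl⟩
  obtain ⟨Tz, hTTz⟩ : ∃ T, T = P.twist (ℓ.ψ z) := ⟨_, rfl⟩
  obtain ⟨Λ, hΛ⟩ : ∃ Λ, Λ = ℓ.rate P x := ⟨_, rfl⟩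
  have hLbig' : P.A * P.twist R / P.kap * t ≤ |Λ| := by
    rw [hΛ]
    exact (mul_le_mul_of_nonneg_left hsx (by positivity)).trans hLbig
  rw [← hΛ] at hLne
  rw [← hs, ← hTT, ← hTT', ← hΛ] at hrm
  rw [← hs, ← hTTz] at hsX
  rw [← hTT', ← hTT] at hd1
  rw [← hTT', ← hTTz] at hd2
  rw [← hTT'] at hT1 hT1p
  rw [← hTT] at hT hTl hTp
  rw [← hTTz] at hTz hTzl hTzp
  have hθ : T' / T ≤ P.kap ^ 2 := by
    rw [div_le_iff₀ hTp]
    calc T' ≤ P.kap * P.twist R := hT1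
      _ ≤ P.kap * (P.kap * T) := by gcongr
      _ = P.kap ^ 2 * T := by ring
  have hθL : |T' / T / Λ| ≤ e / 4 := by
    have hΛ0 := abs_pos.2 hLne
    rw [abs_div, abs_of_pos (by positivity : 0 < T' / T), div_le_iff₀ hΛ0]
    rw [div_le_iff₀ (by positivity)] at hbig2
    have h5 : e / 4 * (P.A * P.twist R / P.kap * t) ≤ e / 4 * |Λ| := by gcongr
    refine hθ.trans (le_trans ?_ h5)
    rw [show e / 4 * (P.A * P.twist R / P.kap * t) = e * (P.A * P.twist R) * t / (4 * P.kap) by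
      field_simp, le_div_iff₀ (by positivity)]
    linarith
  -- with `T = T' = Tz` and `sin = 1 / (A Tz)` the rate is `1 + 1 - 2 - θ / Λ`, where `Λ` is large
  have e2 : m.rate P (g x) = (T' / T - 1) + (-2 * (T' / Tz - 1))
      + (-(2 * P.A * T' * (s - 1 / (P.A * Tz)))) + (-(T' / T / Λ)) := by
    have e3 : m.rate P (g x) = (1 + T' / T - 2 * P.A * T' * s) - T' / T / Λ := by
      field_simp at hrm ⊢
      linarith
    rw [e3]
    field_simp
    ring
  have h5 : |-(2 * P.A * T' * (s - 1 / (P.A * Tz)))| ≤ e / 4 := by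
    rw [abs_neg, abs_mul, abs_of_pos (by positivity)]
    calc 2 * P.A * T' * |s - 1 / (P.A * Tz)|
        ≤ 2 * P.A * (P.kap * P.twist R) * (killWidth P / P.twist R) := by gcongr
      _ = e / 4 := by
        rw [killWidth, ← hee]
        field_simp
        norm_num
  have h6 : |-2 * (T' / Tz - 1)| ≤ e / 6 := by
    rw [abs_mul, abs_neg, abs_two]
    linarith
  rw [← hee, e2]
  rw [← abs_neg] at hθL
  have h7 := abs_add_le ((T' / T - 1) + (-2 * (T' / Tz - 1))
      + (-(2 * P.A * T' * (s - 1 / (P.A * Tz))))) (-(T' / T / Λ))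
  have h8 := abs_add_three (T' / T - 1) (-2 * (T' / Tz - 1))
    (-(2 * P.A * T' * (s - 1 / (P.A * Tz))))
  linarith

end CurvePair

namespace CuttingRule

variable {P : Params} {L ystar : ℝ} {F : Phase → Phase} (S : CuttingRule P ystar F) {ℓ : CurvePair}

/-- The points of the base of `ℓ` that lie in a piece. -/
def pieceSet (ℓ : CurvePair) : Set ℝ := ⋃ c : S.pieces ℓ, Ioo (c : Piece).left (c : Piece).right

/-- The probability of the remainder. -/
def stopProb (ℓ : CurvePair) : ℝ :=
  ∫ x in Ioo ℓ.a ℓ.b, (S.pieceSet ℓ)ᶜ.indicator (fun _ => 1) x * ℓ.ρ x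

theorem isOpen_pieceSet : IsOpen (S.pieceSet ℓ) := isOpen_iUnion fun _ => isOpen_Ioo

theorem pieceSet_subset (hℓ : ℓ.IsStandard P ystar) : S.pieceSet ℓ ⊆ Ioo ℓ.a ℓ.b :=
  iUnion_subset fun c => S.piece_subset hℓ c.2

theorem stopProb_nonneg (hℓ : ℓ.IsStandard P ystar) : 0 ≤ S.stopProb ℓ :=
  setIntegral_nonneg measurableSet_Ioo fun x hx =>
    mul_nonneg (indicator_nonneg (fun _ _ => zero_le_one) x) (hℓ.density_pos x hx).le

theorem stopProb_eq (ℓ : CurvePair) :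
    S.stopProb ℓ = ∫ x in Ioo ℓ.a ℓ.b \ S.pieceSet ℓ, ℓ.ρ x := by
  have hm := (S.isOpen_pieceSet (ℓ := ℓ)).measurableSet.compl
  unfold stopProb
  rw [sdiff_eq, inter_comm, ← Measure.restrict_restrict hm, ← integral_indicator hm]
  congr 1
  ext x
  by_cases h : x ∈ (S.pieceSet ℓ)ᶜ
  · simp only [indicator_of_mem h, one_mul]
  · simp only [indicator_of_notMem h, zero_mul]

/-- The pieces and the remainder have total probability `1`. -/
theorem hasSum_mass (hℓ : ℓ.IsStandard P ystar) :
    HasSum (fun c : S.pieces ℓ => ℓ.mass c) (1 - S.stopProb ℓ) := by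
  have h := S.hasSum_pieces hℓ (A := fun c => Ioo c.left c.right) (fun _ _ => measurableSet_Ioo)
    (fun _ => Subset.rfl) hℓ.integrable_density
  have e : ∫ x in ⋃ c : S.pieces ℓ, Ioo (c : Piece).left (c : Piece).right, ℓ.ρ x
      = 1 - S.stopProb ℓ := by
    rw [stopProb_eq, setIntegral_sdiff S.isOpen_pieceSet.measurableSet hℓ.integrable_density
      (S.pieceSet_subset hℓ), hℓ.density_integral]
    unfold pieceSet
    ring
  rw [e] at h
  exact h

theorem mass_nonneg (hℓ : ℓ.IsStandard P ystar) (c : S.pieces ℓ) : 0 ≤ ℓ.mass c :=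
  setIntegral_nonneg measurableSet_Ioo fun x hx =>
    (hℓ.density_pos x (S.piece_subset hℓ c.2 hx)).le

theorem stopProb_le_one (hℓ : ℓ.IsStandard P ystar) : S.stopProb ℓ ≤ 1 := by
  have := (S.hasSum_mass hℓ).nonneg (S.mass_nonneg hℓ)
  linarith

/-- A point of the critical windows lies in the remainder, or its image does. -/
theorem eventually_not_mem_pieceSet (hP : P.Pos) (hδ : 0 < P.δ) (hδ' : P.δ < Real.pi / 4)
    (hD : 0 < P.D) {t : ℝ} (ht : 0 < t) :
    ∀ᶠ R in atTop, ∀ (L ystar : ℝ) (F : Phase → Phase) (S : CuttingRule P ystar F)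
      (ℓ : CurvePair) (x z : ℝ), P.IsTwistMap L F → 0 ≤ L → L < ystar → ℓ.IsStandard P ystar →
      (∀ x ∈ Ioo ℓ.a ℓ.b, ℓ.ψ x ∈ Icc (2 * R / 5) (5 * R / 2)) → x ∈ S.pieceSet ℓ →
      z ∈ Ioo ℓ.a ℓ.b → t ≤ |Real.sin x| →
      |Real.sin (P.nextX x (ℓ.ψ x)) - 1 / (P.A * P.twist (ℓ.ψ z))|
        ≤ CurvePair.killWidth P / P.twist R →
      ∃ c ∈ S.pieces ℓ, x ∈ Ioo c.left c.right ∧ c.steps = 1 ∧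
        ∀ g k, CurvePair.IsLift P ℓ c.left c.right c.target g k → g x ∉ S.pieceSet c.target := by
  have hA := hP.A_pos
  filter_upwards [CurvePair.eventually_abs_rate_next_le hP hδ hδ' hD ht,
    CurvePair.eventually_one_lt_abs_rate hP hD,
    CurvePair.eventually_lt_abs_rate_of_standby hP hδ hδ' hD,
    eventually_ge_atTop (48 * P.A)] with R hsmall hone hstand hRA
  intro L ystar F S ℓ x z hF hL hy hℓ hh hx hz hsx hsX
  have hy0 : 0 < ystar := by linarith
  have he : CurvePair.standbyRate P ≤ 1 / 2 := min_le_left _ _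
  obtain ⟨⟨c, hc⟩, hxc⟩ := mem_iUnion.1 hx
  have hadm := S.admissible ℓ hℓ c hc
  -- the images of the points of the piece lie in the range of heights of the rate estimates
  have hht : ∀ (m : CurvePair) (g : ℝ → ℝ) (k : ℝ),
      CurvePair.IsLift P ℓ c.left c.right m g k → ∀ y ∈ Ioo m.a m.b,
        m.ψ y ∈ Icc (R / 3) (3 * R) := by
    intro m g k hg y hy'
    rw [← hg.image] at hy'
    obtain ⟨w, hw, rfl⟩ := hy'
    rw [hg.curve w hw]
    have h1 := hh w (S.piece_subset hℓ hc hw)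
    have h2 := abs_le.1 (abs_nextY_sub_le hA w (ℓ.ψ w))
    constructor <;> linarith [h1.1, h1.2, h2.1, h2.2]
  refine ⟨c, hc, hxc, ?_⟩
  rcases hadm.exists_isLift hP hF hL hy hℓ.toIsBasic with
    ⟨hs, -⟩ | ⟨-, m, g, k, g', k', hm, hg, hg'⟩
  · refine ⟨hs, fun g k hg hgx => ?_⟩
    have hn := hadm.2.2.2.1
    have h1 := hsmall ystar _ _ k x z g ℓ c.target hy0 hℓ hh hn.toIsBasic hg hadm.1 hadm.2.2.1
      hxc hz hsx hsX
    obtain ⟨⟨d, hd⟩, hxd⟩ := mem_iUnion.1 hgx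
    have hadm' := S.admissible c.target hn d hd
    rcases hadm'.exists_isLift hP hF hL hy hn.toIsBasic with
      ⟨-, g₁, k₁, hg₁⟩ | ⟨-, m, g₁, k₁, g₂, k₂, hm, hg₁, hg₂⟩
    · have := hone ystar _ _ k₁ (g x) g₁ c.target d.target hy0 hn.toIsBasic hadm'.2.2.2.1 hg₁
        hadm'.1 hadm'.2.2.1 hxd (hht _ _ _ hg _ (hg.mem hxc))
      linarith
    · have := hstand ystar _ _ k₁ k₂ g₁ g₂ c.target m d.target hy0 hn (hht _ _ _ hg) hm
        hadm'.2.2.2.1 hg₁ hg₂ hadm'.1 hadm'.2.2.1 (g x) hxd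
      linarith
  · exfalso
    have h1 := hsmall ystar _ _ k x z g ℓ m hy0 hℓ hh hm hg hadm.1 hadm.2.2.1 hxc hz hsx hsX
    have := hone ystar _ _ k' (g x) g' m c.target hy0 hm hadm.2.2.2.1 hg'
      le_rfl le_rfl (hg.mem hxc) (hht _ _ _ hg _ (hg.mem hxc))
    linarith

end CuttingRule

namespace CurvePair

variable {P : Params}

/-- The probability of the critical windows is at least of order `1 / Y'(R)`, by equidistribution of
the phase away from the zeros of the sine, which carry at most half of the probability. -/
theorem eventually_le_prob_window (hP : P.Pos) (hδ : 0 < P.δ)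
    (hδ' : P.δ < Real.pi / 4) (hD : 0 < P.D) {η : ℝ} (hη : 0 < η) :
    ∀ᶠ R in atTop, ∀ (ystar : ℝ) (ℓ : CurvePair) (z : ℝ), ℓ.IsStandard P ystar →
      (∀ x ∈ Ioo ℓ.a ℓ.b, ℓ.ψ x ∈ Icc (2 * R / 5) (5 * R / 2)) → z ∈ Ioo ℓ.a ℓ.b →
      MeasurableSet ({x | P.δ / 96 ≤ |Real.sin x| ∧ |Real.sin (P.nextX x (ℓ.ψ x))
          - 1 / (P.A * P.twist (ℓ.ψ z))| ≤ η / P.twist R} ∩ Ioo ℓ.a ℓ.b) ∧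
      η / 256 / P.twist R ≤ ∫ x in {x | P.δ / 96 ≤ |Real.sin x| ∧ |Real.sin (P.nextX x (ℓ.ψ x))
          - 1 / (P.A * P.twist (ℓ.ψ z))| ≤ η / P.twist R} ∩ Ioo ℓ.a ℓ.b, ℓ.ρ x := by
  have hA := hP.A_pos
  have hk := hP.kap_pos
  have hpi := Real.pi_pos
  have hK := hP.one_le_stdConst hD
  have ho := RegCurve.oscConst_nonneg hP (K := P.stdConst) (by linarith)
  -- the exceptional interval has length at most `4 t`, and the density is at most `12 / δ`
  obtain ⟨t, ht⟩ : ∃ t, t = P.δ / 96 := ⟨_, rfl⟩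
  have ht0 : 0 < t := by rw [ht]; positivity
  obtain ⟨b, hb⟩ : ∃ b, b = P.kap / P.A + η := ⟨_, rfl⟩
  have hb0 : 0 < b := by rw [hb]; positivity
  filter_upwards [eventually_ge_atTop 1, hP.twist_tendsto.eventually_ge_atTop 1,
    eventually_regCurve hP hδ hδ' hD,
    hP.twist_tendsto.eventually_ge_atTop (P.kap * (1 + P.kap * P.stdConst) / (P.A * t)),
    hP.twist_tendsto.eventually_ge_atTop b,
    hP.twist_tendsto.eventually_ge_atTop (b ^ 3 / η),
    hP.twist_tendsto.eventually_ge_atTop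
      (8 * (RegCurve.oscConst P P.stdConst * (2 * Real.pi) * (12 / P.δ)) / t)]
    with R hR hτ hreg hbig1 hbig2 hbig3 hbig4
  intro ystar ℓ z hℓ hh hz
  have hR0 : 0 < R := by linarith
  have hτ0 := hP.twist_pos hR0
  have hreg' := hreg ystar ℓ hℓ fun x hx => ⟨by linarith [(hh x hx).1], by linarith [(hh x hx).2]⟩
  have hTzl := hreg'.le_twist hP hR0 hz
  have hTzp := hP.twist_pos (hreg'.pos hR0 hz)
  obtain ⟨τ, hττ⟩ : ∃ τ, τ = P.twist R := ⟨_, rfl⟩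
  obtain ⟨σ, hσ⟩ : ∃ σ, σ = 1 / (P.A * P.twist (ℓ.ψ z)) := ⟨_, rfl⟩
  rw [← hσ, ← hττ, ← ht]
  have hσ0 : 0 < σ := by rw [hσ]; positivity
  have hσ1 : σ ≤ P.kap / P.A / τ := by
    rw [hσ, hττ, div_div, div_le_div_iff₀ (by positivity) (by positivity), one_mul]
    calc P.A * P.twist R ≤ P.A * (P.kap * P.twist (ℓ.ψ z)) := by gcongr
      _ = _ := by ring
  rw [← hττ] at hτ hτ0 hbig1 hbig2 hbig3 hbig4
  obtain ⟨w, hw⟩ : ∃ w, w = η / τ := ⟨_, rfl⟩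
  have hw0 : 0 < w := by rw [hw]; positivity
  have hσw : σ + w ≤ b / τ := by
    rw [hb, add_div, hw]
    linarith
  have hmean : w / 64 ≤ circMean (sinBump σ w) := by
    refine le_circMean_sinBump hw0 hσ0 (hσw.trans ?_) ?_
    · rwa [div_le_one hτ0]
    · refine (pow_le_pow_left₀ (by positivity) hσw 3).trans ?_
      rw [div_pow, hw, div_le_div_iff₀ (by positivity) hτ0]
      rw [div_le_iff₀ hη] at hbig3
      calc b ^ 3 * τ ≤ τ * η * τ := by gcongr
        _ = η * τ ^ 2 * 1 := by ring
        _ ≤ η * τ ^ 2 * τ := by gcongr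
        _ = η * τ ^ 3 := by ring
  rw [← hw]
  have hmeas : MeasurableSet ({x | t ≤ |Real.sin x| ∧ |Real.sin (P.nextX x (ℓ.ψ x)) - σ| ≤ w}
      ∩ Ioo ℓ.a ℓ.b) := by
    have h1 : ContinuousOn (fun x => |Real.sin (P.nextX x (ℓ.ψ x)) - σ|) (Ioo ℓ.a ℓ.b) :=
      fun x hx => ((hreg'.hasDerivAt_phase hR0 hx).sin.continuousAt.sub
        continuousAt_const).abs.continuousWithinAt
    have h2 : MeasurableSet (Ioo ℓ.a ℓ.b ∩ (fun x => |Real.sin (P.nextX x (ℓ.ψ x)) - σ|) ⁻¹' Iic w) := by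
      obtain ⟨u, hu, he⟩ := continuousOn_iff_isClosed.1 h1 (Iic w) isClosed_Iic
      rw [inter_comm, he]
      exact hu.measurableSet.inter measurableSet_Ioo
    have h3 : MeasurableSet {x : ℝ | t ≤ |Real.sin x|} :=
      measurableSet_le measurable_const (by fun_prop)
    have e : {x | t ≤ |Real.sin x| ∧ |Real.sin (P.nextX x (ℓ.ψ x)) - σ| ≤ w} ∩ Ioo ℓ.a ℓ.b
        = {x : ℝ | t ≤ |Real.sin x|}
          ∩ (Ioo ℓ.a ℓ.b ∩ (fun x => |Real.sin (P.nextX x (ℓ.ψ x)) - σ|) ⁻¹' Iic w) := by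
      ext x
      simp only [mem_inter_iff, mem_ofPred_eq, mem_preimage, mem_Iic]
      tauto
    rw [e]
    exact h3.inter h2
  refine ⟨hmeas, ?_⟩
  have hl := hℓ.length_le_one hδ'
  have hi := hℓ.integrable_density
  obtain ⟨c, d, hc, hcd, hd, hdc, hs1, hs2, -⟩ := exists_sin_lt_interval hℓ.lt hl ht0
    (by rw [ht]; linarith [Real.pi_le_four])
  have hsub1 : Ioo ℓ.a c ⊆ Ioo ℓ.a ℓ.b := Ioo_subset_Ioo_right (hcd.trans hd)
  have hsub2 : Ioo d ℓ.b ⊆ Ioo ℓ.a ℓ.b := Ioo_subset_Ioo_left (hc.trans hcd)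
  -- on each side of the exceptional interval the window has its expected share
  have hside : ∀ p q, ℓ.a ≤ p → q ≤ ℓ.b → (∀ x ∈ Ioo p q, t ≤ |Real.sin x|) →
      circMean (sinBump σ w) * ((∫ x in Ioo p q, ℓ.ρ x) - 1 / 8)
        ≤ ∫ x in {x | t ≤ |Real.sin x| ∧ |Real.sin (P.nextX x (ℓ.ψ x)) - σ| ≤ w} ∩ Ioo p q,
          ℓ.ρ x := by
    intro p q hp hq hs
    have hsub : Ioo p q ⊆ Ioo ℓ.a ℓ.b := Ioo_subset_Ioo hp hq
    have h1 := (hreg'.mono hp hq).abs_integral_window_sub_le hP hR (hττ ▸ hτ) (by linarith)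
      (by positivity) ht0 (by
        rw [← hττ]
        rw [div_le_iff₀ (by positivity)] at hbig1
        linarith) hs (continuous_sinBump σ w) (sinBump_mem hw0) (periodic_sinBump σ w)
    rw [← hττ] at h1
    have h2 : RegCurve.oscConst P P.stdConst * (2 * Real.pi * circMean (sinBump σ w)) * (12 / P.δ) / (τ * t)
        ≤ circMean (sinBump σ w) / 8 := by
      rw [div_le_iff₀ ht0] at hbig4
      rw [div_le_div_iff₀ (by positivity) (by norm_num)]
      have h3 : 0 ≤ circMean (sinBump σ w) := circMean_nonneg (sinBump_mem hw0)
      calc _ = circMean (sinBump σ w)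
            * (8 * (RegCurve.oscConst P P.stdConst * (2 * Real.pi) * (12 / P.δ))) := by ring
        _ ≤ _ := by gcongr
    have h4 := (abs_le.1 (h1.trans h2)).1
    have h5 : ∫ x in Ioo p q, ℓ.ρ x * sinBump σ w (P.nextX x (ℓ.ψ x))
        ≤ ∫ x in {x | t ≤ |Real.sin x| ∧ |Real.sin (P.nextX x (ℓ.ψ x)) - σ| ≤ w} ∩ Ioo p q,
          ℓ.ρ x := by
      have hm : MeasurableSet ({x | t ≤ |Real.sin x| ∧ |Real.sin (P.nextX x (ℓ.ψ x)) - σ| ≤ w}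
          ∩ Ioo p q) := by
        have := hmeas.inter (measurableSet_Ioo (a := p) (b := q))
        rwa [inter_assoc, inter_eq_right.2 hsub] at this
      rw [← integral_indicator hm, ← integral_indicator measurableSet_Ioo]
      have hgi : Integrable (indicator ({x | t ≤ |Real.sin x| ∧
          |Real.sin (P.nextX x (ℓ.ψ x)) - σ| ≤ w} ∩ Ioo p q) ℓ.ρ) :=
        (integrable_indicator_iff hm).2 (hi.mono_set (inter_subset_right.trans hsub))
      refine integral_mono_of_nonneg (Eventually.of_forall fun x => ?_) hgi
        (Eventually.of_forall fun x => ?_)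
      · refine indicator_nonneg (fun x hx => ?_) x
        exact mul_nonneg (hℓ.density_pos x (hsub hx)).le (sinBump_mem hw0 _).1
      · by_cases hx : x ∈ Ioo p q
        · have hρ := hℓ.density_pos x (hsub hx)
          simp only [indicator_of_mem hx]
          by_cases hxe : |Real.sin (P.nextX x (ℓ.ψ x)) - σ| ≤ w
          · rw [indicator_of_mem (show x ∈ {x | t ≤ |Real.sin x| ∧
              |Real.sin (P.nextX x (ℓ.ψ x)) - σ| ≤ w} ∩ Ioo p q from ⟨⟨hs x hx, hxe⟩, hx⟩)]
            exact mul_le_of_le_one_right hρ.le (sinBump_mem hw0 _).2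
          · rw [indicator_of_notMem (fun h => hxe h.1.2)]
            refine le_of_eq ?_
            unfold sinBump
            rw [max_eq_left, mul_zero]
            have : 1 ≤ |Real.sin (P.nextX x (ℓ.ψ x)) - σ| / w := by
              rw [le_div_iff₀ hw0]
              linarith
            linarith
        · rw [indicator_of_notMem hx, indicator_of_notMem fun h => hx h.2]
    linarith
  have h1 := hside ℓ.a c le_rfl (hcd.trans hd) hs1
  have h2 := hside d ℓ.b (hc.trans hcd) le_rfl hs2
  have h3 : (∫ x in Ioo c d, ℓ.ρ x) ≤ 1 / 2 := by
    have h4 := abs_integral_Ioo_le_mul (V := 12 / P.δ) hcd fun x hx => by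
      have hx' : x ∈ Ioo ℓ.a ℓ.b := ⟨hc.trans_lt hx.1, hx.2.trans_le hd⟩
      rw [abs_of_pos (hℓ.density_pos x hx')]
      exact hℓ.density_le hδ hδ' hx'
    refine (le_abs_self _).trans (h4.trans ?_)
    calc 12 / P.δ * (d - c) ≤ 12 / P.δ * (4 * t) := by gcongr
      _ = 1 / 2 := by
        rw [ht]
        field_simp
        norm_num
  have h4 : (1 : ℝ) = (∫ x in Ioo ℓ.a c, ℓ.ρ x) + ((∫ x in Ioo c d, ℓ.ρ x)
      + ∫ x in Ioo d ℓ.b, ℓ.ρ x) := by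
    rw [← setIntegral_Ioo_add_Ioo hcd hd (hi.mono_set (Ioo_subset_Ioo_left hc)),
      ← setIntegral_Ioo_add_Ioo hc (hcd.trans hd) hi, hℓ.density_integral]
  have hm1 : ∀ p q, ℓ.a ≤ p → q ≤ ℓ.b → MeasurableSet ({x | t ≤ |Real.sin x| ∧
      |Real.sin (P.nextX x (ℓ.ψ x)) - σ| ≤ w} ∩ Ioo p q) := by
    intro p q hp hq
    have := hmeas.inter (measurableSet_Ioo (a := p) (b := q))
    rwa [inter_assoc, inter_eq_right.2 (Ioo_subset_Ioo hp hq)] at this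
  have h5 := setIntegral_union (f := ℓ.ρ) (μ := volume)
    (s := {x | t ≤ |Real.sin x| ∧ |Real.sin (P.nextX x (ℓ.ψ x)) - σ| ≤ w} ∩ Ioo ℓ.a c)
    (t := {x | t ≤ |Real.sin x| ∧ |Real.sin (P.nextX x (ℓ.ψ x)) - σ| ≤ w} ∩ Ioo d ℓ.b)
    (disjoint_left.2 fun x hx hx' => by linarith [hx.2.2, hx'.2.1])
    (hm1 _ _ (hc.trans hcd) le_rfl)
    (hi.mono_set (inter_subset_right.trans hsub1)) (hi.mono_set (inter_subset_right.trans hsub2))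
  have h6 := setIntegral_mono_set (f := ℓ.ρ) (μ := volume)
    (hi.mono_set (inter_subset_right (s := {x | t ≤ |Real.sin x| ∧
      |Real.sin (P.nextX x (ℓ.ψ x)) - σ| ≤ w})))
    ((ae_restrict_mem hmeas).mono fun x hx => (hℓ.density_pos x hx.2).le)
    (LE.le.eventuallyLE (union_subset (inter_subset_inter_right {x | t ≤ |Real.sin x| ∧
      |Real.sin (P.nextX x (ℓ.ψ x)) - σ| ≤ w} hsub1)
      (inter_subset_inter_right {x | t ≤ |Real.sin x| ∧
      |Real.sin (P.nextX x (ℓ.ψ x)) - σ| ≤ w} hsub2)))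
  have h7 : η / 256 / τ = w / 64 / 4 := by
    rw [hw]
    ring
  rw [h7]
  nlinarith

end CurvePair

namespace CuttingRule

variable {P : Params}

/-- In two steps the remainder takes a share of order `1 / Y'(R)`. -/
theorem exists_le_stopProb (hP : P.Pos) (hδ : 0 < P.δ) (hδ' : P.δ < Real.pi / 4) (hD : 0 < P.D) :
    ∃ c : ℝ, 0 < c ∧ ∀ᶠ R in atTop, ∀ (L ystar : ℝ) (F : Phase → Phase)
      (S : CuttingRule P ystar F) (ℓ : CurvePair) (σ : ℝ), P.IsTwistMap L F → 0 ≤ L → L < ystar →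
      ℓ.IsStandard P ystar → (∀ x ∈ Ioo ℓ.a ℓ.b, ℓ.ψ x ∈ Icc (2 * R / 5) (5 * R / 2)) →
      HasSum (fun c : S.pieces ℓ => ℓ.mass c * S.stopProb (c : Piece).target) σ →
      c / P.twist R ≤ S.stopProb ℓ + σ := by
  have hA := hP.A_pos
  have hk := hP.kap_pos
  have hw : 0 < CurvePair.killWidth P := by
    have := CurvePair.standbyRate_pos hP
    unfold CurvePair.killWidth
    positivity
  refine ⟨CurvePair.killWidth P / 256, by positivity, ?_⟩
  filter_upwards [eventually_not_mem_pieceSet hP hδ hδ' hD (t := P.δ / 96) (by positivity),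
    CurvePair.eventually_le_prob_window hP hδ hδ' hD hw] with R hkill hprob
  intro L ystar F S ℓ σ hF hL hy hℓ hh hσ
  have hz : (ℓ.a + ℓ.b) / 2 ∈ Ioo ℓ.a ℓ.b := ⟨by linarith [hℓ.lt], by linarith [hℓ.lt]⟩
  obtain ⟨hm, hE⟩ := hprob ystar ℓ _ hℓ hh hz
  obtain ⟨E, hEE⟩ : ∃ E, E = {x | P.δ / 96 ≤ |Real.sin x| ∧ |Real.sin (P.nextX x (ℓ.ψ x))
    - 1 / (P.A * P.twist (ℓ.ψ ((ℓ.a + ℓ.b) / 2)))| ≤ CurvePair.killWidth P / P.twist R} := ⟨_, rfl⟩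
  rw [← hEE] at hm hE
  have hi := hℓ.integrable_density
  have hps := S.pieceSet_subset hℓ
  have hpm := (S.isOpen_pieceSet (ℓ := ℓ)).measurableSet
  have h1 := integral_inter_add_sdiff (μ := volume) (f := ℓ.ρ) hpm
    (hi.mono_set (inter_subset_right (s := E)))
  have h2 : ∫ x in (E ∩ Ioo ℓ.a ℓ.b) \ S.pieceSet ℓ, ℓ.ρ x ≤ S.stopProb ℓ := by
    rw [S.stopProb_eq]
    refine setIntegral_mono_set (hi.mono_set sdiff_subset) ?_
      (LE.le.eventuallyLE (sdiff_subset_sdiff_left inter_subset_right))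
    filter_upwards [ae_restrict_mem (measurableSet_Ioo.diff hpm)] with x hx
      using (hℓ.density_pos x hx.1).le
  have h3 := S.hasSum_pieces hℓ (A := fun c => (E ∩ Ioo ℓ.a ℓ.b) ∩ Ioo c.left c.right)
    (fun _ _ => hm.inter measurableSet_Ioo) (fun _ => inter_subset_right) hi
  rw [← inter_iUnion] at h3
  have h4 : (∫ x in (E ∩ Ioo ℓ.a ℓ.b) ∩ S.pieceSet ℓ, ℓ.ρ x) ≤ σ := by
    refine hasSum_le (fun c => ?_) h3 hσ
    have hadm := S.admissible ℓ hℓ c c.2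
    have hn := hadm.2.2.2.1
    have hsub := S.piece_subset hℓ c.2
    rcases ((E ∩ Ioo ℓ.a ℓ.b) ∩ Ioo (c : Piece).left (c : Piece).right).eq_empty_or_nonempty
      with he | ⟨x₀, hx₀⟩
    · rw [he]
      simpa using mul_nonneg (S.mass_nonneg hℓ c) (S.stopProb_nonneg hn)
    · have hkill' : ∀ x ∈ (E ∩ Ioo ℓ.a ℓ.b) ∩ Ioo (c : Piece).left (c : Piece).right,
          (c : Piece).steps = 1 ∧ ∀ g k, CurvePair.IsLift P ℓ (c : Piece).left (c : Piece).right
            (c : Piece).target g k → g x ∉ S.pieceSet (c : Piece).target := by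
        intro x hx
        have hxE := hx.1.1
        rw [hEE] at hxE
        obtain ⟨d, hd, hxd, h5, h6⟩ := hkill L ystar F S ℓ x _ hF hL hy hℓ hh
          (mem_iUnion.2 ⟨c, hx.2⟩) hz hxE.1 hxE.2
        have hdc : d = c := by
          by_contra hne
          exact disjoint_left.1 (S.disjoint ℓ hℓ hd c.2 hne) hxd hx.2
        rw [hdc] at h5 h6
        exact ⟨h5, h6⟩
      rcases hadm.exists_isLift hP hF hL hy hℓ.toIsBasic with ⟨-, g, k, hg⟩ | ⟨hs, -⟩
      swap
      · have := (hkill' x₀ hx₀).1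
        omega
      have h5 := hg.integral_piece hn.toIsBasic
        ((S.pieceSet (c : Piece).target)ᶜ.indicator fun _ => 1)
      have hgi : IntegrableOn (fun x => (S.pieceSet (c : Piece).target)ᶜ.indicator
          (fun _ => (1 : ℝ)) (g x) * ℓ.ρ x) (Ioo (c : Piece).left (c : Piece).right) := by
        refine (hi.mono_set hsub).mono' ?_ ?_
        · have h6 : AEMeasurable g
              (volume.restrict (Ioo (c : Piece).left (c : Piece).right)) :=
            hg.continuousOn.aemeasurable measurableSet_Ioo
          have h7 : Measurable ((S.pieceSet (c : Piece).target)ᶜ.indicator fun _ => (1 : ℝ)) :=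
            measurable_const.indicator S.isOpen_pieceSet.measurableSet.compl
          exact (h7.comp_aemeasurable h6).aestronglyMeasurable.mul
            (hi.mono_set hsub).aestronglyMeasurable
        · filter_upwards [ae_restrict_mem measurableSet_Ioo] with x hx
          have hρ := hℓ.density_pos x (hsub hx)
          rw [Real.norm_eq_abs, abs_mul, abs_of_pos hρ]
          refine mul_le_of_le_one_left hρ.le ?_
          by_cases hg' : g x ∈ (S.pieceSet (c : Piece).target)ᶜ
          · simp [indicator_of_mem hg']
          · simp [indicator_of_notMem hg']
      calc ∫ x in (E ∩ Ioo ℓ.a ℓ.b) ∩ Ioo (c : Piece).left (c : Piece).right, ℓ.ρ x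
          = ∫ x in (E ∩ Ioo ℓ.a ℓ.b) ∩ Ioo (c : Piece).left (c : Piece).right,
            (S.pieceSet (c : Piece).target)ᶜ.indicator (fun _ => (1 : ℝ)) (g x) * ℓ.ρ x := by
            refine setIntegral_congr_fun (hm.inter measurableSet_Ioo) fun x hx => ?_
            rw [indicator_of_mem (show g x ∈ (S.pieceSet (c : Piece).target)ᶜ from
              (hkill' x hx).2 g k hg), one_mul]
        _ ≤ ∫ x in Ioo (c : Piece).left (c : Piece).right,
            (S.pieceSet (c : Piece).target)ᶜ.indicator (fun _ => (1 : ℝ)) (g x) * ℓ.ρ x := by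
            refine setIntegral_mono_set hgi ?_ (LE.le.eventuallyLE inter_subset_right)
            filter_upwards [ae_restrict_mem measurableSet_Ioo] with x hx
            exact mul_nonneg (indicator_nonneg (fun _ _ => zero_le_one) _)
              (hℓ.density_pos x (hsub hx)).le
        _ = ℓ.mass c * S.stopProb (c : Piece).target := h5
  linarith

end CuttingRule

/-! ### The diffusion coefficient -/

namespace CurvePair

variable {P : Params}

/-- The phase is equidistributed to first order, so that the mean square of its cosine is close to
`1 / 2`. -/
theorem eventually_le_integral_cos_sq (hP : P.Pos) (hδ : 0 < P.δ) (hδ' : P.δ < Real.pi / 4)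
    (hD : 0 < P.D) : ∀ᶠ R in atTop, ∀ (ystar : ℝ) (ℓ : CurvePair), ℓ.IsStandard P ystar →
      (∀ x ∈ Ioo ℓ.a ℓ.b, ℓ.ψ x ∈ Icc (R / 3) (3 * R)) →
      1 / 4 ≤ ∫ x in Ioo ℓ.a ℓ.b, Real.cos (P.nextX x (ℓ.ψ x)) ^ 2 * ℓ.ρ x := by
  have hA := hP.A_pos
  have hk := hP.kap_pos
  have hK := hP.one_le_stdConst hD
  have ho := RegCurve.oscConst_nonneg hP (K := P.stdConst) (by linarith)
  obtain ⟨t, ht⟩ : ∃ t, t = P.δ / 192 := ⟨_, rfl⟩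
  have ht0 : 0 < t := by rw [ht]; positivity
  filter_upwards [eventually_ge_atTop 1, hP.twist_tendsto.eventually_ge_atTop 1,
    eventually_regCurve hP hδ hδ' hD,
    hP.twist_tendsto.eventually_ge_atTop (P.kap * (1 + P.kap * P.stdConst) / (P.A * t)),
    hP.twist_tendsto.eventually_ge_atTop
      (8 * (RegCurve.oscConst P P.stdConst * (1 / 2) * (12 / P.δ)) / t)]
    with R hR hτ hreg hbig1 hbig2
  intro ystar ℓ hℓ hh
  have hreg' := hreg ystar ℓ hℓ hh
  have hR0 : 0 < R := by linarith
  have hτ0 := hP.twist_pos hR0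
  have hi := hℓ.integrable_density
  have hm : Measurable fun z : ℝ × ℝ => Real.cos (2 * P.nextX z.1 z.2) :=
    Real.measurable_cos.comp ((measurable_nextX P).const_mul 2)
  have hfi : IntegrableOn (fun x => Real.cos (2 * P.nextX x (ℓ.ψ x)) * ℓ.ρ x) (Ioo ℓ.a ℓ.b) := by
    refine hi.mono' (hreg'.aestronglyMeasurable_comp
      (f := fun x y => Real.cos (2 * P.nextX x y)) hm) ?_
    filter_upwards [ae_restrict_mem measurableSet_Ioo] with x hx
    have hρ := hℓ.density_pos x hx
    rw [Real.norm_eq_abs, abs_mul, abs_of_pos hρ]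
    exact mul_le_of_le_one_left hρ.le (Real.abs_cos_le_one _)
  have h1 := abs_integral_le_of_sin_split (B := 1 / 8) (C := 1 / 4) hℓ.lt (hℓ.length_le_one hδ')
    ht0 (by rw [ht]; linarith [Real.pi_le_four]) hfi (by norm_num) (by norm_num) (by
      intro p q hp hpq hq hs
      have h2 := (hreg'.mono hp hq).abs_integral_phase_le hP hR hτ (by linarith) ht0
        (by rw [div_le_iff₀ (by positivity)] at hbig1; linarith) hs (α := ℓ.ρ) (α₁ := deriv ℓ.ρ)
        (B := fun X => Real.sin (2 * X) / 2) (b := fun X => Real.cos (2 * X)) (β := 1 / 2)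
        (V := 12 / P.δ) (by positivity) (hreg'.mono hp hq).derw
        (fun x hx => by
          rw [abs_of_nonneg ((hreg'.mono hp hq).nonneg x hx)]
          exact (hreg'.mono hp hq).le x hx)
        (fun x hx => ((hreg'.mono hp hq).regular x hx).trans (mul_le_mul_of_nonneg_left
          ((hreg'.mono hp hq).le x hx) (by linarith)))
        (fun X => by
          refine ((((hasDerivAt_id X).const_mul 2).sin).div_const 2).congr_deriv ?_
          simp)
        (by fun_prop) ⟨1, fun X => Real.abs_cos_le_one _⟩ (fun X => by
          rw [abs_div, abs_two]
          have := Real.abs_sin_le_one (2 * X)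
          linarith)
      have e : ∀ x, Real.cos (2 * P.nextX x (ℓ.ψ x)) * ℓ.ρ x
        = ℓ.ρ x * Real.cos (2 * P.nextX x (ℓ.ψ x)) := fun x => mul_comm _ _
      simp only [e]
      refine h2.trans ?_
      rw [div_le_iff₀ ht0] at hbig2
      rw [div_le_div_iff₀ (by positivity) (by norm_num)]
      linarith) (by
      intro p q hp hpq hq hl hs
      have h2 := abs_integral_Ioo_le_mul (V := 12 / P.δ)
        (f := fun x => Real.cos (2 * P.nextX x (ℓ.ψ x)) * ℓ.ρ x) hpq.le fun x hx => by
          have hx' : x ∈ Ioo ℓ.a ℓ.b := Ioo_subset_Ioo hp hq hx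
          have hρ := hℓ.density_pos x hx'
          rw [abs_mul, abs_of_pos hρ]
          exact (mul_le_of_le_one_left hρ.le (Real.abs_cos_le_one _)).trans
            (hℓ.density_le hδ hδ' hx')
      refine h2.trans ?_
      calc 12 / P.δ * (q - p) ≤ 12 / P.δ * (4 * t) := by gcongr
        _ = 1 / 4 := by
          rw [ht]
          field_simp
          norm_num)
  have e : ∀ x, Real.cos (P.nextX x (ℓ.ψ x)) ^ 2 * ℓ.ρ x
      = 1 / 2 * ℓ.ρ x + 1 / 2 * (Real.cos (2 * P.nextX x (ℓ.ψ x)) * ℓ.ρ x) := fun x => by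
    rw [Real.cos_two_mul]
    ring
  simp only [e]
  rw [integral_add (hi.const_mul _) (hfi.const_mul _), integral_const_mul, integral_const_mul,
    hℓ.density_integral]
  have := (abs_le.1 h1).1
  linarith

end CurvePair

/-! ### The potential and its drift -/

/-- The function of the height `f`, corrected on the windows `|sin x| < s`, where the increment of
the height is decided by the next phase. -/
def testFun (P : Params) (f a : ℝ → ℝ) (β s x y : ℝ) : ℝ := f y + β * windowTerm P a s x y

/-- A function `f` of the height that is a quadratic polynomial: its increments over one step
`2 A t` are `β a t + b t²`. -/
structure IsQuadratic (P : Params) (R : ℝ) (f a : ℝ → ℝ) (a' β b B : ℝ) : Prop where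
  weight : IsWeight R a a'
  nonneg : 0 ≤ β
  measurable : Measurable f
  step : ∀ y t, f (y + 2 * P.A * t) = f y + β * a y * t + b * t ^ 2
  abs_le : ∀ y ∈ Icc (R / 8) (8 * R), |f y| ≤ B

section Periodicity

variable (P : Params) (f a : ℝ → ℝ) (β s x y : ℝ) (k : ℤ)

theorem nextX_sub_int : P.nextX (x - 2 * Real.pi * k) y = P.nextX x y - 2 * Real.pi * k := by
  unfold Params.nextX
  ring

theorem sin_sub_two_pi_mul_int : Real.sin (x - 2 * Real.pi * k) = Real.sin x := by
  rw [mul_comm, Real.sin_sub_int_mul_two_pi]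

theorem cos_sub_two_pi_mul_int : Real.cos (x - 2 * Real.pi * k) = Real.cos x := by
  rw [mul_comm, Real.cos_sub_int_mul_two_pi]

theorem nextY_sub_int : P.nextY (x - 2 * Real.pi * k) y = P.nextY x y := by
  simp only [Params.nextY, nextX_sub_int, cos_sub_two_pi_mul_int]

theorem windowTerm_sub_int : windowTerm P a s (x - 2 * Real.pi * k) y = windowTerm P a s x y := by
  simp only [windowTerm, nextX_sub_int, cos_sub_two_pi_mul_int, sin_sub_two_pi_mul_int]

theorem driftTerm_sub_int : driftTerm P a s (x - 2 * Real.pi * k) y = driftTerm P a s x y := by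
  simp only [driftTerm, outerTerm, nextX_sub_int, nextY_sub_int, cos_sub_two_pi_mul_int,
    sin_sub_two_pi_mul_int, windowTerm_sub_int]

theorem testFun_sub_int :
    testFun P f a β s (x - 2 * Real.pi * k) y = testFun P f a β s x y := by
  simp only [testFun, windowTerm_sub_int]

end Periodicity

namespace IsQuadratic

variable {P : Params} {R a' β b B s : ℝ} {f a : ℝ → ℝ}

/-- The increment of the test function along the orbit. -/
theorem testFun_next (h : IsQuadratic P R f a a' β b B) (x y : ℝ) :
    testFun P f a β s (P.nextX x y) (P.nextY x y)
      = testFun P f a β s x y + β * driftTerm P a s x y + b * Real.cos (P.nextX x y) ^ 2 := by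
  have h1 := h.step y (Real.cos (P.nextX x y))
  have e : outerTerm P a s x y = a y * Real.cos (P.nextX x y) - windowTerm P a s x y := by
    unfold outerTerm windowTerm
    by_cases hs : s ≤ |Real.sin x|
    · rw [if_pos hs, if_neg hs.not_gt, sub_zero]
    · rw [if_neg hs, if_pos (not_le.1 hs), sub_self]
  unfold testFun driftTerm
  rw [e]
  have e2 : P.nextY x y = y + 2 * P.A * Real.cos (P.nextX x y) := rfl
  rw [← e2] at h1
  rw [h1]
  ring

theorem measurable_testFun (h : IsQuadratic P R f a a' β b B) :
    Measurable fun z : ℝ × ℝ => testFun P f a β s z.1 z.2 :=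
  (h.measurable.comp measurable_snd).add ((measurable_windowTerm h.weight).const_mul β)

theorem abs_testFun_le (h : IsQuadratic P R f a a' β b B) {x y : ℝ}
    (hy : y ∈ Icc (R / 8) (8 * R)) : |testFun P f a β s x y| ≤ B + β := by
  unfold testFun
  refine (abs_add_le _ _).trans (add_le_add (h.abs_le y hy) ?_)
  rw [abs_mul, abs_of_nonneg h.nonneg]
  refine mul_le_of_le_one_right h.nonneg ((abs_windowTerm_le h.weight hy).trans ?_)
  split_ifs <;> norm_num

end IsQuadratic

theorem measurable_comp_next {P : Params} {h : ℝ → ℝ → ℝ}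
    (hh : Measurable fun z : ℝ × ℝ => h z.1 z.2) :
    Measurable fun z : ℝ × ℝ => h (P.nextX z.1 z.2) (P.nextY z.1 z.2) := by
  simpa only [Function.comp_def] using hh.comp ((measurable_nextX P).prodMk (measurable_nextY P))

namespace CurvePair

variable {P : Params} {L ystar : ℝ} {ℓ m n : CurvePair} {u v k k' : ℝ} {g g' : ℝ → ℝ}

/-- The expectation of a function of the lifted angle and the height. -/
def mean (ℓ : CurvePair) (h : ℝ → ℝ → ℝ) : ℝ := ∫ x in Ioo ℓ.a ℓ.b, h x (ℓ.ψ x) * ℓ.ρ x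

theorem IsBasic.integrableOn_comp (hℓ : ℓ.IsBasic ystar) {h : ℝ → ℝ → ℝ} {B : ℝ}
    (hm : Measurable fun z : ℝ × ℝ => h z.1 z.2) (hB : ∀ x ∈ Ioo ℓ.a ℓ.b, |h x (ℓ.ψ x)| ≤ B) :
    IntegrableOn (fun x => h x (ℓ.ψ x) * ℓ.ρ x) (Ioo ℓ.a ℓ.b) := by
  have hi := hℓ.integrable_density
  have h1 : AEMeasurable ℓ.ψ (volume.restrict (Ioo ℓ.a ℓ.b)) :=
    ContinuousOn.aemeasurable (fun x hx => (hℓ.hasDerivAt hx).continuousAt.continuousWithinAt)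
      measurableSet_Ioo
  refine (hi.const_mul B).mono'
    ((hm.comp_aemeasurable (aemeasurable_id.prodMk h1)).aestronglyMeasurable.mul
      hi.aestronglyMeasurable) ?_
  filter_upwards [ae_restrict_mem measurableSet_Ioo] with x hx
  have hρ := hℓ.density_pos x hx
  rw [Real.norm_eq_abs, abs_mul, abs_of_pos hρ]
  exact mul_le_mul_of_nonneg_right (hB x hx) hρ.le

theorem IsBasic.abs_mean_le (hℓ : ℓ.IsBasic ystar) {h : ℝ → ℝ → ℝ} {B : ℝ}
    (hB : ∀ x ∈ Ioo ℓ.a ℓ.b, |h x (ℓ.ψ x)| ≤ B) : |ℓ.mean h| ≤ B := by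
  have h1 := norm_integral_le_of_norm_le (hℓ.integrable_density.const_mul B)
    (f := fun x => h x (ℓ.ψ x) * ℓ.ρ x) (by
      filter_upwards [ae_restrict_mem measurableSet_Ioo] with x hx
      have hρ := hℓ.density_pos x hx
      rw [Real.norm_eq_abs, abs_mul, abs_of_pos hρ]
      exact mul_le_mul_of_nonneg_right (hB x hx) hρ.le)
  rwa [integral_const_mul, hℓ.density_integral, mul_one, Real.norm_eq_abs] at h1

theorem IsBasic.le_mean (hℓ : ℓ.IsBasic ystar) {h : ℝ → ℝ → ℝ} {B b : ℝ}
    (hm : Measurable fun z : ℝ × ℝ => h z.1 z.2) (hB : ∀ x ∈ Ioo ℓ.a ℓ.b, |h x (ℓ.ψ x)| ≤ B)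
    (hb : ∀ x ∈ Ioo ℓ.a ℓ.b, b ≤ h x (ℓ.ψ x)) : b ≤ ℓ.mean h := by
  have h1 := setIntegral_mono_on (hℓ.integrable_density.const_mul b) (hℓ.integrableOn_comp hm hB)
    measurableSet_Ioo fun x hx => mul_le_mul_of_nonneg_right (hb x hx) (hℓ.density_pos x hx).le
  rwa [integral_const_mul, hℓ.density_integral, mul_one] at h1

theorem IsBasic.mean_le (hℓ : ℓ.IsBasic ystar) {h : ℝ → ℝ → ℝ} {B b : ℝ}
    (hm : Measurable fun z : ℝ × ℝ => h z.1 z.2) (hB : ∀ x ∈ Ioo ℓ.a ℓ.b, |h x (ℓ.ψ x)| ≤ B)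
    (hb : ∀ x ∈ Ioo ℓ.a ℓ.b, h x (ℓ.ψ x) ≤ b) : ℓ.mean h ≤ b := by
  have h1 := setIntegral_mono_on (hℓ.integrableOn_comp hm hB) (hℓ.integrable_density.const_mul b)
    measurableSet_Ioo fun x hx => mul_le_mul_of_nonneg_right (hb x hx) (hℓ.density_pos x hx).le
  rwa [integral_const_mul, hℓ.density_integral, mul_one] at h1

/-- Expectations on the image of a piece. -/
theorem IsLift.mul_mean (hg : IsLift P ℓ u v m g k) (hm : m.IsBasic ystar) {h : ℝ → ℝ → ℝ}
    (hh : ∀ x y (j : ℤ), h (x - 2 * Real.pi * j) y = h x y) :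
    (∫ x in Ioo u v, ℓ.ρ x) * m.mean h
      = ∫ x in Ioo u v, h (P.nextX x (ℓ.ψ x)) (P.nextY x (ℓ.ψ x)) * ℓ.ρ x := by
  have h1 := hg.integral_piece hm fun x => h x (m.ψ x)
  rw [mean, ← h1]
  obtain ⟨j, hj⟩ := hg.lift
  refine setIntegral_congr_fun measurableSet_Ioo fun x hx => ?_
  rw [hg.curve x hx, hj, hh]

/-- Expectations on the second image of a stand-by piece. -/
theorem IsLift.mul_mean_comp (hg : IsLift P ℓ u v m g k) (hg' : IsLift P m m.a m.b n g' k')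
    (hm : m.IsBasic ystar) (hn : n.IsBasic ystar) {h : ℝ → ℝ → ℝ}
    (hh : ∀ x y (j : ℤ), h (x - 2 * Real.pi * j) y = h x y) :
    (∫ x in Ioo u v, ℓ.ρ x) * n.mean h
      = ∫ x in Ioo u v, h (P.nextX (P.nextX x (ℓ.ψ x)) (P.nextY x (ℓ.ψ x)))
        (P.nextY (P.nextX x (ℓ.ψ x)) (P.nextY x (ℓ.ψ x))) * ℓ.ρ x := by
  have h1 := hg'.mul_mean hn hh
  rw [hm.density_integral, one_mul] at h1
  rw [h1]
  refine hg.mul_mean hm (h := fun x y => h (P.nextX x y) (P.nextY x y)) fun x y j => ?_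
  rw [nextX_sub_int, nextY_sub_int, hh]

end CurvePair

namespace CuttingRule

variable {P : Params} {L ystar : ℝ} {F : Phase → Phase} (S : CuttingRule P ystar F) {ℓ : CurvePair}
  {R a' β b B s ε : ℝ} {f a : ℝ → ℝ}

/-- The heights of the target of a piece are close to the heights of the pair. -/
theorem target_height (hP : P.Pos) (hF : P.IsTwistMap L F) (hL : 0 ≤ L) (hy : L < ystar)
    (hℓ : ℓ.IsStandard P ystar) {c : Piece} (hc : c ∈ S.pieces ℓ) {lo hi : ℝ}
    (hh : ∀ x ∈ Ioo ℓ.a ℓ.b, ℓ.ψ x ∈ Icc lo hi) :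
    ∀ x ∈ Ioo c.target.a c.target.b, c.target.ψ x ∈ Icc (lo - 4 * P.A) (hi + 4 * P.A) := by
  have hA := hP.A_pos
  have hsub := S.piece_subset hℓ hc
  intro z hz
  rcases (S.admissible ℓ hℓ c hc).exists_isLift hP hF hL hy hℓ.toIsBasic with
    ⟨-, g, k, hg⟩ | ⟨-, m, g, k, g', k', hm, hg, hg'⟩
  · rw [← hg.image] at hz
    obtain ⟨x, hx, rfl⟩ := hz
    rw [hg.curve x hx]
    have h1 := hh x (hsub hx)
    have h2 := abs_le.1 (abs_nextY_sub_le hA x (ℓ.ψ x))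
    constructor <;> linarith [h1.1, h1.2, h2.1, h2.2]
  · rw [← hg'.image] at hz
    obtain ⟨y, hy', rfl⟩ := hz
    rw [hg'.curve y hy']
    rw [← hg.image] at hy'
    obtain ⟨x, hx, rfl⟩ := hy'
    rw [hg.curve x hx]
    have h1 := hh x (hsub hx)
    have h2 := abs_le.1 (abs_nextY_sub_le hA x (ℓ.ψ x))
    have h3 := abs_le.1 (abs_nextY_sub_le hA (g x) (P.nextY x (ℓ.ψ x)))
    constructor <;> linarith [h1.1, h1.2, h2.1, h2.2, h3.1, h3.2]

/-- The expectation of the test function on the target of a piece. On a piece that is mapped in one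
step the drift has been charged on the target, where it is at most `ε`; on a stand-by piece it is
that of the second step. In this way both kinds of pieces give the same integral, over the whole
piece. -/
theorem mass_mul_mean_le (hP : P.Pos) (hF : P.IsTwistMap L F) (hL : 0 ≤ L) (hy : L < ystar)
    (hRA : 48 * P.A ≤ R) (hq : IsQuadratic P R f a a' β b B) (hℓ : ℓ.IsStandard P ystar)
    (hh : ∀ x ∈ Ioo ℓ.a ℓ.b, ℓ.ψ x ∈ Icc (R / 2) (2 * R)) {c : Piece} (hc : c ∈ S.pieces ℓ)
    (hε : |c.target.mean (driftTerm P a s)| ≤ ε) :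
    ℓ.mass c * c.target.mean (testFun P f a β s)
      ≤ (∫ x in Ioo c.left c.right,
          (testFun P f a β s (P.nextX x (ℓ.ψ x)) (P.nextY x (ℓ.ψ x))
            + β * driftTerm P a s (P.nextX x (ℓ.ψ x)) (P.nextY x (ℓ.ψ x))) * ℓ.ρ x)
        + (β * ε + max b 0) * ℓ.mass c := by
  have hA := hP.A_pos
  have hβ := hq.nonneg
  have hsub := S.piece_subset hℓ hc
  have hadm := S.admissible ℓ hℓ c hc
  have hn := hadm.2.2.2.1
  have hmass := S.mass_nonneg hℓ ⟨c, hc⟩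
  have hε0 : 0 ≤ ε := (abs_nonneg _).trans hε
  have hs1 : ∀ x ∈ Ioo ℓ.a ℓ.b, P.nextY x (ℓ.ψ x) ∈ Icc (R / 4) (4 * R) := by
    intro x hx
    have h1 := hh x hx
    have h2 := abs_le.1 (abs_nextY_sub_le hA x (ℓ.ψ x))
    constructor <;> linarith [h1.1, h1.2, h2.1, h2.2]
  have hs2 : ∀ x ∈ Ioo ℓ.a ℓ.b,
      P.nextY (P.nextX x (ℓ.ψ x)) (P.nextY x (ℓ.ψ x)) ∈ Icc (R / 8) (8 * R) := by
    intro x hx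
    have h1 := hs1 x hx
    have h2 := abs_le.1 (abs_nextY_sub_le hA (P.nextX x (ℓ.ψ x)) (P.nextY x (ℓ.ψ x)))
    constructor <;> linarith [h1.1, h1.2, h2.1, h2.2]
  have hmt := hq.measurable_testFun (s := s)
  have hmd := measurable_driftTerm (P := P) (s := s) hq.weight
  have hi1 := hℓ.integrableOn_comp
    (h := fun x y => testFun P f a β s (P.nextX x y) (P.nextY x y))
    (measurable_comp_next (P := P) hmt) (B := B + β)
    fun x hx => hq.abs_testFun_le ⟨by linarith [(hs1 x hx).1], by linarith [(hs1 x hx).2]⟩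
  have hi2 := hℓ.integrableOn_comp
    (h := fun x y => driftTerm P a s (P.nextX x y) (P.nextY x y))
    (measurable_comp_next (P := P) hmd) (B := 2)
    fun x hx => abs_driftTerm_le hq.weight
      ⟨by linarith [(hs1 x hx).1], by linarith [(hs1 x hx).2]⟩ (hs2 x hx)
  have hsplit : ∫ x in Ioo c.left c.right,
          (testFun P f a β s (P.nextX x (ℓ.ψ x)) (P.nextY x (ℓ.ψ x))
            + β * driftTerm P a s (P.nextX x (ℓ.ψ x)) (P.nextY x (ℓ.ψ x))) * ℓ.ρ x
      = (∫ x in Ioo c.left c.right,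
          testFun P f a β s (P.nextX x (ℓ.ψ x)) (P.nextY x (ℓ.ψ x)) * ℓ.ρ x)
        + β * ∫ x in Ioo c.left c.right,
            driftTerm P a s (P.nextX x (ℓ.ψ x)) (P.nextY x (ℓ.ψ x)) * ℓ.ρ x := by
    simp only [add_mul, mul_assoc β]
    rw [integral_add (hi1.mono_set hsub) ((hi2.mono_set hsub).const_mul β), integral_const_mul]
  rcases hadm.exists_isLift hP hF hL hy hℓ.toIsBasic with
    ⟨-, g, k, hg⟩ | ⟨-, m, g, k, g', k', hm, hg, hg'⟩
  · -- the drift of the target is added, and paid for by `ε`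
    have h1 := hg.mul_mean hn.toIsBasic (testFun_sub_int P f a β s)
    have h2 := hg.mul_mean hn.toIsBasic (driftTerm_sub_int P a s)
    change ℓ.mass c * _ = _ at h1 h2
    rw [hsplit, h1, ← h2]
    have h3 : 0 ≤ β * (ℓ.mass c * (c.target.mean (driftTerm P a s) + ε)) :=
      mul_nonneg hβ (mul_nonneg hmass (by linarith [(abs_le.1 hε).1]))
    have h4 : 0 ≤ max b 0 * ℓ.mass c := mul_nonneg (le_max_right _ _) hmass
    linarith
  · -- the drift of the second step is the increment of the test function between the two images
    have h1 := hg.mul_mean_comp hg' hm hn.toIsBasic (testFun_sub_int P f a β s)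
    change ℓ.mass c * _ = _ at h1
    have h5 : 0 ≤ β * ε * ℓ.mass c := by positivity
    have h6 : (∫ x in Ioo c.left c.right, testFun P f a β s
        (P.nextX (P.nextX x (ℓ.ψ x)) (P.nextY x (ℓ.ψ x)))
        (P.nextY (P.nextX x (ℓ.ψ x)) (P.nextY x (ℓ.ψ x))) * ℓ.ρ x)
        ≤ ∫ x in Ioo c.left c.right,
          ((testFun P f a β s (P.nextX x (ℓ.ψ x)) (P.nextY x (ℓ.ψ x))
            + β * driftTerm P a s (P.nextX x (ℓ.ψ x)) (P.nextY x (ℓ.ψ x))) * ℓ.ρ x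
            + max b 0 * ℓ.ρ x) := by
      have hi3 := hℓ.integrableOn_comp (h := fun x y => testFun P f a β s
          (P.nextX (P.nextX x y) (P.nextY x y)) (P.nextY (P.nextX x y) (P.nextY x y)))
        (measurable_comp_next (h := fun x y => testFun P f a β s (P.nextX x y) (P.nextY x y))
          (measurable_comp_next hmt)) (B := B + β)
        fun x hx => hq.abs_testFun_le (hs2 x hx)
      have hi4 : IntegrableOn (fun x => (testFun P f a β s (P.nextX x (ℓ.ψ x)) (P.nextY x (ℓ.ψ x))
            + β * driftTerm P a s (P.nextX x (ℓ.ψ x)) (P.nextY x (ℓ.ψ x))) * ℓ.ρ x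
            + max b 0 * ℓ.ρ x) (Ioo ℓ.a ℓ.b) := by
        refine Integrable.add ?_ (hℓ.integrable_density.const_mul _)
        simp only [add_mul, mul_assoc β]
        exact hi1.add (hi2.const_mul β)
      refine setIntegral_mono_on (hi3.mono_set hsub) (hi4.mono_set hsub) measurableSet_Ioo
        fun x hx => ?_
      have hρ := hℓ.density_pos x (hsub hx)
      rw [hq.testFun_next, ← add_mul]
      refine mul_le_mul_of_nonneg_right ?_ hρ.le
      have h7 : b * Real.cos (P.nextX (P.nextX x (ℓ.ψ x)) (P.nextY x (ℓ.ψ x))) ^ 2 ≤ max b 0 := by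
        have h8 := Real.cos_sq_le_one (P.nextX (P.nextX x (ℓ.ψ x)) (P.nextY x (ℓ.ψ x)))
        refine (mul_le_mul_of_nonneg_right (le_max_left b 0) (sq_nonneg _)).trans ?_
        exact mul_le_of_le_one_right (le_max_right _ _) h8
      linarith
    rw [integral_add _ ((hℓ.integrable_density.mono_set hsub).const_mul _), integral_const_mul] at h6
    · rw [h1]
      change _ ≤ _ + max b 0 * ℓ.mass c at h6
      linarith
    · simp only [add_mul, mul_assoc β]
      exact (hi1.mono_set hsub).add ((hi2.mono_set hsub).const_mul β)

end CuttingRule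

namespace CuttingRule

variable {P : Params} {L ystar : ℝ} {F : Phase → Phase} (S : CuttingRule P ystar F) {ℓ : CurvePair}
  {R a' β b B s ε lo : ℝ} {f a : ℝ → ℝ}

theorem summable_mass_mul (hℓ : ℓ.IsStandard P ystar) {v : CurvePair → ℝ} {C : ℝ}
    (hv : ∀ c ∈ S.pieces ℓ, |v c.target| ≤ C) :
    Summable fun c : S.pieces ℓ => ℓ.mass c * v (c : Piece).target := by
  refine Summable.of_norm_bounded ((S.hasSum_mass hℓ).summable.mul_right C) fun c => ?_
  rw [Real.norm_eq_abs, abs_mul, abs_of_nonneg (S.mass_nonneg hℓ c)]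
  exact mul_le_mul_of_nonneg_left (hv c c.2) (S.mass_nonneg hℓ c)

/-- The mean of the test function over the targets of the pieces, compared with its expectation on
the pair: the drift is small, the quadratic term is averaged over the phase, and the remainder is
lost. -/
theorem exists_hasSum_mean_le (hP : P.Pos) (hF : P.IsTwistMap L F) (hL : 0 ≤ L) (hy : L < ystar)
    (hRA : 48 * P.A ≤ R) (hq : IsQuadratic P R f a a' β b B) (hℓ : ℓ.IsStandard P ystar)
    (hh : ∀ x ∈ Ioo ℓ.a ℓ.b, ℓ.ψ x ∈ Icc (R / 2) (2 * R))
    (hε : ∀ m : CurvePair, m.IsStandard P ystar →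
      (∀ x ∈ Ioo m.a m.b, m.ψ x ∈ Icc (2 * R / 5) (5 * R / 2)) →
      |m.mean (driftTerm P a s)| ≤ ε ∧
      |m.mean (fun x y => driftTerm P a s (P.nextX x y) (P.nextY x y))| ≤ ε)
    (hlo : ∀ x ∈ Ioo ℓ.a ℓ.b, lo ≤ testFun P f a β s (P.nextX x (ℓ.ψ x)) (P.nextY x (ℓ.ψ x))) :
    ∃ σ, HasSum (fun c : S.pieces ℓ => ℓ.mass c * (c : Piece).target.mean (testFun P f a β s)) σ ∧
      σ ≤ ℓ.mean (testFun P f a β s) + 3 * (β * ε)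
        + b * (∫ x in Ioo ℓ.a ℓ.b, Real.cos (P.nextX x (ℓ.ψ x)) ^ 2 * ℓ.ρ x) + max b 0
        - (lo - 2 * β) * S.stopProb ℓ := by
  have hA := hP.A_pos
  have hβ := hq.nonneg
  have hi := hℓ.integrable_density
  have hs1 : ∀ x ∈ Ioo ℓ.a ℓ.b, P.nextY x (ℓ.ψ x) ∈ Icc (R / 8) (8 * R) := by
    intro x hx
    have h1 := hh x hx
    have h2 := abs_le.1 (abs_nextY_sub_le hA x (ℓ.ψ x))
    constructor <;> linarith [h1.1, h1.2, h2.1, h2.2]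
  have hs2 : ∀ x ∈ Ioo ℓ.a ℓ.b,
      P.nextY (P.nextX x (ℓ.ψ x)) (P.nextY x (ℓ.ψ x)) ∈ Icc (R / 8) (8 * R) := by
    intro x hx
    have h1 := hh x hx
    have h2 := abs_le.1 (abs_nextY_sub_le hA x (ℓ.ψ x))
    have h3 := abs_le.1 (abs_nextY_sub_le hA (P.nextX x (ℓ.ψ x)) (P.nextY x (ℓ.ψ x)))
    constructor <;> linarith [h1.1, h1.2, h2.1, h2.2, h3.1, h3.2]
  have hs0 : ∀ x ∈ Ioo ℓ.a ℓ.b, ℓ.ψ x ∈ Icc (R / 8) (8 * R) := fun x hx =>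
    ⟨by linarith [(hh x hx).1], by linarith [(hh x hx).2]⟩
  have hmt := hq.measurable_testFun (s := s)
  have hmd := measurable_driftTerm (P := P) (s := s) hq.weight
  have hi1 := hℓ.integrableOn_comp
    (h := fun x y => testFun P f a β s (P.nextX x y) (P.nextY x y))
    (measurable_comp_next (P := P) hmt) fun x hx => hq.abs_testFun_le (hs1 x hx)
  have hi2 := hℓ.integrableOn_comp
    (h := fun x y => driftTerm P a s (P.nextX x y) (P.nextY x y))
    (measurable_comp_next (P := P) hmd) fun x hx =>
      abs_driftTerm_le hq.weight (hs1 x hx) (hs2 x hx)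
  have hi3 := hℓ.integrableOn_comp (h := testFun P f a β s) hmt fun x hx =>
    hq.abs_testFun_le (hs0 x hx)
  have hi4 := hℓ.integrableOn_comp (h := driftTerm P a s) hmd fun x hx =>
    abs_driftTerm_le hq.weight (hs0 x hx) (hs1 x hx)
  have hi5 := hℓ.integrableOn_comp (h := fun x y => Real.cos (P.nextX x y) ^ 2) (B := 1)
    ((Real.measurable_cos.comp (measurable_nextX P)).pow_const 2) fun x _ => by
      rw [abs_of_nonneg (sq_nonneg _)]
      exact Real.cos_sq_le_one _
  obtain ⟨H, hH⟩ : ∃ H : ℝ → ℝ, H = fun x =>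
    (testFun P f a β s (P.nextX x (ℓ.ψ x)) (P.nextY x (ℓ.ψ x))
      + β * driftTerm P a s (P.nextX x (ℓ.ψ x)) (P.nextY x (ℓ.ψ x))) * ℓ.ρ x := ⟨_, rfl⟩
  have hHi : IntegrableOn H (Ioo ℓ.a ℓ.b) := by
    rw [hH]
    simp only [add_mul, mul_assoc β]
    exact hi1.add (hi2.const_mul β)
  have hchild : ∀ c ∈ S.pieces ℓ, c.target.IsStandard P ystar ∧
      ∀ x ∈ Ioo c.target.a c.target.b, c.target.ψ x ∈ Icc (2 * R / 5) (5 * R / 2) := by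
    intro c hc
    refine ⟨(S.admissible ℓ hℓ c hc).2.2.2.1, fun x hx => ?_⟩
    have := S.target_height hP hF hL hy hℓ hc hh x hx
    constructor <;> linarith [this.1, this.2]
  have hsum : Summable fun c : S.pieces ℓ =>
      ℓ.mass c * (c : Piece).target.mean (testFun P f a β s) := by
    refine S.summable_mass_mul hℓ (v := fun m => m.mean (testFun P f a β s)) (C := B + β)
      fun c hc => ?_
    obtain ⟨hn, hnh⟩ := hchild c hc
    exact hn.abs_mean_le fun x hx => hq.abs_testFun_le
      ⟨by linarith [(hnh x hx).1, (hs0 _ ⟨left_lt_add_div_two.2 hℓ.lt, add_div_two_lt_right.2 hℓ.lt⟩).1,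
        (hs0 _ ⟨left_lt_add_div_two.2 hℓ.lt, add_div_two_lt_right.2 hℓ.lt⟩).2],
      by linarith [(hnh x hx).2, (hs0 _ ⟨left_lt_add_div_two.2 hℓ.lt, add_div_two_lt_right.2 hℓ.lt⟩).1,
        (hs0 _ ⟨left_lt_add_div_two.2 hℓ.lt, add_div_two_lt_right.2 hℓ.lt⟩).2]⟩
  refine ⟨_, hsum.hasSum, ?_⟩
  have h1 := (S.hasSum_pieces hℓ (A := fun c => Ioo c.left c.right) (fun _ _ => measurableSet_Ioo)
    (fun _ => Subset.rfl) hHi).add ((S.hasSum_mass hℓ).mul_left (β * ε + max b 0))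
  have h2 := hasSum_le (fun c : S.pieces ℓ => by
    have h3 := S.mass_mul_mean_le hP hF hL hy hRA hq hℓ hh c.2
      (hε _ (hchild c c.2).1 (hchild c c.2).2).1
    rw [hH]
    exact h3) hsum.hasSum h1
  refine h2.trans ?_
  have hps := S.pieceSet_subset hℓ
  have hpm := (S.isOpen_pieceSet (ℓ := ℓ)).measurableSet
  have h4 : ∫ x in Ioo ℓ.a ℓ.b \ S.pieceSet ℓ, H x
      = (∫ x in Ioo ℓ.a ℓ.b, H x) - ∫ x in S.pieceSet ℓ, H x := setIntegral_sdiff hpm hHi hps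
  have h5 : (lo - 2 * β) * S.stopProb ℓ ≤ ∫ x in Ioo ℓ.a ℓ.b \ S.pieceSet ℓ, H x := by
    rw [S.stopProb_eq, ← integral_const_mul]
    refine setIntegral_mono_on ((hi.mono_set sdiff_subset).const_mul _) (hHi.mono_set sdiff_subset)
      (measurableSet_Ioo.diff hpm) fun x hx => ?_
    have hρ := hℓ.density_pos x hx.1
    rw [hH]
    refine mul_le_mul_of_nonneg_right ?_ hρ.le
    have h6 := (abs_le.1 (abs_driftTerm_le (P := P) (s := s) (x := P.nextX x (ℓ.ψ x)) hq.weight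
      (hs1 x hx.1) (hs2 x hx.1))).1
    have h7 := hlo x hx.1
    nlinarith
  have h6 : ∫ x in Ioo ℓ.a ℓ.b, H x
      = (ℓ.mean (testFun P f a β s) + β * ℓ.mean (driftTerm P a s)
        + b * ∫ x in Ioo ℓ.a ℓ.b, Real.cos (P.nextX x (ℓ.ψ x)) ^ 2 * ℓ.ρ x)
        + β * ℓ.mean (fun x y => driftTerm P a s (P.nextX x y) (P.nextY x y)) := by
    rw [hH]
    unfold CurvePair.mean
    simp only [hq.testFun_next, add_mul, mul_assoc β, mul_assoc b]
    have hi6 : IntegrableOn (fun x => testFun P f a β s x (ℓ.ψ x) * ℓ.ρ x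
        + β * (driftTerm P a s x (ℓ.ψ x) * ℓ.ρ x)) (Ioo ℓ.a ℓ.b) := hi3.add (hi4.const_mul β)
    have hi7 : IntegrableOn (fun x => testFun P f a β s x (ℓ.ψ x) * ℓ.ρ x
        + β * (driftTerm P a s x (ℓ.ψ x) * ℓ.ρ x)
        + b * (Real.cos (P.nextX x (ℓ.ψ x)) ^ 2 * ℓ.ρ x)) (Ioo ℓ.a ℓ.b) :=
      hi6.add (hi5.const_mul b)
    rw [integral_add hi7 (hi2.const_mul β), integral_add hi6 (hi5.const_mul b),
      integral_add hi3 (hi4.const_mul β), integral_const_mul, integral_const_mul,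
      integral_const_mul]
  obtain ⟨h7, h8⟩ := hε ℓ hℓ fun x hx => by
    have h1 := hh x hx
    constructor <;> linarith [h1.1, h1.2]
  have h9 : β * ℓ.mean (driftTerm P a s) ≤ β * ε :=
    mul_le_mul_of_nonneg_left (abs_le.1 h7).2 hβ
  have h10 : β * ℓ.mean (fun x y => driftTerm P a s (P.nextX x y) (P.nextY x y)) ≤ β * ε :=
    mul_le_mul_of_nonneg_left (abs_le.1 h8).2 hβ
  have h11 : (β * ε + max b 0) * (1 - S.stopProb ℓ) ≤ β * ε + max b 0 := by
    refine mul_le_of_le_one_right (add_nonneg (mul_nonneg hβ ((abs_nonneg _).trans h7))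
      (le_max_right _ _)) ?_
    linarith [S.stopProb_nonneg hℓ]
  change (∫ x in S.pieceSet ℓ, H x) + _ ≤ _
  linarith

end CuttingRule

/-- The quadratic polynomial in `z = (y - R) / R` with the coefficients `c₀`, `c₁`, `c₂`. -/
def quadFun (c₀ c₁ c₂ R y : ℝ) : ℝ := c₀ + c₁ * ((y - R) / R) + c₂ * ((y - R) / R) ^ 2

/-- The derivative of the quadratic polynomial, normalized so that it is at most `1` at the heights
that occur. -/
def quadSlope (c₁ c₂ R y : ℝ) : ℝ := (c₁ + 2 * c₂ * ((y - R) / R)) / 14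

/-- The constants refer to the range `|z| ≤ 7` of the variable for the heights in `[R/8, 8R]`; with
`|c₁| + 14 |c₂| ≤ 14` the normalized slope is at most `1` there. -/
theorem isQuadratic_quadFun {P : Params} (hA : 0 < P.A) {R c₀ c₁ c₂ : ℝ} (hR : 1 ≤ R)
    (h0 : |c₀| ≤ 1) (h12 : |c₁| + 14 * |c₂| ≤ 14) :
    IsQuadratic P R (quadFun c₀ c₁ c₂ R) (quadSlope c₁ c₂ R) (c₂ / (7 * R)) (28 * P.A / R)
      (4 * P.A ^ 2 * c₂ / R ^ 2) 99 := by
  have hR0 : 0 < R := by linarith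
  have hz : ∀ y ∈ Icc (R / 8) (8 * R), |(y - R) / R| ≤ 7 := by
    intro y hy
    rw [abs_div, abs_of_pos hR0, div_le_iff₀ hR0, abs_le]
    constructor <;> linarith [hy.1, hy.2]
  have hc2 : |c₂| ≤ 1 := by linarith [abs_nonneg c₁]
  refine ⟨⟨fun y => ?_, ?_, fun y hy => ?_⟩, by positivity, ?_, fun y t => ?_, fun y hy => ?_⟩
  · refine (((((hasDerivAt_id y).sub_const R).div_const R).const_mul (2 * c₂)).const_add
      c₁).div_const 14 |>.congr_deriv ?_
    field_simp
    ring
  · rw [abs_div, abs_of_pos (by positivity : 0 < 7 * R), div_le_one (by positivity)]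
    linarith
  · unfold quadSlope
    rw [abs_div, abs_of_pos (by norm_num : (0 : ℝ) < 14), div_le_one (by norm_num)]
    have h1 := hz y hy
    have h2 : |2 * c₂ * ((y - R) / R)| ≤ 2 * |c₂| * 7 := by
      rw [abs_mul, abs_mul, abs_two]
      gcongr
    refine (abs_add_le _ _).trans ?_
    linarith
  · unfold quadFun
    fun_prop
  · unfold quadFun quadSlope
    field_simp
    ring
  · unfold quadFun
    have h1 := hz y hy
    have h2 : |c₁ * ((y - R) / R)| ≤ |c₁| * 7 := by
      rw [abs_mul]
      gcongr
    have h3 : |c₂ * ((y - R) / R) ^ 2| ≤ |c₂| * 7 ^ 2 := by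
      rw [abs_mul, abs_pow]
      gcongr
    have := abs_add_three c₀ (c₁ * ((y - R) / R)) (c₂ * ((y - R) / R) ^ 2)
    linarith [abs_nonneg c₁, abs_nonneg c₂]

namespace CuttingRule

variable {P : Params} {ystar : ℝ} {F : Phase → Phase}

/-- The potential of a pair: the expectation of the test function, minus a multiple of the
probability of the remainder. The windows have the width `M / √Y'(R)`. -/
def potential (S : CuttingRule P ystar F) (c₀ c₁ c₂ κ M R : ℝ) (ℓ : CurvePair) : ℝ :=
  ℓ.mean (testFun P (quadFun c₀ c₁ c₂ R) (quadSlope c₁ c₂ R) (28 * P.A / R) (M / √(P.twist R)))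
    - κ * S.stopProb ℓ

/-- The potential decreases on the average by `d` in each step from the heights `[R/2, 2R]`. -/
def PotentialDecreases (S : CuttingRule P ystar F) (c₀ c₁ c₂ κ M R d : ℝ) : Prop :=
  ∀ ℓ : CurvePair, ℓ.IsStandard P ystar → (∀ x ∈ Ioo ℓ.a ℓ.b, ℓ.ψ x ∈ Icc (R / 2) (2 * R)) →
    ∃ σ, HasSum (fun c : S.pieces ℓ => ℓ.mass c * S.potential c₀ c₁ c₂ κ M R (c : Piece).target) σ ∧
      σ ≤ S.potential c₀ c₁ c₂ κ M R ℓ - d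

/-- The bound on the drift along weighted curves, for standard pairs. -/
theorem exists_drift_small (hP : P.Pos) (hδ : 0 < P.δ) (hδ' : P.δ < Real.pi / 4) (hD : 0 < P.D)
    {ε c₁ c₂ : ℝ} (hε : 0 < ε) (h12 : |c₁| + 14 * |c₂| ≤ 14) :
    ∃ M : ℝ, 0 < M ∧ ∀ᶠ R in atTop, ∀ (ystar : ℝ) (m : CurvePair), m.IsStandard P ystar →
      (∀ x ∈ Ioo m.a m.b, m.ψ x ∈ Icc (2 * R / 5) (5 * R / 2)) →
      |m.mean (driftTerm P (quadSlope c₁ c₂ R) (M / √(P.twist R)))| ≤ ε / √(P.twist R) ∧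
      |m.mean (fun x y => driftTerm P (quadSlope c₁ c₂ R) (M / √(P.twist R))
        (P.nextX x y) (P.nextY x y))| ≤ ε / √(P.twist R) := by
  have hK := hP.one_le_stdConst hD
  obtain ⟨M, hM, h⟩ := RegCurve.exists_abs_integral_drift_next_le hP (K := P.stdConst)
    (ε := ε * P.δ / 12) (by linarith) (by positivity)
  refine ⟨M, hM, ?_⟩
  filter_upwards [h, CurvePair.eventually_regCurve hP hδ hδ' hD, eventually_ge_atTop 1]
    with R h hreg hR
  intro ystar m hm hh
  have hreg' := hreg ystar m hm fun x hx => ⟨by linarith [(hh x hx).1], by linarith [(hh x hx).2]⟩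
  have h1 := h _ _ _ _ _ _ _ _ _ _ hreg' hm.lt (hm.length_le_one hδ') (by positivity)
    (isQuadratic_quadFun hP.A_pos (c₀ := 0) hR (by simp) h12).weight hh
  have e : ε * P.δ / 12 * (12 / P.δ) = ε := by
    field_simp
  rw [e] at h1
  exact h1

end CuttingRule

/-- The window term changes the test function by at most `β`. -/
theorem IsQuadratic.abs_testFun_sub_le {P : Params} {R a' β b B s : ℝ} {f a : ℝ → ℝ}
    (h : IsQuadratic P R f a a' β b B) {x y : ℝ} (hy : y ∈ Icc (R / 8) (8 * R)) :
    |testFun P f a β s x y - f y| ≤ β := by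
  unfold testFun
  rw [add_sub_cancel_left, abs_mul, abs_of_nonneg h.nonneg]
  refine mul_le_of_le_one_right h.nonneg ((abs_windowTerm_le h.weight hy).trans ?_)
  split_ifs <;> norm_num

theorem sub_div_mem {R y lo hi : ℝ} (hR : 0 < R) (hy : y ∈ Icc ((1 + lo) * R) ((1 + hi) * R)) :
    (y - R) / R ∈ Icc lo hi := by
  constructor
  · rw [le_div_iff₀ hR]
    linarith [hy.1]
  · rw [div_le_iff₀ hR]
    linarith [hy.2]

namespace CuttingRule

variable {P : Params} {L ystar : ℝ} {F : Phase → Phase} (S : CuttingRule P ystar F) {ℓ : CurvePair}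
  {R ε l c₀ c₁ c₂ κ M : ℝ}

/-- The mean change of the potential in one step: the drift, the diffusion, and two gains from the
mass that is lost into the remainder, now and in the next step. The variable `z = (y - R) / R` stays
in `[-0.51, 1.1]`, where the quadratic polynomial is at least `l`. -/
theorem exists_hasSum_potential_le (hP : P.Pos) (hF : P.IsTwistMap L F) (hL : 0 ≤ L)
    (hy : L < ystar) (hR : 1 ≤ R) (hRA : 200 * P.A ≤ R) (h0 : |c₀| ≤ 1)
    (h12 : |c₁| + 14 * |c₂| ≤ 14) (hℓ : ℓ.IsStandard P ystar)
    (hh : ∀ x ∈ Ioo ℓ.a ℓ.b, ℓ.ψ x ∈ Icc (R / 2) (2 * R))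
    (hε : ∀ (ystar : ℝ) (m : CurvePair), m.IsStandard P ystar →
      (∀ x ∈ Ioo m.a m.b, m.ψ x ∈ Icc (2 * R / 5) (5 * R / 2)) →
      |m.mean (driftTerm P (quadSlope c₁ c₂ R) (M / √(P.twist R)))| ≤ ε / √(P.twist R) ∧
      |m.mean (fun x y => driftTerm P (quadSlope c₁ c₂ R) (M / √(P.twist R))
        (P.nextX x y) (P.nextY x y))| ≤ ε / √(P.twist R))
    (hl : ∀ z ∈ Icc (-0.51 : ℝ) 1.1, l ≤ c₀ + c₁ * z + c₂ * z ^ 2) :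
    ∃ σ σ₂, HasSum (fun c : S.pieces ℓ =>
        ℓ.mass c * S.potential c₀ c₁ c₂ κ M R (c : Piece).target) σ ∧
      HasSum (fun c : S.pieces ℓ => ℓ.mass c * S.stopProb (c : Piece).target) σ₂ ∧ 0 ≤ σ₂ ∧
      σ ≤ S.potential c₀ c₁ c₂ κ M R ℓ + 84 * P.A * ε / (R * √(P.twist R))
        + 4 * P.A ^ 2 * c₂ / R ^ 2
          * (∫ x in Ioo ℓ.a ℓ.b, Real.cos (P.nextX x (ℓ.ψ x)) ^ 2 * ℓ.ρ x)
        + max (4 * P.A ^ 2 * c₂ / R ^ 2) 0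
        - (l - 84 * P.A / R - κ) * S.stopProb ℓ - κ * σ₂ := by
  have hA := hP.A_pos
  have hR0 : 0 < R := by linarith
  have hq := isQuadratic_quadFun hA hR h0 h12
  obtain ⟨σ, hσ, hσ1⟩ := S.exists_hasSum_mean_le (lo := l - 28 * P.A / R) hP hF hL hy (by linarith)
    hq hℓ hh (hε ystar) (fun x hx => by
      have h1 := hh x hx
      have h2 := abs_le.1 (abs_nextY_sub_le hA x (ℓ.ψ x))
      have h3 := (abs_le.1 (hq.abs_testFun_sub_le (s := M / √(P.twist R))
        (x := P.nextX x (ℓ.ψ x)) (y := P.nextY x (ℓ.ψ x))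
        ⟨by linarith [h1.1, h2.1], by linarith [h1.2, h2.2]⟩)).1
      have h4 := hl ((P.nextY x (ℓ.ψ x) - R) / R) (sub_div_mem hR0
        ⟨by linarith [h1.1, h2.1], by linarith [h1.2, h2.2]⟩)
      change l ≤ quadFun c₀ c₁ c₂ R (P.nextY x (ℓ.ψ x)) at h4
      linarith)
  have h1 := (S.summable_mass_mul hℓ (v := S.stopProb) (C := 1) fun c hc => by
    have hn := (S.admissible ℓ hℓ c hc).2.2.2.1
    rw [abs_of_nonneg (S.stopProb_nonneg hn)]
    exact S.stopProb_le_one hn).hasSum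
  have h2 : HasSum (fun c : S.pieces ℓ =>
      ℓ.mass c * S.potential c₀ c₁ c₂ κ M R (c : Piece).target)
      (σ - κ * ∑' c : S.pieces ℓ, ℓ.mass c * S.stopProb (c : Piece).target) := by
    have e : (fun c : S.pieces ℓ => ℓ.mass c * S.potential c₀ c₁ c₂ κ M R (c : Piece).target)
        = fun c : S.pieces ℓ => ℓ.mass c * (c : Piece).target.mean (testFun P (quadFun c₀ c₁ c₂ R)
          (quadSlope c₁ c₂ R) (28 * P.A / R) (M / √(P.twist R)))
          - κ * (ℓ.mass c * S.stopProb (c : Piece).target) := by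
      funext c
      unfold potential
      ring
    rw [e]
    exact hσ.sub (h1.mul_left κ)
  refine ⟨_, _, h2, h1, h1.nonneg fun c => mul_nonneg (S.mass_nonneg hℓ c)
    (S.stopProb_nonneg (S.admissible ℓ hℓ c c.2).2.2.2.1), ?_⟩
  · have e1 : 3 * (28 * P.A / R * (ε / √(P.twist R))) = 84 * P.A * ε / (R * √(P.twist R)) := by
      field_simp
      ring
    have e2 : l - 28 * P.A / R - 2 * (28 * P.A / R) = l - 84 * P.A / R := by
      ring
    rw [e1, e2] at hσ1
    have e3 : S.potential c₀ c₁ c₂ κ M R ℓ = ℓ.mean (testFun P (quadFun c₀ c₁ c₂ R)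
      (quadSlope c₁ c₂ R) (28 * P.A / R) (M / √(P.twist R))) - κ * S.stopProb ℓ := rfl
    rw [e3]
    linarith

/-- From the exponent `3` on the potential is a concave function of the height, and it decreases by
diffusion; the drift is of lower order because `√Y'(R)` is at least of order `R`. -/
theorem exists_potentialDecreases_of_three_le (hP : P.Pos) (hδ : 0 < P.δ)
    (hδ' : P.δ < Real.pi / 4) (hD : 0 < P.D) (h3 : 3 ≤ P.γ) :
    ∃ M d : ℝ, 0 < d ∧ ∀ᶠ R in atTop, ∀ (L ystar : ℝ) (F : Phase → Phase)
      (S : CuttingRule P ystar F), P.IsTwistMap L F → 0 ≤ L → L < ystar →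
      S.PotentialDecreases 0.37 0.66 (-0.02) 0 M R (d / R ^ 2) := by
  have hA := hP.A_pos
  have h0 : (0 : ℝ) < P.Yhat * P.γ := mul_pos hP.Yhat_pos hP.γ_pos
  obtain ⟨r, hr⟩ : ∃ r, r = √(P.Yhat * P.γ) := ⟨_, rfl⟩
  have hr0 : 0 < r := by rw [hr]; exact Real.sqrt_pos.2 h0
  have h12 : |(0.66 : ℝ)| + 14 * |(-0.02 : ℝ)| ≤ 14 := by norm_num
  -- the gain by diffusion is at least `4 A² · 0.02 · (1 / 4) / R² = 0.02 A² / R²`, and with this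
  -- choice of `ε` the drift takes at most half of it
  obtain ⟨M, -, hM⟩ := exists_drift_small hP hδ hδ' hD (ε := P.A * r / 8400) (by positivity) h12
  refine ⟨M, 0.01 * P.A ^ 2, by positivity, ?_⟩
  filter_upwards [hM, eventually_ge_atTop 1, eventually_ge_atTop (200 * P.A),
    eventually_ge_atTop (84 * P.A / 0.02),
    CurvePair.eventually_le_integral_cos_sq hP hδ hδ' hD] with R hM hR hRA hRA2 hcos
  intro L ystar F S hF hL hy ℓ hℓ hh
  have hR0 : 0 < R := by linarith
  obtain ⟨σ, σ₂, h1, -, -, h2⟩ := S.exists_hasSum_potential_le (l := 0.02) (κ := 0) hP hF hL hy hR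
    hRA (c₀ := 0.37) (by norm_num) h12 hℓ hh hM (fun z hz => by nlinarith [hz.1, hz.2])
  refine ⟨σ, h1, ?_⟩
  have h4 := hcos ystar ℓ hℓ fun x hx => ⟨by linarith [(hh x hx).1], by linarith [(hh x hx).2]⟩
  obtain ⟨I, hI⟩ : ∃ I, I = ∫ x in Ioo ℓ.a ℓ.b, Real.cos (P.nextX x (ℓ.ψ x)) ^ 2 * ℓ.ρ x :=
    ⟨_, rfl⟩
  rw [← hI] at h2 h4
  have h5 : r * R ≤ √(P.twist R) := by
    refine Real.le_sqrt_of_sq_le ?_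
    rw [mul_pow, hr, Real.sq_sqrt h0.le]
    exact hP.sq_le_twist h3 hR
  have h6 : 84 * P.A * (P.A * r / 8400) / (R * √(P.twist R)) ≤ 0.01 * P.A ^ 2 / R ^ 2 := by
    have h7 : 0 < √(P.twist R) := lt_of_lt_of_le (by positivity) h5
    rw [div_le_div_iff₀ (by positivity) (by positivity)]
    calc 84 * P.A * (P.A * r / 8400) * R ^ 2 = 0.01 * P.A ^ 2 * (R * (r * R)) := by ring
      _ ≤ _ := by gcongr
  have h7 : max (4 * P.A ^ 2 * (-0.02) / R ^ 2) 0 = 0 := by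
    refine max_eq_right ?_
    rw [div_le_iff₀ (by positivity)]
    nlinarith [sq_nonneg P.A]
  have h8 : 4 * P.A ^ 2 * (-0.02) / R ^ 2 * I ≤ -(0.02 * P.A ^ 2 / R ^ 2) := by
    have h9 : 0 ≤ P.A ^ 2 / R ^ 2 := by positivity
    have e1 : 4 * P.A ^ 2 * (-0.02) / R ^ 2 * I = -(0.08 * (P.A ^ 2 / R ^ 2) * I) := by ring
    have e2 : 0.02 * P.A ^ 2 / R ^ 2 = 0.02 * (P.A ^ 2 / R ^ 2) := by ring
    rw [e1, e2]
    nlinarith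
  have h9 : 84 * P.A / R ≤ 0.02 := by
    rw [div_le_iff₀ (by norm_num)] at hRA2
    rw [div_le_iff₀ hR0]
    linarith
  have h10 : 0 ≤ (0.02 - 84 * P.A / R - 0) * S.stopProb ℓ :=
    mul_nonneg (by linarith) (S.stopProb_nonneg hℓ)
  have e1 : 0.02 * P.A ^ 2 / R ^ 2 = 0.01 * P.A ^ 2 / R ^ 2 + 0.01 * P.A ^ 2 / R ^ 2 := by ring
  rw [h7] at h2
  linarith

/-- Below the exponent `3` the loss of mass into the remainder, at the rate `1 / Y'(R)`, dominates
the diffusion and the drift. -/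
theorem exists_potentialDecreases_of_lt_three (hP : P.Pos) (hδ : 0 < P.δ)
    (hδ' : P.δ < Real.pi / 4) (hD : 0 < P.D) (h3 : P.γ < 3) :
    ∃ M d : ℝ, 0 < d ∧ ∀ᶠ R in atTop, ∀ (L ystar : ℝ) (F : Phase → Phase)
      (S : CuttingRule P ystar F), P.IsTwistMap L F → 0 ≤ L → L < ystar →
      S.PotentialDecreases 0.1 0 1 0.04 M R (d / R ^ 2) := by
  have hA := hP.A_pos
  have h12 : |(0 : ℝ)| + 14 * |(1 : ℝ)| ≤ 14 := by norm_num
  obtain ⟨M, -, hM⟩ := exists_drift_small hP hδ hδ' hD one_pos h12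
  obtain ⟨c, hc, hkill⟩ := exists_le_stopProb hP hδ hδ' hD
  refine ⟨M, 1, one_pos, ?_⟩
  filter_upwards [hM, hkill, eventually_ge_atTop 1, eventually_ge_atTop (200 * P.A),
    eventually_ge_atTop (84 * P.A / 0.02),
    (Params.Pos.twist_div_sq_tendsto h3).eventually_le_const
      (show 0 < 0.02 * c / (1 + 8 * P.A ^ 2) by positivity),
    (Params.Pos.twist_div_sq_tendsto h3).eventually_le_const
      (show 0 < (0.02 * c / (84 * P.A)) ^ 2 by positivity)] with R hM hkill hR hRA hRA2 hT1 hT2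
  intro L ystar F S hF hL hy ℓ hℓ hh
  have hR0 : 0 < R := by linarith
  have hτ := hP.twist_pos hR0
  obtain ⟨σ, σ₂, h1, h1', hσ₂, h2⟩ := S.exists_hasSum_potential_le (l := 0.1) (κ := 0.04) hP hF hL
    hy hR hRA (c₀ := 0.1) (by norm_num) h12 hℓ hh hM (fun z hz => by nlinarith [sq_nonneg z])
  refine ⟨σ, h1, ?_⟩
  have h4 := hkill L ystar F S ℓ σ₂ hF hL hy hℓ
    (fun x hx => ⟨by linarith [(hh x hx).1], by linarith [(hh x hx).2]⟩) h1'
  have h5 := (abs_le.1 (hℓ.abs_mean_le (h := fun x y => Real.cos (P.nextX x y) ^ 2) (B := 1)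
    fun x _ => by
      rw [abs_of_nonneg (sq_nonneg _)]
      exact Real.cos_sq_le_one _)).2
  change (∫ x in Ioo ℓ.a ℓ.b, Real.cos (P.nextX x (ℓ.ψ x)) ^ 2 * ℓ.ρ x) ≤ 1 at h5
  obtain ⟨I, hI⟩ : ∃ I, I = ∫ x in Ioo ℓ.a ℓ.b, Real.cos (P.nextX x (ℓ.ψ x)) ^ 2 * ℓ.ρ x :=
    ⟨_, rfl⟩
  rw [← hI] at h2 h5
  have h6 : max (4 * P.A ^ 2 * 1 / R ^ 2) 0 = 4 * P.A ^ 2 / R ^ 2 := by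
    rw [mul_one]
    exact max_eq_left (by positivity)
  have h7 : 4 * P.A ^ 2 * 1 / R ^ 2 * I ≤ 4 * P.A ^ 2 / R ^ 2 := by
    rw [mul_one]
    exact mul_le_of_le_one_right (by positivity) h5
  -- the gain by the loss of mass is at least `0.04 c / Y'(R)`; one half pays for the diffusion and
  -- the claimed decrease, the other half for the drift
  have h8 : (1 + 8 * P.A ^ 2) / R ^ 2 ≤ 0.02 * (c / P.twist R) := by
    rw [le_div_iff₀ (by positivity), div_mul_eq_mul_div, div_le_iff₀ (by positivity)] at hT1
    rw [mul_div_assoc', div_le_div_iff₀ (by positivity) hτ]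
    linarith
  have h9 : 84 * P.A * 1 / (R * √(P.twist R)) ≤ 0.02 * (c / P.twist R) := by
    have hs := Real.sqrt_pos.2 hτ
    have h10 : √(P.twist R) / R ≤ 0.02 * c / (84 * P.A) := by
      refine le_of_sq_le_sq ?_ (by positivity)
      rwa [div_pow, Real.sq_sqrt hτ.le]
    rw [div_le_div_iff₀ hR0 (by positivity)] at h10
    rw [mul_div_assoc', div_le_div_iff₀ (by positivity) hτ]
    calc 84 * P.A * 1 * P.twist R = √(P.twist R) * (84 * P.A) * √(P.twist R) := by
          nth_rewrite 1 [← Real.mul_self_sqrt hτ.le]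
          ring
      _ ≤ 0.02 * c * R * √(P.twist R) := by gcongr
      _ = _ := by ring
  have h10 : 84 * P.A / R ≤ 0.02 := by
    rw [div_le_iff₀ (by norm_num)] at hRA2
    rw [div_le_iff₀ hR0]
    linarith
  have h11 : 0.04 * S.stopProb ℓ ≤ (0.1 - 84 * P.A / R - 0.04) * S.stopProb ℓ :=
    mul_le_mul_of_nonneg_right (by linarith) (S.stopProb_nonneg hℓ)
  have e1 : (1 + 8 * P.A ^ 2) / R ^ 2 = 1 / R ^ 2 + 4 * P.A ^ 2 / R ^ 2 + 4 * P.A ^ 2 / R ^ 2 := by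
    ring
  rw [h6] at h2
  linarith

end CuttingRule

/-! ### Exit times and exit signs -/
theorem level_pred (master : CurvePair) (k : ℤ) : level master (k - 1) = level master k / 2 := by
  unfold level
  rw [zpow_sub_one₀ two_ne_zero]
  ring

theorem level_succ (master : CurvePair) (k : ℤ) : level master (k + 1) = 2 * level master k := by
  unfold level
  rw [zpow_add_one₀ two_ne_zero]
  ring

theorem IsCompatible.height {master ℓ : CurvePair} {k : ℤ} (h : IsCompatible master k ℓ) :
    ∀ x ∈ Ioo ℓ.a ℓ.b, ℓ.ψ x ∈ Icc (level master k / 2) (2 * level master k) := by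
  intro x hx
  have := h _ ⟨x, hx, rfl⟩
  rwa [level_pred, level_succ] at this

namespace CuttingRule

variable {P : Params} {L ystar : ℝ} {F : Phase → Phase} (S : CuttingRule P ystar F) {ℓ : CurvePair}
  {R c₀ c₁ c₂ κ M lo hi : ℝ}

/-- The potential is close to the value of the quadratic polynomial, up to the share of the
remainder. -/
theorem potential_mem (hA : 0 < P.A) (hR : 1 ≤ R) (h0 : |c₀| ≤ 1) (h12 : |c₁| + 14 * |c₂| ≤ 14)
    (hκ : 0 ≤ κ) (hℓ : ℓ.IsStandard P ystar) (hlo : -(1 / 2 + 1 / 4) ≤ lo) (hhi : hi ≤ 7)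
    (hh : ∀ x ∈ Ioo ℓ.a ℓ.b, ℓ.ψ x ∈ Icc ((1 + lo) * R) ((1 + hi) * R)) {l u : ℝ}
    (hl : ∀ z ∈ Icc lo hi, c₀ + c₁ * z + c₂ * z ^ 2 ∈ Icc l u) :
    S.potential c₀ c₁ c₂ κ M R ℓ ∈ Icc (l - κ - 28 * P.A / R) (u + 28 * P.A / R) := by
  have hR0 : 0 < R := by linarith
  have hq := isQuadratic_quadFun hA hR h0 h12
  have hh' : ∀ x ∈ Ioo ℓ.a ℓ.b, ℓ.ψ x ∈ Icc (R / 8) (8 * R) := fun x hx =>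
    ⟨by nlinarith [(hh x hx).1], by nlinarith [(hh x hx).2]⟩
  have hm := hq.measurable_testFun (s := M / √(P.twist R))
  have h1 : ∀ x ∈ Ioo ℓ.a ℓ.b, testFun P (quadFun c₀ c₁ c₂ R) (quadSlope c₁ c₂ R) (28 * P.A / R)
      (M / √(P.twist R)) x (ℓ.ψ x) ∈ Icc (l - 28 * P.A / R) (u + 28 * P.A / R) := by
    intro x hx
    have h2 := abs_le.1 (hq.abs_testFun_sub_le (s := M / √(P.twist R)) (x := x) (hh' x hx))
    have h3 := hl _ (sub_div_mem hR0 (hh x hx))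
    change quadFun c₀ c₁ c₂ R (ℓ.ψ x) ∈ Icc l u at h3
    constructor <;> linarith [h3.1, h3.2, h2.1, h2.2]
  have h2 := hℓ.le_mean hm (fun x hx => hq.abs_testFun_le (hh' x hx)) fun x hx => (h1 x hx).1
  have h3 := hℓ.mean_le hm (fun x hx => hq.abs_testFun_le (hh' x hx)) fun x hx => (h1 x hx).2
  have h4 := mul_nonneg hκ (S.stopProb_nonneg hℓ)
  have h5 := mul_le_of_le_one_right hκ (S.stopProb_le_one hℓ)
  unfold potential
  constructor <;> linarith

/-- In both regimes there is a potential at each level, with a decrease of order `1 / R²`. -/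
theorem exists_potentialDecreases (hP : P.Pos) (hδ : 0 < P.δ) (hδ' : P.δ < Real.pi / 4)
    (hD : 0 < P.D) :
    ∃ c₀ c₁ c₂ κ : ℝ, |c₀| ≤ 1 ∧ |c₁| + 14 * |c₂| ≤ 14 ∧ 0 ≤ κ ∧
      (∀ z ∈ Icc (-0.51 : ℝ) 1.1, c₀ + c₁ * z + c₂ * z ^ 2 ∈ Icc (0.025 + κ) 1.9) ∧
      (∀ z ∈ Icc (0.999 : ℝ) 1.001, 1.005 + κ ≤ c₀ + c₁ * z + c₂ * z ^ 2) ∧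
      (∀ z ∈ Icc (-0.001 : ℝ) 0.001, c₀ + c₁ * z + c₂ * z ^ 2 ≤ 0.395) ∧
      ∃ M d : ℝ, 0 < d ∧ ∀ᶠ R in atTop, ∀ (L ystar : ℝ) (F : Phase → Phase)
        (S : CuttingRule P ystar F), P.IsTwistMap L F → 0 ≤ L → L < ystar →
        S.PotentialDecreases c₀ c₁ c₂ κ M R (d / R ^ 2) := by
  -- `0.37 + 0.66 z - 0.02 z²` is concave and `0.1 + z²` is convex; both are positive on the whole
  -- range, less than `0.4` at the level (`z = 0`) and more than `1` at the next one (`z = 1`)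
  rcases le_or_gt 3 P.γ with h3 | h3
  · refine ⟨0.37, 0.66, -0.02, 0, by norm_num, by norm_num, le_rfl, fun z hz => ⟨?_, ?_⟩,
      fun z hz => ?_, fun z hz => ?_, exists_potentialDecreases_of_three_le hP hδ hδ' hD h3⟩ <;>
    nlinarith [hz.1, hz.2]
  · refine ⟨0.1, 0, 1, 0.04, by norm_num, by norm_num, by norm_num, fun z hz => ⟨?_, ?_⟩,
      fun z hz => ?_, fun z hz => ?_, exists_potentialDecreases_of_lt_three hP hδ hδ' hD h3⟩ <;>
    nlinarith [hz.1, hz.2]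

/-- At each high level there is a potential that is at most `0.4` on the pairs close to the level.
-/
theorem exists_isPotential (hP : P.Pos) (hδ : 0 < P.δ) (hδ' : P.δ < Real.pi / 4) (hD : 0 < P.D)
    (ν : ℕ) :
    ∃ d : ℝ, 0 < d ∧ ∀ᶠ R in atTop, ∀ (L ystar : ℝ) (F : Phase → Phase)
      (S : CuttingRule P ystar F) (master : CurvePair) (k : ℤ), P.IsTwistMap L F → 0 ≤ L →
      L < ystar → level master k = R →
      ∃ V : CurvePair → ℝ, S.IsPotential (IsCompatible master k) (IsCloseTo P ν master (k + 1))
          (fun ℓ => ∀ x ∈ Ioo ℓ.a ℓ.b, ℓ.ψ x ∈ Icc (0.49 * R) (2.1 * R)) V 0.02 (1 - d / R ^ 2) ∧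
        (∀ ℓ : CurvePair, ℓ.IsStandard P ystar →
          (∀ x ∈ Ioo ℓ.a ℓ.b, ℓ.ψ x ∈ Icc (0.49 * R) (2.1 * R)) → V ℓ ≤ 2) ∧
        ∀ ℓ : CurvePair, ℓ.IsStandard P ystar →
          (∀ x ∈ Ioo ℓ.a ℓ.b, ℓ.ψ x ∈ Icc (R - 2 * P.A * ν) (R + 2 * P.A * ν)) → V ℓ ≤ 0.4 := by
  have hA := hP.A_pos
  obtain ⟨c₀, c₁, c₂, κ, h0, h12, hκ, hn, hone, hzero, M, d, hd, hM⟩ :=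
    exists_potentialDecreases hP hδ hδ' hD
  refine ⟨d / 2, by positivity, ?_⟩
  filter_upwards [hM, eventually_ge_atTop 1, eventually_ge_atTop (28 * P.A / 0.005),
    eventually_ge_atTop (2 * P.A * ν / 0.001), eventually_ge_atTop (400 * P.A),
    eventually_ge_atTop d] with R hM hR hR1 hR2 hR3 hR4
  intro L ystar F S master k hF hL hy hk
  have hR0 : 0 < R := by linarith
  have hβ : 28 * P.A / R ≤ 0.005 := by
    rw [div_le_iff₀ (by norm_num)] at hR1
    rw [div_le_iff₀ hR0]
    linarith
  rw [div_le_iff₀ (by norm_num)] at hR2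
  have hnear : ∀ ℓ : CurvePair, ℓ.IsStandard P ystar →
      (∀ x ∈ Ioo ℓ.a ℓ.b, ℓ.ψ x ∈ Icc (0.49 * R) (2.1 * R)) →
      S.potential c₀ c₁ c₂ κ M R ℓ ∈ Icc 0.02 2 := by
    intro ℓ hℓ hh
    have h1 := S.potential_mem (M := M) hA hR h0 h12 hκ hℓ (lo := -0.51) (hi := 1.1) (by norm_num)
      (by norm_num) (fun x hx => ⟨by linarith [(hh x hx).1], by linarith [(hh x hx).2]⟩) hn
    constructor <;> linarith [h1.1, h1.2]
  refine ⟨S.potential c₀ c₁ c₂ κ M R, ⟨by norm_num, ?_, ?_, fun ℓ hℓ hh => (hnear ℓ hℓ hh).1,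
    fun ℓ hℓ hh hc => ?_, fun ℓ hℓ hG c hc => ?_, fun ℓ hℓ hG => ?_⟩,
    fun ℓ hℓ hh => (hnear ℓ hℓ hh).2, fun ℓ hℓ hh => ?_⟩
  · have : d / 2 / R ^ 2 < 1 := by
      rw [div_lt_one (by positivity)]
      nlinarith
    linarith
  · have : 0 ≤ d / 2 / R ^ 2 := by positivity
    linarith
  · have h1 := S.potential_mem (M := M) hA hR h0 h12 hκ hℓ (lo := 0.999) (hi := 1.001) (l := 1.005 + κ)
      (u := 1.9) (by norm_num) (by norm_num) (fun x hx => by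
        have h2 := hc _ ⟨x, hx, rfl⟩
        rw [level_succ, hk] at h2
        exact ⟨by linarith [h2.1], by linarith [h2.2]⟩) fun z hz => ⟨hone z hz,
          (hn z ⟨by linarith [hz.1], by linarith [hz.2]⟩).2⟩
    linarith [h1.1]
  · have hh := hG.height
    rw [hk] at hh
    intro x hx
    have h1 := S.target_height hP hF hL hy hℓ hc hh x hx
    constructor <;> linarith [h1.1, h1.2]
  · have hh := hG.height
    rw [hk] at hh
    obtain ⟨σ, hσ, hσ1⟩ := hM L ystar F S hF hL hy ℓ hℓ hh
    refine ⟨σ, hσ, hσ1.trans ?_⟩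
    have h1 := (hnear ℓ hℓ fun x hx =>
      ⟨by linarith [(hh x hx).1], by linarith [(hh x hx).2]⟩).2
    have h2 : 0 ≤ d / 2 / R ^ 2 := by positivity
    have h3 : d / R ^ 2 = d / 2 / R ^ 2 * 2 := by ring
    nlinarith
  · have h1 := S.potential_mem (M := M) hA hR h0 h12 hκ hℓ (lo := -0.001) (hi := 0.001)
      (l := 0.025 + κ) (u := 0.395) (by norm_num) (by norm_num) (fun x hx =>
        ⟨by linarith [(hh x hx).1], by linarith [(hh x hx).2]⟩) fun z hz =>
          ⟨(hn z ⟨by linarith [hz.1], by linarith [hz.2]⟩).1, hzero z hz⟩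
    linarith [h1.2]

end CuttingRule

theorem mainTheorem3 (P : Params) (hA : 0 < P.A) (hY : 0 < P.Yhat) (hγ : 2 < P.γ)
    (hδ : 0 < P.δ) (hδ' : P.δ < Real.pi / 4) (hD : 0 < P.D) (L : ℝ) (hL : 0 ≤ L) (ν : ℕ) :
    ∃ y₀ : ℝ, L < y₀ ∧ ∃ C : ℝ, 0 < C ∧ ∃ ϑ : ℝ, 0 < ϑ ∧ ϑ < 1 ∧
      ∀ ystar : ℝ, y₀ ≤ ystar →
      ∀ F : Phase → Phase, P.IsTwistMap L F →
      ∀ S : CuttingRule P ystar F,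
      ∀ master : CurvePair, master.IsStandard P ystar →
      ∀ (k : ℤ) (ℓ : CurvePair), ℓ.IsStandard P ystar →
        (∀ s : ℕ, ℓ.prob {p | (s : ℕ∞) ≤ S.exitTime master k ℓ p}
          ≤ C * ϑ ^ ((s : ℝ) / ℓ.yhat ^ 2)) ∧
        (IsCloseTo P ν master k ℓ →
          (0.6 : ℝ) ≤ ℓ.prob {p | S.exitSign ν master k ℓ p = -1}) := by
  have hP : P.Pos := ⟨hA, hY, hγ⟩
  obtain ⟨d, hd, hev⟩ := CuttingRule.exists_isPotential hP hδ hδ' hD ν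
  obtain ⟨R₀, hR₀⟩ := eventually_atTop.1 (hev.and ((eventually_ge_atTop 1).and
    (eventually_ge_atTop (400 * P.A * ν))))
  -- a compatible pair above this height has a level at least `R₀`; since `R ≤ 2 ŷ` for such a pair,
  -- `(1 - d / R²) ^ (s / 2) ≤ exp (-d s / (8 ŷ²))`
  refine ⟨max (L + 1) (2 * |R₀| + 2 * P.A * ν), (lt_add_one L).trans_le (le_max_left _ _), 100,
    by norm_num, Real.exp (-(d / 8)), Real.exp_pos _, Real.exp_lt_one_iff.2 (by linarith), ?_⟩
  intro ystar hystar F hF S master hmaster k ℓ hℓ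
  have hy : L < ystar := by linarith [le_max_left (L + 1) (2 * |R₀| + 2 * P.A * ν)]
  have hy2 : 2 * |R₀| + 2 * P.A * ν ≤ ystar := (le_max_right _ _).trans hystar
  have hν : 0 ≤ 2 * P.A * ν := by positivity
  have hmid : (ℓ.a + ℓ.b) / 2 ∈ Ioo ℓ.a ℓ.b := ⟨by linarith [hℓ.lt], by linarith [hℓ.lt]⟩
  have hym := hℓ.height _ hmid
  refine ⟨fun s => ?_, fun hclose => ?_⟩
  · by_cases hG : IsCompatible master k ℓ
    · have hh := hG.height
      obtain ⟨R, hR⟩ : ∃ R, R = level master k := ⟨_, rfl⟩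
      rw [← hR] at hh
      have hRR : R₀ ≤ R := by linarith [le_abs_self R₀, (hh _ hmid).2]
      obtain ⟨h1, h2, -⟩ := hR₀ R hRR
      obtain ⟨V, hV, hV2, -⟩ := h1 L ystar F S master k hF hL hy hR.symm
      have hN : ∀ x ∈ Ioo ℓ.a ℓ.b, ℓ.ψ x ∈ Icc (0.49 * R) (2.1 * R) := fun x hx =>
        ⟨by linarith [(hh x hx).1], by linarith [(hh x hx).2]⟩
      have h3 := hV.prob_le_time_le hP hF hL hy s ℓ hℓ hN
      have h4 := hV2 ℓ hℓ hN
      have hlam := hV.lam_pos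
      have hyhat : R / 2 ≤ ℓ.yhat := by
        refine le_csInf ((nonempty_Ioo.2 hℓ.lt).image _) ?_
        rintro _ ⟨x, hx, rfl⟩
        exact (hh x hx).1
      have h5 : (1 - d / R ^ 2) ^ ((s : ℝ) / 2) ≤ Real.exp (-(d / 8)) ^ ((s : ℝ) / ℓ.yhat ^ 2) := by
        have h6 : (1 - d / R ^ 2) ^ ((s : ℝ) / 2) ≤ Real.exp (-(d / R ^ 2)) ^ ((s : ℝ) / 2) :=
          Real.rpow_le_rpow hlam.le (Real.one_sub_le_exp_neg _) (by positivity)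
        refine h6.trans ?_
        rw [← Real.exp_mul, ← Real.exp_mul, Real.exp_le_exp]
        have h7 : R ^ 2 ≤ 4 * ℓ.yhat ^ 2 := by nlinarith
        have h8 : 0 < ℓ.yhat := by linarith
        have h9 : d * s / (8 * ℓ.yhat ^ 2) ≤ d * s / (2 * R ^ 2) :=
          div_le_div_of_nonneg_left (by positivity) (by positivity) (by linarith)
        have e1 : -(d / R ^ 2) * ((s : ℝ) / 2) = -(d * s / (2 * R ^ 2)) := by
          field_simp
        have e2 : -(d / 8) * ((s : ℝ) / ℓ.yhat ^ 2) = -(d * s / (8 * ℓ.yhat ^ 2)) := by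
          field_simp
        rw [e1, e2]
        linarith
      refine h3.trans (mul_le_mul ?_ h5 (Real.rpow_nonneg hlam.le _) (by norm_num))
      rw [div_le_iff₀ (by norm_num)]
      linarith
    · have ho := S.isOpen_trace_le_time (G := IsCompatible master k) hP hF hL hy hℓ s
      rcases Nat.eq_zero_or_pos s with rfl | hs
      · refine (hℓ.prob_le_one ho.measurableSet).trans ?_
        simp
      · have e : {p | (s : ℕ∞) ≤ S.exitTime master k ℓ p} = ∅ := by
          ext p
          simp only [mem_ofPred_eq, mem_empty_iff_false, iff_false, not_le]
          rw [CuttingRule.exitTime, S.time_of_not hG]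
          exact_mod_cast hs
        rw [e]
        have : ℓ.prob ∅ = 0 := by simp [CurvePair.prob, CurvePair.expect]
        rw [this]
        positivity
  · obtain ⟨R, hR⟩ : ∃ R, R = level master k := ⟨_, rfl⟩
    have hh : ∀ x ∈ Ioo ℓ.a ℓ.b, ℓ.ψ x ∈ Icc (R - 2 * P.A * ν) (R + 2 * P.A * ν) := fun x hx =>
      hR ▸ hclose _ ⟨x, hx, rfl⟩
    have hRR : R₀ ≤ R := by linarith [le_abs_self R₀, (hh _ hmid).2, abs_nonneg R₀]
    obtain ⟨h1, h2, h2'⟩ := hR₀ R hRR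
    obtain ⟨V, hV, -, hV2⟩ := h1 L ystar F S master k hF hL hy hR.symm
    have h3 := hV.prob_exists_reachSet_le hP hF hL hy hℓ fun x hx =>
      ⟨by linarith [(hh x hx).1], by linarith [(hh x hx).2]⟩
    have h4 := S.one_sub_le_prob_exitSign hP hF hL hy hℓ (h3.trans (hV2 ℓ hℓ hh))
    linarith


end
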